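/- An orthogonal polyhedron is a connected 3-manifold with boundary in $\mathbb R^3$ that is the union of finitely many axis-parallel boxes. It is called 2-reflex if its reflex edges (the edges with inner dihedral angle $270^\circ$) have at most two different directions; fix an axis direction, called vertical, to which no reflex edge is parallel. The bricks of a 2-reflex orthogonal polyhedron are the maximal cuboids into which its horizontal cross-sections (each a disjoint union of rectangles) partition it. The non-empty intersections of two distinct bricks are the contact rectangles. A contact rectangle is a collar if the horizontal extent of one of its two bricks lies strictly inside that of the other, so that all four sides of the contact rectangle are reflex edges. The genus of the polyhedron is the genus of its boundary surface. A set of reflex edges, used as closed (respectively open) guards, guards the polyhedron $P$ if every point $p\in P$ is joined by a segment contained in $P$ to some point of one of these edges with (respectively without) its endpoints. Theorem. Every 2-reflex orthogonal polyhedron with $r>0$ reflex edges, $b$ collars and genus $g$ can be guarded by at most $$\left\lfloor \frac{r-g}{2} \right\rfloor - b + 1$$ closed reflex edge guards, and also by at most that many open reflex edge guards. In particular, $\lfloor (r-g)/2\rfloor+1$ reflex edge guards suffice. For $g=0$ the latter bound is tight: for every $r>0$ there is a 2-reflex orthogonal polyhedron of genus $0$ with $r$ reflex edges that cannot be guarded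 by fewer than $\lfloor r/2\rfloor+1$ reflex edge guards, whether closed or open. -/

import Mathlib

open Set Topology

/-- Points of three-dimensional space. Only the topology and the affine structure are used. -/
abbrev Pt : Type := Fin 3 → ℝ

/-! ### Orthogonal polyhedra -/

/-- `P` is a three-dimensional manifold with boundary in `ℝ³`: around each of its points there is
a chart of `ℝ³` that carries `P` to the half-space `{x | 0 ≤ x 0}`. -/
def IsThreeManifold (P : Set Pt) : Prop :=
  ∀ p ∈ P, ∃ φ : OpenPartialHomeomorph Pt Pt, p ∈ φ.source ∧
    ∀ q ∈ φ.source, (q ∈ P ↔ 0 ≤ φ q 0)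

/-- An orthogonal polyhedron: a connected 3-manifold with boundary in `ℝ³` that is the union of
finitely many (non-degenerate) axis-parallel boxes `[a, b]`. -/
structure IsOrthogonalPolyhedron (P : Set Pt) : Prop where
  union_boxes : ∃ F : Finset (Pt × Pt), (∀ c ∈ F, ∀ i, c.1 i < c.2 i) ∧
    P = ⋃ c ∈ F, Icc c.1 c.2
  connected : IsConnected P
  manifold : IsThreeManifold P

/-! ### Reflex edges -/

/-- `p` lies in the relative interior of a reflex edge of `P` parallel to the axis `i`: near `p`,
the set `P` is the complement of an open quadrant-shaped wedge whose spine is the line through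
`p` parallel to the axis `i` (so that the inner dihedral angle is `270°`). -/
def IsReflexPoint (P : Set Pt) (i : Fin 3) (p : Pt) : Prop :=
  ∃ s : Fin 3 → ℝ, (∀ j, s j = 1 ∨ s j = -1) ∧
    ∀ᶠ q in 𝓝 p, (q ∈ P ↔ ∃ j, j ≠ i ∧ s j * (q j - p j) ≤ 0)

/-- The pair `e` consists of the endpoints of a reflex edge of `P` parallel to the axis `i`, in
increasing order along the axis: a maximal segment with reflex interior points. -/
def IsReflexEdge (P : Set Pt) (i : Fin 3) (e : Pt × Pt) : Prop :=
  (∀ j, j ≠ i → e.1 j = e.2 j) ∧ e.1 i < e.2 i ∧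
    (∀ p ∈ openSegment ℝ e.1 e.2, IsReflexPoint P i p) ∧
    ¬ IsReflexPoint P i e.1 ∧ ¬ IsReflexPoint P i e.2

/-- The reflex edges of `P`, each given by its two endpoints. -/
def reflexEdges (P : Set Pt) : Set (Pt × Pt) :=
  {e | ∃ i, IsReflexEdge P i e}

/-- `P` is a 2-reflex orthogonal polyhedron whose reflex edges all have one of the two directions
other than `k`. The axis `k` is called vertical. -/
structure IsTwoReflex (P : Set Pt) (k : Fin 3) : Prop where
  polyhedron : IsOrthogonalPolyhedron P
  no_vertical : ∀ e, ¬ IsReflexEdge P k e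

/-! ### Bricks, contact rectangles, and collars -/

/-- The box `[B.1, B.2]` is non-degenerate, and its section by each horizontal plane strictly
between its bottom and its top is a connected component of the section of `P` by that plane. -/
def IsSlab (P : Set Pt) (k : Fin 3) (B : Pt × Pt) : Prop :=
  (∀ i, B.1 i < B.2 i) ∧
    ∀ p ∈ Icc B.1 B.2, B.1 k < p k → p k < B.2 k →
      connectedComponentIn (P ∩ {q | q k = p k}) p = Icc B.1 B.2 ∩ {q | q k = p k}

/-- A brick of `P`: a maximal cuboid in the partition of `P` given by its horizontal sections. -/
def IsBrick (P : Set Pt) (k : Fin 3) (B : Pt × Pt) : Prop :=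
  IsSlab P k B ∧ ∀ C, IsSlab P k C → Icc B.1 B.2 ⊆ Icc C.1 C.2 → C = B

/-- `R` is a contact rectangle: the non-empty intersection of two different bricks. -/
def IsContactRectangleOf (P : Set Pt) (k : Fin 3) (B C : Pt × Pt) (R : Set Pt) : Prop :=
  IsBrick P k B ∧ IsBrick P k C ∧ B ≠ C ∧ R = Icc B.1 B.2 ∩ Icc C.1 C.2 ∧ R.Nonempty

/-- The collars of `P`: the contact rectangles of two bricks one of which (here `B`, which may be
the upper one or the lower one) has its horizontal extent strictly inside that of the other, so
that four reflex edges wind around the smaller brick. -/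
def collars (P : Set Pt) (k : Fin 3) : Set (Set Pt) :=
  {R | ∃ B C, IsContactRectangleOf P k B C R ∧ ∀ i, i ≠ k → C.1 i < B.1 i ∧ B.2 i < C.2 i}

/-! ### Genus -/

/-- `c` is (given by the least and the greatest corner of) a cell of the grid whose planes
orthogonal to the axis `i` are `x i = t` with `t ∈ G i`. In each coordinate the cell is
a single value of `G i` or the interval between two consecutive values. -/
def IsGridCell (G : Fin 3 → Finset ℝ) (c : Pt × Pt) : Prop :=
  ∀ i, c.1 i ∈ G i ∧ c.2 i ∈ G i ∧ c.1 i ≤ c.2 i ∧ ∀ t ∈ G i, ¬ (c.1 i < t ∧ t < c.2 i)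

/-- The relatively open cell with least corner `c.1` and greatest corner `c.2`. -/
def cellSet (c : Pt × Pt) : Set Pt :=
  {q | ∀ i, (c.1 i = c.2 i ∧ q i = c.1 i) ∨ (c.1 i < q i ∧ q i < c.2 i)}

/-- The dimension of a cell. -/
noncomputable def cellDim (c : Pt × Pt) : ℕ := {i | c.1 i < c.2 i}.ncard

/-- The set `S` is a union of cells of the grid `G`. -/
def IsGridComplex (G : Fin 3 → Finset ℝ) (S : Set Pt) : Prop :=
  ∀ p ∈ S, ∃ c, IsGridCell G c ∧ p ∈ cellSet c ∧ cellSet c ⊆ S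

/-- The number of `d`-dimensional cells of the grid `G` in `S`. -/
noncomputable def cellCount (G : Fin 3 → Finset ℝ) (S : Set Pt) (d : ℕ) : ℕ :=
  {c | IsGridCell G c ∧ cellDim c = d ∧ cellSet c ⊆ S}.ncard

/-- The boundary surface of `P` has genus `g`: if it is subdivided into the vertices, edges and
faces of a grid, Euler's formula `V - E + F = 2 - 2 g` holds. (The boundary of a 2-reflex
orthogonal polyhedron is a connected surface, as a cavity would have reflex edges in all three
directions.) -/
def HasGenus (P : Set Pt) (g : ℕ) : Prop :=
  ∃ G : Fin 3 → Finset ℝ, IsGridComplex G (frontier P) ∧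
    (cellCount G (frontier P) 0 : ℤ) - cellCount G (frontier P) 1 + cellCount G (frontier P) 2
      = 2 - 2 * g

/-! ### Guards -/

/-- The points `p` and `q` see each other in `P`. -/
def Sees (P : Set Pt) (p q : Pt) : Prop := segment ℝ p q ⊆ P

/-- Closed guards on the edges in `S` guard `P`: each point of `P` is seen by some point of some
closed edge. -/
def ClosedGuards (P : Set Pt) (S : Finset (Pt × Pt)) : Prop :=
  ∀ p ∈ P, ∃ e ∈ S, ∃ q ∈ segment ℝ e.1 e.2, Sees P q p

/-- Open guards on the edges in `S` guard `P`: each point of `P` is seen by some point of some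
edge without its endpoints. -/
def OpenGuards (P : Set Pt) (S : Finset (Pt × Pt)) : Prop :=
  ∀ p ∈ P, ∃ e ∈ S, ∃ q ∈ openSegment ℝ e.1 e.2, Sees P q p

/-! The upper bound is a statement about the graph whose vertices are the bricks and whose edges
are their contacts.

*The brick complex.* Near a point at a generic level, a 2-reflex polyhedron is a box: with three
quadrants there would be a vertical reflex edge, and two opposite quadrants contradict the
manifold property, as the interior would be separated near the point. So the components of generic
sections are rectangles and sweep out boxes, the bricks. Two bricks meet only if one lies on top of
the other, no three bricks share a point, and bricks that touch in less than a rectangle would again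
separate the interior (`IsTwoReflex.exists_complex`). From there on only the combinatorial structure
`IsBrickComplex` is used. Its reflex edges are exactly the sides of contact rectangles on which one
of the two bricks ends and the other does not (`encard_reflexEdges`). As no three bricks share a
point, inclusion and exclusion give the Euler characteristics of the polyhedron and of its interior,
hence of the boundary, and thereby `g = 1 - B + C` for `B` bricks and `C` contacts (`genus_eq`).

*Guarding.* Only the contacts with a single reflex edge are used to share guards; they are the
relation `Adj`, and one of the two bricks is then a child of the other: its extent arises from that
of the other one by moving one side inwards. A set of `n` bricks linked by such contacts is guarded
by at most `(n + 1) / 2` open edges (`guardable`), by induction on `n`. Remove a brick `A` of maximal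
horizontal extent. The remaining parts hang at children of `A`. The parts with an even number of
bricks are guarded by induction. At most two odd parts, called castles here, are left on each of the
two horizontal faces of `A`, since all children on one face lie at opposite sides. A castle of `m`
bricks together with `A` is guarded by `(m + 1) / 2` edges including the reflex edge between the
castle and `A`; so one or two castles are fine, and with three or four castles there are two on
opposite faces of `A` that save a guard (`castle_pair`). Without castles, any edge that sees `A`
does. A castle itself is handled by
recursion, as only its lowest brick or this brick and two smaller castles above it matter
(`castle_split`).

*Counting.* If `M` contacts have several reflex edges, then there are at most `M + 1` linked parts
(`IsComponents.card_le`), and `r ≥ C + M + 2 b` as a collar has four reflex edges (`card_add_le`).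
So the number `m` of guards satisfies `2 m ≤ B + M + 1 ≤ r - 2 b + 1 + B - C = r - g - 2 b + 2`.

*The lower bound.* In a winding staircase of `r + 1` bricks with one reflex edge between consecutive
bricks, there is a witness in each brick such that each reflex edge sees only the witnesses in the
two bricks next to it (`le_card_of_closedGuards_staircase`). -/

/-! ### Brick complexes -/

/-- The box `B` lies on top of the box `A` (with respect to the vertical axis `k`) and their
horizontal extents overlap in a non-degenerate rectangle. -/
def Stacked (k : Fin 3) (A B : Pt × Pt) : Prop :=
  A.2 k = B.1 k ∧ ∀ i, i ≠ k → A.1 i < B.2 i ∧ B.1 i < A.2 i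

/-- `P` is the union of the finite family `𝓑` of non-degenerate boxes, two of which only meet by
being stacked on one another, with different horizontal extents. -/
structure IsBrickComplex (P : Set Pt) (k : Fin 3) (𝓑 : Finset (Pt × Pt)) : Prop where
  lt : ∀ A ∈ 𝓑, ∀ i, A.1 i < A.2 i
  eq_iUnion : P = ⋃ A ∈ 𝓑, Icc A.1 A.2
  meet : ∀ A ∈ 𝓑, ∀ B ∈ 𝓑, A ≠ B → ∀ p ∈ Icc A.1 A.2, p ∈ Icc B.1 B.2 →
    Stacked k A B ∨ Stacked k B A
  differ : ∀ A ∈ 𝓑, ∀ B ∈ 𝓑, Stacked k A B → ∃ i, i ≠ k ∧ (A.1 i ≠ B.1 i ∨ A.2 i ≠ B.2 i)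

/-- The coordinate of the upper (`s = true`) or lower (`s = false`) side of the box `A` that is
orthogonal to the axis `i`. -/
def side (A : Pt × Pt) (i : Fin 3) (s : Bool) : ℝ := cond s (A.2 i) (A.1 i)

/-- The intersection of two boxes, as a box. -/
def meetBox (A B : Pt × Pt) : Pt × Pt := (A.1 ⊔ B.1, A.2 ⊓ B.2)

/-- The edge of the contact rectangle of `A` and `B` that lies on its side `(i, s)`. -/
noncomputable def contactEdge (A B : Pt × Pt) (i : Fin 3) (s : Bool) : Pt × Pt :=
  (Function.update (meetBox A B).1 i (side (meetBox A B) i s),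
    Function.update (meetBox A B).2 i (side (meetBox A B) i s))

@[simp] theorem side_true (A : Pt × Pt) (i : Fin 3) : side A i true = A.2 i := rfl
@[simp] theorem side_false (A : Pt × Pt) (i : Fin 3) : side A i false = A.1 i := rfl

theorem exists_third {i k : Fin 3} (h : i ≠ k) :
    ∃ j, j ≠ i ∧ j ≠ k ∧ ∀ l, l = i ∨ l = j ∨ l = k := by
  revert i k; decide

theorem forall_axes {i j k : Fin 3} (h : ∀ l, l = i ∨ l = j ∨ l = k) {Q : Fin 3 → Prop}
    (hi : Q i) (hj : Q j) (hk : Q k) : ∀ l, Q l := by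
  intro l
  rcases h l with rfl | rfl | rfl <;> assumption

theorem mem_box {A : Pt × Pt} {p : Pt} : p ∈ Icc A.1 A.2 ↔ ∀ i, A.1 i ≤ p i ∧ p i ≤ A.2 i :=
  ⟨fun h i => ⟨h.1 i, h.2 i⟩, fun h => ⟨fun i => (h i).1, fun i => (h i).2⟩⟩

/-- Neighbourhoods in terms of small cubes. -/
theorem eventually_nhds_cube {p : Pt} {Q : Pt → Prop} :
    (∀ᶠ q in 𝓝 p, Q q) ↔ ∃ δ > 0, ∀ q : Pt, (∀ i, |q i - p i| < δ) → Q q := by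
  rw [Metric.eventually_nhds_iff]
  refine exists_congr fun δ => and_congr_right fun hδ => forall_congr' fun q => ?_
  rw [dist_pi_lt_iff hδ]
  simp only [Real.dist_eq]

theorem isClosed_box (A : Pt × Pt) : IsClosed (Icc A.1 A.2) := isClosed_Icc

theorem convex_box (A : Pt × Pt) : Convex ℝ (Icc A.1 A.2) := convex_Icc _ _

theorem Stacked.inter {k : Fin 3} {A B : Pt × Pt} (h : Stacked k A B) (hA : ∀ i, A.1 i < A.2 i)
    (hB : ∀ i, B.1 i < B.2 i) :
    ∃ p : Pt, p ∈ Icc A.1 A.2 ∧ p ∈ Icc B.1 B.2 ∧ p k = A.2 k := by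
  refine ⟨A.1 ⊔ B.1, mem_box.2 fun i => ?_, mem_box.2 fun i => ?_, ?_⟩
  · refine ⟨le_sup_left, sup_le (hA i).le ?_⟩
    by_cases hi : i = k
    · subst hi; exact h.1.ge
    · exact (h.2 i hi).2.le
  · refine ⟨le_sup_right, sup_le ?_ (hB i).le⟩
    by_cases hi : i = k
    · subst hi; exact (hA i).le.trans (h.1.le.trans (hB i).le)
    · exact (h.2 i hi).1.le
  · have := hA k
    rw [Pi.sup_apply, ← h.1]
    exact sup_of_le_right this.le

theorem Stacked.eq_of_mem {k : Fin 3} {A B : Pt × Pt} (h : Stacked k A B) {p : Pt}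
    (hA : p ∈ Icc A.1 A.2) (hB : p ∈ Icc B.1 B.2) : p k = A.2 k :=
  le_antisymm (hA.2 k) (h.1.le.trans (hB.1 k))

namespace IsBrickComplex

variable {P : Set Pt} {k : Fin 3} {𝓑 : Finset (Pt × Pt)}

theorem mem_iff (h : IsBrickComplex P k 𝓑) {p : Pt} : p ∈ P ↔ ∃ A ∈ 𝓑, p ∈ Icc A.1 A.2 := by
  have := h.eq_iUnion
  subst this
  simp only [mem_iUnion, exists_prop]

theorem box_subset (h : IsBrickComplex P k 𝓑) {A : Pt × Pt} (hA : A ∈ 𝓑) : Icc A.1 A.2 ⊆ P :=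
  fun _ hp => h.mem_iff.2 ⟨A, hA, hp⟩

theorem isCompact (h : IsBrickComplex P k 𝓑) : IsCompact P := by
  rw [h.eq_iUnion]
  exact 𝓑.isCompact_biUnion fun A _ => isCompact_Icc

/-- The bricks below and above a common point are determined by the point. -/
theorem stacked_unique (h : IsBrickComplex P k 𝓑) {A B C : Pt × Pt} (hA : A ∈ 𝓑) (hB : B ∈ 𝓑)
    (hC : C ∈ 𝓑) (hAB : Stacked k A B) {p : Pt} (pA : p ∈ Icc A.1 A.2) (pB : p ∈ Icc B.1 B.2)
    (pC : p ∈ Icc C.1 C.2) : C = A ∨ C = B := by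
  by_contra! hne
  have e1 := hAB.eq_of_mem pA pB
  have e2 := hAB.1
  have lA := h.lt A hA k
  have lB := h.lt B hB k
  have lC := h.lt C hC k
  rcases h.meet A hA C hC hne.1.symm p pA pC with h1 | h1
  · have := h1.eq_of_mem pA pC
    have h3 := h1.1
    rcases h.meet B hB C hC hne.2.symm p pB pC with h2 | h2
    · have := h2.1; linarith
    · have := h2.1; linarith
  · have := h1.eq_of_mem pC pA
    have h3 := h1.1
    linarith

/-- Near a point, only the bricks containing it matter. -/
theorem eventually_mem (h : IsBrickComplex P k 𝓑) (p : Pt) :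
    ∀ᶠ q in 𝓝 p, q ∈ P ↔ ∃ A ∈ 𝓑, p ∈ Icc A.1 A.2 ∧ q ∈ Icc A.1 A.2 := by
  have : ∀ᶠ q in 𝓝 p, ∀ A ∈ 𝓑, q ∈ Icc A.1 A.2 → p ∈ Icc A.1 A.2 := by
    rw [Filter.eventually_all_finset]
    intro A _
    by_cases hp : p ∈ Icc A.1 A.2
    · exact Filter.Eventually.of_forall fun _ _ => hp
    · filter_upwards [(isClosed_box A).isOpen_compl.mem_nhds hp] with q hq hq'
      exact absurd hq' hq
  filter_upwards [this] with q hq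
  rw [h.mem_iff]
  exact ⟨fun ⟨A, hA, hqA⟩ => ⟨A, hA, hq A hA hqA, hqA⟩, fun ⟨A, hA, _, hqA⟩ => ⟨A, hA, hqA⟩⟩

theorem eventually_mem_stacked (h : IsBrickComplex P k 𝓑) {A B : Pt × Pt} (hA : A ∈ 𝓑)
    (hB : B ∈ 𝓑) (hAB : Stacked k A B) {p : Pt} (pA : p ∈ Icc A.1 A.2) (pB : p ∈ Icc B.1 B.2) :
    ∀ᶠ q in 𝓝 p, q ∈ P ↔ q ∈ Icc A.1 A.2 ∨ q ∈ Icc B.1 B.2 := by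
  filter_upwards [h.eventually_mem p] with q hq
  rw [hq]
  constructor
  · rintro ⟨C, hC, pC, qC⟩
    rcases h.stacked_unique hA hB hC hAB pA pB pC with rfl | rfl
    exacts [Or.inl qC, Or.inr qC]
  · rintro (h1 | h1)
    exacts [⟨A, hA, pA, h1⟩, ⟨B, hB, pB, h1⟩]

theorem eventually_mem_single (h : IsBrickComplex P k 𝓑) {A : Pt × Pt} (hA : A ∈ 𝓑) {p : Pt}
    (pA : p ∈ Icc A.1 A.2) (hp : ∀ B ∈ 𝓑, p ∈ Icc B.1 B.2 → B = A) :
    ∀ᶠ q in 𝓝 p, q ∈ P ↔ q ∈ Icc A.1 A.2 := by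
  filter_upwards [h.eventually_mem p] with q hq
  rw [hq]
  constructor
  · rintro ⟨C, hC, pC, qC⟩
    rwa [← hp C hC pC]
  · exact fun h1 => ⟨A, hA, pA, h1⟩

/-- A point of `P` lies in a single brick or on the contact of two stacked bricks. -/
theorem single_or_stacked (h : IsBrickComplex P k 𝓑) {p : Pt} (hp : p ∈ P) :
    (∃ A ∈ 𝓑, p ∈ Icc A.1 A.2 ∧ ∀ B ∈ 𝓑, p ∈ Icc B.1 B.2 → B = A) ∨
    ∃ A ∈ 𝓑, ∃ B ∈ 𝓑, Stacked k A B ∧ p ∈ Icc A.1 A.2 ∧ p ∈ Icc B.1 B.2 := by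
  obtain ⟨A, hA, pA⟩ := h.mem_iff.1 hp
  by_cases hs : ∀ B ∈ 𝓑, p ∈ Icc B.1 B.2 → B = A
  · exact Or.inl ⟨A, hA, pA, hs⟩
  · push Not at hs
    obtain ⟨B, hB, pB, hne⟩ := hs
    rcases h.meet A hA B hB hne.symm p pA pB with h1 | h1
    · exact Or.inr ⟨A, hA, B, hB, h1, pA, pB⟩
    · exact Or.inr ⟨B, hB, A, hA, h1, pB, pA⟩

/-- Two bricks stacked on one another have no common interior level. -/
theorem stacked_ne (h : IsBrickComplex P k 𝓑) {A B : Pt × Pt} (hA : A ∈ 𝓑)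
    (hAB : Stacked k A B) : A ≠ B := by
  rintro rfl
  have := h.lt A hA k
  have := hAB.1
  linarith

theorem eq_of_stacked (h : IsBrickComplex P k 𝓑) {A B C D : Pt × Pt} (hA : A ∈ 𝓑) (hB : B ∈ 𝓑)
    (hC : C ∈ 𝓑) (hD : D ∈ 𝓑) (hAB : Stacked k A B) (hCD : Stacked k C D) {p : Pt}
    (pA : p ∈ Icc A.1 A.2) (pB : p ∈ Icc B.1 B.2) (pC : p ∈ Icc C.1 C.2) (pD : p ∈ Icc D.1 D.2) :
    C = A ∧ D = B := by
  have e1 := hAB.eq_of_mem pA pB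
  have e2 := hCD.eq_of_mem pC pD
  have a1 := hAB.1
  have a2 := hCD.1
  have lA := h.lt A hA k
  have lB := h.lt B hB k
  have lC := h.lt C hC k
  have lD := h.lt D hD k
  constructor
  · rcases h.stacked_unique hA hB hC hAB pA pB pC with e | rfl
    · exact e
    · linarith
  · rcases h.stacked_unique hA hB hD hAB pA pB pD with rfl | e
    · linarith
    · exact e

end IsBrickComplex

/-! ### Reflex edges of a brick complex -/

theorem meetBox_apply_fst (A B : Pt × Pt) (i : Fin 3) :
    (meetBox A B).1 i = max (A.1 i) (B.1 i) := rfl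

theorem meetBox_apply_snd (A B : Pt × Pt) (i : Fin 3) :
    (meetBox A B).2 i = min (A.2 i) (B.2 i) := rfl

theorem openSegment_of_axis {e : Pt × Pt} {j : Fin 3} (he : ∀ l, l ≠ j → e.1 l = e.2 l)
    (hj : e.1 j < e.2 j) {p : Pt} :
    p ∈ openSegment ℝ e.1 e.2 ↔ (∀ l, l ≠ j → p l = e.1 l) ∧ e.1 j < p j ∧ p j < e.2 j := by
  constructor
  · rintro ⟨a, b, ha, hb, hab, rfl⟩
    refine ⟨fun l hl => ?_, ?_, ?_⟩
    · simp only [Pi.add_apply, Pi.smul_apply, smul_eq_mul]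
      rw [← he l hl, ← add_mul, hab, one_mul]
    · simp only [Pi.add_apply, Pi.smul_apply, smul_eq_mul]
      obtain rfl : a = 1 - b := by linarith
      nlinarith
    · simp only [Pi.add_apply, Pi.smul_apply, smul_eq_mul]
      obtain rfl : b = 1 - a := by linarith
      nlinarith
  · rintro ⟨h1, h2, h3⟩
    have hd : 0 < e.2 j - e.1 j := by linarith
    refine ⟨(e.2 j - p j) / (e.2 j - e.1 j), (p j - e.1 j) / (e.2 j - e.1 j),
      div_pos (by linarith) hd, div_pos (by linarith) hd, by field_simp; ring, ?_⟩
    funext l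
    simp only [Pi.add_apply, Pi.smul_apply, smul_eq_mul]
    by_cases hl : l = j
    · subst hl
      field_simp
      ring
    · rw [h1 l hl, ← he l hl]
      field_simp
      ring

theorem segment_of_axis {e : Pt × Pt} {j : Fin 3} (he : ∀ l, l ≠ j → e.1 l = e.2 l)
    {p : Pt} (hp : p ∈ segment ℝ e.1 e.2) : ∀ l, l ≠ j → p l = e.1 l := by
  obtain ⟨a, b, ha, hb, hab, rfl⟩ := hp
  intro l hl
  simp only [Pi.add_apply, Pi.smul_apply, smul_eq_mul]
  rw [← he l hl, ← add_mul, hab, one_mul]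

theorem reflexPoint_mem {P : Set Pt} {j : Fin 3} {p : Pt} (h : IsReflexPoint P j p) : p ∈ P := by
  obtain ⟨s, hs, hp⟩ := h
  obtain ⟨i, hi⟩ : ∃ i, i ≠ j := exists_ne j
  exact hp.self_of_nhds.2 ⟨i, hi, by simp⟩

section contactEdge

variable {A B : Pt × Pt} {i j k : Fin 3} {s : Bool}

theorem contactEdge_axis (hAB : Stacked k A B) (hA : A.1 k < A.2 k) (hB : B.1 k < B.2 k)
    (hik : i ≠ k) (hl : ∀ l, l = i ∨ l = j ∨ l = k) :
    ∀ l, l ≠ j → (contactEdge A B i s).1 l = (contactEdge A B i s).2 l := by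
  intro l hlj
  rcases hl l with rfl | rfl | rfl
  · simp [contactEdge]
  · exact absurd rfl hlj
  · have := hAB.1
    simp only [contactEdge, Function.update_of_ne hik.symm, meetBox_apply_fst, meetBox_apply_snd]
    rw [max_eq_right (by linarith), min_eq_left (by linarith), this]

theorem contactEdge_fst_same : (contactEdge A B i s).1 i = side (meetBox A B) i s := by
  simp [contactEdge]

theorem contactEdge_fst_vert (hAB : Stacked k A B) (hA : A.1 k < A.2 k) (hik : i ≠ k) :
    (contactEdge A B i s).1 k = A.2 k := by
  simp only [contactEdge, Function.update_of_ne hik.symm, meetBox_apply_fst]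
  rw [← hAB.1, max_eq_right hA.le]

theorem contactEdge_fst_other (hji : j ≠ i) :
    (contactEdge A B i s).1 j = max (A.1 j) (B.1 j) := by
  simp [contactEdge, Function.update_of_ne hji, meetBox_apply_fst]

theorem contactEdge_snd_other (hji : j ≠ i) :
    (contactEdge A B i s).2 j = min (A.2 j) (B.2 j) := by
  simp [contactEdge, Function.update_of_ne hji, meetBox_apply_snd]

theorem contactEdge_lt (hAB : Stacked k A B) (hA : A.1 j < A.2 j) (hB : B.1 j < B.2 j)
    (hji : j ≠ i) (hjk : j ≠ k) : (contactEdge A B i s).1 j < (contactEdge A B i s).2 j := by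
  have := hAB.2 j hjk
  rw [contactEdge_fst_other hji, contactEdge_snd_other hji, max_lt_iff, lt_min_iff, lt_min_iff]
  tauto

theorem mem_openSegment_contactEdge (hAB : Stacked k A B) (hA : ∀ i, A.1 i < A.2 i)
    (hB : ∀ i, B.1 i < B.2 i) (hik : i ≠ k) (hji : j ≠ i) (hjk : j ≠ k)
    (hl : ∀ l, l = i ∨ l = j ∨ l = k) {p : Pt} :
    p ∈ openSegment ℝ (contactEdge A B i s).1 (contactEdge A B i s).2 ↔
      p i = side (meetBox A B) i s ∧ p k = A.2 k ∧
        (A.1 j < p j ∧ B.1 j < p j) ∧ p j < A.2 j ∧ p j < B.2 j := by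
  rw [openSegment_of_axis (contactEdge_axis hAB (hA k) (hB k) hik hl)
    (contactEdge_lt hAB (hA j) (hB j) hji hjk), contactEdge_fst_other hji,
    contactEdge_snd_other hji, max_lt_iff, lt_min_iff, ← contactEdge_fst_vert hAB (hA k) hik,
    ← contactEdge_fst_same]
  constructor
  · rintro ⟨h1, h2⟩
    exact ⟨h1 i hji.symm, h1 k hjk.symm, h2⟩
  · rintro ⟨h1, h2, h3⟩
    refine ⟨fun l hlj => ?_, h3⟩
    rcases hl l with rfl | rfl | rfl
    exacts [h1, absurd rfl hlj, h2]

theorem contactEdge_mem_boxes (hAB : Stacked k A B) (hA : ∀ i, A.1 i < A.2 i)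
    (hB : ∀ i, B.1 i < B.2 i) (hik : i ≠ k) {q : Pt} (hqi : q i = side (meetBox A B) i s)
    (hqk : q k = A.2 k)
    (hqj : ∀ l, l ≠ i → l ≠ k → max (A.1 l) (B.1 l) ≤ q l ∧ q l ≤ min (A.2 l) (B.2 l)) :
    q ∈ Icc A.1 A.2 ∧ q ∈ Icc B.1 B.2 := by
  have key : ∀ l, (A.1 l ≤ q l ∧ q l ≤ A.2 l) ∧ (B.1 l ≤ q l ∧ q l ≤ B.2 l) := by
    intro l
    by_cases h1 : l = k
    · subst h1
      have := hA l
      have := hB l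
      have := hAB.1
      exact ⟨⟨by linarith, by linarith⟩, by linarith, by linarith⟩
    by_cases h2 : l = i
    · subst h2
      have a1 := hA l
      have a2 := hB l
      have a3 := hAB.2 l h1
      rw [hqi]
      cases s
      · simp only [side_false, meetBox_apply_fst, le_max_left, le_max_right, max_le_iff, true_and]
        exact ⟨⟨a1.le, a3.2.le⟩, a3.1.le, a2.le⟩
      · simp only [side_true, meetBox_apply_snd, min_le_left, min_le_right, le_min_iff, and_true]
        exact ⟨⟨a1.le, a3.1.le⟩, a3.2.le, a2.le⟩
    · have := hqj l h2 h1
      rw [max_le_iff, le_min_iff] at this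
      tauto
  exact ⟨mem_box.2 fun l => (key l).1, mem_box.2 fun l => (key l).2⟩

end contactEdge

theorem eventually_lt_apply {p : Pt} {l : Fin 3} {a : ℝ} (h : a < p l) :
    ∀ᶠ q in 𝓝 p, a < q l :=
  (continuous_apply l).continuousAt.eventually (lt_mem_nhds h)

theorem eventually_apply_lt {p : Pt} {l : Fin 3} {a : ℝ} (h : p l < a) :
    ∀ᶠ q in 𝓝 p, q l < a :=
  (continuous_apply l).continuousAt.eventually (gt_mem_nhds h)

namespace IsBrickComplex

variable {P : Set Pt} {k : Fin 3} {𝓑 : Finset (Pt × Pt)}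

/-- The relative interior of a side of a contact rectangle, on which exactly one of the two bricks
ends, consists of reflex points. -/
theorem reflexPoint_of_contact (h : IsBrickComplex P k 𝓑) {A B : Pt × Pt} (hA : A ∈ 𝓑)
    (hB : B ∈ 𝓑) (hAB : Stacked k A B) {i j : Fin 3} {s : Bool} (hik : i ≠ k) (hji : j ≠ i)
    (hjk : j ≠ k) (hl : ∀ l, l = i ∨ l = j ∨ l = k) (hs : side A i s ≠ side B i s) {p : Pt}
    (hp : p ∈ openSegment ℝ (contactEdge A B i s).1 (contactEdge A B i s).2) :
    IsReflexPoint P j p := by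
  have lA := h.lt A hA
  have lB := h.lt B hB
  rw [mem_openSegment_contactEdge hAB lA lB hik hji hjk hl] at hp
  obtain ⟨hpi, hpk, ⟨hj1, hj2⟩, hj3, hj4⟩ := hp
  have hpAB := contactEdge_mem_boxes hAB lA lB hik hpi hpk (fun l h1 h2 => by
    rcases hl l with rfl | rfl | rfl
    · exact absurd rfl h1
    · exact ⟨max_le hj1.le hj2.le, le_min hj3.le hj4.le⟩
    · exact absurd rfl h2)
  have hk1 := lA k
  have hk2 := lB k
  have hk3 := hAB.1
  have hi1 := lA i
  have hi2 := lB i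
  have hi3 := hAB.2 i hik
  -- The wedge opens away from the longer brick, and outwards at the side in question.
  refine ⟨fun l => if l = k then (if (side A i s < side B i s ↔ s = true) then -1 else 1)
    else if s = true then 1 else -1, fun l => by dsimp only; split_ifs <;> simp, ?_⟩
  have ev := h.eventually_mem_stacked hA hB hAB hpAB.1 hpAB.2
  have wedge : ∀ q : Pt, ∀ f : Fin 3 → ℝ, (∃ l, l ≠ j ∧ f l * (q l - p l) ≤ 0) ↔
      (f i * (q i - p i) ≤ 0 ∨ f k * (q k - p k) ≤ 0) := by
    intro q f
    constructor
    · rintro ⟨l, hlj, hlq⟩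
      rcases hl l with rfl | rfl | rfl
      exacts [Or.inl hlq, absurd rfl hlj, Or.inr hlq]
    · rintro (h1 | h1)
      exacts [⟨i, hji.symm, h1⟩, ⟨k, hjk.symm, h1⟩]
  have boxes : ∀ C : Pt × Pt, ∀ q : Pt, q ∈ Icc C.1 C.2 ↔
      (C.1 i ≤ q i ∧ q i ≤ C.2 i) ∧ (C.1 j ≤ q j ∧ q j ≤ C.2 j) ∧ C.1 k ≤ q k ∧ q k ≤ C.2 k :=
    fun C q => mem_box.trans ⟨fun H => ⟨H i, H j, H k⟩, fun H => forall_axes hl H.1 H.2.1 H.2.2⟩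
  simp only [wedge, hik, if_false, if_true]
  -- four similar cases: the side `s`, and which of the two bricks ends there
  cases s
  · simp only [side_false, meetBox_apply_fst] at hpi hs ⊢
    rcases lt_or_gt_of_ne hs with hs' | hs'
    · rw [max_eq_right hs'.le] at hpi
      filter_upwards [ev, eventually_lt_apply hj1, eventually_lt_apply hj2,
        eventually_apply_lt hj3, eventually_apply_lt hj4,
        eventually_lt_apply (p := p) (l := k) (a := A.1 k) (by linarith),
        eventually_apply_lt (p := p) (l := k) (a := B.2 k) (by linarith),
        eventually_lt_apply (p := p) (l := i) (a := A.1 i) (by linarith),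
        eventually_apply_lt (p := p) (l := i) (a := A.2 i) (by linarith),
        eventually_apply_lt (p := p) (l := i) (a := B.2 i) (by linarith)]
        with q e1 e2 e3 e4 e5 e6 e7 e8 e9 e10
      rw [e1, boxes, boxes]
      simp only [hs', Bool.false_eq_true, iff_false, not_true_eq_false, if_false]
      constructor
      · rintro (H | H)
        · right; linarith [H.2.2.2]
        · left; linarith [H.1.1]
      · intro H
        by_cases hq : q k ≤ p k
        · left; exact ⟨⟨by linarith, by linarith⟩, ⟨by linarith, by linarith⟩, by linarith, by linarith⟩
        · right
          rcases H with H | H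
          · exact ⟨⟨by linarith, by linarith⟩, ⟨by linarith, by linarith⟩, by linarith, by linarith⟩
          · exact absurd (by linarith) hq
    · rw [max_eq_left hs'.le] at hpi
      filter_upwards [ev, eventually_lt_apply hj1, eventually_lt_apply hj2,
        eventually_apply_lt hj3, eventually_apply_lt hj4,
        eventually_lt_apply (p := p) (l := k) (a := A.1 k) (by linarith),
        eventually_apply_lt (p := p) (l := k) (a := B.2 k) (by linarith),
        eventually_lt_apply (p := p) (l := i) (a := B.1 i) (by linarith),
        eventually_apply_lt (p := p) (l := i) (a := A.2 i) (by linarith),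
        eventually_apply_lt (p := p) (l := i) (a := B.2 i) (by linarith)]
        with q e1 e2 e3 e4 e5 e6 e7 e8 e9 e10
      rw [e1, boxes, boxes]
      simp only [not_lt.2 hs'.le, Bool.false_eq_true, if_true,
        if_false]
      constructor
      · rintro (H | H)
        · left; linarith [H.1.1]
        · right; linarith [H.2.2.1]
      · intro H
        by_cases hq : p k ≤ q k
        · right; exact ⟨⟨by linarith, by linarith⟩, ⟨by linarith, by linarith⟩, by linarith, by linarith⟩
        · left
          rcases H with H | H
          · exact ⟨⟨by linarith, by linarith⟩, ⟨by linarith, by linarith⟩, by linarith, by linarith⟩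
          · exact absurd (by linarith) hq
  · simp only [side_true, meetBox_apply_snd] at hpi hs ⊢
    rcases lt_or_gt_of_ne hs with hs' | hs'
    · rw [min_eq_left hs'.le] at hpi
      filter_upwards [ev, eventually_lt_apply hj1, eventually_lt_apply hj2,
        eventually_apply_lt hj3, eventually_apply_lt hj4,
        eventually_lt_apply (p := p) (l := k) (a := A.1 k) (by linarith),
        eventually_apply_lt (p := p) (l := k) (a := B.2 k) (by linarith),
        eventually_apply_lt (p := p) (l := i) (a := B.2 i) (by linarith),
        eventually_lt_apply (p := p) (l := i) (a := A.1 i) (by linarith),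
        eventually_lt_apply (p := p) (l := i) (a := B.1 i) (by linarith)]
        with q e1 e2 e3 e4 e5 e6 e7 e8 e9 e10
      rw [e1, boxes, boxes]
      simp only [hs', if_true]
      constructor
      · rintro (H | H)
        · left; linarith [H.1.2]
        · right; linarith [H.2.2.1]
      · intro H
        by_cases hq : p k ≤ q k
        · right; exact ⟨⟨by linarith, by linarith⟩, ⟨by linarith, by linarith⟩, by linarith, by linarith⟩
        · left
          rcases H with H | H
          · exact ⟨⟨by linarith, by linarith⟩, ⟨by linarith, by linarith⟩, by linarith, by linarith⟩
          · exact absurd (by linarith) hq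
    · rw [min_eq_right hs'.le] at hpi
      filter_upwards [ev, eventually_lt_apply hj1, eventually_lt_apply hj2,
        eventually_apply_lt hj3, eventually_apply_lt hj4,
        eventually_lt_apply (p := p) (l := k) (a := A.1 k) (by linarith),
        eventually_apply_lt (p := p) (l := k) (a := B.2 k) (by linarith),
        eventually_apply_lt (p := p) (l := i) (a := A.2 i) (by linarith),
        eventually_lt_apply (p := p) (l := i) (a := A.1 i) (by linarith),
        eventually_lt_apply (p := p) (l := i) (a := B.1 i) (by linarith)]
        with q e1 e2 e3 e4 e5 e6 e7 e8 e9 e10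
      rw [e1, boxes, boxes]
      simp only [not_lt.2 hs'.le, iff_true, if_false, if_true]
      constructor
      · rintro (H | H)
        · right; linarith [H.2.2.2]
        · left; linarith [H.1.2]
      · intro H
        by_cases hq : q k ≤ p k
        · left; exact ⟨⟨by linarith, by linarith⟩, ⟨by linarith, by linarith⟩, by linarith, by linarith⟩
        · right
          rcases H with H | H
          · exact ⟨⟨by linarith, by linarith⟩, ⟨by linarith, by linarith⟩, by linarith, by linarith⟩
          · exact absurd (by linarith) hq

/-- A point of a contact at which one of the bricks ends in the direction `j` is not
a reflex point for the direction `j`. -/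
theorem not_reflexPoint_of_end (h : IsBrickComplex P k 𝓑) {A B : Pt × Pt} (hA : A ∈ 𝓑)
    (hB : B ∈ 𝓑) (hAB : Stacked k A B) {j : Fin 3} (hjk : j ≠ k) {p : Pt}
    (pA : p ∈ Icc A.1 A.2) (pB : p ∈ Icc B.1 B.2)
    (hend : p j = A.1 j ∨ p j = A.2 j ∨ p j = B.1 j ∨ p j = B.2 j) : ¬ IsReflexPoint P j p := by
  rintro ⟨f, hf, hp⟩
  have ev := h.eventually_mem_stacked hA hB hAB pA pB
  -- A point of the ending brick `C`, moved in the direction `j` across its end, stays in `P`.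
  have main : ∀ C : Pt × Pt, (∀ l, C.1 l < C.2 l) → p ∈ Icc C.1 C.2 →
      (∀ᶠ q in 𝓝 p, q ∈ Icc C.1 C.2 → q ∈ P) → ∀ σ : ℝ, (σ = 1 ∨ σ = -1) →
      (∀ᶠ q in 𝓝 p, q ∈ P → 0 < σ * (q k - p k) → q ∈ Icc C.1 C.2) →
      (0 < σ → p k < C.2 k) → (σ < 0 → C.1 k < p k) →
      (p j = C.1 j ∨ p j = C.2 j) → False := by
    intro C hC pC hCP σ hσ hPC hσ1 hσ2 hend
    obtain ⟨δ, hδ, H⟩ := eventually_nhds_cube.1 ((hp.and hCP).and hPC)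
    -- the point `p + t (c - p)` with `c` an interior point of `C` at a level beyond `p`
    set c : Pt := fun l => if l = k then p k + σ * (if σ = 1 then (C.2 k - p k) else (p k - C.1 k))
      else (C.1 l + C.2 l) / 2 with hc
    obtain ⟨t, ht0, ht1, htδ⟩ : ∃ t : ℝ, 0 < t ∧ t ≤ 1 ∧ ∀ l, t * |c l - p l| < δ := by
      refine ⟨min 1 (δ / (∑ l, |c l - p l| + 1)), by positivity, min_le_left _ _, fun l => ?_⟩
      have h1 : |c l - p l| ≤ ∑ l, |c l - p l| :=
        Finset.single_le_sum (f := fun l => |c l - p l|) (fun _ _ => abs_nonneg _)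
          (Finset.mem_univ l)
      have h2 : 0 ≤ ∑ l, |c l - p l| := Finset.sum_nonneg fun _ _ => abs_nonneg _
      calc _ ≤ (δ / (∑ l, |c l - p l| + 1)) * |c l - p l| :=
            mul_le_mul_of_nonneg_right (min_le_right _ _) (abs_nonneg _)
        _ ≤ (δ / (∑ l, |c l - p l| + 1)) * ∑ l, |c l - p l| := by gcongr
        _ < δ := by
            rw [div_mul_eq_mul_div, div_lt_iff₀ (by linarith)]
            nlinarith
    have hck : 0 < σ * (c k - p k) := by
      simp only [hc, if_true]
      rcases hσ with rfl | rfl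
      · have := hσ1 one_pos; norm_num; linarith
      · have := hσ2 (by norm_num); norm_num; linarith
    have cC : c ∈ Icc C.1 C.2 := by
      refine mem_box.2 fun l => ?_
      have h1 := hC l
      have h2 := (mem_box.1 pC) l
      by_cases hlk : l = k
      · subst hlk
        rcases hσ with rfl | rfl
        · simp only [hc, if_true]; constructor <;> linarith
        · norm_num [hc]; linarith
      · simp only [hc, hlk, if_false]; constructor <;> linarith
    have key : ∀ τ : ℝ, |τ| ≤ 1 → |τ * (t * (c j - p j))| < δ := by
      intro τ hτ
      rw [abs_mul, abs_mul, abs_of_pos ht0]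
      have := htδ j
      have h0 : 0 ≤ t * |c j - p j| := by positivity
      nlinarith
    let q : ℝ → Pt := fun τ l => if l = j then p j + τ * (t * (c j - p j)) else
      p l + t * (c l - p l)
    have qδ : ∀ τ, |τ| ≤ 1 → ∀ l, |q τ l - p l| < δ := by
      intro τ hτ l
      by_cases hlj : l = j
      · subst hlj; simpa [q] using key τ hτ
      · simp only [q, hlj, if_false, add_sub_cancel_left, abs_mul, abs_of_pos ht0]; exact htδ l
    have q1 : q 1 ∈ P := by
      refine (H _ (qδ 1 (by simp))).1.2 ?_
      have : q 1 = (1 - t) • p + t • c := by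
        funext l
        by_cases hlj : l = j
        · subst hlj; simp [q]; ring
        · simp [q, hlj]; ring
      rw [this]
      exact convex_box C pC cC (by linarith) ht0.le (by ring)
    have q2 : q (-1) ∈ P := by
      rw [(H _ (qδ (-1) (by simp))).1.1]
      obtain ⟨l, hlj, hl⟩ := (H _ (qδ 1 (by simp))).1.1.1 q1
      refine ⟨l, hlj, ?_⟩
      simpa only [q, hlj, if_false] using hl
    have q3 : q (-1) ∈ Icc C.1 C.2 := by
      refine (H _ (qδ (-1) (by simp))).2 q2 ?_
      simp only [q, hjk.symm, if_false, add_sub_cancel_left]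
      have : σ * (t * (c k - p k)) = t * (σ * (c k - p k)) := by ring
      rw [this]; positivity
    have q4 := mem_box.1 q3 j
    have hCj := hC j
    have cj : c j = (C.1 j + C.2 j) / 2 := by simp [hc, hjk]
    simp only [q, if_true, cj] at q4
    rcases hend with e | e <;> rw [e] at q4 <;> nlinarith [q4.1, q4.2]
  have lA := h.lt A hA
  have lB := h.lt B hB
  have e1 := hAB.eq_of_mem pA pB
  have e2 := hAB.1
  have lAk := lA k
  have lBk := lB k
  have hA' : p j = A.1 j ∨ p j = A.2 j → False := by
    refine main A lA pA ?_ (-1) (Or.inr rfl) ?_ (by norm_num) fun _ => by linarith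
    · filter_upwards [ev] with q hq hqA using hq.2 (Or.inl hqA)
    · filter_upwards [ev] with q hq hqP hqk
      refine (hq.1 hqP).resolve_right fun hqB => ?_
      have := hqB.1 k
      linarith
  have hB' : p j = B.1 j ∨ p j = B.2 j → False := by
    refine main B lB pB ?_ 1 (Or.inl rfl) ?_ (fun _ => by linarith) (by norm_num)
    · filter_upwards [ev] with q hq hqB using hq.2 (Or.inr hqB)
    · filter_upwards [ev] with q hq hqP hqk
      refine (hq.1 hqP).resolve_left fun hqA => ?_
      have := hqA.2 k
      linarith
  rcases hend with e | e | e | e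
  exacts [hA' (Or.inl e), hA' (Or.inr e), hB' (Or.inl e), hB' (Or.inr e)]

/-- Every side of a contact rectangle on which exactly one of the two bricks ends is
a reflex edge. -/
theorem isReflexEdge_contactEdge (h : IsBrickComplex P k 𝓑) {A B : Pt × Pt} (hA : A ∈ 𝓑)
    (hB : B ∈ 𝓑) (hAB : Stacked k A B) {i j : Fin 3} {s : Bool} (hik : i ≠ k) (hji : j ≠ i)
    (hjk : j ≠ k) (hl : ∀ l, l = i ∨ l = j ∨ l = k) (hs : side A i s ≠ side B i s) :
    IsReflexEdge P j (contactEdge A B i s) := by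
  have lA := h.lt A hA
  have lB := h.lt B hB
  have hax := contactEdge_axis (s := s) hAB (lA k) (lB k) hik hl
  have hlt := contactEdge_lt (s := s) hAB (lA j) (lB j) hji hjk
  have e1 := contactEdge_fst_other (A := A) (B := B) (s := s) hji
  have e2 := contactEdge_snd_other (A := A) (B := B) (s := s) hji
  have e3 := contactEdge_fst_vert (i := i) (s := s) hAB (lA k) hik
  refine ⟨hax, hlt, fun p hp => h.reflexPoint_of_contact hA hB hAB hik hji hjk hl hs hp, ?_, ?_⟩
  · have hm := contactEdge_mem_boxes hAB lA lB hik (contactEdge_fst_same (A := A) (B := B) (s := s))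
      e3 (fun l h1 h2 => by
        rcases hl l with rfl | rfl | rfl
        · exact absurd rfl h1
        · rw [← e1, ← e2]; exact ⟨le_rfl, hlt.le⟩
        · exact absurd rfl h2)
    refine h.not_reflexPoint_of_end hA hB hAB hjk hm.1 hm.2 ?_
    rw [e1]
    rcases max_choice (A.1 j) (B.1 j) with e | e <;> rw [e] <;> simp
  · have hm := contactEdge_mem_boxes (q := (contactEdge A B i s).2) hAB lA lB hik
      (by rw [← hax i hji.symm, contactEdge_fst_same]) (by rw [← hax k hjk.symm, e3])
      (fun l h1 h2 => by
        rcases hl l with rfl | rfl | rfl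
        · exact absurd rfl h1
        · rw [← e1, ← e2]; exact ⟨hlt.le, le_rfl⟩
        · exact absurd rfl h2)
    refine h.not_reflexPoint_of_end hA hB hAB hjk hm.1 hm.2 ?_
    rw [e2]
    rcases min_choice (A.2 j) (B.2 j) with e | e <;> rw [e] <;> simp

end IsBrickComplex

/-- Near a reflex point for the direction `j`, the set `P` is not convex, not even on one side of
the plane through the point orthogonal to `j`. -/
theorem IsReflexPoint.not_convex {P C : Set Pt} {j : Fin 3} {p : Pt} (h : IsReflexPoint P j p)
    (hC : Convex ℝ C) {τ : ℝ} (hτ : τ = 0 ∨ τ = 1)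
    (hev : ∀ᶠ q in 𝓝 p, (τ = 0 ∨ 0 < q j - p j) → (q ∈ P ↔ q ∈ C)) : False := by
  obtain ⟨s, hs, hp⟩ := h
  obtain ⟨i, hij⟩ : ∃ i, i ≠ j := exists_ne j
  obtain ⟨m, hmi, hmj, hl⟩ := exists_third hij
  obtain ⟨δ, hδ, H⟩ := eventually_nhds_cube.1 (hp.and hev)
  -- the midpoint of two points of the set lies in the wedge
  let q : ℝ → ℝ → Pt := fun a b l =>
    if l = j then p j + τ * (δ / 4) else if l = i then p i + a * (δ / 4) * s i else
      p m + b * (δ / 4) * s m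
  have hτ' : |τ| ≤ 1 := by rcases hτ with rfl | rfl <;> simp
  have qδ : ∀ a b, |a| ≤ 3 → |b| ≤ 3 → ∀ l, |q a b l - p l| < δ := by
    intro a b ha hb
    have hsi : ∀ l, |s l| = 1 := fun l => by rcases hs l with e | e <;> rw [e] <;> norm_num
    have h4 : |δ / 4| = δ / 4 := abs_of_pos (by linarith)
    refine forall_axes hl ?_ ?_ ?_
    · simp only [q, hij, if_false, if_true, add_sub_cancel_left, abs_mul, hsi, h4]; nlinarith
    · simp only [q, hmj, hmi, if_false, add_sub_cancel_left, abs_mul, hsi, h4]; nlinarith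
    · simp only [q, if_true, add_sub_cancel_left, abs_mul, h4]; nlinarith
  have cond : ∀ a b, (τ = 0 ∨ 0 < q a b j - p j) := by
    intro a b
    rcases hτ with rfl | rfl
    · exact Or.inl rfl
    · right; simp [q]; linarith
  have ss : ∀ l, s l * s l = 1 := fun l => by rcases hs l with e | e <;> rw [e] <;> norm_num
  have q1 : q 3 (-1) ∈ P := by
    refine (H _ (qδ _ _ (by norm_num) (by norm_num))).1.2 ⟨m, hmj, ?_⟩
    simp only [q, hmj, hmi, if_false, add_sub_cancel_left]
    nlinarith [ss m]
  have q2 : q (-1) 3 ∈ P := by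
    refine (H _ (qδ _ _ (by norm_num) (by norm_num))).1.2 ⟨i, hij, ?_⟩
    simp only [q, hij, if_false, if_true, add_sub_cancel_left]
    nlinarith [ss i]
  have c1 := ((H _ (qδ _ _ (by norm_num) (by norm_num))).2 (cond 3 (-1))).1 q1
  have c2 := ((H _ (qδ _ _ (by norm_num) (by norm_num))).2 (cond (-1) 3)).1 q2
  have c3 : q 1 1 ∈ C := by
    have : q 1 1 = (1 / 2 : ℝ) • q 3 (-1) + (1 / 2 : ℝ) • q (-1) 3 := by
      funext l
      simp only [q, Pi.add_apply, Pi.smul_apply, smul_eq_mul]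
      split_ifs <;> ring
    rw [this]
    exact hC c1 c2 (by norm_num) (by norm_num) (by norm_num)
  have q3 := ((H _ (qδ _ _ (by norm_num) (by norm_num))).2 (cond 1 1)).2 c3
  obtain ⟨l, hlj, hq⟩ := (H _ (qδ _ _ (by norm_num) (by norm_num))).1.1 q3
  rcases hl l with rfl | rfl | rfl
  · simp only [q, hij, if_false, if_true, add_sub_cancel_left] at hq
    nlinarith [ss l]
  · simp only [q, hmj, hmi, if_false, add_sub_cancel_left] at hq
    nlinarith [ss l]
  · exact hlj rfl

/-- Two reflex edges with the same direction that share an interior point are equal. -/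
theorem IsReflexEdge.eq_of_mem {P : Set Pt} {j : Fin 3} {e e' : Pt × Pt} (h : IsReflexEdge P j e)
    (h' : IsReflexEdge P j e') {p : Pt} (hp : p ∈ openSegment ℝ e.1 e.2)
    (hp' : p ∈ openSegment ℝ e'.1 e'.2) : e = e' := by
  rw [openSegment_of_axis h.1 h.2.1] at hp
  rw [openSegment_of_axis h'.1 h'.2.1] at hp'
  have key : ∀ {a b : Pt × Pt}, IsReflexEdge P j a → IsReflexEdge P j b →
      (∀ l, l ≠ j → a.1 l = b.1 l) → a.1 j < p j → p j < a.2 j → b.1 j < p j → p j < b.2 j →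
      a.1 j ≤ b.1 j ∧ b.2 j ≤ a.2 j := by
    intro a b ha hb hl h1 h2 h3 h4
    constructor
    · by_contra! hlt
      refine ha.2.2.2.1 (hb.2.2.1 _ ?_)
      rw [openSegment_of_axis hb.1 hb.2.1]
      exact ⟨hl, hlt, by linarith⟩
    · by_contra! hlt
      refine ha.2.2.2.2 (hb.2.2.1 _ ?_)
      rw [openSegment_of_axis hb.1 hb.2.1]
      exact ⟨fun l hlj => by rw [← ha.1 l hlj, hl l hlj], by linarith, hlt⟩
  have hl : ∀ l, l ≠ j → e.1 l = e'.1 l := fun l hlj => by rw [← hp.1 l hlj, hp'.1 l hlj]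
  have k1 := key h h' hl hp.2.1 hp.2.2 hp'.2.1 hp'.2.2
  have k2 := key h' h (fun l hlj => (hl l hlj).symm) hp'.2.1 hp'.2.2 hp.2.1 hp.2.2
  refine Prod.ext (funext fun l => ?_) (funext fun l => ?_)
  · by_cases hlj : l = j
    · subst hlj; exact le_antisymm k1.1 k2.1
    · exact hl l hlj
  · by_cases hlj : l = j
    · subst hlj; exact le_antisymm k2.2 k1.2
    · rw [← h.1 l hlj, ← h'.1 l hlj, hl l hlj]

namespace IsBrickComplex

variable {P : Set Pt} {k : Fin 3} {𝓑 : Finset (Pt × Pt)}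

/-- Every reflex point lies in the relative interior of a side of a contact rectangle on which
exactly one of the two bricks ends. -/
theorem contact_of_reflexPoint (h : IsBrickComplex P k 𝓑) {j : Fin 3} {p : Pt}
    (hp : IsReflexPoint P j p) : j ≠ k ∧ ∃ A ∈ 𝓑, ∃ B ∈ 𝓑, ∃ i s, Stacked k A B ∧ i ≠ k ∧ j ≠ i ∧
      side A i s ≠ side B i s ∧
      p ∈ openSegment ℝ (contactEdge A B i s).1 (contactEdge A B i s).2 := by
  rcases h.single_or_stacked (reflexPoint_mem hp) with
    ⟨A, hA, pA, hs⟩ | ⟨A, hA, B, hB, hAB, pA, pB⟩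
  · refine (hp.not_convex (convex_box A) (Or.inl rfl) ?_).elim
    filter_upwards [h.eventually_mem_single hA pA hs] with q hq _ using hq
  have lA := h.lt A hA
  have lB := h.lt B hB
  have ev := h.eventually_mem_stacked hA hB hAB pA pB
  have hpk := hAB.eq_of_mem pA pB
  have hk3 := hAB.1
  have hk1 := lA k
  have hk2 := lB k
  have hjk : j ≠ k := by
    rintro rfl
    refine hp.not_convex (convex_box B) (Or.inr rfl) ?_
    filter_upwards [ev] with q hq hq'
    rw [hq]
    refine ⟨fun H => H.resolve_left fun hqA => ?_, Or.inr⟩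
    have := hqA.2 j
    norm_num at hq'
    linarith
  obtain ⟨i, hij, hik, hl⟩ := exists_third hjk
  obtain ⟨f, hf, hp⟩ := hp
  obtain ⟨δ, hδ, H⟩ := eventually_nhds_cube.1 (hp.and ev)
  -- test points around `p`, with coordinates in units of `δ / 2`
  let q : ℝ → ℝ → ℝ → Pt := fun a b c l =>
    if l = i then p i + a * (δ / 2) else if l = j then p j + b * (δ / 2) else p k + c * (δ / 2)
  have qi : ∀ a b c, q a b c i = p i + a * (δ / 2) := fun a b c => by simp [q]
  have qj : ∀ a b c, q a b c j = p j + b * (δ / 2) := fun a b c => by simp [q, hij.symm]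
  have qk : ∀ a b c, q a b c k = p k + c * (δ / 2) := fun a b c => by simp [q, hik.symm, hjk.symm]
  have qδ : ∀ a b c, |a| ≤ 1 → |b| ≤ 1 → |c| ≤ 1 → ∀ l, |q a b c l - p l| < δ := by
    intro a b c ha hb hc
    have h2 : |δ / 2| = δ / 2 := abs_of_pos (by linarith)
    refine forall_axes (i := i) (j := j) (k := k) (fun l => by rcases hl l with e | e | e <;> tauto)
      ?_ ?_ ?_
    · rw [qi, add_sub_cancel_left, abs_mul, h2]; nlinarith
    · rw [qj, add_sub_cancel_left, abs_mul, h2]; nlinarith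
    · rw [qk, add_sub_cancel_left, abs_mul, h2]; nlinarith
  have hl' : ∀ l, l = i ∨ l = j ∨ l = k := fun l => by rcases hl l with e | e | e <;> tauto
  have wedge : ∀ q : Pt, (∃ l, l ≠ j ∧ f l * (q l - p l) ≤ 0) ↔
      (f i * (q i - p i) ≤ 0 ∨ f k * (q k - p k) ≤ 0) := by
    intro q
    constructor
    · rintro ⟨l, hlj, hlq⟩
      rcases hl' l with rfl | rfl | rfl
      exacts [Or.inl hlq, absurd rfl hlj, Or.inr hlq]
    · rintro (h1 | h1)
      exacts [⟨i, hij, h1⟩, ⟨k, hjk.symm, h1⟩]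
  -- membership of the test points
  have key : ∀ a b c, |a| ≤ 1 → |b| ≤ 1 → |c| ≤ 1 →
      ((f i * (a * (δ / 2)) ≤ 0 ∨ f k * (c * (δ / 2)) ≤ 0) ↔
        (q a b c ∈ Icc A.1 A.2 ∨ q a b c ∈ Icc B.1 B.2)) := by
    intro a b c ha hb hc
    have := H _ (qδ a b c ha hb hc)
    rw [← this.2, this.1, wedge, qi, qk, add_sub_cancel_left, add_sub_cancel_left]
  have below : ∀ a b c, |a| ≤ 1 → |b| ≤ 1 → c = -1 →
      ((f i * (a * (δ / 2)) ≤ 0 ∨ f k * (c * (δ / 2)) ≤ 0) ↔ q a b c ∈ Icc A.1 A.2) := by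
    rintro a b c ha hb rfl
    rw [key a b _ ha hb (by norm_num)]
    refine ⟨fun H => H.resolve_right fun hq => ?_, Or.inl⟩
    have := hq.1 k
    rw [qk] at this
    linarith
  have above : ∀ a b c, |a| ≤ 1 → |b| ≤ 1 → c = 1 →
      ((f i * (a * (δ / 2)) ≤ 0 ∨ f k * (c * (δ / 2)) ≤ 0) ↔ q a b c ∈ Icc B.1 B.2) := by
    rintro a b c ha hb rfl
    rw [key a b _ ha hb (by norm_num)]
    refine ⟨fun H => H.resolve_left fun hq => ?_, Or.inr⟩
    have := hq.2 k
    rw [qk] at this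
    linarith
  have one : |(1 : ℝ)| ≤ 1 := by norm_num
  have mone : |(-1 : ℝ)| ≤ 1 := by norm_num
  -- `C` is the longer brick and `D` the one that ends at the side
  have finish : ∀ C D : Pt × Pt, p ∈ Icc C.1 C.2 → p ∈ Icc D.1 D.2 →
      (∀ i, C.1 i < C.2 i) → (∀ i, D.1 i < D.2 i) →
      (∀ a b, |a| ≤ 1 → |b| ≤ 1 → ∃ c, q a b c ∈ Icc C.1 C.2) →
      (∀ a b, |a| ≤ 1 → |b| ≤ 1 → f i * a ≤ 0 → ∃ c, q a b c ∈ Icc D.1 D.2) →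
      (∀ a b, |a| ≤ 1 → |b| ≤ 1 → 0 < f i * a → ∃ c, p k + c * (δ / 2) ∈ Icc (D.1 k) (D.2 k) ∧
        q a b c ∉ Icc D.1 D.2) →
      (C.1 j < p j ∧ D.1 j < p j) ∧ (p j < C.2 j ∧ p j < D.2 j) ∧
      ∃ s, side C i s ≠ side D i s ∧ p i = side (meetBox C D) i s := by
    intro C D pC pD lC lD hC hD hD'
    have Cj1 : C.1 j < p j := by
      obtain ⟨c, hc⟩ := hC 1 (-1) one mone
      have := hc.1 j; rw [qj] at this; linarith
    have Cj2 : p j < C.2 j := by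
      obtain ⟨c, hc⟩ := hC 1 1 one one
      have := hc.2 j; rw [qj] at this; linarith
    have Ci1 : C.1 i < p i := by
      obtain ⟨c, hc⟩ := hC (-1) 1 mone one
      have := hc.1 i; rw [qi] at this; linarith
    have Ci2 : p i < C.2 i := by
      obtain ⟨c, hc⟩ := hC 1 1 one one
      have := hc.2 i; rw [qi] at this; linarith
    have Dj1 : D.1 j < p j := by
      obtain ⟨c, hc⟩ := hD 0 (-1) (by norm_num) mone (by simp)
      have := hc.1 j; rw [qj] at this; linarith
    have Dj2 : p j < D.2 j := by
      obtain ⟨c, hc⟩ := hD 0 1 (by norm_num) one (by simp)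
      have := hc.2 j; rw [qj] at this; linarith
    have pDi := mem_box.1 pD i
    refine ⟨⟨Cj1, Dj1⟩, ⟨Cj2, Dj2⟩, ?_⟩
    rcases hf i with e | e
    · -- the box `D` ends at its upper side
      have hDi : p i = D.2 i := by
        refine le_antisymm pDi.2 (not_lt.1 fun hlt => ?_)
        have hpos : 0 < min 1 (min ((D.2 i - p i) / δ) (min ((p j - D.1 j)/δ) ((D.2 j - p j)/δ))) := by
          refine lt_min one_pos (lt_min (div_pos (by linarith) hδ)
            (lt_min (div_pos (by linarith) hδ) (div_pos (by linarith) hδ)))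
        set t := min 1 (min ((D.2 i - p i) / δ) (min ((p j - D.1 j)/δ) ((D.2 j - p j)/δ))) with ht
        have ht1 : t ≤ 1 := min_le_left _ _
        have ht2 : t ≤ (D.2 i - p i) / δ := (min_le_right _ _).trans (min_le_left _ _)
        rw [le_div_iff₀ hδ] at ht2
        obtain ⟨c, hc1, hc2⟩ := hD' t 0 (by rw [abs_of_pos hpos]; exact ht1) (by norm_num)
          (by rw [e]; linarith)
        refine hc2 (mem_box.2 (forall_axes hl' ?_ ?_ ?_))
        · rw [qi]; constructor <;> nlinarith
        · rw [qj]; constructor <;> nlinarith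
        · rw [qk]; exact hc1
      refine ⟨true, ?_, ?_⟩
      · simp only [side_true]; linarith
      · simp only [side_true, meetBox_apply_snd]; rw [min_eq_right (by linarith)]; exact hDi
    · have hDi : p i = D.1 i := by
        refine le_antisymm (not_lt.1 fun hlt => ?_) pDi.1
        have hpos : 0 < min 1 ((p i - D.1 i) / δ) :=
          lt_min one_pos (div_pos (by linarith) hδ)
        set t := min 1 ((p i - D.1 i) / δ) with ht
        have ht1 : t ≤ 1 := min_le_left _ _
        have ht2 : t ≤ (p i - D.1 i) / δ := min_le_right _ _
        rw [le_div_iff₀ hδ] at ht2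
        obtain ⟨c, hc1, hc2⟩ := hD' (-t) 0 (by rw [abs_neg, abs_of_pos hpos]; exact ht1)
          (by norm_num) (by rw [e]; linarith)
        refine hc2 (mem_box.2 (forall_axes hl' ?_ ?_ ?_))
        · rw [qi]; constructor <;> nlinarith
        · rw [qj]; constructor <;> nlinarith
        · rw [qk]; exact hc1
      refine ⟨false, ?_, ?_⟩
      · simp only [side_false]; linarith
      · simp only [side_false, meetBox_apply_fst]; rw [max_eq_right (by linarith)]; exact hDi
  have sgn : ∀ a : ℝ, f i * a ≤ 0 → f i * (a * (δ / 2)) ≤ 0 := fun a ha => by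
    rw [← mul_assoc]; exact mul_nonpos_of_nonpos_of_nonneg ha (by linarith)
  have sgn' : ∀ a : ℝ, 0 < f i * a → ¬ f i * (a * (δ / 2)) ≤ 0 := fun a ha => by
    rw [← mul_assoc, not_le]; positivity
  have vertA : p k + -1 * (δ / 2) ∈ Icc (A.1 k) (A.2 k) := by
    have : q 0 0 (-1) ∈ Icc A.1 A.2 :=
      (below 0 0 (-1) (by norm_num) (by norm_num) rfl).1 (Or.inl (by simp))
    have := mem_box.1 this k
    rwa [qk] at this
  have vertB : p k + 1 * (δ / 2) ∈ Icc (B.1 k) (B.2 k) := by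
    have : q 0 0 1 ∈ Icc B.1 B.2 :=
      (above 0 0 1 (by norm_num) (by norm_num) rfl).1 (Or.inl (by simp))
    have := mem_box.1 this k
    rwa [qk] at this
  refine ⟨hjk, A, hA, B, hB, ?_⟩
  rcases hf k with e | e
  · obtain ⟨⟨F1, F2⟩, ⟨F3, F4⟩, s, hs, hpi⟩ := finish A B pA pB lA lB
      (fun a b ha hb => ⟨-1, (below a b _ ha hb rfl).1 (Or.inr (by rw [e]; linarith))⟩)
      (fun a b ha hb hab => ⟨1, (above a b _ ha hb rfl).1 (Or.inl (sgn a hab))⟩)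
      (fun a b ha hb hab => ⟨1, vertB, fun hq => by
        rcases (above a b _ ha hb rfl).2 hq with H | H
        · exact sgn' a hab H
        · rw [e] at H; linarith⟩)
    refine ⟨i, s, hAB, hik, hij.symm, hs, ?_⟩
    rw [mem_openSegment_contactEdge hAB lA lB hik hij.symm hjk hl']
    exact ⟨hpi, hpk, ⟨F1, F2⟩, F3, F4⟩
  · obtain ⟨⟨F1, F2⟩, ⟨F3, F4⟩, s, hs, hpi⟩ := finish B A pB pA lB lA
      (fun a b ha hb => ⟨1, (above a b _ ha hb rfl).1 (Or.inr (by rw [e]; linarith))⟩)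
      (fun a b ha hb hab => ⟨-1, (below a b _ ha hb rfl).1 (Or.inl (sgn a hab))⟩)
      (fun a b ha hb hab => ⟨-1, vertA, fun hq => by
        rcases (below a b _ ha hb rfl).2 hq with H | H
        · exact sgn' a hab H
        · rw [e] at H; linarith⟩)
    refine ⟨i, s, hAB, hik, hij.symm, hs.symm, ?_⟩
    rw [mem_openSegment_contactEdge hAB lA lB hik hij.symm hjk hl']
    refine ⟨?_, hpk, ⟨F2, F1⟩, F4, F3⟩
    rw [hpi]
    simp only [side, meetBox, sup_comm, inf_comm]

theorem no_vertical (h : IsBrickComplex P k 𝓑) (e : Pt × Pt) : ¬ IsReflexEdge P k e := by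
  intro he
  have : (1 / 2 : ℝ) • e.1 + (1 / 2 : ℝ) • e.2 ∈ openSegment ℝ e.1 e.2 :=
    ⟨1 / 2, 1 / 2, by norm_num, by norm_num, by norm_num, rfl⟩
  exact (h.contact_of_reflexPoint (he.2.2.1 _ this)).1 rfl

open Classical in
/-- The sides `(A, B, i, s)` of the contact rectangles on which exactly one of the two bricks
ends. -/
noncomputable def reflexSides (𝓑 : Finset (Pt × Pt)) (k : Fin 3) :
    Finset (((Pt × Pt) × (Pt × Pt)) × (Fin 3 × Bool)) :=
  ((𝓑 ×ˢ 𝓑) ×ˢ Finset.univ).filter fun x =>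
    Stacked k x.1.1 x.1.2 ∧ x.2.1 ≠ k ∧ side x.1.1 x.2.1 x.2.2 ≠ side x.1.2 x.2.1 x.2.2

theorem mem_reflexSides {x : ((Pt × Pt) × (Pt × Pt)) × (Fin 3 × Bool)} :
    x ∈ reflexSides 𝓑 k ↔ (x.1.1 ∈ 𝓑 ∧ x.1.2 ∈ 𝓑) ∧ Stacked k x.1.1 x.1.2 ∧ x.2.1 ≠ k ∧
      side x.1.1 x.2.1 x.2.2 ≠ side x.1.2 x.2.1 x.2.2 := by
  simp [reflexSides]

/-- The reflex edges are the sides of the contact rectangles on which exactly one of the two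
bricks ends. -/
theorem reflexEdges_eq (h : IsBrickComplex P k 𝓑) : reflexEdges P =
    (fun x : ((Pt × Pt) × (Pt × Pt)) × (Fin 3 × Bool) => contactEdge x.1.1 x.1.2 x.2.1 x.2.2) ''
      (reflexSides 𝓑 k : Set _) := by
  ext e
  constructor
  · rintro ⟨j, he⟩
    have hm : (1 / 2 : ℝ) • e.1 + (1 / 2 : ℝ) • e.2 ∈ openSegment ℝ e.1 e.2 :=
      ⟨1 / 2, 1 / 2, by norm_num, by norm_num, by norm_num, rfl⟩
    obtain ⟨hjk, A, hA, B, hB, i, s, hAB, hik, hji, hs, hp⟩ :=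
      h.contact_of_reflexPoint (he.2.2.1 _ hm)
    refine ⟨((A, B), (i, s)), Finset.mem_coe.2 (mem_reflexSides.2 ⟨⟨hA, hB⟩, hAB, hik, hs⟩), ?_⟩
    obtain ⟨j', hj1, hj2, hl⟩ := exists_third hik
    obtain rfl : j = j' := by
      rcases hl j with e | e | e
      exacts [absurd e hji, e, absurd e hjk]
    exact (h.isReflexEdge_contactEdge hA hB hAB hik hji hjk hl hs).eq_of_mem he hp hm
  · rintro ⟨⟨⟨A, B⟩, i, s⟩, hx, rfl⟩
    obtain ⟨⟨hA, hB⟩, hAB, hik, hs⟩ := mem_reflexSides.1 (Finset.mem_coe.1 hx)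
    obtain ⟨j, hji, hjk, hl⟩ := exists_third hik
    exact ⟨j, h.isReflexEdge_contactEdge hA hB hAB hik hji hjk hl hs⟩

theorem encard_reflexEdges (h : IsBrickComplex P k 𝓑) :
    (reflexEdges P).encard = (reflexSides 𝓑 k).card := by
  rw [h.reflexEdges_eq, InjOn.encard_image, Set.encard_coe_eq_coe_finsetCard]
  rintro ⟨⟨A, B⟩, i, s⟩ hx ⟨⟨A', B'⟩, i', s'⟩ hx' hxx
  obtain ⟨⟨hA, hB⟩, hAB, hik, hs⟩ := mem_reflexSides.1 (Finset.mem_coe.1 hx)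
  obtain ⟨⟨hA', hB'⟩, hAB', hik', hs'⟩ := mem_reflexSides.1 (Finset.mem_coe.1 hx')
  obtain ⟨j, hji, hjk, hl⟩ := exists_third hik
  obtain ⟨j', hji', hjk', hl'⟩ := exists_third hik'
  dsimp only at *
  have hax := contactEdge_axis (s := s) hAB (h.lt A hA k) (h.lt B hB k) hik hl
  have hax' := contactEdge_axis (s := s') hAB' (h.lt A' hA' k) (h.lt B' hB' k) hik' hl'
  have hlt := contactEdge_lt (s := s) hAB (h.lt A hA j) (h.lt B hB j) hji hjk
  obtain rfl : j = j' := by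
    by_contra hne
    rw [hxx] at hlt
    exact hlt.ne (hax' j hne)
  obtain rfl : i = i' := by
    rcases hl i' with e | e | e
    exacts [e.symm, absurd e.symm hji', absurd e hik']
  obtain ⟨p, hm⟩ : ∃ p, p ∈ openSegment ℝ (contactEdge A B i s).1 (contactEdge A B i s).2 :=
    ⟨_, 1 / 2, 1 / 2, by norm_num, by norm_num, by norm_num, rfl⟩
  have hm' := hm
  rw [hxx] at hm'
  rw [mem_openSegment_contactEdge hAB (h.lt A hA) (h.lt B hB) hik hji hjk hl] at hm
  rw [mem_openSegment_contactEdge hAB' (h.lt A' hA') (h.lt B' hB') hik hji hjk hl] at hm'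
  have b1 := contactEdge_mem_boxes hAB (h.lt A hA) (h.lt B hB) hik hm.1 hm.2.1 (fun l h1 h2 => by
    rcases hl l with rfl | rfl | rfl
    · exact absurd rfl h1
    · exact ⟨max_le hm.2.2.1.1.le hm.2.2.1.2.le, le_min hm.2.2.2.1.le hm.2.2.2.2.le⟩
    · exact absurd rfl h2)
  have b2 := contactEdge_mem_boxes hAB' (h.lt A' hA') (h.lt B' hB') hik hm'.1 hm'.2.1
    (fun l h1 h2 => by
    rcases hl l with rfl | rfl | rfl
    · exact absurd rfl h1
    · exact ⟨max_le hm'.2.2.1.1.le hm'.2.2.1.2.le, le_min hm'.2.2.2.1.le hm'.2.2.2.2.le⟩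
    · exact absurd rfl h2)
  obtain ⟨rfl, rfl⟩ := h.eq_of_stacked hA hB hA' hB' hAB hAB' b1.1 b1.2 b2.1 b2.2
  have hss : side (meetBox A' B') i s = side (meetBox A' B') i s' := hm.1.symm.trans hm'.1
  have hlt' : (meetBox A' B').1 i < (meetBox A' B').2 i := by
    rw [meetBox_apply_fst, meetBox_apply_snd, max_lt_iff, lt_min_iff, lt_min_iff]
    exact ⟨⟨h.lt _ hA i, (hAB.2 i hik).1⟩, (hAB.2 i hik).2, h.lt _ hB i⟩
  cases s <;> cases s' <;> first | rfl | (simp only [side_false, side_true] at hss; linarith)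

end IsBrickComplex

/-! ### Euler characteristics of grid complexes -/

/-- The integer `1` or `0`, according to whether `p` holds. -/
noncomputable def ind (p : Prop) : ℤ := open Classical in if p then 1 else 0

theorem ind_pos {p : Prop} (h : p) : ind p = 1 := if_pos h

theorem ind_neg {p : Prop} (h : ¬ p) : ind p = 0 := if_neg h

@[simp] theorem ind_true : ind True = 1 := ind_pos trivial

@[simp] theorem ind_false : ind False = 0 := ind_neg not_false

theorem sum_ind {α : Type*} (X : Finset α) (p : α → Prop) [DecidablePred p] :
    ∑ a ∈ X, ind (p a) = (X.filter p).card := by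
  rw [← Finset.sum_boole]
  refine Finset.sum_congr rfl fun a _ => ?_
  by_cases h : p a
  · rw [ind_pos h, if_pos h]
  · rw [ind_neg h, if_neg h]

/-- The cells of the one-dimensional grid with vertex set `G`: the vertices and the intervals
between consecutive vertices. -/
noncomputable def lineCells (G : Finset ℝ) : Finset (ℝ × ℝ) :=
  open Classical in (G ×ˢ G).filter fun c => c.1 ≤ c.2 ∧ ∀ t ∈ G, ¬ (c.1 < t ∧ t < c.2)

/-- The sign with which a cell of a one-dimensional grid enters the Euler characteristic. -/
noncomputable def lineSign (c : ℝ × ℝ) : ℤ := if c.1 = c.2 then 1 else -1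

/-- The centre of a cell of a one-dimensional grid. -/
noncomputable def mid (c : ℝ × ℝ) : ℝ := (c.1 + c.2) / 2

theorem mem_lineCells {G : Finset ℝ} {c : ℝ × ℝ} : c ∈ lineCells G ↔
    c.1 ∈ G ∧ c.2 ∈ G ∧ c.1 ≤ c.2 ∧ ∀ t ∈ G, ¬ (c.1 < t ∧ t < c.2) := by
  simp [lineCells, and_assoc]

theorem le_mid_iff {G : Finset ℝ} {c : ℝ × ℝ} (hc : c ∈ lineCells G) {a : ℝ} (ha : a ∈ G) :
    a ≤ mid c ↔ a ≤ c.1 := by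
  obtain ⟨-, -, h1, h2⟩ := mem_lineCells.1 hc
  have := h2 a ha
  unfold mid
  constructor
  · intro h
    by_contra! h3
    exact this ⟨h3, by linarith⟩
  · intro h; linarith

theorem mid_le_iff {G : Finset ℝ} {c : ℝ × ℝ} (hc : c ∈ lineCells G) {b : ℝ} (hb : b ∈ G) :
    mid c ≤ b ↔ c.2 ≤ b := by
  obtain ⟨-, -, h1, h2⟩ := mem_lineCells.1 hc
  have := h2 b hb
  unfold mid
  constructor
  · intro h
    by_contra! h3
    exact this ⟨by linarith, h3⟩
  · intro h; linarith

/-- The Euler characteristic of a closed interval is `1`: each vertex but the last one is the left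
end of exactly one edge. -/
theorem sum_lineSign_closed {G : Finset ℝ} {a b : ℝ} (ha : a ∈ G) (hb : b ∈ G) (hab : a ≤ b) :
    ∑ c ∈ lineCells G, lineSign c * ind (a ≤ mid c ∧ mid c ≤ b) = 1 := by
  classical
  have h0 : ∑ c ∈ lineCells G, lineSign c * ind (a ≤ mid c ∧ mid c ≤ b) =
      ∑ c ∈ (lineCells G).filter (fun c => a ≤ c.1 ∧ c.2 ≤ b), lineSign c := by
    rw [Finset.sum_filter]
    refine Finset.sum_congr rfl fun c hc => ?_
    rw [le_mid_iff hc ha, mid_le_iff hc hb, ind]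
    split_ifs <;> simp
  rw [h0, ← Finset.sum_filter_add_sum_filter_not _ (fun c => c.1 = c.2)]
  set X := (lineCells G).filter (fun c => a ≤ c.1 ∧ c.2 ≤ b) with hX
  have mX : ∀ c, c ∈ X ↔ c ∈ lineCells G ∧ a ≤ c.1 ∧ c.2 ≤ b := fun c => by simp [hX]
  have h1 : ∑ c ∈ X.filter (fun c => c.1 = c.2), lineSign c = (X.filter (fun c => c.1 = c.2)).card := by
    rw [Finset.card_eq_sum_ones, Nat.cast_sum]
    refine Finset.sum_congr rfl fun c hc => ?_
    simp [lineSign, (Finset.mem_filter.1 hc).2]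
  have h2 : ∑ c ∈ X.filter (fun c => ¬ c.1 = c.2), lineSign c =
      -((X.filter (fun c => ¬ c.1 = c.2)).card : ℤ) := by
    rw [Finset.card_eq_sum_ones, Nat.cast_sum, ← Finset.sum_neg_distrib]
    refine Finset.sum_congr rfl fun c hc => ?_
    simp [lineSign, (Finset.mem_filter.1 hc).2]
  have c1 : (X.filter (fun c => c.1 = c.2)).card = (G.filter fun t => a ≤ t ∧ t ≤ b).card := by
    refine Finset.card_bij (fun c _ => c.1) ?_ ?_ ?_
    · intro c hc
      obtain ⟨hc, he⟩ := Finset.mem_filter.1 hc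
      obtain ⟨hc, h3, h4⟩ := (mX c).1 hc
      exact Finset.mem_filter.2 ⟨(mem_lineCells.1 hc).1, h3, he ▸ h4⟩
    · intro c hc c' hc' h
      have e1 := (Finset.mem_filter.1 hc).2
      have e2 := (Finset.mem_filter.1 hc').2
      exact Prod.ext h (by rw [← e1, ← e2, h])
    · intro t ht
      obtain ⟨ht, h3, h4⟩ := Finset.mem_filter.1 ht
      refine ⟨(t, t), Finset.mem_filter.2 ⟨(mX _).2 ⟨mem_lineCells.2 ⟨ht, ht, le_rfl, ?_⟩, h3, h4⟩, rfl⟩, rfl⟩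
      rintro s - ⟨h5, h6⟩
      exact lt_asymm h5 h6
  have c2 : (X.filter (fun c => ¬ c.1 = c.2)).card = (G.filter fun t => a ≤ t ∧ t < b).card := by
    refine Finset.card_bij (fun c _ => c.1) ?_ ?_ ?_
    · intro c hc
      obtain ⟨hc, he⟩ := Finset.mem_filter.1 hc
      obtain ⟨hc, h3, h4⟩ := (mX c).1 hc
      have hc := mem_lineCells.1 hc
      exact Finset.mem_filter.2 ⟨hc.1, h3, (lt_of_le_of_ne hc.2.2.1 he).trans_le h4⟩
    · intro c hc c' hc' h
      obtain ⟨hc, he⟩ := Finset.mem_filter.1 hc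
      obtain ⟨hc', he'⟩ := Finset.mem_filter.1 hc'
      have hc := mem_lineCells.1 ((mX c).1 hc).1
      have hc' := mem_lineCells.1 ((mX c').1 hc').1
      have l1 := lt_of_le_of_ne hc.2.2.1 he
      have l2 := lt_of_le_of_ne hc'.2.2.1 he'
      refine Prod.ext h (le_antisymm (not_lt.1 fun h5 => ?_) (not_lt.1 fun h5 => ?_))
      · exact hc.2.2.2 _ hc'.2.1 ⟨h ▸ l2, h5⟩
      · exact hc'.2.2.2 _ hc.2.1 ⟨h ▸ l1, h5⟩
    · intro t ht
      obtain ⟨ht, h3, h4⟩ := Finset.mem_filter.1 ht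
      have hne : (G.filter fun s => t < s).Nonempty := ⟨b, Finset.mem_filter.2 ⟨hb, h4⟩⟩
      have hm := Finset.mem_filter.1 (Finset.min'_mem _ hne)
      set m := (G.filter fun s => t < s).min' hne with hm'
      refine ⟨(t, m), Finset.mem_filter.2 ⟨(mX _).2 ⟨mem_lineCells.2 ⟨ht, hm.1, hm.2.le, ?_⟩,
        h3, ?_⟩, hm.2.ne⟩, rfl⟩
      · rintro s hs ⟨h5, h6⟩
        exact absurd (Finset.min'_le _ s (Finset.mem_filter.2 ⟨hs, h5⟩)) (not_le.2 h6)
      · exact Finset.min'_le _ b (Finset.mem_filter.2 ⟨hb, h4⟩)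
  have c3 : G.filter (fun t => a ≤ t ∧ t ≤ b) = insert b (G.filter fun t => a ≤ t ∧ t < b) := by
    ext t
    simp only [Finset.mem_filter, Finset.mem_insert]
    constructor
    · rintro ⟨h3, h4, h5⟩
      rcases h5.lt_or_eq with h6 | h6
      exacts [Or.inr ⟨h3, h4, h6⟩, Or.inl h6]
    · rintro (rfl | ⟨h3, h4, h5⟩)
      exacts [⟨hb, hab, le_rfl⟩, ⟨h3, h4, h5.le⟩]
  rw [h1, h2, c1, c2, c3, Finset.card_insert_of_notMem (by simp)]
  push_cast
  ring

theorem sum_lineSign_point {G : Finset ℝ} {a : ℝ} (ha : a ∈ G) :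
    ∑ c ∈ lineCells G, lineSign c * (ind (mid c = a)) = 1 := by
  have := sum_lineSign_closed ha ha le_rfl
  simpa only [← le_antisymm_iff, eq_comm (a := a)] using this

/-- The Euler characteristic (with compact supports) of an open interval is `-1`. -/
theorem sum_lineSign_open {G : Finset ℝ} {a b : ℝ} (ha : a ∈ G) (hb : b ∈ G) (hab : a < b) :
    ∑ c ∈ lineCells G, lineSign c * ind (a < mid c ∧ mid c < b) = -1 := by
  have : ∑ c ∈ lineCells G, lineSign c * ind (a < mid c ∧ mid c < b) =
      ∑ c ∈ lineCells G, lineSign c * ind (a ≤ mid c ∧ mid c ≤ b) -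
      ∑ c ∈ lineCells G, lineSign c * (ind (mid c = a)) -
      ∑ c ∈ lineCells G, lineSign c * (ind (mid c = b)) := by
    rw [← Finset.sum_sub_distrib, ← Finset.sum_sub_distrib]
    refine Finset.sum_congr rfl fun c _ => ?_
    rw [← mul_sub, ← mul_sub]
    congr 1
    rcases lt_trichotomy (mid c) a with h1 | h1 | h1
    · rw [ind_neg (by intro h; linarith [h.1]), ind_neg (by intro h; linarith [h.1]),
        ind_neg h1.ne, ind_neg (h1.trans hab).ne]; rfl
    · rw [h1]; simp [hab.le, hab.ne]
    · rcases lt_trichotomy (mid c) b with h2 | h2 | h2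
      · rw [ind_pos ⟨h1, h2⟩, ind_pos ⟨h1.le, h2.le⟩, ind_neg h1.ne', ind_neg h2.ne]; rfl
      · rw [h2]; simp [hab.le, hab.ne']
      · rw [ind_neg (by intro h; linarith [h.2]), ind_neg (by intro h; linarith [h.2]),
          ind_neg h1.ne', ind_neg h2.ne']; rfl
  rw [this, sum_lineSign_closed ha hb hab.le, sum_lineSign_point ha, sum_lineSign_point hb]
  norm_num

/-- The centre of the product of three one-dimensional cells. -/
noncomputable def centre (x : Fin 3 → ℝ × ℝ) : Pt := fun i => mid (x i)

/-- The Euler characteristic of the set of those cells of the grid `G` whose centres are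
in `S`. -/
noncomputable def eulerSum (G : Fin 3 → Finset ℝ) (S : Set Pt) : ℤ :=
  ∑ x ∈ Fintype.piFinset fun i => lineCells (G i),
    (∏ i, lineSign (x i)) * (ind (centre x ∈ S))

theorem eulerSum_pi (G : Fin 3 → Finset ℝ) (Φ : Fin 3 → ℝ → Prop) :
    eulerSum G {q | ∀ i, Φ i (q i)} =
      ∏ i, ∑ c ∈ lineCells (G i), lineSign c * (ind (Φ i (mid c))) := by
  rw [Finset.prod_univ_sum, eulerSum]
  refine Finset.sum_congr rfl fun x _ => ?_
  rw [Finset.prod_mul_distrib]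
  congr 1
  by_cases h : ∀ i, Φ i (mid (x i))
  · rw [ind_pos (show centre x ∈ _ from h), Finset.prod_eq_one fun i _ => ind_pos (h i)]
  · obtain ⟨i, hi⟩ := not_forall.1 h
    rw [ind_neg (show ¬ centre x ∈ _ from h), Finset.prod_eq_zero (Finset.mem_univ i) (ind_neg hi)]

/-- The grid cell that is the product of three one-dimensional cells. -/
def cellOf (x : Fin 3 → ℝ × ℝ) : Pt × Pt := (fun i => (x i).1, fun i => (x i).2)

theorem isGridCell_iff {G : Fin 3 → Finset ℝ} {c : Pt × Pt} :
    IsGridCell G c ↔ ∀ i, (c.1 i, c.2 i) ∈ lineCells (G i) := by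
  simp only [IsGridCell, mem_lineCells]

theorem isGridCell_cellOf {G : Fin 3 → Finset ℝ} {x : Fin 3 → ℝ × ℝ} :
    IsGridCell G (cellOf x) ↔ x ∈ Fintype.piFinset fun i => lineCells (G i) := by
  rw [isGridCell_iff, Fintype.mem_piFinset]; rfl

theorem centre_mem_cellSet {G : Fin 3 → Finset ℝ} {x : Fin 3 → ℝ × ℝ}
    (hx : x ∈ Fintype.piFinset fun i => lineCells (G i)) : centre x ∈ cellSet (cellOf x) := by
  intro i
  have := mem_lineCells.1 (Fintype.mem_piFinset.1 hx i)
  simp only [cellOf, centre, mid]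
  rcases this.2.2.1.lt_or_eq with h | h
  · right; constructor <;> linarith
  · left; exact ⟨h, by linarith⟩

/-- Distinct cells of a grid are disjoint. -/
theorem gridCell_unique {G : Fin 3 → Finset ℝ} {c c' : Pt × Pt} (hc : IsGridCell G c)
    (hc' : IsGridCell G c') {p : Pt} (hp : p ∈ cellSet c) (hp' : p ∈ cellSet c') : c = c' := by
  have : ∀ i, c.1 i = c'.1 i ∧ c.2 i = c'.2 i := by
    intro i
    obtain ⟨a1, a2, a3, a4⟩ := hc i
    obtain ⟨b1, b2, b3, b4⟩ := hc' i
    rcases hp i with ⟨h1, h2⟩ | ⟨h1, h2⟩ <;> rcases hp' i with ⟨h3, h4⟩ | ⟨h3, h4⟩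
    · exact ⟨by linarith, by linarith⟩
    · exact absurd ⟨by linarith, by linarith⟩ (b4 _ a1)
    · exact absurd ⟨by linarith, by linarith⟩ (a4 _ b1)
    · have := a4 _ b1
      have := a4 _ b2
      have := b4 _ a1
      have := b4 _ a2
      refine ⟨le_antisymm (not_lt.1 fun h => ?_) (not_lt.1 fun h => ?_),
        le_antisymm (not_lt.1 fun h => ?_) (not_lt.1 fun h => ?_)⟩
      · exact b4 _ a1 ⟨h, by linarith⟩
      · exact a4 _ b1 ⟨h, by linarith⟩
      · exact a4 _ b2 ⟨by linarith, h⟩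
      · exact b4 _ a2 ⟨by linarith, h⟩
  exact Prod.ext (funext fun i => (this i).1) (funext fun i => (this i).2)

theorem prod_lineSign {G : Fin 3 → Finset ℝ} {x : Fin 3 → ℝ × ℝ}
    (hx : x ∈ Fintype.piFinset fun i => lineCells (G i)) :
    ∏ i, lineSign (x i) = (-1) ^ cellDim (cellOf x) := by
  classical
  have : ∀ i, lineSign (x i) = if (x i).1 < (x i).2 then -1 else 1 := by
    intro i
    have := (mem_lineCells.1 (Fintype.mem_piFinset.1 hx i)).2.2.1
    rw [lineSign]
    rcases this.lt_or_eq with h | h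
    · rw [if_neg h.ne, if_pos h]
    · rw [if_pos h, if_neg h.not_lt]
  simp only [this]
  rw [Finset.prod_ite, Finset.prod_const, Finset.prod_const_one, mul_one, cellDim, cellOf,
    Set.ncard_eq_toFinset_card', Set.toFinset_ofPred]

/-- The numbers of cells of a grid complex add up to its Euler characteristic. -/
theorem cellCount_alternating {G : Fin 3 → Finset ℝ} {S : Set Pt} (hS : IsGridComplex G S) :
    (cellCount G S 0 : ℤ) - cellCount G S 1 + cellCount G S 2 - cellCount G S 3 =
      eulerSum G S := by
  classical
  set X := (Fintype.piFinset fun i => lineCells (G i)).filter fun x => centre x ∈ S with hX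
  have hcount : ∀ d, cellCount G S d = (X.filter fun x => cellDim (cellOf x) = d).card := by
    intro d
    rw [← Set.ncard_coe_finset, cellCount]
    symm
    refine Set.ncard_congr (fun x _ => cellOf x) ?_ ?_ ?_
    · intro x hx
      obtain ⟨hx, hd⟩ := Finset.mem_filter.1 (Finset.mem_coe.1 hx)
      obtain ⟨hx, hxS⟩ := Finset.mem_filter.1 hx
      refine ⟨isGridCell_cellOf.2 hx, hd, ?_⟩
      obtain ⟨c, hc, hpc, hcS⟩ := hS _ hxS
      rwa [gridCell_unique (isGridCell_cellOf.2 hx) hc (centre_mem_cellSet hx) hpc]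
    · intro x y _ _ hxy
      rw [cellOf, cellOf, Prod.mk.injEq] at hxy
      exact funext fun i => Prod.ext (congrFun hxy.1 i) (congrFun hxy.2 i)
    · rintro c ⟨hc, hd, hcS⟩
      have hx : (fun i => (c.1 i, c.2 i)) ∈ Fintype.piFinset fun i => lineCells (G i) :=
        Fintype.mem_piFinset.2 (isGridCell_iff.1 hc)
      exact ⟨fun i => (c.1 i, c.2 i), Finset.mem_coe.2 (Finset.mem_filter.2
        ⟨Finset.mem_filter.2 ⟨hx, hcS (centre_mem_cellSet hx)⟩, hd⟩), rfl⟩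
  have hsum : eulerSum G S = ∑ x ∈ X, (-1 : ℤ) ^ cellDim (cellOf x) := by
    rw [eulerSum, hX, Finset.sum_filter]
    refine Finset.sum_congr rfl fun x hx => ?_
    rw [prod_lineSign hx, ind]
    split_ifs <;> simp
  have hle : ∀ x ∈ X, cellDim (cellOf x) ∈ Finset.range 4 := by
    intro x _
    rw [Finset.mem_range, Nat.lt_succ_iff, cellDim]
    exact (Set.ncard_le_card _).trans (by simp)
  rw [hsum, ← Finset.sum_fiberwise_of_maps_to hle]
  have : ∀ d, ∑ x ∈ X.filter (fun x => cellDim (cellOf x) = d), (-1 : ℤ) ^ cellDim (cellOf x) =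
      (cellCount G S d : ℤ) * (-1) ^ d := by
    intro d
    rw [hcount, Finset.sum_congr rfl (g := fun _ => (-1 : ℤ) ^ d)
      (fun x hx => by rw [(Finset.mem_filter.1 hx).2]), Finset.sum_const, nsmul_eq_mul]
  simp only [this, Finset.sum_range_succ, Finset.sum_range_zero]
  ring

/-- The frontier of a closed set has empty interior, so that it contains no cell of full
dimension. -/
theorem cellCount_three_frontier {G : Fin 3 → Finset ℝ} {P : Set Pt} (hP : IsClosed P) :
    cellCount G (frontier P) 3 = 0 := by
  have hfin : {c | IsGridCell G c ∧ cellDim c = 3 ∧ cellSet c ⊆ frontier P}.Finite := by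
    refine Set.Finite.subset (Set.Finite.image cellOf
      (Fintype.piFinset fun i => lineCells (G i)).finite_toSet) ?_
    rintro c ⟨hc, -, -⟩
    exact ⟨fun i => (c.1 i, c.2 i), Fintype.mem_piFinset.2 (isGridCell_iff.1 hc), rfl⟩
  rw [cellCount, Set.ncard_eq_zero hfin]
  rw [Set.eq_empty_iff_forall_notMem]
  rintro c ⟨hc, hd, hcP⟩
  have hall : ∀ i, c.1 i < c.2 i := by
    have : {i | c.1 i < c.2 i} = Set.univ := by
      apply Set.eq_of_subset_of_ncard_le (Set.subset_univ _)
      rw [← cellDim, hd, Set.ncard_univ]; simp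
    intro i
    have := this.ge (Set.mem_univ i)
    exact this
  have hopen : IsOpen (cellSet c) := by
    have : cellSet c = Set.univ.pi fun i => Ioo (c.1 i) (c.2 i) := by
      ext q
      simp only [cellSet, mem_ofPred_eq, Set.mem_pi, Set.mem_univ, true_imp_iff, mem_Ioo]
      exact forall_congr' fun i => ⟨fun h => h.resolve_left fun h' => (hall i).ne h'.1, Or.inr⟩
    rw [this]
    exact isOpen_set_pi Set.finite_univ fun _ _ => isOpen_Ioo
  have hx : (fun i => (c.1 i, c.2 i)) ∈ Fintype.piFinset fun i => lineCells (G i) :=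
    Fintype.mem_piFinset.2 (isGridCell_iff.1 hc)
  have h1 := interior_maximal hcP hopen (centre_mem_cellSet hx)
  rw [interior_frontier hP] at h1
  exact h1

/-! ### The genus of a brick complex -/

/-- The Euler characteristic is additive in the indicator function. -/
theorem eulerSum_linear {α β : Type*} (G : Fin 3 → Finset ℝ) {S : Set Pt} (X : Finset α)
    (f : α → Set Pt) (Y : Finset β) (g : β → Set Pt) (ε : ℤ)
    (h : ∀ q, (ind (q ∈ S)) =
      ∑ a ∈ X, (ind (q ∈ f a)) + ε * ∑ b ∈ Y, (ind (q ∈ g b))) :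
    eulerSum G S = ∑ a ∈ X, eulerSum G (f a) + ε * ∑ b ∈ Y, eulerSum G (g b) := by
  simp only [eulerSum]
  rw [Finset.sum_comm, Finset.sum_comm (s := Y), Finset.mul_sum, ← Finset.sum_add_distrib]
  refine Finset.sum_congr rfl fun x _ => ?_
  rw [h, mul_add, Finset.mul_sum, ← Finset.mul_sum, ← Finset.mul_sum, mul_left_comm]

theorem eulerSum_box {G : Fin 3 → Finset ℝ} {A : Pt × Pt} (h1 : ∀ i, A.1 i ∈ G i)
    (h2 : ∀ i, A.2 i ∈ G i) (h : ∀ i, A.1 i ≤ A.2 i) : eulerSum G (Icc A.1 A.2) = 1 := by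
  have : Icc A.1 A.2 = {q : Pt | ∀ i, A.1 i ≤ q i ∧ q i ≤ A.2 i} := by
    ext q; exact mem_box
  rw [this, eulerSum_pi G fun i x => A.1 i ≤ x ∧ x ≤ A.2 i]
  exact Finset.prod_eq_one fun i _ => sum_lineSign_closed (h1 i) (h2 i) (h i)

theorem eulerSum_openBox {G : Fin 3 → Finset ℝ} {A : Pt × Pt} (h1 : ∀ i, A.1 i ∈ G i)
    (h2 : ∀ i, A.2 i ∈ G i) (h : ∀ i, A.1 i < A.2 i) :
    eulerSum G {q : Pt | ∀ i, A.1 i < q i ∧ q i < A.2 i} = -1 := by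
  rw [eulerSum_pi G fun i x => A.1 i < x ∧ x < A.2 i]
  rw [Finset.prod_congr rfl fun i _ => sum_lineSign_open (h1 i) (h2 i) (h i)]
  simp

/-- The relative interior of the contact rectangle of `A` and `B`. -/
def openContact (k : Fin 3) (A B : Pt × Pt) : Set Pt :=
  {q | ∀ i, if i = k then q i = A.2 k else (meetBox A B).1 i < q i ∧ q i < (meetBox A B).2 i}

theorem meetBox_lt {k : Fin 3} {A B : Pt × Pt} (hAB : Stacked k A B) {i : Fin 3} (hik : i ≠ k)
    (hA : A.1 i < A.2 i) (hB : B.1 i < B.2 i) : (meetBox A B).1 i < (meetBox A B).2 i := by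
  rw [meetBox_apply_fst, meetBox_apply_snd, max_lt_iff, lt_min_iff, lt_min_iff]
  exact ⟨⟨hA, (hAB.2 i hik).1⟩, (hAB.2 i hik).2, hB⟩

theorem eulerSum_openContact {G : Fin 3 → Finset ℝ} {k : Fin 3} {A B : Pt × Pt}
    (hAB : Stacked k A B) (hA : ∀ i, A.1 i < A.2 i) (hB : ∀ i, B.1 i < B.2 i)
    (gA : ∀ i, A.1 i ∈ G i ∧ A.2 i ∈ G i) (gB : ∀ i, B.1 i ∈ G i ∧ B.2 i ∈ G i) :
    eulerSum G (openContact k A B) = 1 := by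
  obtain ⟨i, hik⟩ : ∃ i, i ≠ k := exists_ne k
  obtain ⟨j, hji, hjk, hl⟩ := exists_third hik
  have key : ∀ l, l ≠ k → ∑ c ∈ lineCells (G l), lineSign c * ind (if l = k then mid c = A.2 k else
        (meetBox A B).1 l < mid c ∧ mid c < (meetBox A B).2 l) = -1 := by
    intro l hlk
    rw [← sum_lineSign_open (G := G l) (a := (meetBox A B).1 l) (b := (meetBox A B).2 l) ?_ ?_
      (meetBox_lt hAB hlk (hA l) (hB l))]
    · simp only [hlk, if_false]
    · rw [meetBox_apply_fst]; rcases max_choice (A.1 l) (B.1 l) with e | e <;> rw [e]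
      exacts [(gA l).1, (gB l).1]
    · rw [meetBox_apply_snd]; rcases min_choice (A.2 l) (B.2 l) with e | e <;> rw [e]
      exacts [(gA l).2, (gB l).2]
  have key' : ∑ c ∈ lineCells (G k), lineSign c * ind (if k = k then mid c = A.2 k else
        (meetBox A B).1 k < mid c ∧ mid c < (meetBox A B).2 k) = 1 := by
    simpa using sum_lineSign_point (gA k).2
  have huniv : (Finset.univ : Finset (Fin 3)) = {i, j, k} := by
    ext l; simp [hl l]
  rw [openContact, eulerSum_pi G fun i x => if i = k then x = A.2 k else
    (meetBox A B).1 i < x ∧ x < (meetBox A B).2 i, huniv,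
    Finset.prod_insert (by simp [hji.symm, hik]), Finset.prod_insert (by simp [hjk]),
    Finset.prod_singleton, key i hik, key j hjk, key']
  norm_num

theorem mem_openContact {k : Fin 3} {A B : Pt × Pt} {q : Pt} :
    q ∈ openContact k A B ↔ q k = A.2 k ∧
      ∀ i, i ≠ k → (A.1 i < q i ∧ B.1 i < q i) ∧ q i < A.2 i ∧ q i < B.2 i := by
  simp only [openContact, mem_ofPred_eq, meetBox_apply_fst, meetBox_apply_snd, max_lt_iff,
    lt_min_iff]
  constructor
  · intro H
    refine ⟨by simpa using H k, fun i hi => by simpa [hi] using H i⟩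
  · rintro ⟨h1, h2⟩ i
    by_cases hi : i = k
    · subst hi; simpa using h1
    · simpa [hi] using h2 i hi

namespace IsBrickComplex

variable {P : Set Pt} {k : Fin 3} {𝓑 : Finset (Pt × Pt)}

open Classical in
/-- The pairs of bricks stacked on one another. -/
noncomputable def contacts (𝓑 : Finset (Pt × Pt)) (k : Fin 3) : Finset ((Pt × Pt) × (Pt × Pt)) :=
  (𝓑 ×ˢ 𝓑).filter fun x => Stacked k x.1 x.2

theorem mem_contacts {x : (Pt × Pt) × (Pt × Pt)} :
    x ∈ contacts 𝓑 k ↔ (x.1 ∈ 𝓑 ∧ x.2 ∈ 𝓑) ∧ Stacked k x.1 x.2 := by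
  simp [contacts]

theorem interior_box (A : Pt × Pt) :
    interior (Icc A.1 A.2) = {q : Pt | ∀ i, A.1 i < q i ∧ q i < A.2 i} := by
  rw [← Set.pi_univ_Icc, interior_pi_set Set.finite_univ]
  ext q
  simp [interior_Icc]

theorem mem_interior_of_single (h : IsBrickComplex P k 𝓑) {A : Pt × Pt} (hA : A ∈ 𝓑) {p : Pt}
    (pA : p ∈ Icc A.1 A.2) (hs : ∀ B ∈ 𝓑, p ∈ Icc B.1 B.2 → B = A) :
    p ∈ interior P ↔ ∀ i, A.1 i < p i ∧ p i < A.2 i := by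
  have : p ∈ interior P ↔ p ∈ interior (Icc A.1 A.2) := by
    rw [mem_interior_iff_mem_nhds, mem_interior_iff_mem_nhds]
    exact Filter.eventually_congr (h.eventually_mem_single hA pA hs)
  rw [this, interior_box]; rfl

/-- At a contact of two bricks, exactly the points in the relative interior of the contact rectangle
are inner points. -/
theorem mem_interior_of_stacked (h : IsBrickComplex P k 𝓑) {A B : Pt × Pt} (hA : A ∈ 𝓑)
    (hB : B ∈ 𝓑) (hAB : Stacked k A B) {p : Pt} (pA : p ∈ Icc A.1 A.2) (pB : p ∈ Icc B.1 B.2) :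
    p ∈ interior P ↔ p ∈ openContact k A B := by
  have ev := h.eventually_mem_stacked hA hB hAB pA pB
  have hpk := hAB.eq_of_mem pA pB
  have lA := h.lt A hA k
  have lB := h.lt B hB k
  have e := hAB.1
  rw [mem_interior_iff_mem_nhds, mem_openContact]
  constructor
  · intro hP
    obtain ⟨δ, hδ, H⟩ := eventually_nhds_cube.1 (ev.and hP)
    refine ⟨hpk, fun i hik => ?_⟩
    have key : ∀ a c : ℝ, |a| ≤ 1 → |c| ≤ 1 → c ≠ 0 →
        (c < 0 → A.1 i ≤ p i + a * (δ / 2) ∧ p i + a * (δ / 2) ≤ A.2 i) ∧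
        (0 < c → B.1 i ≤ p i + a * (δ / 2) ∧ p i + a * (δ / 2) ≤ B.2 i) := by
      intro a c ha hc hc0
      have h2 : |δ / 2| = δ / 2 := abs_of_pos (by linarith)
      set q : Pt := Function.update (Function.update p k (p k + c * (δ / 2))) i
        (p i + a * (δ / 2)) with hq
      have qi : q i = p i + a * (δ / 2) := by simp [hq]
      have qk : q k = p k + c * (δ / 2) := by simp [hq, hik.symm]
      have := H q (fun l => by
        by_cases hli : l = i
        · subst hli; rw [qi, add_sub_cancel_left, abs_mul, h2]; nlinarith
        by_cases hlk : l = k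
        · subst hlk; rw [qk, add_sub_cancel_left, abs_mul, h2]; nlinarith
        · simp [hq, hli, hlk, hδ])
      have hmem := this.1.1 this.2
      constructor
      · intro hneg
        rcases hmem with hm | hm
        · rw [← qi]; exact mem_box.1 hm i
        · have := hm.1 k; rw [qk] at this; nlinarith
      · intro hpos
        rcases hmem with hm | hm
        · have := hm.2 k; rw [qk] at this; nlinarith
        · rw [← qi]; exact mem_box.1 hm i
    have one : |(1 : ℝ)| ≤ 1 := by norm_num
    have mone : |(-1 : ℝ)| ≤ 1 := by norm_num
    have k1 := (key (-1) (-1) mone mone (by norm_num)).1 (by norm_num)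
    have k2 := (key (-1) 1 mone one (by norm_num)).2 (by norm_num)
    have k3 := (key 1 (-1) one mone (by norm_num)).1 (by norm_num)
    have k4 := (key 1 1 one one (by norm_num)).2 (by norm_num)
    exact ⟨⟨by linarith, by linarith⟩, by linarith, by linarith⟩
  · rintro ⟨-, H⟩
    have ev2 : ∀ᶠ q in 𝓝 p, ∀ i, i ≠ k → (A.1 i < q i ∧ B.1 i < q i) ∧ q i < A.2 i ∧ q i < B.2 i := by
      rw [Filter.eventually_all]
      intro i
      by_cases hi : i = k
      · exact Filter.Eventually.of_forall fun _ h => absurd hi h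
      · obtain ⟨⟨h1, h2⟩, h3, h4⟩ := H i hi
        filter_upwards [eventually_lt_apply h1, eventually_lt_apply h2, eventually_apply_lt h3,
          eventually_apply_lt h4] with q a b c d _ using ⟨⟨a, b⟩, c, d⟩
    filter_upwards [ev, ev2, eventually_lt_apply (p := p) (l := k) (a := A.1 k) (by linarith),
      eventually_apply_lt (p := p) (l := k) (a := B.2 k) (by linarith)] with q e1 e2 e3 e4
    rw [e1]
    rcases le_total (q k) (p k) with hq | hq
    · left
      refine mem_box.2 fun i => ?_
      by_cases hi : i = k
      · subst hi; exact ⟨e3.le, by linarith⟩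
      · exact ⟨(e2 i hi).1.1.le, (e2 i hi).2.1.le⟩
    · right
      refine mem_box.2 fun i => ?_
      by_cases hi : i = k
      · subst hi; exact ⟨by linarith, e4.le⟩
      · exact ⟨(e2 i hi).1.2.le, (e2 i hi).2.2.le⟩

theorem openContact_subset (h : IsBrickComplex P k 𝓑) {A B : Pt × Pt} (hA : A ∈ 𝓑)
    (hB : B ∈ 𝓑) (hAB : Stacked k A B) {q : Pt} (hq : q ∈ openContact k A B) :
    q ∈ Icc A.1 A.2 ∧ q ∈ Icc B.1 B.2 := by
  rw [mem_openContact] at hq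
  have lA := h.lt A hA k
  have lB := h.lt B hB k
  have e := hAB.1
  constructor <;> refine mem_box.2 fun i => ?_ <;> by_cases hi : i = k
  · subst hi; exact ⟨by linarith, by linarith⟩
  · exact ⟨(hq.2 i hi).1.1.le, (hq.2 i hi).2.1.le⟩
  · subst hi; exact ⟨by linarith, by linarith⟩
  · exact ⟨(hq.2 i hi).1.2.le, (hq.2 i hi).2.2.le⟩

/-- Inclusion and exclusion for the bricks; no three of them share a point. -/
theorem indicator_eq (h : IsBrickComplex P k 𝓑) (q : Pt) :
    (ind (q ∈ P)) = ∑ A ∈ 𝓑, (ind (q ∈ Icc A.1 A.2)) +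
      (-1) * ∑ x ∈ contacts 𝓑 k, (ind (q ∈ Icc (meetBox x.1 x.2).1 (meetBox x.1 x.2).2))
      := by
  classical
  have hm : ∀ x : (Pt × Pt) × (Pt × Pt), q ∈ Icc (meetBox x.1 x.2).1 (meetBox x.1 x.2).2 ↔
      q ∈ Icc x.1.1 x.1.2 ∧ q ∈ Icc x.2.1 x.2.2 := by
    intro x
    rw [meetBox, ← Icc_inter_Icc]; rfl
  simp only [hm]
  rw [sum_ind, sum_ind]
  by_cases hq : q ∈ P
  · rw [ind_pos hq]
    rcases h.single_or_stacked hq with ⟨A, hA, pA, hs⟩ | ⟨A, hA, B, hB, hAB, pA, pB⟩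
    · have e1 : 𝓑.filter (fun A => q ∈ Icc A.1 A.2) = {A} := by
        ext C; simp only [Finset.mem_filter, Finset.mem_singleton]
        exact ⟨fun hC => hs C hC.1 hC.2, by rintro rfl; exact ⟨hA, pA⟩⟩
      have e2 : (contacts 𝓑 k).filter (fun x => q ∈ Icc x.1.1 x.1.2 ∧ q ∈ Icc x.2.1 x.2.2) = ∅ := by
        rw [Finset.filter_eq_empty_iff]
        rintro ⟨C, D⟩ hx ⟨h1, h2⟩
        obtain ⟨⟨hC, hD⟩, hCD⟩ := mem_contacts.1 hx
        exact h.stacked_ne hC hCD ((hs C hC h1).trans (hs D hD h2).symm)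
      rw [e1, e2]; simp
    · have e1 : 𝓑.filter (fun A => q ∈ Icc A.1 A.2) = {A, B} := by
        ext C; simp only [Finset.mem_filter, Finset.mem_singleton, Finset.mem_insert]
        exact ⟨fun hC => h.stacked_unique hA hB hC.1 hAB pA pB hC.2,
          by rintro (rfl | rfl); exacts [⟨hA, pA⟩, ⟨hB, pB⟩]⟩
      have e2 : (contacts 𝓑 k).filter (fun x => q ∈ Icc x.1.1 x.1.2 ∧ q ∈ Icc x.2.1 x.2.2) =
          {(A, B)} := by
        ext ⟨C, D⟩
        simp only [Finset.mem_filter, Finset.mem_singleton, mem_contacts, Prod.mk.injEq]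
        constructor
        · rintro ⟨⟨⟨hC, hD⟩, hCD⟩, h1, h2⟩
          exact h.eq_of_stacked hA hB hC hD hAB hCD pA pB h1 h2
        · rintro ⟨rfl, rfl⟩
          exact ⟨⟨⟨hA, hB⟩, hAB⟩, pA, pB⟩
      rw [e1, e2, Finset.card_pair (h.stacked_ne hA hAB)]; simp
  · rw [ind_neg hq]
    have e1 : 𝓑.filter (fun A => q ∈ Icc A.1 A.2) = ∅ := by
      rw [Finset.filter_eq_empty_iff]
      exact fun A hA hqA => hq (h.box_subset hA hqA)
    have e2 : (contacts 𝓑 k).filter (fun x => q ∈ Icc x.1.1 x.1.2 ∧ q ∈ Icc x.2.1 x.2.2) = ∅ := by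
      rw [Finset.filter_eq_empty_iff]
      rintro ⟨C, D⟩ hx ⟨h1, h2⟩
      exact hq (h.box_subset (mem_contacts.1 hx).1.1 h1)
    rw [e1, e2]; simp

/-- The interior is the disjoint union of the open bricks and the open contact rectangles. -/
theorem indicator_interior_eq (h : IsBrickComplex P k 𝓑) (q : Pt) :
    (ind (q ∈ interior P)) =
      ∑ A ∈ 𝓑, (ind (q ∈ {q : Pt | ∀ i, A.1 i < q i ∧ q i < A.2 i})) +
      1 * ∑ x ∈ contacts 𝓑 k, (ind (q ∈ openContact k x.1 x.2)) := by
  classical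
  rw [sum_ind, sum_ind]
  have hbox : ∀ A : Pt × Pt, q ∈ {q : Pt | ∀ i, A.1 i < q i ∧ q i < A.2 i} → q ∈ Icc A.1 A.2 :=
    fun A hA => mem_box.2 fun i => ⟨(hA i).1.le, (hA i).2.le⟩
  by_cases hq : q ∈ P
  · rcases h.single_or_stacked hq with ⟨A, hA, pA, hs⟩ | ⟨A, hA, B, hB, hAB, pA, pB⟩
    · have e2 : (contacts 𝓑 k).filter (fun x => q ∈ openContact k x.1 x.2) = ∅ := by
        rw [Finset.filter_eq_empty_iff]
        rintro ⟨C, D⟩ hx hqx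
        obtain ⟨⟨hC, hD⟩, hCD⟩ := mem_contacts.1 hx
        obtain ⟨h1, h2⟩ := h.openContact_subset hC hD hCD hqx
        exact h.stacked_ne hC hCD ((hs C hC h1).trans (hs D hD h2).symm)
      rw [e2]
      by_cases hi : q ∈ interior P
      · have e1 : 𝓑.filter (fun A => q ∈ {q : Pt | ∀ i, A.1 i < q i ∧ q i < A.2 i}) = {A} := by
          ext C; simp only [Finset.mem_filter, Finset.mem_singleton]
          exact ⟨fun hC => hs C hC.1 (hbox C hC.2), by
            rintro rfl; exact ⟨hA, (h.mem_interior_of_single hA pA hs).1 hi⟩⟩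
        rw [ind_pos hi, e1]; simp
      · have e1 : 𝓑.filter (fun A => q ∈ {q : Pt | ∀ i, A.1 i < q i ∧ q i < A.2 i}) = ∅ := by
          rw [Finset.filter_eq_empty_iff]
          intro C hC hqC
          obtain rfl := hs C hC (hbox C hqC)
          exact hi ((h.mem_interior_of_single hA pA hs).2 hqC)
        rw [ind_neg hi, e1]; simp
    · have e1 : 𝓑.filter (fun A => q ∈ {q : Pt | ∀ i, A.1 i < q i ∧ q i < A.2 i}) = ∅ := by
        rw [Finset.filter_eq_empty_iff]
        intro C hC hqC
        have hk := hAB.eq_of_mem pA pB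
        have := hqC k
        have := hAB.1
        rcases h.stacked_unique hA hB hC hAB pA pB (hbox C hqC) with rfl | rfl <;> linarith
      rw [e1]
      by_cases hi : q ∈ interior P
      · have e2 : (contacts 𝓑 k).filter (fun x => q ∈ openContact k x.1 x.2) = {(A, B)} := by
          ext ⟨C, D⟩
          simp only [Finset.mem_filter, Finset.mem_singleton, mem_contacts, Prod.mk.injEq]
          constructor
          · rintro ⟨⟨⟨hC, hD⟩, hCD⟩, hqx⟩
            obtain ⟨h1, h2⟩ := h.openContact_subset hC hD hCD hqx
            exact h.eq_of_stacked hA hB hC hD hAB hCD pA pB h1 h2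
          · rintro ⟨rfl, rfl⟩
            exact ⟨⟨⟨hA, hB⟩, hAB⟩, (h.mem_interior_of_stacked hA hB hAB pA pB).1 hi⟩
        rw [ind_pos hi, e2]; simp
      · have e2 : (contacts 𝓑 k).filter (fun x => q ∈ openContact k x.1 x.2) = ∅ := by
          rw [Finset.filter_eq_empty_iff]
          rintro ⟨C, D⟩ hx hqx
          obtain ⟨⟨hC, hD⟩, hCD⟩ := mem_contacts.1 hx
          obtain ⟨h1, h2⟩ := h.openContact_subset hC hD hCD hqx
          obtain ⟨rfl, rfl⟩ := h.eq_of_stacked hA hB hC hD hAB hCD pA pB h1 h2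
          exact hi ((h.mem_interior_of_stacked hA hB hAB pA pB).2 hqx)
        rw [ind_neg hi, e2]; simp
  · rw [ind_neg fun hi => hq (interior_subset hi)]
    have e1 : 𝓑.filter (fun A => q ∈ {q : Pt | ∀ i, A.1 i < q i ∧ q i < A.2 i}) = ∅ := by
      rw [Finset.filter_eq_empty_iff]
      exact fun A hA hqA => hq (h.box_subset hA (hbox A hqA))
    have e2 : (contacts 𝓑 k).filter (fun x => q ∈ openContact k x.1 x.2) = ∅ := by
      rw [Finset.filter_eq_empty_iff]
      rintro ⟨C, D⟩ hx hqx
      obtain ⟨⟨hC, hD⟩, hCD⟩ := mem_contacts.1 hx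
      exact hq (h.box_subset hC (h.openContact_subset hC hD hCD hqx).1)
    rw [e1, e2]; simp

/-- The Euler characteristic of the boundary, by inclusion and exclusion over the bricks and the
contact rectangles. -/
theorem eulerSum_frontier (h : IsBrickComplex P k 𝓑) {G : Fin 3 → Finset ℝ}
    (hG : ∀ A ∈ 𝓑, ∀ i, A.1 i ∈ G i ∧ A.2 i ∈ G i) :
    eulerSum G (frontier P) = 2 * (𝓑.card - (contacts 𝓑 k).card) := by
  classical
  have h1 := eulerSum_linear G 𝓑 (fun A => Icc A.1 A.2) (contacts 𝓑 k)
    (fun x => Icc (meetBox x.1 x.2).1 (meetBox x.1 x.2).2) (-1) h.indicator_eq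
  have h2 := eulerSum_linear G 𝓑 (fun A => {q : Pt | ∀ i, A.1 i < q i ∧ q i < A.2 i})
    (contacts 𝓑 k) (fun x => openContact k x.1 x.2) 1 h.indicator_interior_eq
  have h3 : eulerSum G (frontier P) = eulerSum G P - eulerSum G (interior P) := by
    simp only [eulerSum]
    rw [← Finset.sum_sub_distrib]
    refine Finset.sum_congr rfl fun x _ => ?_
    rw [← mul_sub]
    congr 1
    rw [h.isCompact.isClosed.frontier_eq]
    by_cases hi : centre x ∈ interior P
    · rw [ind_neg fun H => H.2 hi, ind_pos (interior_subset hi), ind_pos hi]; rfl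
    · by_cases hp : centre x ∈ P
      · rw [ind_pos ⟨hp, hi⟩, ind_pos hp, ind_neg hi]; rfl
      · rw [ind_neg fun H => hp H.1, ind_neg hp, ind_neg hi]; rfl
  have h4 : ∀ x ∈ contacts 𝓑 k, eulerSum G (Icc (meetBox x.1 x.2).1 (meetBox x.1 x.2).2) = 1 := by
    rintro ⟨A, B⟩ hx
    obtain ⟨⟨hA, hB⟩, hAB⟩ := mem_contacts.1 hx
    refine eulerSum_box (fun i => ?_) (fun i => ?_) fun i => ?_
    · rw [meetBox_apply_fst]
      rcases max_choice (A.1 i) (B.1 i) with e | e <;> rw [e]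
      exacts [(hG A hA i).1, (hG B hB i).1]
    · rw [meetBox_apply_snd]
      rcases min_choice (A.2 i) (B.2 i) with e | e <;> rw [e]
      exacts [(hG A hA i).2, (hG B hB i).2]
    · obtain ⟨p, pA, pB, -⟩ := hAB.inter (h.lt A hA) (h.lt B hB)
      exact (max_le (pA.1 i) (pB.1 i)).trans (le_min (pA.2 i) (pB.2 i))
  have h5 : ∀ x ∈ contacts 𝓑 k, eulerSum G (openContact k x.1 x.2) = 1 := by
    rintro ⟨A, B⟩ hx
    obtain ⟨⟨hA, hB⟩, hAB⟩ := mem_contacts.1 hx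
    exact eulerSum_openContact hAB (h.lt A hA) (h.lt B hB) (hG A hA) (hG B hB)
  rw [h3, h1, h2, Finset.sum_congr rfl h4, Finset.sum_congr rfl h5,
    Finset.sum_congr rfl fun A hA =>
      eulerSum_box (fun i => (hG A hA i).1) (fun i => (hG A hA i).2) fun i => (h.lt A hA i).le,
    Finset.sum_congr rfl fun A hA =>
      eulerSum_openBox (fun i => (hG A hA i).1) (fun i => (hG A hA i).2) (h.lt A hA)]
  simp only [Finset.sum_const, nsmul_eq_mul]
  ring

/-- If `frontier P` is a grid complex and points off a frontier point `p` in the direction `i`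
lie in the interior of `P`, then the coordinate `p i` belongs to the grid. -/
theorem mem_grid {G : Fin 3 → Finset ℝ} (hG : IsGridComplex G (frontier P)) {p : Pt}
    (hp : p ∈ frontier P) {i : Fin 3} {σ : ℝ}
    (hint : ∀ᶠ t in 𝓝[>] (0 : ℝ), Function.update p i (p i + σ * t) ∈ interior P) : p i ∈ G i := by
  obtain ⟨c, hc, hpc, hcP⟩ := hG p hp
  rcases hpc i with ⟨h1, h2⟩ | ⟨h1, h2⟩
  · rw [h2]; exact (hc i).1
  · exfalso
    have hcont : Filter.Tendsto (fun t : ℝ => p i + σ * t) (𝓝[>] 0) (𝓝 (p i)) := by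
      have : Continuous fun t : ℝ => p i + σ * t := by fun_prop
      simpa using (this.tendsto 0).mono_left nhdsWithin_le_nhds
    obtain ⟨t, ht1, ht2, ht3⟩ := (hint.and ((hcont.eventually (lt_mem_nhds h1)).and
      (hcont.eventually (gt_mem_nhds h2)))).exists
    refine (hcP (a := Function.update p i (p i + σ * t)) fun l => ?_).2 ht1
    by_cases hl : l = i
    · subst hl; right; simpa using ⟨ht2, ht3⟩
    · simpa [hl] using hpc l

/-- The sides of the bricks lie on the planes of every grid that subdivides the boundary. -/
theorem mem_grid_of_complex (h : IsBrickComplex P k 𝓑) {G : Fin 3 → Finset ℝ}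
    (hG : IsGridComplex G (frontier P)) {A : Pt × Pt} (hA : A ∈ 𝓑) (i : Fin 3) (s : Bool) :
    side A i s ∈ G i := by
  have lA := h.lt A hA
  have hcl := h.isCompact.isClosed
  -- the centre of the face `(i, s)` of the brick
  set p : Pt := Function.update (fun l => (A.1 l + A.2 l) / 2) i (side A i s) with hpdef
  have pi : p i = side A i s := by simp [hpdef]
  have pl : ∀ l, l ≠ i → p l = (A.1 l + A.2 l) / 2 := fun l hl => by simp [hpdef, hl]
  have hside : A.1 i ≤ side A i s ∧ side A i s ≤ A.2 i := by
    have := lA i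
    cases s <;> simp [this.le]
  have pA : p ∈ Icc A.1 A.2 := mem_box.2 fun l => by
    have := lA l
    by_cases hl : l = i
    · subst hl; rw [pi]; exact hside
    · rw [pl l hl]; constructor <;> linarith
  by_cases hs : ∀ B ∈ 𝓑, p ∈ Icc B.1 B.2 → B = A
  -- No other brick contains the centre of the face: it is a boundary point, and the points next to
  -- it inside of the brick are inner points.
  · have hpf : p ∈ frontier P := by
      rw [hcl.frontier_eq]
      refine ⟨h.box_subset hA pA, fun hi => ?_⟩
      have := (h.mem_interior_of_single hA pA hs).1 hi i
      rw [pi] at this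
      cases s <;> simp at this
    rw [← pi]
    refine mem_grid (σ := cond s (-1) 1) hG hpf ?_
    have hpos : (0 : ℝ) < A.2 i - A.1 i := sub_pos.2 (lA i)
    filter_upwards [Ioo_mem_nhdsGT hpos] with t ht
    refine interior_mono (h.box_subset hA) ?_
    rw [interior_box]
    intro l
    by_cases hl : l = i
    · subst hl
      have h1 := ht.1
      have h2 := ht.2
      rw [Function.update_self, pi]
      cases s
      · simp only [side_false, cond_false]; constructor <;> linarith
      · simp only [side_true, cond_true]; constructor <;> linarith
    · rw [Function.update_of_ne hl, pl l hl]
      have := lA l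
      constructor <;> linarith
  · -- The face is horizontal and covered by another brick, hence it has a reflex edge.
    push Not at hs
    obtain ⟨B, hB, pB, hBA⟩ := hs
    have hst := h.meet A hA B hB hBA.symm p pA pB
    obtain ⟨C, hC, D, hD, hCD, hlev, hmem⟩ : ∃ C ∈ 𝓑, ∃ D ∈ 𝓑, Stacked k C D ∧
        side A i s = C.2 k ∧ i = k := by
      have hik : i = k := by
        by_contra hik
        have := pl k (Ne.symm hik)
        have := lA k
        rcases hst with h1 | h1
        · have := h1.eq_of_mem pA pB; linarith
        · have := h1.eq_of_mem pB pA; have := h1.1; linarith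
      subst hik
      rcases hst with h1 | h1
      · exact ⟨A, hA, B, hB, h1, by rw [← pi]; exact h1.eq_of_mem pA pB, rfl⟩
      · exact ⟨B, hB, A, hA, h1, by rw [← pi]; exact h1.eq_of_mem pB pA, rfl⟩
    rw [hlev, hmem]
    have lC := h.lt C hC
    have lD := h.lt D hD
    obtain ⟨m, hmk, hm⟩ := h.differ C hC D hD hCD
    obtain ⟨s', hs'⟩ : ∃ s', side C m s' ≠ side D m s' := by
      rcases hm with e | e
      exacts [⟨false, e⟩, ⟨true, e⟩]
    obtain ⟨j, hjm, hjk, hl⟩ := exists_third hmk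
    set e := contactEdge C D m s' with he
    obtain ⟨x, hx⟩ : ∃ x, x ∈ openSegment ℝ e.1 e.2 :=
      ⟨_, 1 / 2, 1 / 2, by norm_num, by norm_num, by norm_num, rfl⟩
    obtain ⟨f, hf, hev⟩ := h.reflexPoint_of_contact hC hD hCD hmk hjm hjk hl hs' hx
    have hxk := ((mem_openSegment_contactEdge hCD lC lD hmk hjm hjk hl).1 hx).2.1
    have hxP : x ∈ P := hev.self_of_nhds.2 ⟨m, hjm.symm, by simp⟩
    rw [← hxk]
    obtain ⟨δ, hδ, H⟩ := eventually_nhds_cube.1 hev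
    have ff : ∀ l, f l * f l = 1 := fun l => by rcases hf l with e | e <;> rw [e] <;> norm_num
    have fa : ∀ l, |f l| = 1 := fun l => by rcases hf l with e | e <;> rw [e] <;> norm_num
    -- opposite to the opening of the wedge, the points above or below `x` are inner points
    refine mem_grid (σ := - f k) hG ?_ ?_
    · rw [hcl.frontier_eq]
      refine ⟨hxP, fun hi => ?_⟩
      obtain ⟨δ', hδ', H'⟩ := eventually_nhds_cube.1 (mem_interior_iff_mem_nhds.1 hi)
      have hmin : 0 < min δ δ' := lt_min hδ hδ'
      have hq : ∀ l, |(x l + f l * (min δ δ' / 2)) - x l| < min δ δ' := by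
        intro l
        rw [add_sub_cancel_left, abs_mul, fa, one_mul, abs_of_pos (by linarith)]
        linarith
      have hqP := H' (fun l => x l + f l * (min δ δ' / 2)) fun l => (hq l).trans_le (min_le_right _ _)
      obtain ⟨l, -, hlq⟩ := (H _ fun l => (hq l).trans_le (min_le_left _ _)).1 hqP
      rw [add_sub_cancel_left, ← mul_assoc, ff] at hlq
      linarith
    · filter_upwards [Ioo_mem_nhdsGT hδ] with t ht
      have h1 := ht.1
      have h2 := ht.2
      set y := Function.update x k (x k + -f k * t) with hy
      have hyx : ∀ l, |y l - x l| < δ := by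
        intro l
        by_cases hlk : l = k
        · subst hlk
          rw [hy, Function.update_self, add_sub_cancel_left, abs_mul, abs_neg, fa, one_mul,
            abs_of_pos h1]
          exact h2
        · rw [hy, Function.update_of_ne hlk, sub_self, abs_zero]; exact hδ
      have hnear : ∀ᶠ q in 𝓝 y, ∀ l, |q l - x l| < δ := by
        rw [Filter.eventually_all]
        intro l
        have : Continuous fun q : Pt => |q l - x l| := by fun_prop
        exact (this.tendsto y).eventually (gt_mem_nhds (hyx l))
      have hneg : ∀ᶠ q in 𝓝 y, f k * (q k - x k) < 0 := by
        have : Continuous fun q : Pt => f k * (q k - x k) := by fun_prop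
        refine (this.tendsto y).eventually (gt_mem_nhds ?_)
        simp only [hy, Function.update_self, add_sub_cancel_left]
        have : f k * (-f k * t) = - (f k * f k * t) := by ring
        rw [this, ff]; linarith
      rw [mem_interior_iff_mem_nhds]
      filter_upwards [hnear, hneg] with q hq1 hq2
      exact (H q hq1).2 ⟨k, hjk.symm, hq2.le⟩

/-- The genus is the number of independent cycles of the graph of bricks and contacts. -/
theorem genus_eq (h : IsBrickComplex P k 𝓑) {g : ℕ} (hg : HasGenus P g) :
    (g : ℤ) = 1 - 𝓑.card + (contacts 𝓑 k).card := by
  obtain ⟨G, hG, hχ⟩ := hg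
  have h1 := cellCount_alternating hG
  have h2 := h.eulerSum_frontier (G := G) fun A hA i =>
    ⟨h.mem_grid_of_complex hG hA i false, h.mem_grid_of_complex hG hA i true⟩
  rw [cellCount_three_frontier h.isCompact.isClosed] at h1
  push_cast at h1
  linarith

open Classical in
/-- The converse of `genus_eq`: the planes through the sides of the bricks form a grid that
subdivides the boundary. -/
theorem hasGenus (h : IsBrickComplex P k 𝓑) {g : ℕ}
    (hg : (g : ℤ) = 1 - 𝓑.card + (contacts 𝓑 k).card) : HasGenus P g := by
  set G : Fin 3 → Finset ℝ := fun i => 𝓑.image (fun A => A.1 i) ∪ 𝓑.image (fun A => A.2 i) with hGdef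
  have hG : ∀ A ∈ 𝓑, ∀ i, A.1 i ∈ G i ∧ A.2 i ∈ G i := fun A hA i =>
    ⟨Finset.mem_union_left _ (Finset.mem_image_of_mem _ hA),
      Finset.mem_union_right _ (Finset.mem_image_of_mem _ hA)⟩
  have hcl := h.isCompact.isClosed
  have hcx : IsGridComplex G (frontier P) := by
    intro p hp
    rw [hcl.frontier_eq] at hp ⊢
    obtain ⟨A, hA, pA⟩ := h.mem_iff.1 hp.1
    have n1 : ∀ i, ((G i).filter fun t => t ≤ p i).Nonempty := fun i =>
      ⟨A.1 i, Finset.mem_filter.2 ⟨(hG A hA i).1, pA.1 i⟩⟩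
    have n2 : ∀ i, ((G i).filter fun t => p i ≤ t).Nonempty := fun i =>
      ⟨A.2 i, Finset.mem_filter.2 ⟨(hG A hA i).2, pA.2 i⟩⟩
    -- the cell of `p` lies between the grid planes next to `p`
    set c : Pt × Pt := (fun i => ((G i).filter fun t => t ≤ p i).max' (n1 i),
      fun i => ((G i).filter fun t => p i ≤ t).min' (n2 i)) with hc
    have c1 : ∀ i, c.1 i ∈ G i ∧ c.1 i ≤ p i := fun i =>
      Finset.mem_filter.1 (Finset.max'_mem _ (n1 i))
    have c2 : ∀ i, c.2 i ∈ G i ∧ p i ≤ c.2 i := fun i =>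
      Finset.mem_filter.1 (Finset.min'_mem _ (n2 i))
    have c3 : ∀ i, ∀ t ∈ G i, t ≤ p i → t ≤ c.1 i := fun i t ht htp =>
      Finset.le_max' _ t (Finset.mem_filter.2 ⟨ht, htp⟩)
    have c4 : ∀ i, ∀ t ∈ G i, p i ≤ t → c.2 i ≤ t := fun i t ht htp =>
      Finset.min'_le _ t (Finset.mem_filter.2 ⟨ht, htp⟩)
    refine ⟨c, fun i => ⟨(c1 i).1, (c2 i).1, (c1 i).2.trans (c2 i).2, fun t ht ⟨h1, h2⟩ => ?_⟩,
      fun i => ?_, ?_⟩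
    · rcases le_total t (p i) with h3 | h3
      · exact absurd (c3 i t ht h3) (not_le.2 h1)
      · exact absurd (c4 i t ht h3) (not_le.2 h2)
    · rcases (c1 i).2.lt_or_eq with h1 | h1
      · rcases (c2 i).2.lt_or_eq with h2 | h2
        · exact Or.inr ⟨h1, h2⟩
        · have := c3 i _ (c2 i).1 h2.ge
          left; constructor <;> linarith [(c1 i).2]
      · have := c4 i _ (c1 i).1 h1.ge
        left; constructor <;> linarith [(c2 i).2]
    · intro q hq
      -- the points `p` and `q` compare in the same way to all grid planes
      have cmp1 : ∀ i, ∀ t ∈ G i, t ≤ q i ↔ t ≤ p i := by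
        intro i t ht
        have a1 := c1 i
        have a2 := c2 i
        rcases hq i with ⟨h1, h2⟩ | ⟨h1, h2⟩
        · have : q i = p i := by linarith [a1.2, a2.2]
          rw [this]
        · constructor
          · intro h3; by_contra! h4
            linarith [c4 i t ht h4.le]
          · intro h3; linarith [c3 i t ht h3]
      have cmp2 : ∀ i, ∀ t ∈ G i, q i ≤ t ↔ p i ≤ t := by
        intro i t ht
        have a1 := c1 i
        have a2 := c2 i
        rcases hq i with ⟨h1, h2⟩ | ⟨h1, h2⟩
        · have : q i = p i := by linarith [a1.2, a2.2]
          rw [this]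
        · constructor
          · intro h3; by_contra! h4
            linarith [c3 i t ht h4.le]
          · intro h3; linarith [c4 i t ht h3]
      have hbox : ∀ A ∈ 𝓑, q ∈ Icc A.1 A.2 ↔ p ∈ Icc A.1 A.2 := by
        intro A hA
        rw [mem_box, mem_box]
        exact forall_congr' fun i => by
          rw [cmp1 i _ (hG A hA i).1, cmp2 i _ (hG A hA i).2]
      have st1 : ∀ A ∈ 𝓑, ∀ i, A.1 i < q i ↔ A.1 i < p i := fun A hA i => by
        rw [← not_le, ← not_le, cmp2 i _ (hG A hA i).1]
      have st2 : ∀ A ∈ 𝓑, ∀ i, q i < A.2 i ↔ p i < A.2 i := fun A hA i => by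
        rw [← not_le, ← not_le, cmp1 i _ (hG A hA i).2]
      refine ⟨h.mem_iff.2 ⟨A, hA, (hbox A hA).2 pA⟩, fun hqi => hp.2 ?_⟩
      rcases h.single_or_stacked hp.1 with ⟨A, hA, pA, hs⟩ | ⟨A, hA, B, hB, hAB, pA, pB⟩
      · rw [h.mem_interior_of_single hA ((hbox A hA).2 pA)
          fun B hB hqB => hs B hB ((hbox B hB).1 hqB)] at hqi
        exact (h.mem_interior_of_single hA pA hs).2 fun i =>
          ⟨(st1 A hA i).1 (hqi i).1, (st2 A hA i).1 (hqi i).2⟩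
      · rw [h.mem_interior_of_stacked hA hB hAB ((hbox A hA).2 pA) ((hbox B hB).2 pB),
          mem_openContact] at hqi
        rw [h.mem_interior_of_stacked hA hB hAB pA pB, mem_openContact]
        refine ⟨hAB.eq_of_mem pA pB, fun i hi => ?_⟩
        rw [← st1 A hA, ← st1 B hB, ← st2 A hA, ← st2 B hB]
        exact hqi.2 i hi
  refine ⟨G, hcx, ?_⟩
  have h1 := cellCount_alternating hcx
  rw [cellCount_three_frontier hcl, h.eulerSum_frontier hG] at h1
  push_cast at h1
  linarith

end IsBrickComplex

/-! ### Connected sets of vertices of a graph -/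

/-- The finite set `K` of vertices is connected with respect to the adjacency relation `r`: no
proper non-empty subset of `K` is closed under adjacency in `K`. -/
def Linked {α : Type*} (r : α → α → Prop) (K : Finset α) : Prop :=
  ∀ Y ⊆ K, Y.Nonempty → (∀ x ∈ Y, ∀ y ∈ K, r x y → y ∈ Y) → Y = K

/-- `𝒦` is the set of connected components of the finite set `X` of vertices. -/
structure IsComponents {α : Type*} (r : α → α → Prop) (X : Finset α) (𝒦 : Finset (Finset α)) :
    Prop where
  subset : ∀ K ∈ 𝒦, K ⊆ X
  nonempty : ∀ K ∈ 𝒦, K.Nonempty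
  linked : ∀ K ∈ 𝒦, Linked r K
  disjoint : ∀ K ∈ 𝒦, ∀ L ∈ 𝒦, K ≠ L → Disjoint K L
  cover : ∀ x ∈ X, ∃ K ∈ 𝒦, x ∈ K
  closed : ∀ K ∈ 𝒦, ∀ x ∈ K, ∀ y ∈ X, r x y → y ∈ K

theorem exists_components {α : Type*} {r : α → α → Prop} (hr : ∀ x y, r x y → r y x)
    (X : Finset α) : ∃ 𝒦, IsComponents r X 𝒦 := by
  classical
  -- the component of `x` is the least closed set containing it
  let comp : α → Finset α := fun x => X.filter fun y =>
    ∀ Y ⊆ X, x ∈ Y → (∀ a ∈ Y, ∀ b ∈ X, r a b → b ∈ Y) → y ∈ Y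
  have mem : ∀ x y, y ∈ comp x ↔ y ∈ X ∧ ∀ Y ⊆ X, x ∈ Y → (∀ a ∈ Y, ∀ b ∈ X, r a b → b ∈ Y) →
      y ∈ Y := fun x y => by simp [comp]
  have closed : ∀ x, ∀ a ∈ comp x, ∀ b ∈ X, r a b → b ∈ comp x := fun x a ha b hb hab =>
    (mem x b).2 ⟨hb, fun Y hY hx hc => hc a (((mem x a).1 ha).2 Y hY hx hc) b hb hab⟩
  have sub : ∀ x, comp x ⊆ X := fun x => Finset.filter_subset _ _
  have self : ∀ x ∈ X, x ∈ comp x := fun x hx => (mem x x).2 ⟨hx, fun _ _ h _ => h⟩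
  have linked : ∀ x ∈ X, Linked r (comp x) := by
    intro x hxX Y hY hne hc
    have hYX : Y ⊆ X := hY.trans (sub x)
    have hcX : ∀ a ∈ Y, ∀ b ∈ X, r a b → b ∈ Y := fun a ha b hb hab =>
      hc a ha b (closed x a (hY ha) b hb hab) hab
    by_cases hx : x ∈ Y
    · exact Finset.Subset.antisymm hY fun y hy => ((mem x y).1 hy).2 Y hYX hx hcX
    · exfalso
      obtain ⟨y, hy⟩ := hne
      have hyX := (mem x y).1 (hY hy)
      have := hyX.2 (X \ Y) Finset.sdiff_subset (Finset.mem_sdiff.2 ⟨hxX, hx⟩)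
        (fun a ha b hb hab => Finset.mem_sdiff.2 ⟨hb, fun hbY =>
          (Finset.mem_sdiff.1 ha).2 (hcX b hbY a (Finset.mem_sdiff.1 ha).1 (hr a b hab))⟩)
      exact (Finset.mem_sdiff.1 this).2 hy
  refine ⟨X.image comp, ?_, ?_, ?_, ?_, ?_, ?_⟩
  · intro K hK
    obtain ⟨x, hx, rfl⟩ := Finset.mem_image.1 hK
    exact sub x
  · intro K hK
    obtain ⟨x, hx, rfl⟩ := Finset.mem_image.1 hK
    exact ⟨x, self x hx⟩
  · intro K hK
    obtain ⟨x, hx, rfl⟩ := Finset.mem_image.1 hK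
    exact linked x hx
  · intro K hK L hL hne
    obtain ⟨x, hx, rfl⟩ := Finset.mem_image.1 hK
    obtain ⟨y, hy, rfl⟩ := Finset.mem_image.1 hL
    by_contra hd
    have hd : (comp x ∩ comp y).Nonempty := Finset.not_disjoint_iff_nonempty_inter.1 hd
    refine hne ((linked x hx _ Finset.inter_subset_left hd fun a ha b hb hab => ?_).symm.trans
      (linked y hy _ Finset.inter_subset_right hd fun a ha b hb hab => ?_))
    · exact Finset.mem_inter.2 ⟨hb, closed y a (Finset.mem_inter.1 ha).2 b (sub x hb) hab⟩
    · exact Finset.mem_inter.2 ⟨closed x a (Finset.mem_inter.1 ha).1 b (sub y hb) hab, hb⟩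
  · exact fun x hx => ⟨comp x, Finset.mem_image_of_mem _ hx, self x hx⟩
  · intro K hK
    obtain ⟨x, hx, rfl⟩ := Finset.mem_image.1 hK
    exact closed x

/-- Joining the components into a connected whole takes at least as many edges, minus one. -/
theorem IsComponents.card_le {α : Type*} {r R : α → α → Prop} {X : Finset α}
    {𝒦 : Finset (Finset α)} (h𝒦 : IsComponents r X 𝒦) (hX : Linked R X) (E : Finset (α × α))
    (hE : ∀ K ∈ 𝒦, ∀ L ∈ 𝒦, K ≠ L → ∀ x ∈ K, ∀ y ∈ L, R x y → (x, y) ∈ E ∨ (y, x) ∈ E) :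
    𝒦.card ≤ E.card + 1 := by
  classical
  -- a family of `n + 1` components that is joined by `n` pairs in `E` grows one component at a time
  have key : ∀ n, n + 1 ≤ 𝒦.card → ∃ 𝒮 ⊆ 𝒦, 𝒮.card = n + 1 ∧
      n ≤ (E.filter fun e => (∃ K ∈ 𝒮, e.1 ∈ K) ∧ ∃ K ∈ 𝒮, e.2 ∈ K).card := by
    intro n
    induction n with
    | zero =>
      intro h
      obtain ⟨K, hK⟩ := Finset.card_pos.1 (by omega : 0 < 𝒦.card)
      exact ⟨{K}, by simpa using hK, by simp, by simp⟩
    | succ n ih =>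
      intro h
      obtain ⟨𝒮, hS, hc, hn⟩ := ih (by omega)
      set Y := X.filter fun x => ∃ K ∈ 𝒮, x ∈ K with hY
      have mY : ∀ x, x ∈ Y ↔ x ∈ X ∧ ∃ K ∈ 𝒮, x ∈ K := fun x => by simp [hY]
      obtain ⟨K₀, hK₀⟩ := Finset.card_pos.1 (by omega : 0 < 𝒮.card)
      obtain ⟨x₀, hx₀⟩ := h𝒦.nonempty K₀ (hS hK₀)
      have hYne : Y.Nonempty := ⟨x₀, (mY _).2 ⟨h𝒦.subset _ (hS hK₀) hx₀, K₀, hK₀, hx₀⟩⟩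
      obtain ⟨L₀, hL₀, hL₀S⟩ : ∃ L ∈ 𝒦, L ∉ 𝒮 := by
        by_contra! hall
        have := Finset.card_le_card (show 𝒦 ⊆ 𝒮 from hall)
        omega
      have hYX : Y ≠ X := by
        intro he
        obtain ⟨y, hy⟩ := h𝒦.nonempty L₀ hL₀
        obtain ⟨-, K, hK, hyK⟩ := (mY y).1 (he ▸ h𝒦.subset _ hL₀ hy)
        have hne : K ≠ L₀ := fun e => hL₀S (e ▸ hK)
        exact Finset.disjoint_left.1 (h𝒦.disjoint K (hS hK) L₀ hL₀ hne) hyK hy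
      obtain ⟨x, hx, y, hy, hxy, hyY⟩ : ∃ x ∈ Y, ∃ y ∈ X, R x y ∧ y ∉ Y := by
        by_contra! hall
        exact hYX (hX Y (Finset.filter_subset _ _) hYne fun x hx y hy hxy => hall x hx y hy hxy)
      obtain ⟨hxX, K, hK, hxK⟩ := (mY x).1 hx
      obtain ⟨L, hL, hyL⟩ := h𝒦.cover y hy
      have hLS : L ∉ 𝒮 := fun hLS => hyY ((mY y).2 ⟨hy, L, hLS, hyL⟩)
      have hyS : ¬ ∃ K ∈ 𝒮, y ∈ K := fun h => hyY ((mY y).2 ⟨hy, h⟩)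
      refine ⟨insert L 𝒮, Finset.insert_subset hL hS, by
        rw [Finset.card_insert_of_notMem hLS, hc], ?_⟩
      have new : ∀ e ∈ E, (e = (x, y) ∨ e = (y, x)) → n + 1 ≤ (E.filter fun e =>
          (∃ K ∈ insert L 𝒮, e.1 ∈ K) ∧ ∃ K ∈ insert L 𝒮, e.2 ∈ K).card := by
        intro e heE he
        have hnot : e ∉ E.filter fun e => (∃ K ∈ 𝒮, e.1 ∈ K) ∧ ∃ K ∈ 𝒮, e.2 ∈ K := by
          intro hmem
          have := (Finset.mem_filter.1 hmem).2
          rcases he with rfl | rfl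
          exacts [hyS this.2, hyS this.1]
        calc n + 1 ≤ (insert e (E.filter fun e => (∃ K ∈ 𝒮, e.1 ∈ K) ∧ ∃ K ∈ 𝒮, e.2 ∈ K)).card := by
              rw [Finset.card_insert_of_notMem hnot]; omega
          _ ≤ _ := by
              refine Finset.card_le_card (Finset.insert_subset ?_ ?_)
              · refine Finset.mem_filter.2 ⟨heE, ?_⟩
                have a1 : ∃ K ∈ insert L 𝒮, x ∈ K := ⟨K, Finset.mem_insert_of_mem hK, hxK⟩
                have a2 : ∃ K ∈ insert L 𝒮, y ∈ K := ⟨L, Finset.mem_insert_self _ _, hyL⟩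
                rcases he with rfl | rfl
                exacts [⟨a1, a2⟩, ⟨a2, a1⟩]
              · intro e' he'
                obtain ⟨h1, ⟨K1, hK1, h2⟩, K2, hK2, h3⟩ := Finset.mem_filter.1 he'
                exact Finset.mem_filter.2 ⟨h1, ⟨K1, Finset.mem_insert_of_mem hK1, h2⟩,
                  K2, Finset.mem_insert_of_mem hK2, h3⟩
      have hKL : K ≠ L := fun e => hLS (e ▸ hK)
      rcases hE K (hS hK) L hL hKL x hxK y hyL hxy with he | he
      exacts [new _ he (Or.inl rfl), new _ he (Or.inr rfl)]
  rcases Nat.eq_zero_or_pos 𝒦.card with h0 | h0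
  · omega
  · obtain ⟨𝒮, -, -, hn⟩ := key (𝒦.card - 1) (by omega)
    have := hn.trans (Finset.card_filter_le _ _)
    omega

theorem IsComponents.sum_card {α : Type*} {r : α → α → Prop} {X : Finset α}
    {𝒦 : Finset (Finset α)} (h : IsComponents r X 𝒦) : ∑ K ∈ 𝒦, K.card = X.card := by
  classical
  have : X = 𝒦.biUnion fun K => K := by
    ext x
    rw [Finset.mem_biUnion]
    exact ⟨fun hx => h.cover x hx, fun ⟨K, hK, hx⟩ => h.subset K hK hx⟩
  rw [this, Finset.card_biUnion fun K hK L hL hne => h.disjoint K hK L hL hne]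

/-! ### Visibility between bricks -/

/-- The brick `v` is attached to the face of the brick `p` in the vertical direction `u` (upwards
for `u = true`), and its horizontal extent is obtained from that of `p` by moving the single side
`(i, s)` inwards. -/
structure IsChild (k : Fin 3) (p v : Pt × Pt) (i : Fin 3) (s u : Bool) : Prop where
  ne : i ≠ k
  level : side p k u = side v k (!u)
  sub : ∀ l, l ≠ k → p.1 l ≤ v.1 l ∧ v.2 l ≤ p.2 l
  side_ne : side v i s ≠ side p i s
  side_eq : ∀ l t, l ≠ k → (l ≠ i ∨ t ≠ s) → side v l t = side p l t

/-- Two bricks are adjacent if their contact rectangle has a single reflex edge. -/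
def Adj (k : Fin 3) (A B : Pt × Pt) : Prop :=
  ∃ i s u, IsChild k A B i s u ∨ IsChild k B A i s u

theorem Adj.symm {k : Fin 3} {A B : Pt × Pt} (h : Adj k A B) : Adj k B A := by
  obtain ⟨i, s, u, h⟩ := h
  exact ⟨i, s, u, h.symm⟩

/-- The point `g` sees every point of the box `v`. -/
def SeesBox (P : Set Pt) (g : Pt) (v : Pt × Pt) : Prop :=
  ∀ q ∈ Icc v.1 v.2, segment ℝ g q ⊆ P

/-- Every point of the box `v` is seen by a point of the open edge `e`. -/
def EdgeSeesBox (P : Set Pt) (e v : Pt × Pt) : Prop :=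
  ∀ q ∈ Icc v.1 v.2, ∃ g ∈ openSegment ℝ e.1 e.2, segment ℝ g q ⊆ P

/-- The box `v` is seen by one of the edges in `E`. -/
def Seen (P : Set Pt) (E : Finset (Pt × Pt)) (v : Pt × Pt) : Prop :=
  ∃ e ∈ E, EdgeSeesBox P e v

theorem Seen.mono {P : Set Pt} {E E' : Finset (Pt × Pt)} {v : Pt × Pt} (h : Seen P E v)
    (hE : E ⊆ E') : Seen P E' v := by
  obtain ⟨e, he, hv⟩ := h
  exact ⟨e, hE he, hv⟩

/-- The point `g` is not beyond the face of `v` from which the direction `u` points into `v`. -/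
def Behind (k : Fin 3) (v : Pt × Pt) (u : Bool) (g : Pt) : Prop :=
  cond u (g k ≤ v.1 k) (v.2 k ≤ g k)

/-- The edge `e` contains points above or below each point of the line `x i = x` across the
horizontal extent of `v`, and these points see all of `v`, looking in the direction `u`. -/
def LineGuard (P : Set Pt) (k : Fin 3) (e v : Pt × Pt) (i : Fin 3) (x : ℝ) (u : Bool) : Prop :=
  ∀ j, j ≠ i → j ≠ k → ∀ t ∈ Ioo (v.1 j) (v.2 j), ∃ g ∈ openSegment ℝ e.1 e.2,
    g i = x ∧ g j = t ∧ Behind k v u g ∧ SeesBox P g v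

theorem LineGuard.sees {P : Set Pt} {k : Fin 3} {e v : Pt × Pt} {i : Fin 3} {x : ℝ} {u : Bool}
    (h : LineGuard P k e v i x u) (hik : i ≠ k) (hv : ∀ l, v.1 l < v.2 l) :
    EdgeSeesBox P e v := by
  obtain ⟨j, hji, hjk, -⟩ := exists_third hik
  have := hv j
  obtain ⟨g, hg, -, -, -, hs⟩ := h j hji hjk ((v.1 j + v.2 j) / 2)
    ⟨by linarith, by linarith⟩
  exact fun q hq => ⟨g, hg, hs q hq⟩

theorem segment_subset_of_mem {g q m : Pt} (hm : m ∈ segment ℝ g q) :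
    segment ℝ g q ⊆ segment ℝ g m ∪ segment ℝ m q := by
  rw [segment_eq_image'] at hm
  obtain ⟨τ, ⟨h0, h1⟩, rfl⟩ := hm
  intro y hy
  rw [segment_eq_image'] at hy
  obtain ⟨t, ⟨t0, t1⟩, rfl⟩ := hy
  rcases le_total t τ with h | h
  · left
    rcases h0.eq_or_lt with rfl | hτ
    · obtain rfl : t = 0 := le_antisymm h t0
      simp
    · rw [segment_eq_image']
      refine ⟨t / τ, ⟨by positivity, (div_le_one hτ).2 h⟩, ?_⟩
      funext l
      simp only [Pi.add_apply, Pi.smul_apply, Pi.sub_apply, smul_eq_mul]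
      field_simp
      ring
  · right
    rcases h1.eq_or_lt with rfl | hτ
    · obtain rfl : t = 1 := le_antisymm t1 h
      simp
    · have hd : 0 < 1 - τ := by linarith
      rw [segment_eq_image']
      refine ⟨(t - τ) / (1 - τ), ⟨div_nonneg (by linarith) hd.le, (div_le_one hd).2 (by linarith)⟩,
        ?_⟩
      funext l
      simp only [Pi.add_apply, Pi.smul_apply, Pi.sub_apply, smul_eq_mul]
      field_simp
      ring

theorem mem_segment_apply {g q m : Pt} (hm : m ∈ segment ℝ g q) {a b : ℝ} {l : Fin 3}
    (hg : a ≤ g l ∧ g l ≤ b) (hq : a ≤ q l ∧ q l ≤ b) : a ≤ m l ∧ m l ≤ b := by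
  obtain ⟨x, y, hx, hy, hxy, rfl⟩ := hm
  simp only [Pi.add_apply, Pi.smul_apply, smul_eq_mul]
  obtain rfl : x = 1 - y := by linarith
  constructor <;> nlinarith

/-- A segment meets every intermediate level. -/
theorem exists_mem_segment_level {g q : Pt} {k : Fin 3} {c : ℝ}
    (h : (g k ≤ c ∧ c ≤ q k) ∨ (q k ≤ c ∧ c ≤ g k)) : ∃ m ∈ segment ℝ g q, m k = c := by
  rcases eq_or_ne (g k) (q k) with he | he
  · exact ⟨g, left_mem_segment _ _ _, by rcases h with h | h <;> linarith⟩
  · have hd : q k - g k ≠ 0 := sub_ne_zero.2 he.symm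
    rw [segment_eq_image']
    refine ⟨_, ⟨(c - g k) / (q k - g k), ?_, rfl⟩, ?_⟩
    · rcases h with h | h
      · have : 0 < q k - g k := lt_of_le_of_ne (by linarith) hd.symm
        exact ⟨div_nonneg (by linarith) this.le, (div_le_one this).2 (by linarith)⟩
      · have : 0 < g k - q k := lt_of_le_of_ne (by linarith) (by intro h; apply hd; linarith)
        rw [← neg_sub (g k) c, ← neg_sub (g k) (q k), neg_div_neg_eq]
        exact ⟨div_nonneg (by linarith) this.le, (div_le_one this).2 (by linarith)⟩
    · simp only [Pi.add_apply, Pi.smul_apply, Pi.sub_apply, smul_eq_mul]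
      field_simp
      ring

theorem side_bounds {v : Pt × Pt} {l : Fin 3} (hv : v.1 l < v.2 l) (s : Bool) :
    v.1 l ≤ side v l s ∧ side v l s ≤ v.2 l := by
  cases s <;> simp [hv.le]

theorem behind_level {k : Fin 3} {v : Pt × Pt} {u : Bool} {g q : Pt} (hg : Behind k v u g)
    (hq : v.1 k ≤ q k ∧ q k ≤ v.2 k) :
    (g k ≤ side v k (!u) ∧ side v k (!u) ≤ q k) ∨ (q k ≤ side v k (!u) ∧ side v k (!u) ≤ g k) := by
  cases u
  · right; exact ⟨hq.2, hg⟩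
  · left; exact ⟨hg, hq.1⟩

namespace IsChild

variable {P : Set Pt} {k : Fin 3} {p v : Pt × Pt} {i : Fin 3} {s u : Bool}

theorem mem_parent (h : IsChild k p v i s u) (hp : p.1 k < p.2 k) {m : Pt}
    (hm : m ∈ Icc v.1 v.2) (hk : m k = side v k (!u)) : m ∈ Icc p.1 p.2 := by
  refine mem_box.2 fun l => ?_
  by_cases hl : l = k
  · subst hl
    rw [hk, ← h.level]
    exact side_bounds hp u
  · have := mem_box.1 hm l
    have h2 := h.sub l hl
    exact ⟨h2.1.trans this.1, this.2.trans h2.2⟩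

theorem stacked (h : IsChild k p v i s u) (hv : ∀ l, v.1 l < v.2 l) :
    cond u (Stacked k p v) (Stacked k v p) := by
  have key : ∀ l, l ≠ k → p.1 l < v.2 l ∧ v.1 l < p.2 l := fun l hl =>
    ⟨(h.sub l hl).1.trans_lt (hv l), (hv l).trans_le (h.sub l hl).2⟩
  cases u
  · exact ⟨h.level.symm, fun l hl => (key l hl).symm⟩
  · exact ⟨h.level, key⟩

/-- What a point sees of a brick extends to the children of the brick over or under the point. -/
theorem seesBox (h : IsChild k p v i s u) (hp : p.1 k < p.2 k) (hv : v.1 k < v.2 k)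
    (hvP : Icc v.1 v.2 ⊆ P) {g : Pt} (hg : Behind k p u g) (hs : SeesBox P g p)
    (hgv : ∀ l, l ≠ k → v.1 l ≤ g l ∧ g l ≤ v.2 l) : SeesBox P g v ∧ Behind k v u g := by
  have hb : Behind k v u g := by
    have := h.level
    cases u
    · simp only [side_false, Bool.not_false, side_true] at this
      simp only [Behind, cond_false] at hg ⊢
      linarith
    · simp only [side_true, Bool.not_true, side_false] at this
      simp only [Behind, cond_true] at hg ⊢
      linarith
  refine ⟨fun q hq => ?_, hb⟩
  obtain ⟨m, hm, hmk⟩ := exists_mem_segment_level (behind_level hb (mem_box.1 hq k))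
  have mv : m ∈ Icc v.1 v.2 := mem_box.2 fun l => by
    by_cases hl : l = k
    · subst hl; rw [hmk]; exact side_bounds hv _
    · exact mem_segment_apply hm (hgv l hl) (mem_box.1 hq l)
  refine (segment_subset_of_mem hm).trans (union_subset (hs m (h.mem_parent hp mv hmk)) ?_)
  exact ((convex_box v).segment_subset mv hq).trans hvP

theorem lineGuard (h : IsChild k p v i s u) (hp : p.1 k < p.2 k) (hv : v.1 k < v.2 k)
    (hvP : Icc v.1 v.2 ⊆ P) {e : Pt × Pt} {i' : Fin 3} {x : ℝ} (hik : i' ≠ k)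
    (hx : v.1 i' ≤ x ∧ x ≤ v.2 i') (hg : LineGuard P k e p i' x u) : LineGuard P k e v i' x u := by
  intro j hji hjk t ht
  have hj := h.sub j hjk
  obtain ⟨g, hge, hgi, hgj, hb, hs⟩ := hg j hji hjk t ⟨hj.1.trans_lt ht.1, ht.2.trans_le hj.2⟩
  have := h.seesBox hp hv hvP hb hs (fun l hl => by
    obtain ⟨j', hj'i, hj'k, hax⟩ := exists_third hik
    obtain rfl : j = j' := by rcases hax j with e | e | e <;> tauto
    rcases hax l with rfl | rfl | rfl
    · rw [hgi]; exact hx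
    · rw [hgj]; exact ⟨ht.1.le, ht.2.le⟩
    · exact absurd rfl hl)
  exact ⟨g, hge, hgi, hgj, this.2, this.1⟩

/-- The sides other than the one in which they differ are common to a brick and its child. -/
theorem lineGuard_side (h : IsChild k p v i s u) (hp : p.1 k < p.2 k) (hv : ∀ l, v.1 l < v.2 l)
    (hvP : Icc v.1 v.2 ⊆ P) {e : Pt × Pt} {i' : Fin 3} {t : Bool} (hik : i' ≠ k)
    (hne : i' ≠ i ∨ t ≠ s) (hg : LineGuard P k e p i' (side p i' t) u) :
    LineGuard P k e v i' (side v i' t) u := by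
  rw [← h.side_eq i' t hik hne] at hg
  exact h.lineGuard hp (hv k) hvP hik (side_bounds (hv i') t) hg

end IsChild

namespace IsBrickComplex

variable {P : Set Pt} {k : Fin 3} {𝓑 : Finset (Pt × Pt)}

theorem same_face (h : IsBrickComplex P k 𝓑) {A B : Pt × Pt} (hA : A ∈ 𝓑) (hB : B ∈ 𝓑) {u : Bool}
    (hu : side A k u = side B k u) {x : Pt} (xA : x ∈ Icc A.1 A.2) (xB : x ∈ Icc B.1 B.2) :
    A = B := by
  by_contra hne
  have lA := h.lt A hA k
  have lB := h.lt B hB k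
  rcases h.meet A hA B hB hne x xA xB with h1 | h1 <;> have := h1.1 <;> cases u <;>
    simp only [side_false, side_true] at hu <;> linarith

theorem child_inter (h : IsBrickComplex P k 𝓑) {p v : Pt × Pt} (hp : p ∈ 𝓑) (hv : v ∈ 𝓑)
    {i : Fin 3} {s u : Bool} (hc : IsChild k p v i s u) :
    ∃ x, x ∈ Icc p.1 p.2 ∧ x ∈ Icc v.1 v.2 ∧ x k = side v k (!u) := by
  set x : Pt := Function.update v.1 k (side v k (!u)) with hx
  have hxk : x k = side v k (!u) := by simp [hx]
  have xv : x ∈ Icc v.1 v.2 := mem_box.2 fun l => by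
    by_cases hl : l = k
    · subst hl; rw [hxk]; exact side_bounds (h.lt v hv _) _
    · simp [hx, hl, (h.lt v hv l).le]
  exact ⟨x, hc.mem_parent (h.lt p hp k) xv hxk, xv, hxk⟩

/-- Two children of a brick on the same face lie at opposite sides. -/
theorem children_opposite (h : IsBrickComplex P k 𝓑) {v w w' : Pt × Pt}
    (hw : w ∈ 𝓑) (hw' : w' ∈ 𝓑) (hne : w ≠ w') {i i' : Fin 3} {s s' u : Bool}
    (hc : IsChild k v w i s u) (hc' : IsChild k v w' i' s' u) : i = i' ∧ s' = !s := by
  have lw := h.lt w hw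
  have lw' := h.lt w' hw'
  by_contra hcon
  have hlev : side w k (!u) = side w' k (!u) := hc.level.symm.trans hc'.level
  -- otherwise the two children have a common point
  suffices ∃ x : Pt, x ∈ Icc w.1 w.2 ∧ x ∈ Icc w'.1 w'.2 by
    obtain ⟨x, h1, h2⟩ := this
    exact hne (h.same_face hw hw' hlev h1 h2)
  by_cases hi : i = i'
  · subst hi
    have hs : s' = s := by
      cases s <;> cases s' <;> simp_all
    subst hs
    -- both contain the corner of `v` opposite to the side `(i, s)`
    refine ⟨fun l => if l = k then side w k (!u) else side v l (!s'), mem_box.2 fun l => ?_,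
      mem_box.2 fun l => ?_⟩ <;> by_cases hl : l = k
    · subst hl; simp only [if_true]; exact side_bounds (lw _) _
    · simp only [hl, if_false]
      rw [← hc.side_eq l (!s') hl (Or.inr (by simp))]
      exact side_bounds (lw l) _
    · subst hl; simp only [if_true]; rw [hlev]; exact side_bounds (lw' _) _
    · simp only [hl, if_false]
      rw [← hc'.side_eq l (!s') hl (Or.inr (by simp))]
      exact side_bounds (lw' l) _
  · refine ⟨fun l => if l = k then side w k (!u) else if l = i then w.1 i else w'.1 l,
      mem_box.2 fun l => ?_, mem_box.2 fun l => ?_⟩ <;> by_cases hl : l = k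
    · subst hl; simp only [if_true]; exact side_bounds (lw _) _
    · by_cases hli : l = i
      · subst hli; simp only [hl, if_false, if_true]; exact ⟨le_rfl, (lw l).le⟩
      · simp only [hl, hli, if_false]
        have e1 := hc.side_eq l false hl (Or.inl hli)
        have e2 := hc.side_eq l true hl (Or.inl hli)
        simp only [side_false, side_true] at e1 e2
        rw [e1, e2]
        exact ⟨(hc'.sub l hl).1, (lw' l).le.trans (hc'.sub l hl).2⟩
    · subst hl; simp only [if_true]; rw [hlev]; exact side_bounds (lw' _) _
    · by_cases hli : l = i
      · subst hli; simp only [hl, if_false, if_true]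
        have e1 := hc'.side_eq l false hl (Or.inl hi)
        have e2 := hc'.side_eq l true hl (Or.inl hi)
        simp only [side_false, side_true] at e1 e2
        rw [e1, e2]
        exact ⟨(hc.sub l hl).1, (lw l).le.trans (hc.sub l hl).2⟩
      · simp only [hl, hli, if_false]; exact ⟨le_rfl, (lw' l).le⟩

/-- The parent of a brick `v` is the only brick at its face of `v`. -/
theorem adj_of_child (h : IsBrickComplex P k 𝓑) {p v w : Pt × Pt} (hp : p ∈ 𝓑) (hv : v ∈ 𝓑)
    (hw : w ∈ 𝓑) (hne : w ≠ p) {i : Fin 3} {s u : Bool} (hc : IsChild k p v i s u)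
    (hvw : Adj k v w) : (∃ i' s', IsChild k v w i' s' u) ∨ ∃ i' s', IsChild k w v i' s' (!u) := by
  have lp := h.lt p hp k
  have lv := h.lt v hv k
  obtain ⟨i', s', u', hc' | hc'⟩ := hvw
  · by_cases hu : u' = u
    · subst hu; exact Or.inl ⟨i', s', hc'⟩
    · obtain rfl : u' = !u := by cases u <;> cases u' <;> simp_all
      obtain ⟨x, xv, xw, hxk⟩ := h.child_inter hv hw hc'
      have hlev := hc'.level
      rw [Bool.not_not] at hlev hxk
      exact absurd (h.same_face hw hp (hlev.symm.trans hc.level.symm) xw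
        (hc.mem_parent lp xv (hxk.trans hlev.symm))) hne
  · by_cases hu : u' = u
    · subst hu
      obtain ⟨x, xw, xv, hxk⟩ := h.child_inter hw hv hc'
      exact absurd (h.same_face hw hp (hc'.level.trans hc.level.symm) xw
        (hc.mem_parent lp xv hxk)) hne
    · obtain rfl : u' = !u := by cases u <;> cases u' <;> simp_all
      exact Or.inr ⟨i', s', hc'⟩

/-- The reflex edge between a brick and its child. -/
theorem exists_own_edge (h : IsBrickComplex P k 𝓑) {p v : Pt × Pt} (hp : p ∈ 𝓑) (hv : v ∈ 𝓑)
    {i : Fin 3} {s u : Bool} (hc : IsChild k p v i s u) : ∃ e ∈ reflexEdges P, ∀ g : Pt,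
      g i = side v i s → g k = side v k (!u) → (∀ j, j ≠ i → j ≠ k → v.1 j < g j ∧ g j < v.2 j) →
        g ∈ openSegment ℝ e.1 e.2 := by
  have lp := h.lt p hp
  have lv := h.lt v hv
  have hst := hc.stacked lv
  obtain ⟨j, hji, hjk, hl⟩ := exists_third hc.ne
  have hlev := hc.level
  have hsub := hc.sub i hc.ne
  have hsubj := hc.sub j hjk
  have hmeet : side v i s = side (meetBox p v) i s := by
    cases s
    · simp only [side_false, meetBox_apply_fst]; exact (max_eq_right hsub.1).symm
    · simp only [side_true, meetBox_apply_snd]; exact (min_eq_right hsub.2).symm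
  cases u
  · simp only [cond_false] at hst
    refine ⟨contactEdge v p i s, ⟨j, h.isReflexEdge_contactEdge hv hp hst hc.ne hji hjk hl
      hc.side_ne⟩, fun g h1 h2 h3 => ?_⟩
    have h3 := h3 j hji hjk
    rw [mem_openSegment_contactEdge hst lv lp hc.ne hji hjk hl]
    refine ⟨?_, h2, ⟨h3.1, by linarith⟩, h3.2, by linarith⟩
    rw [h1, hmeet]
    simp only [side, meetBox, sup_comm, inf_comm]
  · simp only [cond_true] at hst
    refine ⟨contactEdge p v i s, ⟨j, h.isReflexEdge_contactEdge hp hv hst hc.ne hji hjk hl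
      hc.side_ne.symm⟩, fun g h1 h2 h3 => ?_⟩
    have h3 := h3 j hji hjk
    rw [mem_openSegment_contactEdge hst lp lv hc.ne hji hjk hl]
    exact ⟨by rw [h1, hmeet], by rw [h2]; exact hlev.symm, ⟨by linarith, h3.1⟩, by linarith, h3.2⟩

/-- The reflex edge between `p` and its child `v` guards both bricks along the line of the side of
`v` that has been moved inwards. -/
theorem exists_own_guard (h : IsBrickComplex P k 𝓑) {p v : Pt × Pt} (hp : p ∈ 𝓑) (hv : v ∈ 𝓑)
    {i : Fin 3} {s u : Bool} (hc : IsChild k p v i s u) : ∃ e ∈ reflexEdges P,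
      LineGuard P k e v i (side v i s) u ∧ EdgeSeesBox P e p ∧
      (∃ g ∈ openSegment ℝ e.1 e.2, g ∈ Icc v.1 v.2 ∧ g k = side v k (!u)) ∧
      LineGuard P k e p i (side v i s) (!u) := by
  have lp := h.lt p hp
  have lv := h.lt v hv
  obtain ⟨e, he, hge⟩ := h.exists_own_edge hp hv hc
  have hmem : ∀ g : Pt, g i = side v i s → g k = side v k (!u) →
      (∀ j, j ≠ i → j ≠ k → v.1 j < g j ∧ g j < v.2 j) → g ∈ Icc v.1 v.2 := by
    intro g h1 h2 h3
    refine mem_box.2 fun l => ?_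
    by_cases hlk : l = k
    · subst hlk; rw [h2]; exact side_bounds (lv _) _
    by_cases hli : l = i
    · subst hli; rw [h1]; exact side_bounds (lv _) _
    · exact ⟨(h3 l hli hlk).1.le, (h3 l hli hlk).2.le⟩
  set g₀ : Pt := fun l => if l = i then side v i s else if l = k then side v k (!u) else
    (v.1 l + v.2 l) / 2 with hg₀
  have a1 : g₀ i = side v i s := by simp [hg₀]
  have a2 : g₀ k = side v k (!u) := by simp [hg₀, hc.ne.symm]
  have a3 : ∀ j, j ≠ i → j ≠ k → v.1 j < g₀ j ∧ g₀ j < v.2 j := by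
    intro j hji hjk
    have := lv j
    simp only [hg₀, hji, hjk, if_false]
    constructor <;> linarith
  have line : ∀ j, j ≠ i → j ≠ k → ∀ t ∈ Ioo (v.1 j) (v.2 j), ∃ g ∈ openSegment ℝ e.1 e.2,
      g i = side v i s ∧ g j = t ∧ g ∈ Icc v.1 v.2 ∧ g k = side v k (!u) := by
    intro j hji hjk t ht
    set g : Pt := fun l => if l = i then side v i s else if l = k then side v k (!u) else t with hg
    have b1 : g i = side v i s := by simp [hg]
    have b2 : g k = side v k (!u) := by simp [hg, hc.ne.symm]
    have b3 : ∀ j, j ≠ i → j ≠ k → v.1 j < g j ∧ g j < v.2 j := by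
      intro j' hji' hjk'
      obtain rfl : j' = j := by
        obtain ⟨m, hmi, hmk, hm⟩ := exists_third hc.ne
        rcases hm j with e | e | e <;> rcases hm j' with e' | e' | e' <;> simp_all
      simp only [hg, hji', hjk', if_false]
      exact ht
    exact ⟨g, hge _ b1 b2 b3, b1, by simp [hg, hji, hjk], hmem _ b1 b2 b3, b2⟩
  have seesP : ∀ g ∈ Icc v.1 v.2, g k = side v k (!u) → SeesBox P g p := fun g hg hgk q hq =>
    ((convex_box p).segment_subset (hc.mem_parent (lp k) hg hgk) hq).trans (h.box_subset hp)
  refine ⟨e, he, fun j hji hjk t ht => ?_, fun q hq => ⟨g₀, hge _ a1 a2 a3, ?_⟩,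
    ⟨g₀, hge _ a1 a2 a3, hmem _ a1 a2 a3, a2⟩, fun j hji hjk t ht => ?_⟩
  · obtain ⟨g, g1, g2, g3, g4, g5⟩ := line j hji hjk t ht
    refine ⟨g, g1, g2, g3, ?_, fun q hq =>
      ((convex_box v).segment_subset g4 hq).trans (h.box_subset hv)⟩
    cases u
    · simp only [Behind, cond_false, g5, Bool.not_false, side_true, le_refl]
    · simp only [Behind, cond_true, g5, Bool.not_true, side_false, le_refl]
  · exact seesP _ (hmem _ a1 a2 a3) a2 q hq
  · have e1 := hc.side_eq j false hjk (Or.inl hji)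
    have e2 := hc.side_eq j true hjk (Or.inl hji)
    simp only [side_false, side_true] at e1 e2
    rw [← e1, ← e2] at ht
    obtain ⟨g, g1, g2, g3, g4, g5⟩ := line j hji hjk t ht
    refine ⟨g, g1, g2, g3, ?_, seesP g g4 g5⟩
    have := hc.level
    cases u
    · simp only [Behind, Bool.not_false, cond_true, g5]
      exact this.ge
    · simp only [Behind, Bool.not_true, cond_false, g5]
      exact this.le

end IsBrickComplex

/-! ### Guarding trees of bricks -/

namespace IsBrickComplex

variable {P : Set Pt} {k : Fin 3} {𝓑 : Finset (Pt × Pt)}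

/-- All connected sets of fewer than `N` bricks can be guarded by half as many reflex edges,
rounded up. -/
def Guardable (P : Set Pt) (k : Fin 3) (𝓑 : Finset (Pt × Pt)) (N : ℕ) : Prop :=
  ∀ K ⊆ 𝓑, Linked (Adj k) K → K.card < N → K.Nonempty → ∃ E : Finset (Pt × Pt),
    (E : Set (Pt × Pt)) ⊆ reflexEdges P ∧ (∀ w ∈ K, Seen P E w) ∧ 2 * E.card ≤ K.card + 1

/-- After the removal of a vertex from a connected set, the components with an even number of
bricks are guarded separately. -/
theorem remove_vertex {N : ℕ} (IH : Guardable P k 𝓑 N) {K : Finset (Pt × Pt)} (hK : K ⊆ 𝓑)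
    (hlink : Linked (Adj k) K) (hN : K.card ≤ N) {v : Pt × Pt} (hv : v ∈ K) :
    ∃ (𝒪 : Finset (Finset (Pt × Pt))) (E : Finset (Pt × Pt)),
      (E : Set (Pt × Pt)) ⊆ reflexEdges P ∧
      (∀ L ∈ 𝒪, L ⊆ K ∧ v ∉ L ∧ Odd L.card ∧ Linked (Adj k) L ∧ ∃ w ∈ L, Adj k v w) ∧
      (∀ L ∈ 𝒪, ∀ M ∈ 𝒪, L ≠ M → Disjoint L M) ∧
      2 * E.card + ∑ L ∈ 𝒪, L.card + 1 ≤ K.card ∧ Even (K.card + 1 + 𝒪.card) ∧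
      ∀ w ∈ K, w = v ∨ (∃ L ∈ 𝒪, w ∈ L) ∨ Seen P E w := by
  classical
  obtain ⟨𝒦, h𝒦⟩ := exists_components (r := Adj k) (fun x y h => h.symm) (K.erase v)
  have hsub : ∀ L ∈ 𝒦, L ⊆ K := fun L hL => (h𝒦.subset L hL).trans (Finset.erase_subset _ _)
  have hvL : ∀ L ∈ 𝒦, v ∉ L := fun L hL hvL => by simpa using h𝒦.subset L hL hvL
  have hlt : ∀ L ∈ 𝒦, L.card < K.card := fun L hL =>
    Finset.card_lt_card ⟨hsub L hL, fun h => hvL L hL (h hv)⟩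
  have hadj : ∀ L ∈ 𝒦, ∃ w ∈ L, Adj k v w := by
    intro L hL
    by_contra! hno
    have := hlink L (hsub L hL) (h𝒦.nonempty L hL) fun x hx y hy hxy => by
      refine h𝒦.closed L hL x hx y (Finset.mem_erase.2 ⟨?_, hy⟩) hxy
      rintro rfl
      exact hno x hx hxy.symm
    exact hvL L hL (this ▸ hv)
  have hex : ∀ L : Finset (Pt × Pt), ∃ E : Finset (Pt × Pt), L ∈ 𝒦 → Even L.card →
      (E : Set (Pt × Pt)) ⊆ reflexEdges P ∧ (∀ w ∈ L, Seen P E w) ∧ 2 * E.card ≤ L.card := by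
    intro L
    by_cases h : L ∈ 𝒦 ∧ Even L.card
    · obtain ⟨E, h1, h2, h3⟩ := IH L ((hsub L h.1).trans hK) (h𝒦.linked L h.1)
        ((hlt L h.1).trans_le hN) (h𝒦.nonempty L h.1)
      refine ⟨E, fun _ _ => ⟨h1, h2, ?_⟩⟩
      obtain ⟨m, hm⟩ := h.2
      omega
    · exact ⟨∅, fun h1 h2 => absurd ⟨h1, h2⟩ h⟩
  choose E hE using hex
  refine ⟨𝒦.filter fun L => ¬ Even L.card, (𝒦.filter fun L => Even L.card).biUnion E, ?_, ?_, ?_,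
    ?_, ?_, ?_⟩
  · intro e he
    obtain ⟨L, hL, heL⟩ := Finset.mem_biUnion.1 (Finset.mem_coe.1 he)
    obtain ⟨h1, h2⟩ := Finset.mem_filter.1 hL
    exact (hE L h1 h2).1 (Finset.mem_coe.2 heL)
  · intro L hL
    obtain ⟨h1, h2⟩ := Finset.mem_filter.1 hL
    exact ⟨hsub L h1, hvL L h1, Nat.not_even_iff_odd.1 h2, h𝒦.linked L h1, hadj L h1⟩
  · intro L hL M hM
    exact h𝒦.disjoint L (Finset.mem_filter.1 hL).1 M (Finset.mem_filter.1 hM).1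
  · have h1 : 2 * ((𝒦.filter fun L => Even L.card).biUnion E).card ≤
        ∑ L ∈ 𝒦.filter (fun L => Even L.card), L.card := by
      calc _ ≤ 2 * ∑ L ∈ 𝒦.filter (fun L => Even L.card), (E L).card :=
            Nat.mul_le_mul_left _ Finset.card_biUnion_le
        _ ≤ _ := by
            rw [Finset.mul_sum]
            exact Finset.sum_le_sum fun L hL =>
              (hE L (Finset.mem_filter.1 hL).1 (Finset.mem_filter.1 hL).2).2.2
    have h2 := Finset.sum_filter_add_sum_filter_not 𝒦 (fun L => Even L.card) Finset.card
    rw [h𝒦.sum_card, Finset.card_erase_of_mem hv] at h2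
    have := Finset.card_pos.2 ⟨v, hv⟩
    omega
  · have h2 := h𝒦.sum_card
    rw [Finset.card_erase_of_mem hv] at h2
    have := Finset.card_pos.2 ⟨v, hv⟩
    have h3 : ∑ L ∈ 𝒦, L.card ≡ (𝒦.filter fun L => ¬ Even L.card).card [MOD 2] := by
      have : ∀ L ∈ 𝒦, L.card ≡ (if ¬ Even L.card then 1 else 0) [MOD 2] := by
        intro L _
        by_cases h : Even L.card
        · rw [if_neg (not_not.2 h)]; exact (Nat.even_iff.1 h)
        · rw [if_pos h]; exact (Nat.not_even_iff.1 h)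
      rw [Finset.card_filter]
      exact Nat.ModEq.sum this
    rw [h2] at h3
    unfold Nat.ModEq at h3
    rw [Nat.even_iff]
    omega
  · intro w hw
    by_cases hwv : w = v
    · exact Or.inl hwv
    right
    obtain ⟨L, hL, hwL⟩ := h𝒦.cover w (Finset.mem_erase.2 ⟨hwv, hw⟩)
    by_cases he : Even L.card
    · right
      exact ((hE L hL he).2.1 w hwL).mono
        (Finset.subset_biUnion_of_mem E (Finset.mem_filter.2 ⟨hL, he⟩))
    · exact Or.inl ⟨L, Finset.mem_filter.2 ⟨hL, he⟩, hwL⟩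

/-- A castle is a linked set `K` with an odd number of bricks that hangs at its brick `v` off a
parent `p ∉ K` of `v`. Apart from parts that are guarded separately, it consists of `v` only, or of
`v` and two castles hanging off `v` at opposite sides. -/
theorem castle_split (h : IsBrickComplex P k 𝓑) {N : ℕ} (IH : Guardable P k 𝓑 N)
    {K : Finset (Pt × Pt)} (hK : K ⊆ 𝓑) (hlink : Linked (Adj k) K) (hodd : Odd K.card)
    (hN : K.card ≤ N) {p v : Pt × Pt} (hv : v ∈ K) (hp : p ∈ 𝓑) (hpK : p ∉ K) {i : Fin 3}
    {s u : Bool} (hc : IsChild k p v i s u) :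
    ∃ E : Finset (Pt × Pt), (E : Set (Pt × Pt)) ⊆ reflexEdges P ∧
      ((2 * E.card + 1 ≤ K.card ∧ ∀ w ∈ K, w = v ∨ Seen P E w) ∨
      ∃ (i' : Fin 3) (L : Bool → Finset (Pt × Pt)) (w : Bool → Pt × Pt),
        (∀ t, L t ⊆ K ∧ v ∉ L t ∧ (L t).card < K.card ∧ Linked (Adj k) (L t) ∧ Odd (L t).card ∧
          w t ∈ L t ∧ IsChild k v (w t) i' t u) ∧
        2 * E.card + (L false).card + (L true).card + 1 ≤ K.card ∧
        ∀ x ∈ K, x = v ∨ (∃ t, x ∈ L t) ∨ Seen P E x) := by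
  classical
  obtain ⟨𝒪, E, hE, h𝒪, hdisj, hcard, hpar, hcov⟩ := remove_vertex IH hK hlink hN hv
  have hv𝓑 := hK hv
  refine ⟨E, hE, ?_⟩
  rcases 𝒪.eq_empty_or_nonempty with rfl | hne
  · left
    refine ⟨by simpa using hcard, fun w hw => ?_⟩
    rcases hcov w hw with h1 | ⟨L, hL, -⟩ | h1
    exacts [Or.inl h1, absurd hL (by simp), Or.inr h1]
  right
  choose! w hw using fun L hL => (h𝒪 L hL).2.2.2.2
  have hwK : ∀ L ∈ 𝒪, w L ∈ K := fun L hL => (h𝒪 L hL).1 (hw L hL).1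
  have hwne : ∀ L ∈ 𝒪, ∀ M ∈ 𝒪, L ≠ M → w L ≠ w M := fun L hL M hM hLM he =>
    Finset.disjoint_left.1 (hdisj L hL M hM hLM) (hw L hL).1 (he ▸ (hw M hM).1)
  have hadj := fun L hL => h.adj_of_child hp hv𝓑 (hK (hwK L hL))
    (fun e => hpK (e ▸ hwK L hL)) hc (hw L hL).2
  -- a single odd part is excluded by parity
  have h2 : 2 ≤ 𝒪.card := by
    have := Finset.card_pos.2 hne
    obtain ⟨a, ha⟩ := hodd
    obtain ⟨b, hb⟩ := hpar
    omega
  -- with at least two neighbours at the face of `v` opposite to `p`, all of them are children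
  have hchild : ∀ L ∈ 𝒪, ∃ i' s', IsChild k v (w L) i' s' u := by
    intro L hL
    refine (hadj L hL).resolve_right ?_
    rintro ⟨i', s', hbig⟩
    obtain ⟨M, hM, hML⟩ : ∃ M ∈ 𝒪, M ≠ L := Finset.exists_mem_ne (by omega) L
    have hlev : side (w L) k (!u) = side v k u := by
      have := hbig.level; rwa [Bool.not_not] at this
    obtain ⟨x, xv, xM, hlevM, hxk⟩ : ∃ x, x ∈ Icc v.1 v.2 ∧ x ∈ Icc (w M).1 (w M).2 ∧
        side (w M) k (!u) = side v k u ∧ x k = side v k u := by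
      rcases hadj M hM with ⟨i2, s2, hM2⟩ | ⟨i2, s2, hM2⟩
      · obtain ⟨x, x1, x2, x3⟩ := h.child_inter hv𝓑 (hK (hwK M hM)) hM2
        exact ⟨x, x1, x2, hM2.level.symm, x3.trans hM2.level.symm⟩
      · obtain ⟨x, x1, x2, x3⟩ := h.child_inter (hK (hwK M hM)) hv𝓑 hM2
        have := hM2.level
        rw [Bool.not_not] at this x3
        exact ⟨x, x2, x1, this, x3⟩
    refine hwne L hL M hM hML.symm (h.same_face (hK (hwK L hL)) (hK (hwK M hM))
      (hlev.trans hlevM.symm) ?_ xM)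
    exact hbig.mem_parent (h.lt _ (hK (hwK L hL)) k) xv (by rw [Bool.not_not]; exact hxk)
  choose! a b hab using hchild
  have hopp : ∀ L ∈ 𝒪, ∀ M ∈ 𝒪, L ≠ M → a L = a M ∧ b M = !b L := fun L hL M hM hLM =>
    h.children_opposite (hK (hwK L hL)) (hK (hwK M hM)) (hwne L hL M hM hLM) (hab L hL)
      (hab M hM)
  obtain ⟨X, hX, Y, hY, hXY⟩ := Finset.one_lt_card.1 (by omega : 1 < 𝒪.card)
  have hXYo := hopp X hX Y hY hXY
  -- the children on one face lie at opposite sides pairwise, so that there are at most two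
  have hall : ∀ M ∈ 𝒪, M = X ∨ M = Y := by
    intro M hM
    by_contra! hne
    have h1 := (hopp X hX M hM hne.1.symm).2
    have h2 := (hopp Y hY M hM hne.2.symm).2
    rw [h1, hXYo.2] at h2
    cases hb : b X <;> simp [hb] at h2
  have hO : 𝒪 = {X, Y} := by
    ext M
    simp only [Finset.mem_insert, Finset.mem_singleton]
    exact ⟨hall M, by rintro (rfl | rfl) <;> assumption⟩
  have hsum : ∑ L ∈ 𝒪, L.card = X.card + Y.card := by rw [hO, Finset.sum_pair hXY]
  let L : Bool → Finset (Pt × Pt) := fun t => if t = b X then X else Y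
  have hL : ∀ t, L t ∈ 𝒪 ∧ b (L t) = t ∧ a (L t) = a X := by
    intro t
    by_cases ht : t = b X
    · have e : L t = X := if_pos ht
      rw [e]; exact ⟨hX, ht.symm, rfl⟩
    · have e : L t = Y := if_neg ht
      rw [e]; refine ⟨hY, ?_, hXYo.1.symm⟩
      rw [hXYo.2]; cases t <;> cases hb : b X <;> simp_all
  have hLs : (L false).card + (L true).card = X.card + Y.card := by
    cases hb : b X <;> simp [L, hb, add_comm]
  refine ⟨a X, L, fun t => w (L t), fun t => ?_, by omega, fun x hx => ?_⟩
  · obtain ⟨h1, h2, h3⟩ := hL t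
    obtain ⟨c1, c2, c3, c4, -⟩ := h𝒪 _ h1
    refine ⟨c1, c2, Finset.card_lt_card ⟨c1, fun hs => c2 (hs hv)⟩, c4, c3, (hw _ h1).1, ?_⟩
    have := hab _ h1
    rwa [h2, h3] at this
  · rcases hcov x hx with h1 | ⟨M, hM, hxM⟩ | h1
    · exact Or.inl h1
    · right; left
      rcases hall M hM with rfl | rfl
      · exact ⟨b M, by simpa [L] using hxM⟩
      · exact ⟨!b X, by simpa [L] using hxM⟩
    · exact Or.inr (Or.inr h1)

theorem seen_insert_self {e : Pt × Pt} {E : Finset (Pt × Pt)} {w : Pt × Pt} [DecidableEq (Pt × Pt)]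
    (h : EdgeSeesBox P e w) : Seen P (insert e E) w :=
  ⟨e, Finset.mem_insert_self _ _, h⟩

/-- A castle whose lowest brick `v` has a guard along one of its sides needs only half as many
further guards as it has further bricks. -/
theorem castle_side (h : IsBrickComplex P k 𝓑) {N : ℕ} (IH : Guardable P k 𝓑 N) :
    ∀ n, ∀ {K : Finset (Pt × Pt)}, K.card = n → K ⊆ 𝓑 → Linked (Adj k) K → Odd K.card →
      K.card ≤ N → ∀ {p v : Pt × Pt}, v ∈ K → p ∈ 𝓑 → p ∉ K → ∀ {i : Fin 3} {s u : Bool},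
      IsChild k p v i s u → ∀ {e : Pt × Pt} {i' : Fin 3} {s' : Bool}, i' ≠ k →
      LineGuard P k e v i' (side v i' s') u →
      ∃ E : Finset (Pt × Pt), (E : Set (Pt × Pt)) ⊆ reflexEdges P ∧ 2 * E.card + 1 ≤ K.card ∧
        ∀ w ∈ K, EdgeSeesBox P e w ∨ Seen P E w := by
  classical
  intro n
  induction n using Nat.strong_induction_on with
  | _ n ih =>
    intro K hn hK hlink hodd hN p v hv hp hpK i s u hc e i' s' hik hguard
    have hv𝓑 := hK hv
    have lv := h.lt v hv𝓑
    have hev := hguard.sees hik lv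
    obtain ⟨E, hE, hleaf | ⟨j, L, w, hLw, hcard, hcov⟩⟩ :=
      h.castle_split IH hK hlink hodd hN hv hp hpK hc
    · refine ⟨E, hE, hleaf.1, fun w hw => ?_⟩
      rcases hleaf.2 w hw with rfl | h1
      exacts [Or.inl hev, Or.inr h1]
    · -- a child that shares the side inherits the guard, the other one gets its own edge
      have inherit : ∀ t, (i' ≠ j ∨ s' ≠ t) → ∃ E' : Finset (Pt × Pt),
          (E' : Set (Pt × Pt)) ⊆ reflexEdges P ∧ 2 * E'.card + 1 ≤ (L t).card ∧
          ∀ x ∈ L t, EdgeSeesBox P e x ∨ Seen P E' x := by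
        intro t ht
        obtain ⟨c1, c2, c3, c4, c5, c6, c7⟩ := hLw t
        have lw := h.lt (w t) (hK (c1 c6))
        exact ih (L t).card (by omega) rfl (c1.trans hK) c4 c5 (by omega) c6 hv𝓑 c2 c7 hik
          (c7.lineGuard_side (lv k) lw (h.box_subset (hK (c1 c6))) hik ht hguard)
      have own : ∀ t, ∃ E' : Finset (Pt × Pt),
          (E' : Set (Pt × Pt)) ⊆ reflexEdges P ∧ 2 * E'.card ≤ (L t).card + 1 ∧
          ∀ x ∈ L t, EdgeSeesBox P e x ∨ Seen P E' x := by
        intro t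
        obtain ⟨c1, c2, c3, c4, c5, c6, c7⟩ := hLw t
        have lw := h.lt (w t) (hK (c1 c6))
        obtain ⟨e', he', hg', -, -⟩ := h.exists_own_guard hv𝓑 (hK (c1 c6)) c7
        obtain ⟨E', d1, d2, d3⟩ := ih (L t).card (by omega) rfl (c1.trans hK) c4 c5 (by omega) c6
          hv𝓑 c2 c7 c7.ne hg'
        refine ⟨insert e' E', ?_, ?_, fun x hx => Or.inr ?_⟩
        · rw [Finset.coe_insert]; exact insert_subset he' d1
        · have := Finset.card_insert_le e' E'; omega
        · rcases d3 x hx with h1 | h1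
          exacts [seen_insert_self h1, h1.mono (Finset.subset_insert _ _)]
      obtain ⟨Ef, Et, f1, t1, hsum, f3, t3⟩ : ∃ Ef Et : Finset (Pt × Pt),
          (Ef : Set (Pt × Pt)) ⊆ reflexEdges P ∧ (Et : Set (Pt × Pt)) ⊆ reflexEdges P ∧
          2 * Ef.card + 2 * Et.card ≤ (L false).card + (L true).card ∧
          (∀ x ∈ L false, EdgeSeesBox P e x ∨ Seen P Ef x) ∧
          ∀ x ∈ L true, EdgeSeesBox P e x ∨ Seen P Et x := by
        cases s'
        · obtain ⟨A, a1, a2, a3⟩ := own false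
          obtain ⟨B, b1, b2, b3⟩ := inherit true (Or.inr (by simp))
          exact ⟨A, B, a1, b1, by omega, a3, b3⟩
        · obtain ⟨A, a1, a2, a3⟩ := inherit false (Or.inr (by simp))
          obtain ⟨B, b1, b2, b3⟩ := own true
          exact ⟨A, B, a1, b1, by omega, a3, b3⟩
      refine ⟨E ∪ (Ef ∪ Et), ?_, ?_, fun x hx => ?_⟩
      · rw [Finset.coe_union, Finset.coe_union]
        exact union_subset hE (union_subset f1 t1)
      · have := Finset.card_union_le E (Ef ∪ Et)
        have := Finset.card_union_le Ef Et
        omega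
      · rcases hcov x hx with rfl | ⟨t, ht⟩ | h1
        · exact Or.inl hev
        · cases t
          · exact (f3 x ht).imp_right fun h => h.mono (by
              intro y hy; simp [hy])
          · exact (t3 x ht).imp_right fun h => h.mono (by
              intro y hy; simp [hy])
        · exact Or.inr (h1.mono (Finset.subset_union_left))

/-- A castle that uses the reflex edge at its lowest brick `v` also guards the parent of `v`. -/
theorem castle_own (h : IsBrickComplex P k 𝓑) {N : ℕ} (IH : Guardable P k 𝓑 N)
    {K : Finset (Pt × Pt)} (hK : K ⊆ 𝓑) (hlink : Linked (Adj k) K) (hodd : Odd K.card)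
    (hN : K.card ≤ N) {p v : Pt × Pt} (hv : v ∈ K) (hp : p ∈ 𝓑) (hpK : p ∉ K) {i : Fin 3}
    {s u : Bool} (hc : IsChild k p v i s u) :
    ∃ E : Finset (Pt × Pt), (E : Set (Pt × Pt)) ⊆ reflexEdges P ∧ 2 * E.card ≤ K.card + 1 ∧
      Seen P E p ∧ ∀ w ∈ K, Seen P E w := by
  classical
  obtain ⟨e, he, hg, hep, -⟩ := h.exists_own_guard hp (hK hv) hc
  obtain ⟨E, d1, d2, d3⟩ := h.castle_side IH _ rfl hK hlink hodd hN hv hp hpK hc hc.ne hg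
  refine ⟨insert e E, ?_, ?_, seen_insert_self hep, fun x hx => ?_⟩
  · rw [Finset.coe_insert]; exact insert_subset he d1
  · have := Finset.card_insert_le e E; omega
  · rcases d3 x hx with h1 | h1
    exacts [seen_insert_self h1, h1.mono (Finset.subset_insert _ _)]

/-- If a castle branches orthogonally to the side at which its own edge lies, the own edge serves
both branches. -/
theorem castle_cross (h : IsBrickComplex P k 𝓑) {N : ℕ} (IH : Guardable P k 𝓑 N)
    {K : Finset (Pt × Pt)} (hK : K ⊆ 𝓑) (hN : K.card ≤ N) {p v : Pt × Pt} (hv : v ∈ K)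
    (hp : p ∈ 𝓑) {i : Fin 3} {s u : Bool} (hc : IsChild k p v i s u)
    {E : Finset (Pt × Pt)} (hE : (E : Set (Pt × Pt)) ⊆ reflexEdges P) {j : Fin 3}
    {L : Bool → Finset (Pt × Pt)} {w : Bool → Pt × Pt}
    (hLw : ∀ t, L t ⊆ K ∧ v ∉ L t ∧ (L t).card < K.card ∧ Linked (Adj k) (L t) ∧ Odd (L t).card ∧
          w t ∈ L t ∧ IsChild k v (w t) j t u)
    (hcard : 2 * E.card + (L false).card + (L true).card + 1 ≤ K.card)
    (hcov : ∀ x ∈ K, x = v ∨ (∃ t, x ∈ L t) ∨ Seen P E x) (hij : i ≠ j) :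
    ∃ E' : Finset (Pt × Pt), (E' : Set (Pt × Pt)) ⊆ reflexEdges P ∧ 2 * E'.card + 1 ≤ K.card ∧
      ∀ x ∈ K, Seen P E' x := by
  classical
  have hv𝓑 := hK hv
  have lv := h.lt v hv𝓑
  obtain ⟨e, he, hg, -, -⟩ := h.exists_own_guard hp hv𝓑 hc
  have inherit : ∀ t, ∃ E' : Finset (Pt × Pt),
      (E' : Set (Pt × Pt)) ⊆ reflexEdges P ∧ 2 * E'.card + 1 ≤ (L t).card ∧
      ∀ x ∈ L t, EdgeSeesBox P e x ∨ Seen P E' x := by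
    intro t
    obtain ⟨c1, c2, c3, c4, c5, c6, c7⟩ := hLw t
    have lw := h.lt (w t) (hK (c1 c6))
    exact h.castle_side IH _ rfl (c1.trans hK) c4 c5 (by omega) c6 hv𝓑 c2 c7 hc.ne
      (c7.lineGuard_side (lv k) lw (h.box_subset (hK (c1 c6))) hc.ne (Or.inl hij) hg)
  choose F f1 f2 f3 using inherit
  refine ⟨insert e (E ∪ (F false ∪ F true)), ?_, ?_, fun x hx => ?_⟩
  · rw [Finset.coe_insert, Finset.coe_union, Finset.coe_union]
    exact insert_subset he (union_subset hE (union_subset (f1 _) (f1 _)))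
  · have := Finset.card_insert_le e (E ∪ (F false ∪ F true))
    have := Finset.card_union_le E (F false ∪ F true)
    have := Finset.card_union_le (F false) (F true)
    have := f2 false
    have := f2 true
    omega
  · rcases hcov x hx with rfl | ⟨t, ht⟩ | h1
    · exact seen_insert_self (hg.sees hc.ne lv)
    · rcases f3 t x ht with h2 | h2
      · exact seen_insert_self h2
      · refine h2.mono fun y hy => ?_
        cases t <;> simp [hy]
    · exact h1.mono fun y hy => by simp [hy]

/-- A castle with a guard along a line across its lowest brick `v`, orthogonal to the reflex edge
at `v`, needs only half as many further guards as it has further bricks. -/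
theorem castle_line (h : IsBrickComplex P k 𝓑) {N : ℕ} (IH : Guardable P k 𝓑 N) :
    ∀ n, ∀ {K : Finset (Pt × Pt)}, K.card = n → K ⊆ 𝓑 → Linked (Adj k) K → Odd K.card →
      K.card ≤ N → ∀ {p v : Pt × Pt}, v ∈ K → p ∈ 𝓑 → p ∉ K → ∀ {i : Fin 3} {s u : Bool},
      IsChild k p v i s u → ∀ {e : Pt × Pt} {i' : Fin 3} {x : ℝ}, i' ≠ k → i' ≠ i →
      v.1 i' ≤ x ∧ x ≤ v.2 i' → LineGuard P k e v i' x u →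
      ∃ E : Finset (Pt × Pt), (E : Set (Pt × Pt)) ⊆ reflexEdges P ∧ 2 * E.card + 1 ≤ K.card ∧
        ∀ w ∈ K, EdgeSeesBox P e w ∨ Seen P E w := by
  classical
  intro n
  induction n using Nat.strong_induction_on with
  | _ n ih =>
    intro K hn hK hlink hodd hN p v hv hp hpK i s u hc e i' x hik hne hx hguard
    have hv𝓑 := hK hv
    have lv := h.lt v hv𝓑
    have hev := hguard.sees hik lv
    obtain ⟨E, hE, hleaf | ⟨j, L, w, hLw, hcard, hcov⟩⟩ :=
      h.castle_split IH hK hlink hodd hN hv hp hpK hc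
    · refine ⟨E, hE, hleaf.1, fun w hw => ?_⟩
      rcases hleaf.2 w hw with rfl | h1
      exacts [Or.inl hev, Or.inr h1]
    by_cases hij : i = j
    · subst hij
      -- Both children meet the line of the guard. One of them inherits the guard, the other one uses
      -- the reflex edge between itself and `v`.
      obtain ⟨A, a1, a2, a3⟩ : ∃ A : Finset (Pt × Pt), (A : Set (Pt × Pt)) ⊆ reflexEdges P ∧
          2 * A.card + 1 ≤ (L false).card ∧ ∀ y ∈ L false, EdgeSeesBox P e y ∨ Seen P A y := by
        obtain ⟨c1, c2, c3, c4, c5, c6, c7⟩ := hLw false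
        have lw := h.lt _ (hK (c1 c6))
        have e1 := c7.side_eq i' false hik (Or.inl hne)
        have e2 := c7.side_eq i' true hik (Or.inl hne)
        simp only [side_false, side_true] at e1 e2
        have hx' : (w false).1 i' ≤ x ∧ x ≤ (w false).2 i' := by rw [e1, e2]; exact hx
        exact ih _ (by omega) rfl (c1.trans hK) c4 c5 (by omega) c6 hv𝓑 c2 c7 hik hne hx'
          (c7.lineGuard (lv k) (lw k) (h.box_subset (hK (c1 c6))) hik hx' hguard)
      obtain ⟨B, b1, b2, -, b3⟩ := by
        obtain ⟨c1, c2, c3, c4, c5, c6, c7⟩ := hLw true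
        exact h.castle_own IH (c1.trans hK) c4 c5 (by omega) c6 hv𝓑 c2 c7
      refine ⟨E ∪ (A ∪ B), ?_, ?_, fun y hy => ?_⟩
      · rw [Finset.coe_union, Finset.coe_union]
        exact union_subset hE (union_subset a1 b1)
      · have := Finset.card_union_le E (A ∪ B)
        have := Finset.card_union_le A B
        omega
      · rcases hcov y hy with rfl | ⟨t, ht⟩ | h1
        · exact Or.inl hev
        · cases t
          · exact (a3 y ht).imp_right fun h => h.mono fun z hz => by simp [hz]
          · exact Or.inr ((b3 y ht).mono fun z hz => by simp [hz])
        · exact Or.inr (h1.mono Finset.subset_union_left)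
    · obtain ⟨E', d1, d2, d3⟩ := h.castle_cross IH hK hN hv hp hc hE hLw hcard hcov hij
      exact ⟨E', d1, d2, fun y hy => Or.inr (d3 y hy)⟩

end IsBrickComplex

/-! ### Pairs of castles on opposite faces -/

/-- The bricks `v` and `w` grow in the opposite directions `u` and `!u`, their horizontal extents
differ at most in the side `(i, s)`, and their facing sides see each other. -/
structure Facing (P : Set Pt) (k : Fin 3) (v w : Pt × Pt) (i : Fin 3) (s u : Bool) : Prop where
  behind_left : ∀ g : Pt, g k = side w k u → Behind k v u g
  behind_right : ∀ g : Pt, g k = side v k (!u) → Behind k w (!u) g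
  side_eq : ∀ l t, l ≠ k → (l ≠ i ∨ t ≠ s) → side v l t = side w l t
  sees : ∀ x y : Pt, x k = side v k (!u) → y k = side w k u → ∀ b, b = v ∨ b = w →
    (∀ l, l ≠ k → (b.1 l ≤ x l ∧ x l ≤ b.2 l) ∧ (b.1 l ≤ y l ∧ y l ≤ b.2 l)) → segment ℝ x y ⊆ P

namespace Facing

variable {P : Set Pt} {k : Fin 3} {v w : Pt × Pt} {i : Fin 3} {s u : Bool}

theorem symm (h : Facing P k v w i s u) : Facing P k w v i s (!u) where
  behind_left := h.behind_right
  behind_right g hg := by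
    rw [Bool.not_not] at hg ⊢
    exact h.behind_left g hg
  side_eq l t hl ht := (h.side_eq l t hl ht).symm
  sees x y hx hy b hb hxy := by
    rw [Bool.not_not] at hx
    rw [segment_symm]
    exact h.sees y x hy hx b hb.symm fun l hl => (hxy l hl).symm

/-- Points on the facing side of the smaller brick see all of the larger one. -/
theorem seesBox (h : Facing P k v w i s u) (hv : v.1 k < v.2 k) (hvP : Icc v.1 v.2 ⊆ P) {y : Pt}
    (hyk : y k = side w k u) (hy : ∀ l, l ≠ k → v.1 l ≤ y l ∧ y l ≤ v.2 l) : SeesBox P y v := by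
  intro q hq
  obtain ⟨m, hm, hmk⟩ := exists_mem_segment_level
    (behind_level (h.behind_left y hyk) (mem_box.1 hq k))
  have mh : ∀ l, l ≠ k → v.1 l ≤ m l ∧ m l ≤ v.2 l := fun l hl =>
    mem_segment_apply hm (hy l hl) (mem_box.1 hq l)
  have mv : m ∈ Icc v.1 v.2 := mem_box.2 fun l => by
    by_cases hl : l = k
    · subst hl; rw [hmk]; exact side_bounds hv _
    · exact mh l hl
  refine (segment_subset_of_mem hm).trans (union_subset ?_
    (((convex_box v).segment_subset mv hq).trans hvP))
  rw [segment_symm]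
  exact h.sees m y hmk hyk v (Or.inl rfl) fun l hl => ⟨mh l hl, hy l hl⟩

/-- A child of the larger brick at the same side faces the smaller brick. -/
theorem child (h : Facing P k v w i s u) (hv : v.1 k < v.2 k) (hvP : Icc v.1 v.2 ⊆ P)
    (hsub : ∀ l, l ≠ k → v.1 l ≤ w.1 l ∧ w.2 l ≤ v.2 l) {c : Pt × Pt}
    (hc : IsChild k v c i s u) (hck : c.1 k < c.2 k) : Facing P k c w i s u where
  behind_left g hg := by
    have h1 := h.behind_left g hg
    have h2 := hc.level
    cases u
    · simp only [Behind, cond_false, side_false, Bool.not_false, side_true] at h1 h2 ⊢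
      linarith
    · simp only [Behind, cond_true, side_true, Bool.not_true, side_false] at h1 h2 ⊢
      linarith
  behind_right g hg := by
    have h1 := h.behind_right (Function.update g k (side v k (!u))) (by simp)
    have h2 := hc.level
    cases u
    · simp only [Behind, Bool.not_false, cond_true, side_false, side_true,
        Function.update_self] at h1 h2 hg ⊢
      linarith
    · simp only [Behind, Bool.not_true, cond_false, side_false, side_true,
        Function.update_self] at h1 h2 hg ⊢
      linarith
  side_eq l t hl ht := (hc.side_eq l t hl ht).trans (h.side_eq l t hl ht)
  sees x y hx hy b hb hxy := by
    have hxy' : ∀ l, l ≠ k → (v.1 l ≤ x l ∧ x l ≤ v.2 l) ∧ (v.1 l ≤ y l ∧ y l ≤ v.2 l) := by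
      intro l hl
      have h1 := hxy l hl
      have h2 : v.1 l ≤ b.1 l ∧ b.2 l ≤ v.2 l := by
        rcases hb with rfl | rfl
        exacts [hc.sub l hl, hsub l hl]
      exact ⟨⟨h2.1.trans h1.1.1, h1.1.2.trans h2.2⟩, h2.1.trans h1.2.1, h1.2.2.trans h2.2⟩
    have xv : x ∈ Icc v.1 v.2 := mem_box.2 fun l => by
      by_cases hl : l = k
      · subst hl; rw [hx, ← hc.level]; exact side_bounds hv _
      · exact (hxy' l hl).1
    rw [segment_symm]
    exact h.seesBox hv hvP hy (fun l hl => (hxy' l hl).2) x xv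

end Facing

namespace IsBrickComplex

variable {P : Set Pt} {k : Fin 3} {𝓑 : Finset (Pt × Pt)}

set_option maxHeartbeats 1000000 in
/-- Two castles that grow in opposite directions from facing bricks save a guard: the larger one
of the facing bricks is seen from the reflex edge at the smaller one. -/
theorem castle_facing (h : IsBrickComplex P k 𝓑) {N : ℕ} (IH : Guardable P k 𝓑 N)
    {i : Fin 3} {s : Bool} : ∀ n, ∀ {K K' : Finset (Pt × Pt)}, K.card + K'.card = n →
      K ⊆ 𝓑 → Linked (Adj k) K → Odd K.card → K.card ≤ N →
      K' ⊆ 𝓑 → Linked (Adj k) K' → Odd K'.card → K'.card ≤ N →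
      ∀ {p v p' v' : Pt × Pt}, v ∈ K → p ∈ 𝓑 → p ∉ K → v' ∈ K' → p' ∈ 𝓑 → p' ∉ K' →
      ∀ {u : Bool}, IsChild k p v i s u → IsChild k p' v' i s (!u) → Facing P k v v' i s u →
      ∃ E : Finset (Pt × Pt), (E : Set (Pt × Pt)) ⊆ reflexEdges P ∧
        2 * E.card ≤ K.card + K'.card ∧ (∀ w ∈ K, Seen P E w) ∧ ∀ w ∈ K', Seen P E w := by
  classical
  intro n
  induction n using Nat.strong_induction_on with
  | _ n ih =>
    -- by symmetry, the brick `v` may be assumed to be the larger one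
    have key : ∀ {K K' : Finset (Pt × Pt)}, K.card + K'.card = n →
        K ⊆ 𝓑 → Linked (Adj k) K → Odd K.card → K.card ≤ N →
        K' ⊆ 𝓑 → Linked (Adj k) K' → Odd K'.card → K'.card ≤ N →
        ∀ {p v p' v' : Pt × Pt}, v ∈ K → p ∈ 𝓑 → p ∉ K → v' ∈ K' → p' ∈ 𝓑 → p' ∉ K' →
        ∀ {u : Bool}, IsChild k p v i s u → IsChild k p' v' i s (!u) → Facing P k v v' i s u →
        (∀ l, l ≠ k → v.1 l ≤ v'.1 l ∧ v'.2 l ≤ v.2 l) →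
        ∃ E : Finset (Pt × Pt), (E : Set (Pt × Pt)) ⊆ reflexEdges P ∧
          2 * E.card ≤ K.card + K'.card ∧ (∀ w ∈ K, Seen P E w) ∧ ∀ w ∈ K', Seen P E w := by
      intro K K' hn hK hl ho hN hK' hl' ho' hN' p v p' v' hv hp hpK hv' hp' hpK' u hc hc' hf hsub
      have lv := h.lt v (hK hv)
      obtain ⟨E, hE, hleaf | ⟨j, L, w, hLw, hcard, hcov⟩⟩ :=
        h.castle_split IH hK hl ho hN hv hp hpK hc
      -- no smaller castles on `v`: the reflex edge at `v'` also sees `v`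
      · obtain ⟨e, he, hg, -, ⟨y, hye, hyv, hyk⟩, -⟩ := h.exists_own_guard hp' (hK' hv') hc'
        obtain ⟨E', d1, d2, d3⟩ :=
          h.castle_side IH _ rfl hK' hl' ho' hN' hv' hp' hpK' hc' hc'.ne hg
        have hev : EdgeSeesBox P e v := fun q hq => ⟨y, hye, hf.seesBox (lv k)
          (h.box_subset (hK hv)) (by simpa using hyk) (fun l hlk =>
            ⟨(hsub l hlk).1.trans (mem_box.1 hyv l).1, (mem_box.1 hyv l).2.trans (hsub l hlk).2⟩)
          q hq⟩
        refine ⟨insert e (E ∪ E'), ?_, ?_, fun x hx => ?_, fun x hx => ?_⟩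
        · rw [Finset.coe_insert, Finset.coe_union]
          exact insert_subset he (union_subset hE d1)
        · have := Finset.card_insert_le e (E ∪ E')
          have := Finset.card_union_le E E'
          omega
        · rcases hleaf.2 x hx with rfl | h1
          · exact seen_insert_self hev
          · exact h1.mono fun z hz => by simp [hz]
        · rcases d3 x hx with h1 | h1
          · exact seen_insert_self h1
          · exact h1.mono fun z hz => by simp [hz]
      by_cases hij : i = j
      · subst hij
        -- The child at the side `s` still faces `v'`, so that induction applies to it. The other child
        -- uses the reflex edge between itself and `v`, which also sees `v`.
        obtain ⟨A, a1, a2, a3, a4⟩ := by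
          obtain ⟨c1, c2, c3, c4, c5, c6, c7⟩ := hLw s
          exact ih ((L s).card + K'.card) (by omega) rfl (c1.trans hK) c4 c5 (by omega) hK' hl' ho'
            hN' c6 (hK hv) c2 hv' hp' hpK' c7 hc'
            (hf.child (lv k) (h.box_subset (hK hv)) hsub c7 (h.lt _ (hK (c1 c6)) k))
        obtain ⟨B, b1, b2, bv, b3⟩ := by
          obtain ⟨c1, c2, c3, c4, c5, c6, c7⟩ := hLw (!s)
          exact h.castle_own IH (c1.trans hK) c4 c5 (by omega) c6 (hK hv) c2 c7
        have hsum : (L s).card + (L !s).card = (L false).card + (L true).card := by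
          cases s <;> simp [add_comm]
        refine ⟨E ∪ (A ∪ B), ?_, ?_, fun x hx => ?_, fun x hx => ?_⟩
        · rw [Finset.coe_union, Finset.coe_union]
          exact union_subset hE (union_subset a1 b1)
        · have := Finset.card_union_le E (A ∪ B)
          have := Finset.card_union_le A B
          omega
        · rcases hcov x hx with rfl | ⟨t, ht⟩ | h1
          · exact bv.mono fun z hz => by simp [hz]
          · by_cases hts : t = s
            · subst hts
              exact (a3 x ht).mono fun z hz => by simp [hz]
            · obtain rfl : t = !s := by cases t <;> cases s <;> simp_all
              exact (b3 x ht).mono fun z hz => by simp [hz]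
          · exact h1.mono fun z hz => by simp [hz]
        · exact (a4 x hx).mono fun z hz => by simp [hz]
      -- `K` branches orthogonally to its own edge, and so it needs no help from `K'`
      · obtain ⟨A, a1, a2, a3⟩ := h.castle_cross IH hK hN hv hp hc hE hLw hcard hcov hij
        obtain ⟨B, b1, b2, -, b3⟩ := h.castle_own IH hK' hl' ho' hN' hv' hp' hpK' hc'
        refine ⟨A ∪ B, ?_, ?_, fun x hx => ?_, fun x hx => ?_⟩
        · rw [Finset.coe_union]; exact union_subset a1 b1
        · have := Finset.card_union_le A B
          omega
        · exact (a3 x hx).mono Finset.subset_union_left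
        · exact (b3 x hx).mono Finset.subset_union_right
    intro K K' hn hK hl ho hN hK' hl' ho' hN' p v p' v' hv hp hpK hv' hp' hpK' u hc hc' hf
    have hor : (∀ l, l ≠ k → v.1 l ≤ v'.1 l ∧ v'.2 l ≤ v.2 l) ∨
        ∀ l, l ≠ k → v'.1 l ≤ v.1 l ∧ v.2 l ≤ v'.2 l := by
      have e1 : ∀ l, l ≠ k → (l ≠ i ∨ false ≠ s) → v.1 l = v'.1 l := fun l => hf.side_eq l false
      have e2 : ∀ l, l ≠ k → (l ≠ i ∨ true ≠ s) → v.2 l = v'.2 l := fun l => hf.side_eq l true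
      cases s
      · rcases le_total (v.1 i) (v'.1 i) with h1 | h1
        · refine Or.inl fun l hlk => ⟨?_, (e2 l hlk (by simp)).ge⟩
          by_cases hli : l = i
          exacts [hli ▸ h1, (e1 l hlk (Or.inl hli)).le]
        · refine Or.inr fun l hlk => ⟨?_, (e2 l hlk (by simp)).le⟩
          by_cases hli : l = i
          exacts [hli ▸ h1, (e1 l hlk (Or.inl hli)).ge]
      · rcases le_total (v.2 i) (v'.2 i) with h1 | h1
        · refine Or.inr fun l hlk => ⟨(e1 l hlk (by simp)).ge, ?_⟩
          by_cases hli : l = i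
          exacts [hli ▸ h1, (e2 l hlk (Or.inl hli)).le]
        · refine Or.inl fun l hlk => ⟨(e1 l hlk (by simp)).le, ?_⟩
          by_cases hli : l = i
          exacts [hli ▸ h1, (e2 l hlk (Or.inl hli)).ge]
    rcases hor with h1 | h1
    · exact key hn hK hl ho hN hK' hl' ho' hN' hv hp hpK hv' hp' hpK' hc hc' hf h1
    · obtain ⟨E, d1, d2, d3, d4⟩ := key ((add_comm _ _).trans hn) hK' hl' ho' hN' hK hl ho hN hv'
        hp' hpK' hv hp hpK hc' (by rwa [Bool.not_not]) hf.symm h1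
      exact ⟨E, d1, by omega, d4, d3⟩

/-- Two castles on opposite faces of a brick `A` save a guard, unless they lie at opposite sides
of `A`. -/
theorem castle_pair (h : IsBrickComplex P k 𝓑) {N : ℕ} (IH : Guardable P k 𝓑 N)
    {K K' : Finset (Pt × Pt)} (hK : K ⊆ 𝓑) (hl : Linked (Adj k) K) (ho : Odd K.card)
    (hN : K.card ≤ N) (hK' : K' ⊆ 𝓑) (hl' : Linked (Adj k) K') (ho' : Odd K'.card)
    (hN' : K'.card ≤ N) {A v v' : Pt × Pt} (hA : A ∈ 𝓑) (hv : v ∈ K) (hAK : A ∉ K) (hv' : v' ∈ K')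
    (hAK' : A ∉ K') {i i' : Fin 3} {s s' u : Bool} (hc : IsChild k A v i s u)
    (hc' : IsChild k A v' i' s' (!u)) (hii : i = i' → s = s') :
    ∃ E : Finset (Pt × Pt), (E : Set (Pt × Pt)) ⊆ reflexEdges P ∧
      2 * E.card ≤ K.card + K'.card ∧ (∀ w ∈ K, Seen P E w) ∧ ∀ w ∈ K', Seen P E w := by
  classical
  have lA := h.lt A hA
  have lv := h.lt v (hK hv)
  have lv' := h.lt v' (hK' hv')
  have lev := hc.level
  have lev' := hc'.level
  rw [Bool.not_not] at lev'
  by_cases hi : i = i'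
  · subst hi
    obtain rfl := hii rfl
    -- the same side of `A`: the two children face each other across `A`
    refine h.castle_facing IH _ rfl hK hl ho hN hK' hl' ho' hN' hv hA hAK hv' hA hAK' hc hc'
      ⟨fun g hg => ?_, fun g hg => ?_, fun l t hlk ht => (hc.side_eq l t hlk ht).trans
        (hc'.side_eq l t hlk ht).symm, fun x y hx hy b hb hxy => ?_⟩
    · have := lA k
      cases u
      · simp only [Behind, cond_false, side_false, Bool.not_false, side_true] at lev lev' hg ⊢
        linarith
      · simp only [Behind, cond_true, side_false, Bool.not_true, side_true] at lev lev' hg ⊢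
        linarith
    · have := lA k
      cases u
      · simp only [Behind, cond_true, side_false, Bool.not_false, side_true] at lev lev' hg ⊢
        linarith
      · simp only [Behind, cond_false, side_false, Bool.not_true, side_true] at lev lev' hg ⊢
        linarith
    · have hb' : ∀ l, l ≠ k → A.1 l ≤ b.1 l ∧ b.2 l ≤ A.2 l := by
        rcases hb with rfl | rfl
        exacts [hc.sub, hc'.sub]
      refine ((convex_box A).segment_subset (mem_box.2 fun l => ?_) (mem_box.2 fun l => ?_)).trans
        (h.box_subset hA) <;> by_cases hlk : l = k
      · subst hlk; rw [hx, ← lev]; exact side_bounds (lA _) _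
      · exact ⟨(hb' l hlk).1.trans (hxy l hlk).1.1, (hxy l hlk).1.2.trans (hb' l hlk).2⟩
      · subst hlk; rw [hy, ← lev']; exact side_bounds (lA _) _
      · exact ⟨(hb' l hlk).1.trans (hxy l hlk).2.1, (hxy l hlk).2.2.trans (hb' l hlk).2⟩
  -- different axes: the reflex edge at `v'`, seen through `A`, is a guard along a line across `v`
  · obtain ⟨e, he, hg, -, -, hgA⟩ := h.exists_own_guard hA (hK' hv') hc'
    rw [Bool.not_not] at hgA
    have e1 := hc.side_eq i' false hc'.ne (Or.inl (Ne.symm hi))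
    have e2 := hc.side_eq i' true hc'.ne (Or.inl (Ne.symm hi))
    simp only [side_false, side_true] at e1 e2
    have hsub := hc'.sub i' hc'.ne
    have hsb := side_bounds (lv' i') s'
    have hx : v.1 i' ≤ side v' i' s' ∧ side v' i' s' ≤ v.2 i' := by
      rw [e1, e2]; exact ⟨hsub.1.trans hsb.1, hsb.2.trans hsub.2⟩
    obtain ⟨E, d1, d2, d3⟩ := h.castle_line IH _ rfl hK hl ho hN hv hA hAK hc hc'.ne (Ne.symm hi) hx
      (hc.lineGuard (lA k) (lv k) (h.box_subset (hK hv)) hc'.ne hx hgA)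
    obtain ⟨E', d1', d2', d3'⟩ :=
      h.castle_side IH _ rfl hK' hl' ho' hN' hv' hA hAK' hc' hc'.ne hg
    refine ⟨insert e (E ∪ E'), ?_, ?_, fun x hx => ?_, fun x hx => ?_⟩
    · rw [Finset.coe_insert, Finset.coe_union]
      exact insert_subset he (union_subset d1 d1')
    · have := Finset.card_insert_le e (E ∪ E')
      have := Finset.card_union_le E E'
      omega
    · rcases d3 x hx with h1 | h1
      · exact seen_insert_self h1
      · exact h1.mono fun z hz => by simp [hz]
    · rcases d3' x hx with h1 | h1
      · exact seen_insert_self h1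
      · exact h1.mono fun z hz => by simp [hz]

/-! ### Guarding connected sets of bricks -/

set_option maxHeartbeats 1000000 in
/-- If each brick is seen by some reflex edge, then a connected set of `n` bricks is guarded by
`(n + 1) / 2` reflex edges. At a brick of maximal horizontal extent, at most four castles with an
odd number of bricks remain. If there are three or four, two of them on opposite faces save a
guard. -/
theorem guardable (h : IsBrickComplex P k 𝓑)
    (hsee : ∀ A ∈ 𝓑, ∃ e ∈ reflexEdges P, EdgeSeesBox P e A) : ∀ N, Guardable P k 𝓑 N := by
  classical
  intro N
  induction N with
  | zero => exact fun K _ _ hK => absurd hK (Nat.not_lt_zero _)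
  | succ N IH =>
    intro K hK hlink hN hne
    have hN : K.card ≤ N := Nat.lt_succ_iff.1 hN
    obtain ⟨A, hAK, hmax⟩ := K.exists_max_image
      (fun A => ∑ l ∈ Finset.univ.filter (· ≠ k), (A.2 l - A.1 l)) hne
    have hchild : ∀ w ∈ K, Adj k A w → ∃ i s u, IsChild k A w i s u := by
      rintro w hw ⟨i, s, u, hc | hc⟩
      · exact ⟨i, s, u, hc⟩
      · refine absurd (hmax w hw) (not_le.2 (Finset.sum_lt_sum (fun l hl => ?_)
          ⟨i, by simpa using hc.ne, ?_⟩))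
        · have := hc.sub l (by simpa using hl)
          linarith
        · have h1 := hc.sub i hc.ne
          have h2 := hc.side_ne
          cases s
          · simp only [side_false] at h2
            have := lt_of_le_of_ne h1.1 (Ne.symm h2)
            linarith
          · simp only [side_true] at h2
            have := lt_of_le_of_ne h1.2 h2
            linarith
    obtain ⟨𝒪, E, hE, h𝒪, hdisj, hcard, -, hcov⟩ := remove_vertex IH hK hlink hN hAK
    have hA := hK hAK
    have hw : ∀ L, ∃ w, L ∈ 𝒪 → w ∈ L ∧ ∃ i s u, IsChild k A w i s u := by
      intro L
      by_cases hL : L ∈ 𝒪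
      · obtain ⟨h1, h2, h3, h4, w, h5, h6⟩ := h𝒪 L hL
        exact ⟨w, fun _ => ⟨h5, hchild w (h1 h5) h6⟩⟩
      · exact ⟨A, fun h => absurd h hL⟩
    choose w hw using hw
    choose! a b c habc using fun L hL => (hw L hL).2
    have hcardle : ∀ L ∈ 𝒪, L.card ≤ N := fun L hL =>
      (Finset.card_le_card (h𝒪 L hL).1).trans hN
    -- two castles on the same face of `A` lie at opposite sides of it
    have hopp : ∀ L ∈ 𝒪, ∀ M ∈ 𝒪, L ≠ M → c L = c M → a L = a M ∧ b M = !b L := by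
      intro L hL M hM hLM hcc
      have h1 := habc L hL
      have h2 := habc M hM
      rw [← hcc] at h2
      refine h.children_opposite (hK ((h𝒪 L hL).1 (hw L hL).1)) (hK ((h𝒪 M hM).1 (hw M hM).1))
        (fun e => ?_) h1 h2
      exact (Finset.disjoint_left.1 (hdisj L hL M hM hLM) (hw L hL).1) (e ▸ (hw M hM).1)
    -- hence there are at most two castles on each face
    have hfour : 𝒪.card ≤ 4 := by
      have := Finset.card_le_card_of_injOn (s := 𝒪) (t := Finset.univ) (fun L => (c L, b L))
        (fun _ _ => Finset.mem_univ _) (fun L hL M hM hLM => by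
          by_contra hne
          simp only [Prod.mk.injEq] at hLM
          have := (hopp L hL M hM hne hLM.1).2
          rw [hLM.2] at this
          cases hb : b M <;> simp [hb] at this)
      simpa using this
    -- a castle that uses the reflex edge between itself and `A` also guards `A`
    have hown : ∀ L, ∃ F : Finset (Pt × Pt), L ∈ 𝒪 → (F : Set (Pt × Pt)) ⊆ reflexEdges P ∧
        2 * F.card ≤ L.card + 1 ∧ Seen P F A ∧ ∀ x ∈ L, Seen P F x := by
      intro L
      by_cases hL : L ∈ 𝒪
      · obtain ⟨h1, h2, h3, h4, -⟩ := h𝒪 L hL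
        obtain ⟨F, hF⟩ := h.castle_own IH (h1.trans hK) h4 h3 (hcardle L hL) (hw L hL).1 hA h2
          (habc L hL)
        exact ⟨F, fun _ => hF⟩
      · exact ⟨∅, fun h => absurd h hL⟩
    choose F hF using hown
    -- it remains to guard `A` and the castles in `𝒪`
    suffices ∃ G : Finset (Pt × Pt), (G : Set (Pt × Pt)) ⊆ reflexEdges P ∧
        2 * G.card ≤ ∑ L ∈ 𝒪, L.card + 2 ∧ Seen P G A ∧ ∀ L ∈ 𝒪, ∀ x ∈ L, Seen P G x by
      obtain ⟨G, g1, g2, g3, g4⟩ := this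
      refine ⟨E ∪ G, ?_, fun x hx => ?_, ?_⟩
      · rw [Finset.coe_union]; exact union_subset hE g1
      · rcases hcov x hx with rfl | ⟨L, hL, hxL⟩ | h1
        · exact g3.mono Finset.subset_union_right
        · exact (g4 L hL x hxL).mono Finset.subset_union_right
        · exact h1.mono Finset.subset_union_left
      · have := Finset.card_union_le E G
        omega
    have hunion : ∀ 𝒬 ⊆ 𝒪, ((𝒬.biUnion F : Finset (Pt × Pt)) : Set (Pt × Pt)) ⊆ reflexEdges P ∧
        2 * (𝒬.biUnion F).card ≤ ∑ L ∈ 𝒬, L.card + 𝒬.card := by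
      intro 𝒬 h𝒬
      constructor
      · intro e he
        obtain ⟨L, hL, heL⟩ := Finset.mem_biUnion.1 (Finset.mem_coe.1 he)
        exact (hF L (h𝒬 hL)).1 heL
      · calc _ ≤ 2 * ∑ L ∈ 𝒬, (F L).card := Nat.mul_le_mul_left _ Finset.card_biUnion_le
          _ ≤ ∑ L ∈ 𝒬, (L.card + 1) := by
            rw [Finset.mul_sum]
            exact Finset.sum_le_sum fun L hL => (hF L (h𝒬 hL)).2.1
          _ = _ := by rw [Finset.sum_add_distrib]; simp
    -- With at most two castles, each castle may use its own edge; with more, the pair below saves one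
    -- guard, and the others use their own edges.
    rcases Nat.lt_or_ge 𝒪.card 3 with h3 | h3
    · rcases 𝒪.eq_empty_or_nonempty with rfl | ⟨L, hL⟩
      · obtain ⟨e, he, heA⟩ := hsee A hA
        exact ⟨{e}, by simpa using he, by simp, ⟨e, by simp, heA⟩, by simp⟩
      · have := hunion 𝒪 Finset.Subset.rfl
        exact ⟨𝒪.biUnion F, this.1, by omega,
          (hF L hL).2.2.1.mono (Finset.subset_biUnion_of_mem F hL),
          fun M hM x hx => ((hF M hM).2.2.2 x hx).mono (Finset.subset_biUnion_of_mem F hM)⟩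
    -- a pair of castles to which `castle_pair` applies
    obtain ⟨U, hU, V, hV, hUV, hcUV, habUV⟩ : ∃ U ∈ 𝒪, ∃ V ∈ 𝒪, U ≠ V ∧ c V = !c U ∧
        (a U = a V → b U = b V) := by
      have key : ∀ X ∈ 𝒪, ∀ Y ∈ 𝒪, ∀ Z ∈ 𝒪, X ≠ Y → X ≠ Z → Y ≠ Z → c X = c Y →
          ∃ U ∈ 𝒪, ∃ V ∈ 𝒪, U ≠ V ∧ c V = !c U ∧ (a U = a V → b U = b V) := by
        intro X hX Y hY Z hZ hXY hXZ hYZ hcc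
        have h1 := hopp X hX Y hY hXY hcc
        have hZc : c Z = !c X := by
          by_contra hne
          have hcZ : c X = c Z := by cases hx : c X <;> cases hz : c Z <;> simp_all
          have h2 := (hopp X hX Z hZ hXZ hcZ).2
          have h3 := (hopp Y hY Z hZ hYZ (hcc.symm.trans hcZ)).2
          rw [h2, h1.2] at h3
          cases hx : b X <;> simp [hx] at h3
        by_cases hb : a X = a Z → b X = b Z
        · exact ⟨X, hX, Z, hZ, hXZ, hZc, hb⟩
        · refine ⟨Y, hY, Z, hZ, hYZ, by rw [← hcc]; exact hZc, fun _ => ?_⟩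
          push Not at hb
          rw [h1.2]
          cases hx : b X <;> cases hz : b Z <;> simp_all
      obtain ⟨X, Y, Z, hX, hY, hZ, hXY, hXZ, hYZ⟩ := Finset.two_lt_card_iff.1 h3
      by_cases h1 : c X = c Y
      · exact key X hX Y hY Z hZ hXY hXZ hYZ h1
      by_cases h2 : c X = c Z
      · exact key X hX Z hZ Y hY hXZ hXY hYZ.symm h2
      · refine key Y hY Z hZ X hX hYZ hXY.symm hXZ.symm ?_
        cases hx : c X <;> cases hy : c Y <;> cases hz : c Z <;> simp_all
    obtain ⟨G, g1, g2, g3, g4⟩ := by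
      have hcV := habc V hV
      rw [hcUV] at hcV
      obtain ⟨h1, h2, h3, h4, -⟩ := h𝒪 U hU
      obtain ⟨h1', h2', h3', h4', -⟩ := h𝒪 V hV
      exact h.castle_pair IH (h1.trans hK) h4 h3 (hcardle U hU) (h1'.trans hK) h4' h3'
        (hcardle V hV) hA (hw U hU).1 h2 (hw V hV).1 h2' (habc U hU) hcV habUV
    have hVe : V ∈ 𝒪.erase U := Finset.mem_erase.2 ⟨hUV.symm, hV⟩
    set 𝒬 := (𝒪.erase U).erase V with h𝒬
    have hsub : 𝒬 ⊆ 𝒪 := (Finset.erase_subset _ _).trans (Finset.erase_subset _ _)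
    have hQcard : 𝒬.card + 2 = 𝒪.card := by
      rw [h𝒬, Finset.card_erase_of_mem hVe, Finset.card_erase_of_mem hU]
      omega
    have hQsum : ∑ L ∈ 𝒬, L.card + V.card + U.card = ∑ L ∈ 𝒪, L.card := by
      rw [h𝒬, Finset.sum_erase_add _ _ hVe, Finset.sum_erase_add _ _ hU]
    obtain ⟨f1, f2⟩ := hunion 𝒬 hsub
    obtain ⟨M, hM⟩ : 𝒬.Nonempty := Finset.card_pos.1 (by omega)
    refine ⟨G ∪ 𝒬.biUnion F, ?_, ?_, ?_, fun L hL x hx => ?_⟩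
    · rw [Finset.coe_union]; exact union_subset g1 f1
    · have := Finset.card_union_le G (𝒬.biUnion F)
      omega
    · exact (hF M (hsub hM)).2.2.1.mono
        ((Finset.subset_biUnion_of_mem F hM).trans Finset.subset_union_right)
    · by_cases hLU : L = U
      · subst hLU; exact (g3 x hx).mono Finset.subset_union_left
      by_cases hLV : L = V
      · subst hLV; exact (g4 x hx).mono Finset.subset_union_left
      · exact ((hF L hL).2.2.2 x hx).mono ((Finset.subset_biUnion_of_mem F
          (Finset.mem_erase.2 ⟨hLV, Finset.mem_erase.2 ⟨hLU, hL⟩⟩)).trans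
            Finset.subset_union_right)

end IsBrickComplex

/-! ### Counting reflex edges -/

namespace IsBrickComplex

variable {P : Set Pt} {k : Fin 3} {𝓑 : Finset (Pt × Pt)}

/-- The bricks of a connected polyhedron are linked by common points. -/
theorem linked (h : IsBrickComplex P k 𝓑) (hP : IsConnected P) :
    Linked (fun A B => (Icc A.1 A.2 ∩ Icc B.1 B.2).Nonempty) 𝓑 := by
  classical
  intro Y hY hne hcl
  by_contra hYB
  have hcl' : ∀ Z : Finset (Pt × Pt), IsClosed (⋃ A ∈ Z, Icc A.1 A.2) := fun Z =>
    Z.finite_toSet.isClosed_biUnion fun A _ => isClosed_Icc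
  obtain ⟨A, hA⟩ := hne
  obtain ⟨B, hB⟩ : (𝓑 \ Y).Nonempty := by
    rw [Finset.sdiff_nonempty]
    exact fun h => hYB (Finset.Subset.antisymm hY h)
  have hpt : ∀ Z ⊆ 𝓑, ∀ C ∈ Z, (P ∩ ⋃ A ∈ Z, Icc A.1 A.2).Nonempty := fun Z hZ C hC =>
    have h1 : C.1 ∈ Icc C.1 C.2 := ⟨le_rfl, fun i => (h.lt C (hZ hC) i).le⟩
    ⟨C.1, h.box_subset (hZ hC) h1, mem_biUnion hC h1⟩
  obtain ⟨p, -, hp1, hp2⟩ := isPreconnected_closed_iff.1 hP.isPreconnected _ _ (hcl' Y)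
    (hcl' (𝓑 \ Y)) (fun p hp => by
      obtain ⟨C, hC, pC⟩ := h.mem_iff.1 hp
      by_cases hCY : C ∈ Y
      · exact Or.inl (mem_biUnion hCY pC)
      · exact Or.inr (mem_biUnion (Finset.mem_sdiff.2 ⟨hC, hCY⟩) pC))
    (hpt Y hY A hA) (hpt _ Finset.sdiff_subset B hB)
  simp only [mem_iUnion, exists_prop] at hp1 hp2
  obtain ⟨C, hC, pC⟩ := hp1
  obtain ⟨D, hD, pD⟩ := hp2
  obtain ⟨hD, hDY⟩ := Finset.mem_sdiff.1 hD
  exact hDY (hcl C hC D hD ⟨p, pC, pD⟩)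

/-- The sides on which the horizontal extents of two bricks differ. -/
noncomputable def differingSides (k : Fin 3) (x : (Pt × Pt) × (Pt × Pt)) :
    Finset (Fin 3 × Bool) :=
  Finset.univ.filter fun y => y.1 ≠ k ∧ side x.1 y.1 y.2 ≠ side x.2 y.1 y.2

theorem card_reflexSides (𝓑 : Finset (Pt × Pt)) (k : Fin 3) :
    (reflexSides 𝓑 k).card = ∑ x ∈ contacts 𝓑 k, (differingSides k x).card := by
  classical
  rw [← Finset.card_sigma]
  refine Finset.card_bij (fun x _ => ⟨x.1, x.2⟩) ?_ ?_ ?_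
  · intro x hx
    rw [mem_reflexSides] at hx
    rw [Finset.mem_sigma, mem_contacts]
    exact ⟨⟨hx.1, hx.2.1⟩, by simpa [differingSides] using hx.2.2⟩
  · rintro ⟨x, y⟩ _ ⟨x', y'⟩ _ hxy
    simp only [Sigma.mk.injEq, heq_eq_eq] at hxy
    rw [hxy.1, hxy.2]
  · rintro ⟨x, y⟩ hx
    rw [Finset.mem_sigma, mem_contacts] at hx
    exact ⟨(x, y), mem_reflexSides.2 ⟨hx.1.1, hx.1.2, by simpa [differingSides] using hx.2⟩, rfl⟩

theorem differingSides_pos (h : IsBrickComplex P k 𝓑) {x : (Pt × Pt) × (Pt × Pt)}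
    (hx : x ∈ contacts 𝓑 k) : 1 ≤ (differingSides k x).card := by
  rw [mem_contacts] at hx
  obtain ⟨i, hik, h1 | h1⟩ := h.differ _ hx.1.1 _ hx.1.2 hx.2
  · exact Finset.card_pos.2 ⟨(i, false), by simpa [differingSides] using ⟨hik, h1⟩⟩
  · exact Finset.card_pos.2 ⟨(i, true), by simpa [differingSides] using ⟨hik, h1⟩⟩

theorem adj_of_card_eq_one {A B : Pt × Pt} (hst : Stacked k A B)
    (h1 : (differingSides k (A, B)).card = 1) : Adj k A B := by
  obtain ⟨⟨i, s⟩, his⟩ := Finset.card_eq_one.1 h1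
  have mem : ∀ l t, (l ≠ k ∧ side A l t ≠ side B l t) ↔ l = i ∧ t = s := by
    intro l t
    have : (l, t) ∈ differingSides k (A, B) ↔ (l, t) = (i, s) := by rw [his]; simp
    simpa [differingSides] using this
  obtain ⟨hik, hne⟩ := (mem i s).2 ⟨rfl, rfl⟩
  have heq : ∀ l t, l ≠ k → (l ≠ i ∨ t ≠ s) → side A l t = side B l t := by
    intro l t hl ht
    by_contra hcon
    have := (mem l t).1 ⟨hl, hcon⟩
    tauto
  have hsub : (∀ l, l ≠ k → A.1 l ≤ B.1 l ∧ B.2 l ≤ A.2 l) ∨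
      ∀ l, l ≠ k → B.1 l ≤ A.1 l ∧ A.2 l ≤ B.2 l := by
    have e1 : ∀ l, l ≠ k → (l ≠ i ∨ false ≠ s) → A.1 l = B.1 l := fun l => heq l false
    have e2 : ∀ l, l ≠ k → (l ≠ i ∨ true ≠ s) → A.2 l = B.2 l := fun l => heq l true
    cases s
    · rcases le_total (A.1 i) (B.1 i) with h1 | h1
      · refine Or.inl fun l hlk => ⟨?_, (e2 l hlk (by simp)).ge⟩
        by_cases hli : l = i
        exacts [hli ▸ h1, (e1 l hlk (Or.inl hli)).le]
      · refine Or.inr fun l hlk => ⟨?_, (e2 l hlk (by simp)).le⟩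
        by_cases hli : l = i
        exacts [hli ▸ h1, (e1 l hlk (Or.inl hli)).ge]
    · rcases le_total (A.2 i) (B.2 i) with h1 | h1
      · refine Or.inr fun l hlk => ⟨(e1 l hlk (by simp)).ge, ?_⟩
        by_cases hli : l = i
        exacts [hli ▸ h1, (e2 l hlk (Or.inl hli)).le]
      · refine Or.inl fun l hlk => ⟨(e1 l hlk (by simp)).le, ?_⟩
        by_cases hli : l = i
        exacts [hli ▸ h1, (e2 l hlk (Or.inl hli)).ge]
  rcases hsub with h2 | h2
  · exact ⟨i, s, true, Or.inl ⟨hik, hst.1, h2, hne.symm, fun l t hl ht => (heq l t hl ht).symm⟩⟩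
  · exact ⟨i, s, false, Or.inr ⟨hik, hst.1.symm, h2, hne, heq⟩⟩

/-- The contacts at which the horizontal extent of one brick lies strictly inside that of the
other. -/
noncomputable def collarContacts (𝓑 : Finset (Pt × Pt)) (k : Fin 3) :
    Finset ((Pt × Pt) × (Pt × Pt)) :=
  (contacts 𝓑 k).filter fun x =>
    (∀ i, i ≠ k → x.2.1 i < x.1.1 i ∧ x.1.2 i < x.2.2 i) ∨
    ∀ i, i ≠ k → x.1.1 i < x.2.1 i ∧ x.2.2 i < x.1.2 i

theorem card_collar {x : (Pt × Pt) × (Pt × Pt)} (hx : x ∈ collarContacts 𝓑 k) :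
    4 ≤ (differingSides k x).card := by
  have hx := (Finset.mem_filter.1 hx).2
  have : (Finset.univ.filter fun y : Fin 3 × Bool => y.1 ≠ k) ⊆ differingSides k x := by
    rintro ⟨i, s⟩ hi
    simp only [Finset.mem_filter, Finset.mem_univ, true_and] at hi
    simp only [differingSides, Finset.mem_filter, Finset.mem_univ, true_and]
    refine ⟨hi, ?_⟩
    rcases hx with hx | hx <;> have := hx i hi <;> cases s
    exacts [this.1.ne', this.2.ne, this.1.ne, this.2.ne']
  have h4 : ∀ k : Fin 3, 4 ≤ (Finset.univ.filter fun y : Fin 3 × Bool => y.1 ≠ k).card := by decide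
  exact (h4 k).trans (Finset.card_le_card this)

open Classical in
/-- Besides one reflex edge for each contact there is at least one more for each contact with
several reflex edges, and two more for each collar. -/
theorem card_add_le (h : IsBrickComplex P k 𝓑) :
    ((contacts 𝓑 k).filter fun x => ¬ Adj k x.1 x.2).card + 2 * (collarContacts 𝓑 k).card +
      (contacts 𝓑 k).card ≤ (reflexSides 𝓑 k).card := by
  rw [card_reflexSides, Finset.card_filter, collarContacts, Finset.card_filter, Finset.mul_sum,
    Finset.card_eq_sum_ones, ← Finset.sum_add_distrib, ← Finset.sum_add_distrib]
  refine Finset.sum_le_sum fun x hx => ?_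
  have h1 := h.differingSides_pos hx
  by_cases hc : x ∈ collarContacts 𝓑 k
  · have h4 := card_collar hc
    split_ifs <;> omega
  · rw [if_neg (fun hcon => hc (Finset.mem_filter.2 ⟨hx, hcon⟩))]
    by_cases ha : Adj k x.1 x.2
    · rw [if_neg (not_not.2 ha)]
      omega
    · have : (differingSides k x).card ≠ 1 := fun h2 =>
        ha (adj_of_card_eq_one (mem_contacts.1 hx).2 h2)
      rw [if_pos ha]
      omega

/-- In a connected polyhedron with reflex edges, each brick is seen by some reflex edge. -/
theorem exists_edgeSeesBox (h : IsBrickComplex P k 𝓑) (hP : IsConnected P)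
    (hr : (contacts 𝓑 k).Nonempty) : ∀ A ∈ 𝓑, ∃ e ∈ reflexEdges P, EdgeSeesBox P e A := by
  classical
  intro A hA
  obtain ⟨B, hB, hBA, p, pA, pB⟩ : ∃ B ∈ 𝓑, B ≠ A ∧ (Icc A.1 A.2 ∩ Icc B.1 B.2).Nonempty := by
    by_contra! hno
    have := h.linked hP {A} (by simpa using hA) (by simp) (fun x hx y hy hxy => by
      obtain rfl := Finset.mem_singleton.1 hx
      by_contra hyx
      exact hxy.ne_empty (hno y hy (by simpa using hyx)))
    obtain ⟨⟨X, Y⟩, hXY⟩ := hr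
    obtain ⟨⟨hX, hY⟩, hst⟩ := mem_contacts.1 hXY
    rw [← this, Finset.mem_singleton] at hX hY
    exact h.stacked_ne (this ▸ Finset.mem_singleton.2 hX) hst (hX.trans hY.symm)
  have key : ∀ C ∈ 𝓑, ∀ D ∈ 𝓑, Stacked k C D → A = C ∨ A = D →
      ∃ e ∈ reflexEdges P, EdgeSeesBox P e A := by
    intro C hC D hD hCD hACD
    obtain ⟨i, hik, hne⟩ := h.differ C hC D hD hCD
    obtain ⟨s, hs⟩ : ∃ s, side C i s ≠ side D i s := by
      rcases hne with h1 | h1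
      exacts [⟨false, h1⟩, ⟨true, h1⟩]
    obtain ⟨j, hji, hjk, hl⟩ := exists_third hik
    have lC := h.lt C hC
    have lD := h.lt D hD
    have hlt := contactEdge_lt (s := s) hCD (lC j) (lD j) hji hjk
    refine ⟨contactEdge C D i s, ⟨j, h.isReflexEdge_contactEdge hC hD hCD hik hji hjk hl hs⟩, ?_⟩
    set m : Pt := (1 / 2 : ℝ) • (contactEdge C D i s).1 + (1 / 2 : ℝ) • (contactEdge C D i s).2
    have hm : m ∈ openSegment ℝ (contactEdge C D i s).1 (contactEdge C D i s).2 :=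
      ⟨1 / 2, 1 / 2, by norm_num, by norm_num, by norm_num, rfl⟩
    have hm' := (mem_openSegment_contactEdge hCD lC lD hik hji hjk hl).1 hm
    have hmb := contactEdge_mem_boxes hCD lC lD hik hm'.1 hm'.2.1 (fun l hli hlk => by
      obtain rfl : l = j := by rcases hl l with e | e | e <;> tauto
      exact ⟨max_le hm'.2.2.1.1.le hm'.2.2.1.2.le, le_min hm'.2.2.2.1.le hm'.2.2.2.2.le⟩)
    have hmA : m ∈ Icc A.1 A.2 := by
      rcases hACD with rfl | rfl
      exacts [hmb.1, hmb.2]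
    exact fun q hq => ⟨m, hm, ((convex_box A).segment_subset hmA hq).trans (h.box_subset hA)⟩
  rcases h.meet A hA B hB hBA.symm p pA pB with h1 | h1
  · exact key A hA B hB h1 (Or.inl rfl)
  · exact key B hB A hA h1 (Or.inr rfl)

/-- The guards of the connected sets of bricks that are linked by contacts with a single reflex
edge guard the polyhedron. -/
theorem exists_guards (h : IsBrickComplex P k 𝓑) (hP : IsConnected P) {r b g : ℕ}
    (hr : (reflexEdges P).encard = r) (hr0 : 0 < r) (hg : HasGenus P g)
    (hb : b ≤ (collarContacts 𝓑 k).card) :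
    ∃ S : Finset (Pt × Pt), (S : Set (Pt × Pt)) ⊆ reflexEdges P ∧ OpenGuards P S ∧
      (S.card : ℤ) ≤ ⌊((r : ℝ) - g) / 2⌋ - b + 1 := by
  classical
  have hr' : r = (reflexSides 𝓑 k).card := by
    have := h.encard_reflexEdges
    rw [hr] at this
    exact_mod_cast this
  have hne : (contacts 𝓑 k).Nonempty := by
    obtain ⟨x, hx⟩ := Finset.card_pos.1 (hr' ▸ hr0)
    rw [mem_reflexSides] at hx
    exact ⟨x.1, mem_contacts.2 ⟨hx.1, hx.2.1⟩⟩
  have hguard := h.guardable (h.exists_edgeSeesBox hP hne)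
  obtain ⟨𝒦, h𝒦⟩ := exists_components (r := Adj k) (fun x y h => h.symm) 𝓑
  have hE : ∀ K, ∃ E : Finset (Pt × Pt), K ∈ 𝒦 → (E : Set (Pt × Pt)) ⊆ reflexEdges P ∧
      (∀ w ∈ K, Seen P E w) ∧ 2 * E.card ≤ K.card + 1 := by
    intro K
    by_cases hK : K ∈ 𝒦
    · obtain ⟨E, hE⟩ := hguard (K.card + 1) K (h𝒦.subset K hK) (h𝒦.linked K hK)
        (Nat.lt_succ_self _) (h𝒦.nonempty K hK)
      exact ⟨E, fun _ => hE⟩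
    · exact ⟨∅, fun h => absurd h hK⟩
  choose E hE using hE
  -- at most half a guard for each brick and half a guard for each linked part
  have hcard : 2 * (𝒦.biUnion E).card ≤ 𝓑.card + 𝒦.card := by
    calc _ ≤ 2 * ∑ K ∈ 𝒦, (E K).card := Nat.mul_le_mul_left _ Finset.card_biUnion_le
      _ ≤ ∑ K ∈ 𝒦, (K.card + 1) := by
        rw [Finset.mul_sum]
        exact Finset.sum_le_sum fun K hK => (hE K hK).2.2
      _ = _ := by rw [Finset.sum_add_distrib, h𝒦.sum_card]; simp
  -- the linked parts are joined by the contacts with several reflex edges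
  have hcomp : 𝒦.card ≤ ((contacts 𝓑 k).filter fun x => ¬ Adj k x.1 x.2).card + 1 := by
    refine h𝒦.card_le (h.linked hP) _ fun K hK L hL hKL x hx y hy ⟨p, px, py⟩ => ?_
    have hxB := h𝒦.subset K hK hx
    have hyB := h𝒦.subset L hL hy
    have hdis := Finset.disjoint_left.1 (h𝒦.disjoint K hK L hL hKL)
    have hadj : ¬ Adj k x y := fun ha => hdis (h𝒦.closed K hK x hx y hyB ha) hy
    rcases h.meet x hxB y hyB (by rintro rfl; exact hdis hx hy) p px py with h1 | h1
    · exact Or.inl (Finset.mem_filter.2 ⟨mem_contacts.2 ⟨⟨hxB, hyB⟩, h1⟩, hadj⟩)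
    · exact Or.inr (Finset.mem_filter.2 ⟨mem_contacts.2 ⟨⟨hyB, hxB⟩, h1⟩, fun ha => hadj ha.symm⟩)
  refine ⟨𝒦.biUnion E, ?_, fun p hp => ?_, ?_⟩
  · intro e he
    obtain ⟨K, hK, heK⟩ := Finset.mem_biUnion.1 (Finset.mem_coe.1 he)
    exact (hE K hK).1 heK
  · obtain ⟨A, hA, pA⟩ := h.mem_iff.1 hp
    obtain ⟨K, hK, hAK⟩ := h𝒦.cover A hA
    obtain ⟨e, he, hs⟩ := (hE K hK).2.1 A hAK
    obtain ⟨q, hq, hqp⟩ := hs p pA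
    exact ⟨e, Finset.mem_biUnion.2 ⟨K, hK, he⟩, q, hq, hqp⟩
  · have h1 := h.card_add_le
    have h2 := h.genus_eq hg
    rw [← hr'] at h1
    -- the surplus reflex edges pay for the linked parts, and `g = 1 - B + C` for the bricks
    have h3 : 2 * ((𝒦.biUnion E).card : ℤ) + 2 * b ≤ r - g + 2 := by
      have : (g : ℤ) + 𝓑.card = 1 + (contacts 𝓑 k).card := by linarith
      omega
    have h4 : ((𝒦.biUnion E).card : ℤ) + b - 1 ≤ ⌊((r : ℝ) - g) / 2⌋ := by
      rw [Int.le_floor]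
      have : (2 * ((𝒦.biUnion E).card : ℝ) + 2 * b) ≤ r - g + 2 := by exact_mod_cast h3
      push_cast
      linarith
    linarith

theorem _root_.OpenGuards.closed {S : Finset (Pt × Pt)} (h : OpenGuards P S) : ClosedGuards P S :=
  fun p hp => by
    obtain ⟨e, he, q, hq, hs⟩ := h p hp
    exact ⟨e, he, q, openSegment_subset_segment _ _ _ hq, hs⟩

/-- The collars are the contact rectangles at the collar contacts. -/
theorem collars_le (h : IsBrickComplex P k 𝓑) (hbr : ∀ B, IsBrick P k B → B ∈ 𝓑) {b : ℕ}
    (hb : (collars P k).encard = b) : b ≤ (collarContacts 𝓑 k).card := by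
  classical
  have hsub : collars P k ⊆
      (fun x : (Pt × Pt) × (Pt × Pt) => Icc x.1.1 x.1.2 ∩ Icc x.2.1 x.2.2) ''
        (collarContacts 𝓑 k : Set _) := by
    rintro R ⟨B, C, ⟨hB, hC, hne, rfl, p, pB, pC⟩, hin⟩
    have hB := hbr B hB
    have hC := hbr C hC
    rcases h.meet B hB C hC hne p pB pC with h1 | h1
    · exact ⟨(B, C), Finset.mem_coe.2 (Finset.mem_filter.2
        ⟨mem_contacts.2 ⟨⟨hB, hC⟩, h1⟩, Or.inl hin⟩), rfl⟩
    · exact ⟨(C, B), Finset.mem_coe.2 (Finset.mem_filter.2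
        ⟨mem_contacts.2 ⟨⟨hC, hB⟩, h1⟩, Or.inr hin⟩), inter_comm _ _⟩
  have := (encard_le_encard hsub).trans (encard_image_le _ _)
  rw [hb, encard_coe_eq_coe_finsetCard] at this
  exact_mod_cast this

end IsBrickComplex

/-! ### Charts, vertical edges, and locally rectangular sets -/

/-- The interior of a manifold with boundary does not split into two parts near a point. -/
theorem IsThreeManifold.not_separated {P : Set Pt} (hP : IsThreeManifold P) {p : Pt} (hp : p ∈ P)
    {W U V : Set Pt} (hW : W ∈ 𝓝 p) (hU : IsOpen U) (hV : IsOpen V) (hUV : Disjoint U V)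
    (hcov : interior P ∩ W ⊆ U ∪ V) (hpU : p ∈ closure (interior P ∩ U))
    (hpV : p ∈ closure (interior P ∩ V)) : False := by
  obtain ⟨φ, hps, hφ⟩ := hP p hp
  -- in the chart, the interior of `P` is the open half-space
  have hint : ∀ q ∈ φ.source, (q ∈ interior P ↔ 0 < φ q 0) := by
    intro q hq
    constructor
    · intro hqi
      have h1 : ∀ᶠ x in 𝓝 (φ q), φ.symm x ∈ interior P := by
        have := φ.continuousAt_symm (φ.map_source hq)
        rw [ContinuousAt, φ.left_inv hq] at this
        exact this (isOpen_interior.mem_nhds hqi)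
      have h2 : ∀ᶠ x in 𝓝 (φ q), x ∈ φ.target := φ.open_target.mem_nhds (φ.map_source hq)
      obtain ⟨δ, hδ, hd⟩ := eventually_nhds_cube.1 (h1.and h2)
      have h3 := hd (fun i => φ q i - δ / 2) fun i => by
        rw [show φ q i - δ / 2 - φ q i = -(δ / 2) by ring, abs_neg, abs_of_pos (by linarith)]
        linarith
      have h4 := (hφ _ (φ.map_target h3.2)).1 (interior_subset h3.1)
      rw [φ.right_inv h3.2] at h4
      linarith
    · intro hpos
      rw [mem_interior_iff_mem_nhds]
      have h1 : ∀ᶠ q' in 𝓝 q, 0 < φ q' 0 := by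
        have hc : ContinuousAt (fun q' => φ q' 0) q :=
          (continuous_apply (0 : Fin 3)).continuousAt.comp (φ.continuousAt hq)
        exact hc.eventually (lt_mem_nhds hpos)
      filter_upwards [h1, φ.open_source.mem_nhds hq] with q' h2 h3
      exact (hφ q' h3).2 h2.le
  have hN : {x | x ∈ φ.target ∧ φ.symm x ∈ W} ∈ 𝓝 (φ p) := by
    refine Filter.inter_mem (φ.open_target.mem_nhds (φ.map_source hps)) ?_
    have := φ.continuousAt_symm (φ.map_source hps)
    rw [ContinuousAt, φ.left_inv hps] at this
    exact this hW
  obtain ⟨ε, hε, hball⟩ := Metric.mem_nhds_iff.1 hN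
  -- half a ball is convex, and so its image is connected
  have hconv : Convex ℝ (Metric.ball (φ p) ε ∩ {x : Pt | 0 < x 0}) := by
    exact (convex_ball _ _).inter ((convex_Ioi (0 : ℝ)).linear_preimage
      (LinearMap.proj (R := ℝ) (φ := fun _ : Fin 3 => ℝ) 0))
  have hpre : IsPreconnected (φ.symm '' (Metric.ball (φ p) ε ∩ {x : Pt | 0 < x 0})) :=
    hconv.isPreconnected.image _ (φ.continuousOn_symm.mono fun x hx => (hball hx.1).1)
  have hsub : φ.symm '' (Metric.ball (φ p) ε ∩ {x : Pt | 0 < x 0}) ⊆ U ∪ V := by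
    rintro _ ⟨x, ⟨hx1, hx2⟩, rfl⟩
    have hx := hball hx1
    refine hcov ⟨(hint _ (φ.map_target hx.1)).2 ?_, hx.2⟩
    rw [φ.right_inv hx.1]
    exact hx2
  have hmem : ∀ Z : Set Pt, p ∈ closure (interior P ∩ Z) →
      ∃ q ∈ Z, q ∈ φ.symm '' (Metric.ball (φ p) ε ∩ {x : Pt | 0 < x 0}) := by
    intro Z hZ
    obtain ⟨q, ⟨hq1, hq2⟩, hq3, hq4⟩ := mem_closure_iff_nhds.1 hZ _
      (Filter.inter_mem (φ.open_source.mem_nhds hps)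
        ((φ.continuousAt hps) (Metric.ball_mem_nhds _ hε)))
    exact ⟨q, hq4, φ q, ⟨hq2, (hint q hq1).1 hq3⟩, φ.left_inv hq1⟩
  rcases hpre.subset_or_subset hU hV hUV hsub with h1 | h1
  · obtain ⟨q, hq, hqi⟩ := hmem V hpV
    exact disjoint_left.1 hUV (h1 hqi) hq
  · obtain ⟨q, hq, hqi⟩ := hmem U hpU
    exact disjoint_left.1 hUV hq (h1 hqi)

/-- Reflex points along a line form an open set. -/
theorem IsReflexPoint.eventually {P : Set Pt} {k : Fin 3} {p : Pt} (h : IsReflexPoint P k p) :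
    ∀ᶠ q in 𝓝 p, (∀ l, l ≠ k → q l = p l) → IsReflexPoint P k q := by
  obtain ⟨s, hs, hp⟩ := h
  filter_upwards [hp.eventually_nhds] with q hq hl
  refine ⟨s, hs, hq.mono fun q' hq' => hq'.trans ⟨?_, ?_⟩⟩ <;>
  · rintro ⟨j, hj, h1⟩
    exact ⟨j, hj, by rw [hl j hj] at *; exact h1⟩

/-- A reflex point lies on a reflex edge. -/
theorem IsReflexPoint.exists_edge {P : Set Pt} (hP : Bornology.IsBounded P) {k : Fin 3} {p : Pt}
    (h : IsReflexPoint P k p) : ∃ e, IsReflexEdge P k e := by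
  set U : Set ℝ := {t | IsReflexPoint P k (Function.update p k t)} with hU
  have hupd : Continuous fun t : ℝ => Function.update p k t :=
    continuous_const.update k continuous_id
  have hUo : IsOpen U := by
    rw [isOpen_iff_mem_nhds]
    intro t ht
    filter_upwards [hupd.continuousAt.eventually (IsReflexPoint.eventually ht)] with t' ht'
    exact ht' fun l hl => by simp [hl]
  have hp0 : p k ∈ U := by simpa [hU] using h
  obtain ⟨R, hR⟩ := hP.exists_norm_le
  have hUR : ∀ t ∈ U, |t| ≤ R := fun t ht => by
    have h1 := (norm_le_pi_norm (Function.update p k t) k).trans (hR _ (reflexPoint_mem ht))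
    simpa using h1
  have hR0 := hUR _ hp0
  -- the nearest points above and below that are not reflex
  have hbne : (Uᶜ ∩ Ici (p k)).Nonempty := ⟨R + 1, fun hc => by
    have := (le_abs_self _).trans (hUR _ hc); linarith, by
      have := (le_abs_self _).trans hR0
      simp only [mem_Ici]; linarith⟩
  have hane : (Uᶜ ∩ Iic (p k)).Nonempty := ⟨-R - 1, fun hc => by
    have := (neg_le_abs _).trans (hUR _ hc); linarith, by
      have := (neg_le_abs _).trans hR0
      simp only [mem_Iic]; linarith⟩
  have hbb : BddBelow (Uᶜ ∩ Ici (p k)) := ⟨p k, fun t ht => ht.2⟩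
  have hab : BddAbove (Uᶜ ∩ Iic (p k)) := ⟨p k, fun t ht => ht.2⟩
  have hb := (hUo.isClosed_compl.inter isClosed_Ici).csInf_mem hbne hbb
  have ha := (hUo.isClosed_compl.inter isClosed_Iic).csSup_mem hane hab
  set b := sInf (Uᶜ ∩ Ici (p k))
  set a := sSup (Uᶜ ∩ Iic (p k))
  have hpb : p k < b := lt_of_le_of_ne hb.2 fun e => hb.1 (e ▸ hp0)
  have hpa : a < p k := lt_of_le_of_ne ha.2 fun e => ha.1 (e ▸ hp0)
  have hin : ∀ t, a < t → t < b → t ∈ U := by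
    intro t h1 h2
    by_contra ht
    rcases le_total t (p k) with h3 | h3
    · exact absurd (le_csSup hab ⟨ht, h3⟩) (not_le.2 h1)
    · exact absurd (csInf_le hbb ⟨ht, h3⟩) (not_le.2 h2)
  have haxis : ∀ j, j ≠ k → (Function.update p k a, Function.update p k b).1 j =
      (Function.update p k a, Function.update p k b).2 j := fun j hj => by simp [hj]
  have hlt : (Function.update p k a, Function.update p k b).1 k <
      (Function.update p k a, Function.update p k b).2 k := by simpa using hpa.trans hpb
  refine ⟨(Function.update p k a, Function.update p k b), haxis, hlt, fun q hq => ?_, ha.1, hb.1⟩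
  obtain ⟨h1, h2, h3⟩ := (openSegment_of_axis haxis hlt).1 hq
  have h4 : q k ∈ U := hin _ (by simpa using h2) (by simpa using h3)
  have : Function.update p k (q k) = q := by
    funext l
    by_cases hl : l = k
    · subst hl; simp
    · rw [h1 l hl]; simp [hl]
  rwa [hU, mem_ofPred_eq, this] at h4

/-- The box obtained by moving the side `(l, s)` of `K` to the coordinate `c`. -/
def moveSide (K : Pt × Pt) (l : Fin 3) (s : Bool) (c : ℝ) : Pt × Pt :=
  cond s (K.1, Function.update K.2 l c) (Function.update K.1 l c, K.2)

/-- The coordinate at distance `t` beyond the side `(l, s)` of `K`. -/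
def beyond (K : Pt × Pt) (l : Fin 3) (s : Bool) (t : ℝ) : ℝ := cond s (K.2 l + t) (K.1 l - t)

theorem mem_moveSide {K : Pt × Pt} {l : Fin 3} {s : Bool} {ε : ℝ} (hK : K.1 l ≤ K.2 l) {x : Pt}
    (hx : x ∈ Icc (moveSide K l s (beyond K l s ε)).1 (moveSide K l s (beyond K l s ε)).2) :
    x ∈ Icc K.1 K.2 ∨ ∃ t, 0 ≤ t ∧ t ≤ ε ∧ x l = beyond K l s t ∧
      Function.update x l (side K l s) ∈ Icc K.1 K.2 := by
  rw [mem_box] at hx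
  by_cases hxK : x ∈ Icc K.1 K.2
  · exact Or.inl hxK
  right
  cases s
  · simp only [moveSide, beyond, cond_false] at hx
    have hl := hx l
    simp only [Function.update_self] at hl
    have hlt : x l < K.1 l := by
      by_contra! hc
      refine hxK (mem_box.2 fun m => ?_)
      by_cases hm : m = l
      · subst hm; exact ⟨hc, hl.2⟩
      · simpa [hm] using hx m
    refine ⟨K.1 l - x l, by linarith, by linarith, by simp [beyond], mem_box.2 fun m => ?_⟩
    by_cases hm : m = l
    · subst hm; simpa using hK
    · simpa [hm] using hx m
  · simp only [moveSide, beyond, cond_true] at hx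
    have hl := hx l
    simp only [Function.update_self] at hl
    have hlt : K.2 l < x l := by
      by_contra! hc
      refine hxK (mem_box.2 fun m => ?_)
      by_cases hm : m = l
      · subst hm; exact ⟨hl.1, hc⟩
      · simpa [hm] using hx m
    refine ⟨x l - K.2 l, by linarith, by linarith, by simp [beyond], mem_box.2 fun m => ?_⟩
    by_cases hm : m = l
    · subst hm; simpa using hK
    · simpa [hm] using hx m

theorem convex_level (l : Fin 3) (c : ℝ) : Convex ℝ {x : Pt | x l = c} :=
  (convex_singleton c).linear_preimage (LinearMap.proj (R := ℝ) (φ := fun _ : Fin 3 => ℝ) l)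

/-- A compact set that is a non-degenerate box near each of its points is a disjoint union of
boxes: a largest box in it is relatively open. -/
theorem exists_box_component {S : Set Pt} (hS : IsCompact S)
    (hloc : ∀ p ∈ S, ∃ D : Pt × Pt, (∀ i, D.1 i < D.2 i) ∧ p ∈ Icc D.1 D.2 ∧
      ∀ᶠ q in 𝓝 p, q ∈ S ↔ q ∈ Icc D.1 D.2) {p : Pt} (hp : p ∈ S) :
    ∃ K : Pt × Pt, (∀ i, K.1 i < K.2 i) ∧ p ∈ Icc K.1 K.2 ∧ Icc K.1 K.2 ⊆ S ∧
      ∀ q ∈ Icc K.1 K.2, ∀ᶠ q' in 𝓝 q, q' ∈ S → q' ∈ Icc K.1 K.2 := by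
  -- the boxes in `S` that contain `p` form a compact set
  set 𝒞 : Set (Pt × Pt) := {K | p ∈ Icc K.1 K.2 ∧ ∀ x : Pt, (K.1 ⊔ x) ⊓ K.2 ∈ S} with h𝒞
  have h𝒞iff : ∀ K ∈ 𝒞, Icc K.1 K.2 ⊆ S := by
    intro K hK x hx
    have := hK.2 x
    rwa [sup_eq_right.2 hx.1, inf_eq_left.2 hx.2] at this
  have h𝒞mk : ∀ K : Pt × Pt, p ∈ Icc K.1 K.2 → Icc K.1 K.2 ⊆ S → K ∈ 𝒞 := fun K hpK hKS =>
    ⟨hpK, fun x => hKS ⟨le_inf le_sup_left (hpK.1.trans hpK.2), inf_le_right⟩⟩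
  have hcl : IsClosed 𝒞 := by
    have h1 : IsClosed {K : Pt × Pt | p ∈ Icc K.1 K.2} :=
      (isClosed_le continuous_fst continuous_const).inter
        (isClosed_le continuous_const continuous_snd)
    have h2 : IsClosed {K : Pt × Pt | ∀ x : Pt, (K.1 ⊔ x) ⊓ K.2 ∈ S} := by
      rw [ofPred_forall]
      refine isClosed_iInter fun x => hS.isClosed.preimage (?_ : Continuous
        fun K : Pt × Pt => (K.1 ⊔ x) ⊓ K.2)
      refine continuous_pi fun i => (Continuous.max ?_ ?_).min ?_
      · exact (continuous_apply i).comp continuous_fst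
      · exact continuous_const
      · exact (continuous_apply i).comp continuous_snd
    exact h1.inter h2
  have hcomp : IsCompact 𝒞 := by
    refine (hS.prod hS).of_isClosed_subset hcl fun K hK => ?_
    have hle := hK.1.1.trans hK.1.2
    exact ⟨h𝒞iff K hK ⟨le_rfl, hle⟩, h𝒞iff K hK ⟨hle, le_rfl⟩⟩
  obtain ⟨K, hK, hmax⟩ := hcomp.exists_isMaxOn
    ⟨(p, p), h𝒞mk (p, p) ⟨le_rfl, le_rfl⟩ (by simpa using hp)⟩
    (f := fun K : Pt × Pt => ∑ i, (K.2 i - K.1 i)) (by fun_prop)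
  have hKS := h𝒞iff K hK
  have hle : ∀ i, K.1 i ≤ K.2 i := fun i => hK.1.1.trans hK.1.2 i
  have hopen : ∀ q ∈ Icc K.1 K.2, ∀ᶠ q' in 𝓝 q, q' ∈ S → q' ∈ Icc K.1 K.2 := by
    intro q hq
    obtain ⟨D, hD, qD, hSD⟩ := hloc q (hKS hq)
    -- by maximality, `S` does not extend beyond the side of `K` at any of its points
    have hside : ∀ l s, q l = side K l s → side D l s = q l := by
      intro l s hql
      by_contra hne
      -- points of the face near which `S` extends beyond the face
      set Φ : Set Pt := {x | x ∈ Icc K.1 K.2 ∧ x l = side K l s} with hΦ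
      set T : Set Pt := {x | ∀ᶠ z : ℝ × Pt in 𝓝 ((0 : ℝ), x), z.2 ∈ Φ → 0 ≤ z.1 →
        Function.update z.2 l (beyond K l s z.1) ∈ S} with hT
      have hb0 : beyond K l s 0 = side K l s := by cases s <;> simp [beyond]
      have hbc : Continuous (beyond K l s) := by
        cases s
        · exact continuous_const.sub continuous_id
        · exact continuous_const.add continuous_id
      have hmap : Continuous fun z : ℝ × Pt => Function.update z.2 l (beyond K l s z.1) :=
        continuous_snd.update l (hbc.comp continuous_fst)
      have hdich : ∀ x ∈ Φ, ∀ D : Pt × Pt, (∀ i, D.1 i < D.2 i) → x ∈ Icc D.1 D.2 →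
          (∀ᶠ q in 𝓝 x, q ∈ S ↔ q ∈ Icc D.1 D.2) →
          (side D l s ≠ x l → x ∈ T) ∧ (side D l s = x l → ∀ᶠ y in 𝓝 x, y ∈ Φ → y ∉ T) := by
        intro x hx D hD xD hSD
        have hSD' := hSD
        have hx0 : Function.update x l (beyond K l s 0) = x := by
          rw [hb0, ← hx.2]; simp
        constructor
        · intro hne
          have e1 : ∀ᶠ z : ℝ × Pt in 𝓝 ((0 : ℝ), x),
              (Function.update z.2 l (beyond K l s z.1) ∈ S ↔
                Function.update z.2 l (beyond K l s z.1) ∈ Icc D.1 D.2) := by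
            have := hmap.continuousAt (x := ((0 : ℝ), x))
            rw [ContinuousAt, hx0] at this
            exact this hSD
          have e2 : ∀ᶠ z : ℝ × Pt in 𝓝 ((0 : ℝ), x), z.2 ∈ S ↔ z.2 ∈ Icc D.1 D.2 :=
            (continuous_snd.tendsto ((0 : ℝ), x)) hSD
          have e3 : ∀ᶠ z : ℝ × Pt in 𝓝 ((0 : ℝ), x), |beyond K l s z.1 - x l| <
              |side D l s - x l| ∧ |beyond K l s z.1 - x l| < D.2 l - D.1 l := by
            have hc : Continuous fun z : ℝ × Pt => |beyond K l s z.1 - x l| :=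
              ((hbc.comp continuous_fst).sub continuous_const).abs
            have h0 : |beyond K l s (((0 : ℝ), x) : ℝ × Pt).1 - x l| = 0 := by
              simp [hb0, hx.2]
            have h1 := hc.continuousAt.eventually_lt (x₀ := ((0 : ℝ), x))
              (g := fun _ => |side D l s - x l|) continuousAt_const
              (by rw [h0]; exact abs_pos.2 (sub_ne_zero.2 hne))
            have h2 := hc.continuousAt.eventually_lt (x₀ := ((0 : ℝ), x))
              (g := fun _ => D.2 l - D.1 l) continuousAt_const
              (by rw [h0]; linarith [hD l])
            exact h1.and h2
          filter_upwards [e1, e2, e3] with z h1 h2 h3 hz hz0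
          rw [h1, mem_box]
          have hzD := mem_box.1 (h2.1 (hKS hz.1))
          have hxD := mem_box.1 xD l
          intro m
          by_cases hm : m = l
          · subst hm
            rw [Function.update_self]
            have hxm := hx.2
            cases s
            · simp only [side_false, beyond, cond_false] at h3 hxm ⊢
              rw [abs_sub_lt_iff, abs_sub_comm, abs_of_nonneg (by linarith)] at h3
              constructor <;> linarith [h3.1.2, h3.1.1]
            · simp only [side_true, beyond, cond_true] at h3 hxm ⊢
              rw [abs_sub_lt_iff, abs_of_nonneg (by linarith)] at h3
              constructor <;> linarith [h3.1.2, h3.1.1]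
          · simpa [hm] using hzD m
        · intro heq
          filter_upwards [hSD.eventually_nhds] with y hy hyΦ hyT
          have h1 : ∀ᶠ t : ℝ in 𝓝 0, 0 ≤ t → Function.update y l (beyond K l s t) ∈ S := by
            have hc : Continuous fun t : ℝ => (t, y) := by fun_prop
            filter_upwards [(hc.tendsto 0).eventually hyT] with t ht h0
            exact ht hyΦ h0
          have h2 : ∀ᶠ t : ℝ in 𝓝 0, Function.update y l (beyond K l s t) ∈ S ↔
              Function.update y l (beyond K l s t) ∈ Icc D.1 D.2 := by
            have hc : Continuous fun t : ℝ => Function.update y l (beyond K l s t) :=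
              continuous_const.update l hbc
            have := hc.tendsto 0
            rw [hb0, ← hyΦ.2, Function.update_eq_self] at this
            exact this.eventually hy
          obtain ⟨δ, hδ, h3⟩ := Metric.eventually_nhds_iff.1 (h1.and h2)
          have h4 := @h3 (δ / 2) (by
            rw [Real.dist_eq, sub_zero, abs_of_pos (by linarith)]; linarith)
          have h5 := mem_box.1 (h4.2.1 (h4.1 (by linarith))) l
          rw [Function.update_self] at h5
          have hxm := hx.2
          cases s
          · simp only [side_false, beyond, cond_false] at h5 heq hxm; linarith
          · simp only [side_true, beyond, cond_true] at h5 heq hxm; linarith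
      have hqΦ : q ∈ Φ := ⟨hq, hql⟩
      have hΦconv : Convex ℝ Φ := (convex_box K).inter (convex_level l _)
      have hΦcomp : IsCompact Φ :=
        (isCompact_Icc (a := K.1) (b := K.2)).inter_right
          (isClosed_eq (continuous_apply l) continuous_const)
      have hTopen : IsOpen T := by
        rw [isOpen_iff_mem_nhds]
        intro x hx
        have h1 := hx.eventually_nhds
        rw [nhds_prod_eq] at h1
        have h2 := h1.curry
        exact h2.self_of_nhds.mono fun y hy => hy
      -- `T` is relatively clopen in the connected face
      have hΦT : Φ ⊆ T := by
        set V : Set Pt := {x | ∀ᶠ y in 𝓝 x, y ∈ Φ → y ∉ T} with hV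
        have hVopen : IsOpen V := by
          rw [isOpen_iff_mem_nhds]
          intro x hx
          exact hx.eventually_nhds
        have hcov : Φ ⊆ T ∪ V := by
          intro x hx
          obtain ⟨D, hD, xD, hSD⟩ := hloc x (hKS hx.1)
          obtain ⟨h1, h2⟩ := hdich x hx D hD xD hSD
          by_cases hs : side D l s = x l
          · exact Or.inr (h2 hs)
          · exact Or.inl (h1 hs)
        by_contra hcon
        obtain ⟨y, hy, hyT⟩ := not_subset.1 hcon
        obtain ⟨x, hx, hxT, hxV⟩ := hΦconv.isPreconnected T V hTopen hVopen hcov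
          ⟨q, hqΦ, (hdich q hqΦ D hD qD hSD).1 hne⟩ ⟨y, hy, (hcov hy).resolve_left hyT⟩
        exact Filter.Eventually.self_of_nhds hxV hx hxT
      have hev := hΦcomp.eventually_forall_of_forall_eventually (x₀ := (0 : ℝ))
        (P := fun t y => y ∈ Φ → 0 ≤ t → Function.update y l (beyond K l s t) ∈ S)
        fun y hy => hΦT hy
      obtain ⟨δ, hδ, hev⟩ := Metric.eventually_nhds_iff.1 hev
      set K' := moveSide K l s (beyond K l s (δ / 2)) with hK'
      have hsum : ∑ i, (K.2 i - K.1 i) < ∑ i, (K'.2 i - K'.1 i) := by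
        refine Finset.sum_lt_sum (fun i _ => ?_) ⟨l, Finset.mem_univ _, ?_⟩
        · by_cases hi : i = l
          · subst hi
            cases s <;> simp [hK', moveSide, beyond] <;> linarith
          · cases s <;> simp [hK', moveSide, hi]
        · cases s <;> simp [hK', moveSide, beyond] <;> linarith
      refine absurd (hmax (h𝒞mk K' ?_ fun x hx => ?_)) (not_le.2 hsum)
      · refine mem_box.2 fun i => ?_
        have := mem_box.1 hK.1 i
        by_cases hi : i = l
        · subst hi
          cases s <;> simp [hK', moveSide, beyond] <;> constructor <;> linarith
        · cases s <;> simpa [hK', moveSide, hi] using this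
      · rcases mem_moveSide (hle l) hx with h1 | ⟨t, h1, h2, h3, h4⟩
        · exact hKS h1
        · have h5 := @hev t (by rw [Real.dist_eq, sub_zero, abs_of_nonneg h1]; linarith)
            (Function.update x l (side K l s)) ⟨h4, by simp⟩ ⟨h4, by simp⟩ h1
          rwa [Function.update_idem, ← h3, Function.update_eq_self] at h5
    have hnear : ∀ᶠ q' in 𝓝 q, ∀ i, (K.1 i < q i → K.1 i < q' i) ∧ (q i < K.2 i → q' i < K.2 i) := by
      rw [Filter.eventually_all]
      intro i
      refine Filter.Eventually.and ?_ ?_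
      · by_cases hi : K.1 i < q i
        · filter_upwards [eventually_lt_apply hi] with q' h1 _ using h1
        · exact Filter.Eventually.of_forall fun _ h => absurd h hi
      · by_cases hi : q i < K.2 i
        · filter_upwards [eventually_apply_lt hi] with q' h1 _ using h1
        · exact Filter.Eventually.of_forall fun _ h => absurd h hi
    filter_upwards [hSD, hnear] with q' h1 h2 h3
    have h4 := mem_box.1 (h1.1 h3)
    refine mem_box.2 fun i => ⟨?_, ?_⟩
    · rcases (mem_box.1 hq i).1.lt_or_eq with h5 | h5
      · exact ((h2 i).1 h5).le
      · have := hside i false h5.symm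
        simp only [side_false] at this
        linarith [(h4 i).1]
    · rcases (mem_box.1 hq i).2.lt_or_eq with h5 | h5
      · exact ((h2 i).2 h5).le
      · have := hside i true h5
        simp only [side_true] at this
        linarith [(h4 i).2]
  refine ⟨K, fun i => ?_, hK.1, hKS, hopen⟩
  -- the box is not degenerate, as it is a neighbourhood of `p` in `S`
  obtain ⟨D, hD, pD, hSD⟩ := hloc p hp
  obtain ⟨δ, hδ, hd⟩ := eventually_nhds_cube.1 (hSD.and (hopen p hK.1))
  have key : ∀ c, D.1 i ≤ c → c ≤ D.2 i → |c - p i| < δ → K.1 i ≤ c ∧ c ≤ K.2 i := by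
    intro c h1 h2 h3
    have h4 := hd (Function.update p i c) fun m => by
      by_cases hm : m = i
      · subst hm; simpa using h3
      · simpa [hm] using hδ
    have h5 := mem_box.1 (h4.2 (h4.1.2 (mem_box.2 fun m => by
      by_cases hm : m = i
      · subst hm; simpa using ⟨h1, h2⟩
      · simpa [hm] using mem_box.1 pD m))) i
    simpa using h5
  have hpD := mem_box.1 pD i
  have hpK := key (p i) hpD.1 hpD.2 (by simpa using hδ)
  rcases hpD.1.lt_or_eq with h1 | h1
  · have h2 := (key (max (D.1 i) (p i - δ / 2)) (le_max_left _ _) (max_le (hD i).le (by linarith))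
      (by rw [abs_sub_comm, abs_of_nonneg (by simp; constructor <;> linarith)]
          have := le_max_right (D.1 i) (p i - δ / 2); linarith)).1
    have : max (D.1 i) (p i - δ / 2) < p i := max_lt h1 (by linarith)
    linarith
  · have hDi := hD i
    have h2 := (key (min (D.2 i) (p i + δ / 2)) (le_min (hD i).le (by linarith)) (min_le_left _ _)
      (by rw [abs_of_nonneg (by simp; constructor <;> linarith)]
          have := min_le_right (D.2 i) (p i + δ / 2); linarith)).2
    have : p i < min (D.2 i) (p i + δ / 2) := lt_min (by linarith) (by linarith)
    linarith

/-! ### Generic horizontal sections -/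

/-- The set `P` is the union of the finite family `F` of non-degenerate boxes. -/
structure IsBoxUnion (P : Set Pt) (F : Finset (Pt × Pt)) : Prop where
  lt : ∀ c ∈ F, ∀ i, c.1 i < c.2 i
  eq_iUnion : P = ⋃ c ∈ F, Icc c.1 c.2

/-- The coordinates of the corners of the boxes in `F`. -/
noncomputable def gridCoords (F : Finset (Pt × Pt)) (i : Fin 3) : Finset ℝ :=
  F.image (fun c => c.1 i) ∪ F.image (fun c => c.2 i)

theorem fst_mem_gridCoords {F : Finset (Pt × Pt)} {c : Pt × Pt} (hc : c ∈ F) (i : Fin 3) :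
    c.1 i ∈ gridCoords F i :=
  Finset.mem_union_left _ (Finset.mem_image_of_mem (fun c : Pt × Pt => c.1 i) hc)

theorem snd_mem_gridCoords {F : Finset (Pt × Pt)} {c : Pt × Pt} (hc : c ∈ F) (i : Fin 3) :
    c.2 i ∈ gridCoords F i :=
  Finset.mem_union_right _ (Finset.mem_image_of_mem (fun c : Pt × Pt => c.2 i) hc)

/-- The sign of a direction along an axis. -/
def dirSign (s : Bool) : ℝ := cond s 1 (-1)

theorem dirSign_not (s : Bool) : dirSign (!s) = -dirSign s := by cases s <;> simp [dirSign]

theorem dirSign_sq (s : Bool) : dirSign s * dirSign s = 1 := by cases s <;> simp [dirSign]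

theorem dirSign_eq (s : Bool) : dirSign s = 1 ∨ dirSign s = -1 := by cases s <;> simp [dirSign]

theorem exists_dirSign {A : Bool → Prop} (hA : ∃ s, A s) {d : ℝ} :
    (∃ s, A s ∧ 0 ≤ dirSign s * d) ↔ (¬ A false → 0 ≤ d) ∧ (¬ A true → d ≤ 0) := by
  simp only [Bool.exists_bool, dirSign, cond_false, cond_true] at *
  by_cases h1 : A false <;> by_cases h2 : A true <;> simp [h1, h2] at *
  exact le_total d 0

namespace IsBoxUnion

variable {P : Set Pt} {F : Finset (Pt × Pt)}

theorem mem_iff (h : IsBoxUnion P F) {p : Pt} : p ∈ P ↔ ∃ c ∈ F, p ∈ Icc c.1 c.2 := by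
  have := h.eq_iUnion
  subst this
  simp only [mem_iUnion, exists_prop]

theorem box_subset (h : IsBoxUnion P F) {c : Pt × Pt} (hc : c ∈ F) : Icc c.1 c.2 ⊆ P :=
  fun _ hp => h.mem_iff.2 ⟨c, hc, hp⟩

theorem isCompact (h : IsBoxUnion P F) : IsCompact P := by
  rw [h.eq_iUnion]
  exact F.isCompact_biUnion fun _ _ => isCompact_Icc

theorem eventually_mem (h : IsBoxUnion P F) (p : Pt) :
    ∀ᶠ q in 𝓝 p, q ∈ P ↔ ∃ c ∈ F, p ∈ Icc c.1 c.2 ∧ q ∈ Icc c.1 c.2 := by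
  have : ∀ᶠ q in 𝓝 p, ∀ c ∈ F, q ∈ Icc c.1 c.2 → p ∈ Icc c.1 c.2 := by
    rw [Filter.eventually_all_finset]
    intro c _
    by_cases hp : p ∈ Icc c.1 c.2
    · exact Filter.Eventually.of_forall fun _ _ => hp
    · filter_upwards [(isClosed_box c).isOpen_compl.mem_nhds hp] with q hq hq'
      exact absurd hq' hq
  filter_upwards [this] with q hq
  rw [h.mem_iff]
  exact ⟨fun ⟨c, hc, hqc⟩ => ⟨c, hc, hq c hc hqc, hqc⟩, fun ⟨c, hc, _, hqc⟩ => ⟨c, hc, hqc⟩⟩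

theorem eventually_lt (F : Finset (Pt × Pt)) (p : Pt) : ∀ᶠ q in 𝓝 p, ∀ c ∈ F, ∀ l,
    (c.1 l < p l → c.1 l < q l) ∧ (p l < c.2 l → q l < c.2 l) := by
  rw [Filter.eventually_all_finset]
  intro c _
  rw [Filter.eventually_all]
  intro l
  refine Filter.Eventually.and ?_ ?_
  · by_cases hi : c.1 l < p l
    · filter_upwards [eventually_lt_apply hi] with q' h1 _ using h1
    · exact Filter.Eventually.of_forall fun _ h => absurd h hi
  · by_cases hi : p l < c.2 l
    · filter_upwards [eventually_apply_lt hi] with q' h1 _ using h1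
    · exact Filter.Eventually.of_forall fun _ h => absurd h hi

/-- Near a point at a generic level, the horizontal sections of `P` are unions of quadrants. -/
theorem quadrants (h : IsBoxUnion P F) {i j k : Fin 3} (hl : ∀ l, l = i ∨ l = j ∨ l = k) {p : Pt}
    (hp : p ∈ P) (hpk : p k ∉ gridCoords F k) : ∃ X : Bool → Bool → Prop, (∃ s t, X s t) ∧
      ∀ᶠ q in 𝓝 p, q ∈ P ↔ ∃ s t, X s t ∧ 0 ≤ dirSign s * (q i - p i) ∧
        0 ≤ dirSign t * (q j - p j) := by
  set ok : Pt × Pt → Fin 3 → Bool → Prop := fun c l t => cond t (p l < c.2 l) (c.1 l < p l) with hok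
  have key : ∀ c ∈ F, ∀ q : Pt, ∀ l, p ∈ Icc c.1 c.2 → q ∈ Icc c.1 c.2 →
      ∃ t, ok c l t ∧ 0 ≤ dirSign t * (q l - p l) := by
    intro c hc q l hpc hqc
    have h1 := mem_box.1 hpc l
    have h2 := mem_box.1 hqc l
    have h3 := h.lt c hc l
    by_cases h4 : p l < c.2 l ∧ p l ≤ q l
    · exact ⟨true, h4.1, by simp only [dirSign, cond_true]; linarith [h4.2]⟩
    · have h5 : q l ≤ p l := by
        by_contra! h5
        exact h4 ⟨h5.trans_le h2.2, h5.le⟩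
      rcases h1.1.lt_or_eq with h6 | h6
      · exact ⟨false, h6, by simp only [dirSign, cond_false]; linarith⟩
      · exact absurd ⟨h6 ▸ h3, h6 ▸ h2.1⟩ h4
  refine ⟨fun s t => ∃ c ∈ F, p ∈ Icc c.1 c.2 ∧ ok c i s ∧ ok c j t, ?_, ?_⟩
  · obtain ⟨c, hc, hpc⟩ := h.mem_iff.1 hp
    obtain ⟨s, hs, -⟩ := key c hc p i hpc hpc
    obtain ⟨t, ht, -⟩ := key c hc p j hpc hpc
    exact ⟨s, t, c, hc, hpc, hs, ht⟩
  · filter_upwards [h.eventually_mem p, eventually_lt F p] with q h1 h2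
    rw [h1]
    constructor
    · rintro ⟨c, hc, hpc, hqc⟩
      obtain ⟨s, hs, hs'⟩ := key c hc q i hpc hqc
      obtain ⟨t, ht, ht'⟩ := key c hc q j hpc hqc
      exact ⟨s, t, ⟨c, hc, hpc, hs, ht⟩, hs', ht'⟩
    · rintro ⟨s, t, ⟨c, hc, hpc, hs, ht⟩, hs', ht'⟩
      refine ⟨c, hc, hpc, mem_box.2 ?_⟩
      have h3 := mem_box.1 hpc
      have aux : ∀ l u, ok c l u → 0 ≤ dirSign u * (q l - p l) → c.1 l ≤ q l ∧ q l ≤ c.2 l := by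
        intro l u hu hu'
        cases u
        · simp only [hok, dirSign, cond_false] at hu hu'
          exact ⟨((h2 c hc l).1 hu).le, by linarith [(h3 l).2]⟩
        · simp only [hok, dirSign, cond_true] at hu hu'
          exact ⟨by linarith [(h3 l).1], ((h2 c hc l).2 hu).le⟩
      refine forall_axes hl (aux i s hs hs') (aux j t ht ht') ⟨((h2 c hc k).1 ?_).le,
        ((h2 c hc k).2 ?_).le⟩
      · exact lt_of_le_of_ne (h3 k).1 fun e => hpk (e ▸ fst_mem_gridCoords hc k)
      · exact lt_of_le_of_ne (h3 k).2 fun e => hpk (e ▸ snd_mem_gridCoords hc k)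

end IsBoxUnion

/-- A manifold does not consist of two parts on both sides of a coordinate plane that only touch
along this plane. -/
theorem IsThreeManifold.not_touching {P : Set Pt} (hP : IsThreeManifold P) {p : Pt} (hp : p ∈ P)
    {i : Fin 3} (hi : ∀ᶠ q in 𝓝 p, q i = p i → q ∉ interior P)
    (h1 : p ∈ closure (interior P ∩ {q | p i < q i}))
    (h2 : p ∈ closure (interior P ∩ {q | q i < p i})) : False := by
  refine hP.not_separated hp hi (isOpen_lt continuous_const (continuous_apply i))
    (isOpen_lt (continuous_apply i) continuous_const) ?_ ?_ h1 h2
  · exact disjoint_left.2 fun q (h3 : p i < q i) (h4 : q i < p i) => lt_asymm h3 h4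
  · rintro q ⟨h3, h4⟩
    rcases lt_trichotomy (q i) (p i) with h5 | h5 | h5
    · exact Or.inr h5
    · exact absurd h3 (h4 h5)
    · exact Or.inl h5

namespace IsTwoReflex

variable {P : Set Pt} {k : Fin 3} {F : Finset (Pt × Pt)}

/-- Two opposite quadrants of a generic section only occur where the section is a full
neighbourhood. With three quadrants there would be a vertical reflex edge, and with two of them the
polyhedron would not be a manifold. -/
theorem opposite_quadrants (h : IsTwoReflex P k) (hF : IsBoxUnion P F) {i j : Fin 3} (hji : j ≠ i)
    (hik : i ≠ k) (hjk : j ≠ k) (hl : ∀ l, l = i ∨ l = j ∨ l = k) {p : Pt} (hp : p ∈ P)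
    {X : Bool → Bool → Prop} (hX : ∀ᶠ q in 𝓝 p, q ∈ P ↔ ∃ s t, X s t ∧
      0 ≤ dirSign s * (q i - p i) ∧ 0 ≤ dirSign t * (q j - p j))
    {s t : Bool} (h1 : X s t) (h2 : X (!s) (!t)) : X s (!t) := by
  by_contra h3
  have hcases : ∀ a b, X a b ↔ (a = s ∧ b = t) ∨ (a = !s ∧ b = !t) ∨ (a = !s ∧ b = t ∧ X (!s) t) := by
    intro a b
    by_cases ha : a = s <;> by_cases hb : b = t
    · subst ha hb; simp [h1]
    · obtain rfl : b = !t := by cases b <;> cases t <;> simp_all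
      subst ha; simp [h3]
    · obtain rfl : a = !s := by cases a <;> cases s <;> simp_all
      subst hb; simp
    · obtain rfl : a = !s := by cases a <;> cases s <;> simp_all
      obtain rfl : b = !t := by cases b <;> cases t <;> simp_all
      simp [h2]
  by_cases h4 : X (!s) t
  · -- three quadrants
    refine (IsReflexPoint.exists_edge hF.isCompact.isBounded (k := k) (p := p)
      ⟨fun l => if l = i then dirSign s else dirSign (!t), fun l => ?_, ?_⟩).elim h.no_vertical
    · by_cases hli : l = i <;> simp [hli, dirSign_eq]
    · filter_upwards [hX] with q hq
      rw [hq]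
      have hR : (∃ l, l ≠ k ∧ (if l = i then dirSign s else dirSign (!t)) * (q l - p l) ≤ 0) ↔
          dirSign s * (q i - p i) ≤ 0 ∨ dirSign (!t) * (q j - p j) ≤ 0 := by
        constructor
        · rintro ⟨l, hlk, h5⟩
          rcases hl l with rfl | rfl | rfl
          · left; simpa using h5
          · right; simpa [hji] using h5
          · exact absurd rfl hlk
        · rintro (h5 | h5)
          · exact ⟨i, hik, by simpa using h5⟩
          · exact ⟨j, hjk, by simpa [hji] using h5⟩
      rw [hR]
      constructor
      · rintro ⟨a, b, hab, h5, h6⟩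
        rcases (hcases a b).1 hab with ⟨rfl, rfl⟩ | ⟨rfl, rfl⟩ | ⟨rfl, rfl, -⟩
        · right; rw [dirSign_not]; linarith
        · left; rw [dirSign_not] at h5; linarith
        · left; rw [dirSign_not] at h5; linarith
      · have hn := dirSign_not s
        have hn' := dirSign_not t
        rintro (h5 | h5)
        · rcases le_total 0 (dirSign t * (q j - p j)) with h6 | h6
          · exact ⟨!s, t, h4, by rw [hn]; linarith, h6⟩
          · exact ⟨!s, !t, h2, by rw [hn]; linarith, by rw [hn']; linarith⟩
        · rw [hn'] at h5
          rcases le_total 0 (dirSign s * (q i - p i)) with h6 | h6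
          · exact ⟨s, t, h1, h6, by linarith⟩
          · exact ⟨!s, t, h4, by rw [hn]; linarith, by linarith⟩
  · -- two opposite quadrants
    have hX' : ∀ᶠ q in 𝓝 p, q ∈ P ↔
        0 ≤ (dirSign s * (q i - p i)) ∧ 0 ≤ (dirSign t * (q j - p j)) ∨
        dirSign s * (q i - p i) ≤ 0 ∧ dirSign t * (q j - p j) ≤ 0 := by
      filter_upwards [hX] with q hq
      rw [hq]
      constructor
      · rintro ⟨a, b, hab, h5, h6⟩
        rcases (hcases a b).1 hab with ⟨rfl, rfl⟩ | ⟨rfl, rfl⟩ | ⟨rfl, rfl, h7⟩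
        · exact Or.inl ⟨h5, h6⟩
        · rw [dirSign_not] at h5 h6
          exact Or.inr ⟨by linarith, by linarith⟩
        · exact absurd h7 h4
      · rintro (⟨h5, h6⟩ | ⟨h5, h6⟩)
        · exact ⟨s, t, h1, h5, h6⟩
        · exact ⟨!s, !t, h2, by rw [dirSign_not]; linarith, by rw [dirSign_not]; linarith⟩
    have hs2 := dirSign_sq s
    have ht2 := dirSign_sq t
    have abs_s : ∀ c : ℝ, |dirSign s * c| = |c| := fun c => by cases s <;> simp [dirSign]
    have abs_t : ∀ c : ℝ, |dirSign t * c| = |c| := fun c => by cases t <;> simp [dirSign]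
    -- both quadrants have interior points close to `p`
    have hcl : ∀ a : ℝ, a = 1 ∨ a = -1 →
        p ∈ closure (interior P ∩ {q | 0 < a * (dirSign s * (q i - p i))}) := by
      intro a ha
      have haa : a * a = 1 := by rcases ha with rfl | rfl <;> norm_num
      rw [mem_closure_iff_nhds]
      intro N hN
      obtain ⟨δ, hδ, hd⟩ := eventually_nhds_cube.1 (hX'.eventually_nhds.and hN)
      set q : Pt := fun l => if l = i then p i + dirSign s * (a * (δ / 2)) else
        if l = j then p j + dirSign t * (a * (δ / 2)) else p l with hq
      have habs : |a * (δ / 2)| = δ / 2 := by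
        have h0 : |δ / 2| = δ / 2 := abs_of_pos (by linarith)
        rw [abs_mul, h0]; rcases ha with rfl | rfl <;> simp
      have qi : q i = p i + dirSign s * (a * (δ / 2)) := by simp [hq]
      have qj : q j = p j + dirSign t * (a * (δ / 2)) := by simp [hq, hji]
      have e1 : a * (dirSign s * (q i - p i)) = δ / 2 := by
        rw [qi]
        calc _ = (a * a) * (dirSign s * dirSign s) * (δ / 2) := by ring
          _ = _ := by rw [haa, hs2]; ring
      have e2 : a * (dirSign t * (q j - p j)) = δ / 2 := by
        rw [qj]
        calc _ = (a * a) * (dirSign t * dirSign t) * (δ / 2) := by ring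
          _ = _ := by rw [haa, ht2]; ring
      obtain ⟨h5, h6⟩ := hd q fun l => by
        by_cases hli : l = i
        · subst hli; rw [qi, add_sub_cancel_left, abs_s, habs]; linarith
        by_cases hlj : l = j
        · subst hlj; rw [qj, add_sub_cancel_left, abs_t, habs]; linarith
        · simp [hq, hli, hlj, hδ]
      refine ⟨q, h6, mem_interior_iff_mem_nhds.2 ?_, by
        change 0 < a * (dirSign s * (q i - p i)); rw [e1]; linarith⟩
      have c1 : ∀ᶠ q' : Pt in 𝓝 q, 0 < a * (dirSign s * (q' i - p i)) := by
        have hc : Continuous fun q' : Pt => a * (dirSign s * (q' i - p i)) := by fun_prop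
        exact hc.continuousAt.eventually (lt_mem_nhds (by simp only [e1]; linarith))
      have c2 : ∀ᶠ q' : Pt in 𝓝 q, 0 < a * (dirSign t * (q' j - p j)) := by
        have hc : Continuous fun q' : Pt => a * (dirSign t * (q' j - p j)) := by fun_prop
        exact hc.continuousAt.eventually (lt_mem_nhds (by simp only [e2]; linarith))
      filter_upwards [h5, c1, c2] with q' h7 h8 h9
      rw [h7]
      rcases ha with rfl | rfl
      · left; constructor <;> linarith
      · right; constructor <;> linarith
    have htouch : ∀ᶠ q in 𝓝 p, q i = p i → q ∉ interior P := by
      filter_upwards [hX'.eventually_nhds] with q hq hqi hint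
      obtain ⟨δ, hδ, hd⟩ := eventually_nhds_cube.1
        (hq.and (mem_interior_iff_mem_nhds.1 hint))
      have move : ∀ a : ℝ, a = 1 ∨ a = -1 → ∃ q' : Pt, dirSign s * (q' i - p i) = -(a * (δ / 2)) ∧
          dirSign t * (q' j - p j) = dirSign t * (q j - p j) + a * (δ / 2) ∧
          (0 ≤ (dirSign s * (q' i - p i)) ∧ 0 ≤ (dirSign t * (q' j - p j)) ∨
            dirSign s * (q' i - p i) ≤ 0 ∧ dirSign t * (q' j - p j) ≤ 0) := by
        intro a ha
        have habs : |a * (δ / 2)| = δ / 2 := by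
          have h0 : |δ / 2| = δ / 2 := abs_of_pos (by linarith)
          rw [abs_mul, h0]; rcases ha with rfl | rfl <;> simp
        set q' : Pt := fun l => if l = i then q i + dirSign s * (-(a * (δ / 2))) else
          if l = j then q j + dirSign t * (a * (δ / 2)) else q l with hq'
        have qi : q' i = q i + dirSign s * (-(a * (δ / 2))) := by simp [hq']
        have qj : q' j = q j + dirSign t * (a * (δ / 2)) := by simp [hq', hji]
        have h5 := hd q' fun l => by
          by_cases hli : l = i
          · subst hli; rw [qi, add_sub_cancel_left, abs_s, abs_neg, habs]; linarith
          by_cases hlj : l = j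
          · subst hlj; rw [qj, add_sub_cancel_left, abs_t, habs]; linarith
          · simp [hq', hli, hlj, hδ]
        refine ⟨q', ?_, ?_, h5.1.1 h5.2⟩
        · rw [qi, hqi]
          calc _ = (dirSign s * dirSign s) * (-(a * (δ / 2))) := by ring
            _ = _ := by rw [hs2]; ring
        · rw [qj]
          calc _ = dirSign t * (q j - p j) + (dirSign t * dirSign t) * (a * (δ / 2)) := by ring
            _ = _ := by rw [ht2]; ring
      rcases le_total 0 (dirSign t * (q j - p j)) with h5 | h5
      · obtain ⟨q', e1, e2, h6⟩ := move 1 (Or.inl rfl)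
        rw [e1, e2] at h6
        rcases h6 with h6 | h6 <;> linarith [h6.1, h6.2]
      · obtain ⟨q', e1, e2, h6⟩ := move (-1) (Or.inr rfl)
        rw [e1, e2] at h6
        rcases h6 with h6 | h6 <;> linarith [h6.1, h6.2]
    have hc1 := hcl 1 (Or.inl rfl)
    have hc2 := hcl (-1) (Or.inr rfl)
    cases s
    · simp only [dirSign, cond_false] at hc1 hc2
      refine h.polyhedron.manifold.not_touching hp htouch (closure_mono ?_ hc2)
        (closure_mono ?_ hc1) <;> rintro q ⟨h5, h6⟩ <;> refine ⟨h5, ?_⟩ <;>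
        simp only [mem_ofPred_eq] at h6 ⊢ <;> linarith
    · simp only [dirSign, cond_true] at hc1 hc2
      refine h.polyhedron.manifold.not_touching hp htouch (closure_mono ?_ hc1)
        (closure_mono ?_ hc2) <;> rintro q ⟨h5, h6⟩ <;> refine ⟨h5, ?_⟩ <;>
        simp only [mem_ofPred_eq] at h6 ⊢ <;> linarith

/-- At a generic level, the polyhedron is locally a box. -/
theorem local_box (h : IsTwoReflex P k) (hF : IsBoxUnion P F) {p : Pt} (hp : p ∈ P)
    (hpk : p k ∉ gridCoords F k) : ∃ D : Pt × Pt, (∀ l, D.1 l ≤ p l ∧ p l ≤ D.2 l ∧ D.1 l < D.2 l) ∧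
      D.1 k < p k ∧ p k < D.2 k ∧ ∀ᶠ q in 𝓝 p, q ∈ P ↔ q ∈ Icc D.1 D.2 := by
  classical
  obtain ⟨i, hik⟩ : ∃ i, i ≠ k := exists_ne k
  obtain ⟨j, hji, hjk, hl⟩ := exists_third hik
  obtain ⟨X, ⟨s₀, t₀, hX₀⟩, hX⟩ := hF.quadrants hl hp hpk
  have hopp : ∀ s t, X s t → X (!s) (!t) → X s (!t) := fun s t =>
    h.opposite_quadrants hF hji hik hjk hl hp hX
  -- the pattern of the quadrants in `P` is a product of two sets of directions
  have hprod : ∀ s t s' t', X s t' → X s' t → X s t := by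
    intro s t s' t' h1 h2
    by_cases hs : s' = s
    · exact hs ▸ h2
    by_cases ht : t' = t
    · exact ht ▸ h1
    obtain rfl : s' = !s := by cases s <;> cases s' <;> simp_all
    obtain rfl : t' = !t := by cases t <;> cases t' <;> simp_all
    have := hopp s (!t) h1 (by rwa [Bool.not_not])
    rwa [Bool.not_not] at this
  set A : Fin 3 → Bool → Prop := fun l u =>
    if l = i then ∃ t, X u t else if l = j then ∃ s, X s u else True with hA
  have Ai : ∀ u, A i u ↔ ∃ t, X u t := fun u => by simp [hA]
  have Aj : ∀ u, A j u ↔ ∃ s, X s u := fun u => by simp [hA, hji]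
  have Ak : ∀ u, A k u := fun u => by simp [hA, hik.symm, hjk.symm]
  have Ane : ∀ l, ∃ u, A l u :=
    forall_axes hl ⟨s₀, (Ai _).2 ⟨t₀, hX₀⟩⟩ ⟨t₀, (Aj _).2 ⟨s₀, hX₀⟩⟩ ⟨true, Ak _⟩
  set D : Pt × Pt := (fun l => if A l false then p l - 1 else p l,
    fun l => if A l true then p l + 1 else p l) with hD
  refine ⟨D, fun l => ?_, by simp [hD, Ak], by simp [hD, Ak], ?_⟩
  · obtain ⟨u, hu⟩ := Ane l
    simp only [hD]
    by_cases h1 : A l false <;> by_cases h2 : A l true <;> simp only [h1, h2, if_true, if_false]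
    · exact ⟨by linarith, by linarith, by linarith⟩
    · exact ⟨by linarith, by linarith, by linarith⟩
    · exact ⟨by linarith, by linarith, by linarith⟩
    · cases u
      exacts [absurd hu h1, absurd hu h2]
  · have hcube : ∀ᶠ q in 𝓝 p, ∀ l, |q l - p l| < 1 :=
      eventually_nhds_cube.2 ⟨1, one_pos, fun q hq => hq⟩
    filter_upwards [hX, hcube] with q h1 h2
    have hDl : ∀ l, (D.1 l ≤ q l ∧ q l ≤ D.2 l) ↔ ∃ u, A l u ∧ 0 ≤ dirSign u * (q l - p l) := by
      intro l
      rw [exists_dirSign (Ane l)]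
      have := abs_lt.1 (h2 l)
      simp only [hD]
      refine and_congr ?_ ?_
      · by_cases h3 : A l false <;> simp only [h3, if_true, if_false, not_true, false_imp_iff,
          iff_true, not_false_eq_true, true_imp_iff, sub_nonneg]
        linarith
      · by_cases h3 : A l true <;> simp only [h3, if_true, if_false, not_true, false_imp_iff,
          iff_true, not_false_eq_true, true_imp_iff, sub_nonpos]
        linarith
    rw [h1, mem_box]
    constructor
    · rintro ⟨s, t, hst, h3, h4⟩
      exact forall_axes hl ((hDl i).2 ⟨s, (Ai s).2 ⟨t, hst⟩, h3⟩)
        ((hDl j).2 ⟨t, (Aj t).2 ⟨s, hst⟩, h4⟩)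
        ((hDl k).2 (by
          rcases le_total 0 (q k - p k) with h5 | h5
          · exact ⟨true, Ak _, by simpa [dirSign] using h5⟩
          · exact ⟨false, Ak _, by simpa [dirSign] using h5⟩))
    · intro h3
      obtain ⟨s, hs, hs'⟩ := (hDl i).1 (h3 i)
      obtain ⟨t, ht, ht'⟩ := (hDl j).1 (h3 j)
      obtain ⟨t₁, h4⟩ := (Ai s).1 hs
      obtain ⟨s₁, h5⟩ := (Aj t).1 ht
      exact ⟨s, t, hprod s t s₁ t₁ h4 h5, hs', ht'⟩

end IsTwoReflex

/-! ### Slabs and bricks -/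

/-- The local form of `IsSlab`: the box is contained in `P`, and near its points at inner levels
there are no other points of `P`. -/
def LocalSlab (P : Set Pt) (k : Fin 3) (B : Pt × Pt) : Prop :=
  (∀ i, B.1 i < B.2 i) ∧ Icc B.1 B.2 ⊆ P ∧
    ∀ q ∈ Icc B.1 B.2, B.1 k < q k → q k < B.2 k → ∀ᶠ q' in 𝓝 q, q' ∈ P → q' ∈ Icc B.1 B.2

theorem update_mem_box {B : Pt × Pt} {q : Pt} (hq : q ∈ Icc B.1 B.2) {l : Fin 3} {t : ℝ}
    (ht : B.1 l ≤ t ∧ t ≤ B.2 l) : Function.update q l t ∈ Icc B.1 B.2 := by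
  refine mem_box.2 fun m => ?_
  by_cases hm : m = l
  · subst hm; simpa using ht
  · simpa [hm] using mem_box.1 hq m

theorem continuous_update_line (q : Pt) (l : Fin 3) :
    Continuous fun t : ℝ => Function.update q l t :=
  continuous_const.update l continuous_id

theorem box_subset_of_inner {P : Set Pt} {k : Fin 3} {B : Pt × Pt} (hP : IsClosed P)
    (hlt : B.1 k < B.2 k)
    (h : ∀ q ∈ Icc B.1 B.2, B.1 k < q k → q k < B.2 k → q ∈ P) : Icc B.1 B.2 ⊆ P := by
  intro q hq
  have hc : IsClosed {t : ℝ | Function.update q k t ∈ P} :=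
    hP.preimage (continuous_update_line q k)
  have h1 : Ioo (B.1 k) (B.2 k) ⊆ {t : ℝ | Function.update q k t ∈ P} := fun t ht =>
    h _ (update_mem_box hq ⟨ht.1.le, ht.2.le⟩) (by simpa using ht.1) (by simpa using ht.2)
  have h2 := hc.closure_subset_iff.2 h1
  rw [closure_Ioo hlt.ne] at h2
  have h3 := h2 (mem_box.1 hq k)
  simpa using h3

theorem mem_closure_interior_box {B : Pt × Pt} (hB : ∀ i, B.1 i < B.2 i) {p : Pt}
    (hp : p ∈ Icc B.1 B.2) : p ∈ closure (interior (Icc B.1 B.2)) := by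
  rw [(convex_box B).closure_interior_eq_closure_of_nonempty_interior]
  · exact subset_closure hp
  · refine ⟨fun i => (B.1 i + B.2 i) / 2, ?_⟩
    rw [IsBrickComplex.interior_box]
    intro i
    have := hB i
    constructor <;> linarith

/-- For finite unions of boxes, a neighbourhood of a section spreads to nearby levels. -/
theorem IsBoxUnion.isSlab_iff {P : Set Pt} {F : Finset (Pt × Pt)} (hF : IsBoxUnion P F) {k : Fin 3}
    {B : Pt × Pt} : IsSlab P k B ↔ LocalSlab P k B := by
  constructor
  · rintro ⟨hlt, hB⟩
    have hinner : ∀ q ∈ Icc B.1 B.2, B.1 k < q k → q k < B.2 k → q ∈ P := fun q hq h1 h2 => by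
      have : q ∈ Icc B.1 B.2 ∩ {q' | q' k = q k} := ⟨hq, rfl⟩
      rw [← hB q hq h1 h2] at this
      exact (connectedComponentIn_subset _ _ this).1
    refine ⟨hlt, box_subset_of_inner hF.isCompact.isClosed (hlt k) hinner, fun q hq h1 h2 => ?_⟩
    filter_upwards [hF.eventually_mem q, eventually_lt_apply h1, eventually_apply_lt h2]
      with q' h3 h4 h5 hq'
    obtain ⟨c, hc, hqc, hqc'⟩ := h3.1 hq'
    -- the point over `q` at the level of `q'`
    set x : Pt := Function.update q k (q' k) with hx
    have xB : x ∈ Icc B.1 B.2 := update_mem_box hq ⟨h4.le, h5.le⟩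
    have xc : x ∈ Icc c.1 c.2 := update_mem_box hqc (mem_box.1 hqc' k)
    have xk : x k = q' k := by simp [hx]
    have h6 : Icc c.1 c.2 ∩ {y | y k = x k} ⊆ connectedComponentIn (P ∩ {y | y k = x k}) x :=
      ((convex_box c).inter (convex_level k _)).isPreconnected.subset_connectedComponentIn
        ⟨xc, rfl⟩ (inter_subset_inter_left _ (hF.box_subset hc))
    have h7 := h6 ⟨hqc', xk.symm⟩
    rw [hB x xB (by rw [xk]; exact h4) (by rw [xk]; exact h5)] at h7
    exact h7.1
  · rintro ⟨hlt, hsub, hloc⟩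
    refine ⟨hlt, fun p hp h1 h2 => Subset.antisymm ?_ ?_⟩
    · have hC : connectedComponentIn (P ∩ {q | q k = p k}) p ⊆ P ∩ {q | q k = p k} :=
        connectedComponentIn_subset _ _
      refine subset_inter ?_ (hC.trans inter_subset_right)
      by_contra hcon
      obtain ⟨y, hy, hyB⟩ := not_subset.1 hcon
      -- the box is relatively open and closed at this level, so that the component stays in it
      have hUo : IsOpen {q | ∀ᶠ q' in 𝓝 q, q' ∈ P → q' ∈ Icc B.1 B.2} :=
        isOpen_iff_mem_nhds.2 fun q hq => Filter.Eventually.eventually_nhds hq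
      obtain ⟨x, hx, hxU, hxB⟩ := isPreconnected_connectedComponentIn _ _ hUo
        (isClosed_box B).isOpen_compl (fun q hq => by
          by_cases hqB : q ∈ Icc B.1 B.2
          · have hqk : q k = p k := (hC hq).2
            exact Or.inl (hloc q hqB (by rw [hqk]; exact h1) (by rw [hqk]; exact h2))
          · exact Or.inr hqB)
        ⟨p, mem_connectedComponentIn (F := P ∩ {q | q k = p k}) ⟨hsub hp, rfl⟩, hloc p hp h1 h2⟩
        ⟨y, hy, hyB⟩
      exact hxB (Filter.Eventually.self_of_nhds hxU (hC hx).1)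
    · exact ((convex_box B).inter (convex_level k _)).isPreconnected.subset_connectedComponentIn
        ⟨hp, rfl⟩ (inter_subset_inter_left _ hsub)

/-- Slabs that share a point at an inner level of both have the same horizontal extent. -/
theorem IsSlab.same_extent {P : Set Pt} {k : Fin 3} {B C : Pt × Pt} (hB : IsSlab P k B)
    (hC : IsSlab P k C) {p : Pt} (pB : p ∈ Icc B.1 B.2) (pC : p ∈ Icc C.1 C.2)
    (hB1 : B.1 k < p k) (hB2 : p k < B.2 k) (hC1 : C.1 k < p k) (hC2 : p k < C.2 k) :
    ∀ l, l ≠ k → C.1 l = B.1 l ∧ C.2 l = B.2 l := by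
  have e := (hB.2 p pB hB1 hB2).symm.trans (hC.2 p pC hC1 hC2)
  have key : ∀ {B C : Pt × Pt}, Icc B.1 B.2 ∩ {q | q k = p k} ⊆ Icc C.1 C.2 ∩ {q | q k = p k} →
      (∀ i, B.1 i < B.2 i) → B.1 k < p k → p k < B.2 k →
      ∀ l, l ≠ k → C.1 l ≤ B.1 l ∧ B.2 l ≤ C.2 l := by
    intro B C hsub hlt h1 h2 l hl
    have hle : B.1 ≤ B.2 := fun i => (hlt i).le
    have ht : B.1 k ≤ p k ∧ p k ≤ B.2 k := ⟨h1.le, h2.le⟩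
    have h3 := (hsub ⟨update_mem_box ⟨le_rfl, hle⟩ ht, by simp⟩).1.1 l
    have h4 := (hsub ⟨update_mem_box ⟨hle, le_rfl⟩ ht, by simp⟩).1.2 l
    simp only [Function.update_of_ne hl] at h3 h4
    exact ⟨h3, h4⟩
  intro l hl
  have h1 := key e.subset hB.1 hB1 hB2 l hl
  have h2 := key e.symm.subset hC.1 hC1 hC2 l hl
  exact ⟨le_antisymm h1.1 h2.1, le_antisymm h2.2 h1.2⟩

/-- A box is a slab if it is covered by slabs of the same horizontal extent whose inner levels
cover its inner levels. -/
theorem LocalSlab.glue {P : Set Pt} {k : Fin 3} {B : Pt × Pt} (hP : IsClosed P)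
    (hlt : ∀ i, B.1 i < B.2 i)
    (h : ∀ t, B.1 k < t → t < B.2 k → ∃ C, LocalSlab P k C ∧
      (∀ l, l ≠ k → C.1 l = B.1 l ∧ C.2 l = B.2 l) ∧ C.1 k < t ∧ t < C.2 k ∧
      B.1 k ≤ C.1 k ∧ C.2 k ≤ B.2 k) : LocalSlab P k B := by
  have hin : ∀ q ∈ Icc B.1 B.2, B.1 k < q k → q k < B.2 k → ∃ C, LocalSlab P k C ∧
      Icc C.1 C.2 ⊆ Icc B.1 B.2 ∧ q ∈ Icc C.1 C.2 ∧ C.1 k < q k ∧ q k < C.2 k := by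
    intro q hq h1 h2
    obtain ⟨C, hC, hCB, h3, h4, h5, h6⟩ := h (q k) h1 h2
    refine ⟨C, hC, Icc_subset_Icc (fun l => ?_) (fun l => ?_), mem_box.2 fun l => ?_, h3, h4⟩ <;>
      by_cases hl : l = k
    · subst hl; exact h5
    · exact (hCB l hl).1.ge
    · subst hl; exact h6
    · exact (hCB l hl).2.le
    · subst hl; exact ⟨h3.le, h4.le⟩
    · rw [(hCB l hl).1, (hCB l hl).2]; exact mem_box.1 hq l
  refine ⟨hlt, box_subset_of_inner hP (hlt k) fun q hq h1 h2 => ?_, fun q hq h1 h2 => ?_⟩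
  · obtain ⟨C, hC, -, hqC, -⟩ := hin q hq h1 h2
    exact hC.2.1 hqC
  · obtain ⟨C, hC, hsub, hqC, h3, h4⟩ := hin q hq h1 h2
    exact (hC.2.2 q hqC h3 h4).mono fun q' h5 h6 => hsub (h5 h6)

namespace IsBoxUnion

variable {P : Set Pt} {k : Fin 3} {F : Finset (Pt × Pt)}

theorem isBrick_localSlab (hF : IsBoxUnion P F) {B : Pt × Pt} (hB : IsBrick P k B) :
    LocalSlab P k B := hF.isSlab_iff.1 hB.1

/-- A brick contains the slabs that overlap it. -/
theorem slab_subset_brick (hF : IsBoxUnion P F) {B C : Pt × Pt} (hB : IsBrick P k B)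
    (hC : IsSlab P k C) {p : Pt} (pB : p ∈ Icc B.1 B.2) (pC : p ∈ Icc C.1 C.2)
    (hB1 : B.1 k < p k) (hB2 : p k < B.2 k) (hC1 : C.1 k < p k) (hC2 : p k < C.2 k) :
    Icc C.1 C.2 ⊆ Icc B.1 B.2 := by
  have hs := hB.1.same_extent hC pB pC hB1 hB2 hC1 hC2
  have hlB := hB.1.1
  have hslab : LocalSlab P k (B.1 ⊓ C.1, B.2 ⊔ C.2) := by
    have e1 : ∀ l, l ≠ k → (B.1 ⊓ C.1) l = B.1 l := fun l hl => by
      rw [Pi.inf_apply, (hs l hl).1, inf_idem]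
    have e2 : ∀ l, l ≠ k → (B.2 ⊔ C.2) l = B.2 l := fun l hl => by
      rw [Pi.sup_apply, (hs l hl).2, sup_idem]
    refine LocalSlab.glue hF.isCompact.isClosed (fun i => ?_) fun t h1 h2 => ?_
    · exact (inf_le_left.trans_lt (hlB i)).trans_le le_sup_left
    · simp only [Pi.inf_apply, Pi.sup_apply, inf_lt_iff, lt_sup_iff] at h1 h2
      by_cases h3 : B.1 k < t ∧ t < B.2 k
      · exact ⟨B, hF.isBrick_localSlab hB, fun l hl => ⟨(e1 l hl).symm, (e2 l hl).symm⟩, h3.1, h3.2,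
          inf_le_left, le_sup_left⟩
      · refine ⟨C, hF.isSlab_iff.1 hC, fun l hl => ⟨?_, ?_⟩, ?_, ?_, inf_le_right, le_sup_right⟩
        · rw [(hs l hl).1]; exact (e1 l hl).symm
        · rw [(hs l hl).2]; exact (e2 l hl).symm
        · by_contra! h4
          exact h3 ⟨h1.resolve_right (not_lt.2 h4), by linarith⟩
        · by_contra! h4
          exact h3 ⟨by linarith, h2.resolve_right (not_lt.2 h4)⟩
  have := hB.2 _ (hF.isSlab_iff.2 hslab) (Icc_subset_Icc inf_le_left le_sup_left)
  rw [← this]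
  exact Icc_subset_Icc inf_le_right le_sup_right

theorem brick_eq (hF : IsBoxUnion P F) {B C : Pt × Pt} (hB : IsBrick P k B)
    (hC : IsBrick P k C) {p : Pt} (pB : p ∈ Icc B.1 B.2) (pC : p ∈ Icc C.1 C.2)
    (hB1 : B.1 k < p k) (hB2 : p k < B.2 k) (hC1 : C.1 k < p k) (hC2 : p k < C.2 k) : B = C :=
  hC.2 B hB.1 (hF.slab_subset_brick hB hC.1 pB pC hB1 hB2 hC1 hC2)

/-- Each slab is contained in a brick. -/
theorem exists_brick (hF : IsBoxUnion P F) {B : Pt × Pt} (hB : IsSlab P k B) :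
    ∃ C, IsBrick P k C ∧ Icc B.1 B.2 ⊆ Icc C.1 C.2 := by
  have hlt := hB.1
  have hmid : B.1 k < (B.1 k + B.2 k) / 2 ∧ (B.1 k + B.2 k) / 2 < B.2 k := by
    have := hlt k
    constructor <;> linarith
  have hle : B.1 ≤ B.2 := fun i => (hlt i).le
  -- the slabs that contain `B` have the same horizontal extent
  have hsame : ∀ C, IsSlab P k C → Icc B.1 B.2 ⊆ Icc C.1 C.2 →
      (C.1 k ≤ B.1 k ∧ B.2 k ≤ C.2 k) ∧ ∀ l, l ≠ k → C.1 l = B.1 l ∧ C.2 l = B.2 l := by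
    intro C hC hBC
    have h1 := (hBC ⟨le_rfl, hle⟩).1 k
    have h2 := (hBC ⟨hle, le_rfl⟩).2 k
    have hm : Function.update B.1 k ((B.1 k + B.2 k) / 2) ∈ Icc B.1 B.2 :=
      update_mem_box ⟨le_rfl, hle⟩ ⟨hmid.1.le, hmid.2.le⟩
    refine ⟨⟨h1, h2⟩, hB.same_extent hC hm (hBC hm) ?_ ?_ ?_ ?_⟩ <;>
      rw [Function.update_self] <;> linarith
  obtain ⟨R, hR⟩ := hF.isCompact.isBounded.exists_norm_le
  have habs : ∀ C, IsSlab P k C → |C.1 k| ≤ R ∧ |C.2 k| ≤ R := by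
    intro C hC
    have hCP := (hF.isSlab_iff.1 hC).2.1
    have hCle : C.1 ≤ C.2 := fun i => (hC.1 i).le
    exact ⟨(norm_le_pi_norm C.1 k).trans (hR _ (hCP ⟨le_rfl, hCle⟩)),
      (norm_le_pi_norm C.2 k).trans (hR _ (hCP ⟨hCle, le_rfl⟩))⟩
  -- the lowest bottom and the highest top of these slabs bound a slab
  set L : Set ℝ := {t | ∃ C, IsSlab P k C ∧ Icc B.1 B.2 ⊆ Icc C.1 C.2 ∧ C.1 k = t} with hL
  set U : Set ℝ := {t | ∃ C, IsSlab P k C ∧ Icc B.1 B.2 ⊆ Icc C.1 C.2 ∧ C.2 k = t} with hU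
  have hLB : B.1 k ∈ L := ⟨B, hB, Subset.rfl, rfl⟩
  have hUB : B.2 k ∈ U := ⟨B, hB, Subset.rfl, rfl⟩
  have hLb : BddBelow L := ⟨-R, by
    rintro _ ⟨C, hC, -, rfl⟩; exact (abs_le.1 (habs C hC).1).1⟩
  have hUb : BddAbove U := ⟨R, by
    rintro _ ⟨C, hC, -, rfl⟩; exact (abs_le.1 (habs C hC).2).2⟩
  have hLle := csInf_le hLb hLB
  have hUle := le_csSup hUb hUB
  set M : Pt × Pt := (Function.update B.1 k (sInf L), Function.update B.2 k (sSup U)) with hM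
  have hM1 : M.1 k = sInf L := by simp [hM]
  have hM2 : M.2 k = sSup U := by simp [hM]
  have hMl : ∀ l, l ≠ k → M.1 l = B.1 l ∧ M.2 l = B.2 l := fun l hl => by simp [hM, hl]
  have hMlt : ∀ i, M.1 i < M.2 i := by
    intro i
    by_cases hi : i = k
    · subst hi; rw [hM1, hM2]; linarith [hlt i]
    · rw [(hMl i hi).1, (hMl i hi).2]; exact hlt i
  have hMslab : LocalSlab P k M := by
    refine LocalSlab.glue hF.isCompact.isClosed hMlt fun t h1 h2 => ?_
    rw [hM1] at h1
    rw [hM2] at h2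
    obtain ⟨_, ⟨C, hC, hBC, rfl⟩, hCt⟩ := exists_lt_of_csInf_lt ⟨_, hLB⟩ h1
    obtain ⟨_, ⟨D, hD, hBD, rfl⟩, hDt⟩ := exists_lt_of_lt_csSup ⟨_, hUB⟩ h2
    have key : ∀ C, IsSlab P k C → Icc B.1 B.2 ⊆ Icc C.1 C.2 →
        (∀ l, l ≠ k → C.1 l = M.1 l ∧ C.2 l = M.2 l) ∧ M.1 k ≤ C.1 k ∧ C.2 k ≤ M.2 k := by
      intro C hC hBC
      refine ⟨fun l hl => ?_, ?_, ?_⟩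
      · rw [(hMl l hl).1, (hMl l hl).2]; exact (hsame C hC hBC).2 l hl
      · rw [hM1]; exact csInf_le hLb ⟨C, hC, hBC, rfl⟩
      · rw [hM2]; exact le_csSup hUb ⟨C, hC, hBC, rfl⟩
    by_cases h3 : t < C.2 k
    · obtain ⟨h4, h5, h6⟩ := key C hC hBC
      exact ⟨C, hF.isSlab_iff.1 hC, h4, hCt, h3, h5, h6⟩
    · obtain ⟨h4, h5, h6⟩ := key D hD hBD
      refine ⟨D, hF.isSlab_iff.1 hD, h4, ?_, hDt, h5, h6⟩
      have h7 := (hsame C hC hBC).1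
      have h8 := (hsame D hD hBD).1
      linarith [hlt k]
  have hBM : Icc B.1 B.2 ⊆ Icc M.1 M.2 := by
    refine Icc_subset_Icc (fun l => ?_) (fun l => ?_) <;> by_cases hl : l = k
    · subst hl; rw [hM1]; exact hLle
    · exact (hMl l hl).1.le
    · subst hl; rw [hM2]; exact hUle
    · exact (hMl l hl).2.ge
  refine ⟨M, ⟨hF.isSlab_iff.2 hMslab, fun C hC hMC => ?_⟩, hBM⟩
  have hBC := hBM.trans hMC
  have hMle : M.1 ≤ M.2 := fun i => (hMlt i).le
  refine Prod.ext (funext fun l => ?_) (funext fun l => ?_) <;> by_cases hl : l = k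
  · subst hl
    exact le_antisymm ((hMC ⟨le_rfl, hMle⟩).1 l) (by
      rw [hM1]; exact csInf_le hLb ⟨C, hC, hBC, rfl⟩)
  · rw [(hMl l hl).1]; exact ((hsame C hC hBC).2 l hl).1
  · subst hl
    exact le_antisymm (by rw [hM2]; exact le_csSup hUb ⟨C, hC, hBC, rfl⟩)
      ((hMC ⟨hMle, le_rfl⟩).2 l)
  · rw [(hMl l hl).2]; exact ((hsame C hC hBC).2 l hl).2

/-- The vertical sides of a slab lie on sides of boxes in `F`. -/
theorem side_mem_gridCoords (hF : IsBoxUnion P F) {B : Pt × Pt} (hB : LocalSlab P k B) {l : Fin 3}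
    (hl : l ≠ k) (s : Bool) : side B l s ∈ gridCoords F l := by
  by_contra hcon
  set q : Pt := fun m => if m = l then side B l s else (B.1 m + B.2 m) / 2 with hq
  have ql : q l = side B l s := by simp [hq]
  have qm : ∀ m, m ≠ l → B.1 m < q m ∧ q m < B.2 m := fun m hm => by
    have := hB.1 m
    simp only [hq, hm, if_false]
    constructor <;> linarith
  have qB : q ∈ Icc B.1 B.2 := mem_box.2 fun m => by
    by_cases hm : m = l
    · subst hm; rw [ql]; exact side_bounds (hB.1 m) s
    · exact ⟨(qm m hm).1.le, (qm m hm).2.le⟩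
  obtain ⟨c, hc, qc⟩ := hF.mem_iff.1 (hB.2.1 qB)
  have c1 : c.1 l < q l := lt_of_le_of_ne (mem_box.1 qc l).1 fun e =>
    hcon (by rw [← ql, ← e]; exact fst_mem_gridCoords hc l)
  have c2 : q l < c.2 l := lt_of_le_of_ne (mem_box.1 qc l).2 fun e =>
    hcon (by rw [← ql, e]; exact snd_mem_gridCoords hc l)
  have hev := hB.2.2 q qB (qm k hl.symm).1 (qm k hl.symm).2
  have hcont := (continuous_update_line q l).tendsto (q l)
  rw [Function.update_eq_self] at hcont
  obtain ⟨δ, hδ, hd⟩ := Metric.eventually_nhds_iff.1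
    ((hcont.eventually hev).and ((lt_mem_nhds c1).and (gt_mem_nhds c2)))
  have key : ∀ a : ℝ, |a| < δ → B.1 l ≤ q l + a ∧ q l + a ≤ B.2 l := by
    intro a ha
    obtain ⟨h1, h2, h3⟩ := @hd (q l + a) (by rw [Real.dist_eq]; simpa using ha)
    have := mem_box.1 (h1 (hF.box_subset hc (update_mem_box qc ⟨h2.le, h3.le⟩))) l
    simpa using this
  have h1 := key (δ / 2) (by rw [abs_of_pos (by linarith)]; linarith)
  have h2 := key (-(δ / 2)) (by rw [abs_neg, abs_of_pos (by linarith)]; linarith)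
  cases s
  · simp only [side_false] at ql; linarith
  · simp only [side_true] at ql; linarith

end IsBoxUnion

namespace IsTwoReflex

variable {P : Set Pt} {k : Fin 3} {F : Finset (Pt × Pt)}

/-- Points at generic levels lie in slabs. -/
theorem exists_slab (h : IsTwoReflex P k) (hF : IsBoxUnion P F) {p : Pt} (hp : p ∈ P)
    (hpk : p k ∉ gridCoords F k) :
    ∃ K, IsSlab P k K ∧ p ∈ Icc K.1 K.2 ∧ K.1 k < p k ∧ p k < K.2 k := by
  obtain ⟨ε, hε, hball⟩ := Metric.isOpen_iff.1 (gridCoords F k).finite_toSet.isClosed.isOpen_compl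
    (p k) (by simpa using hpk)
  -- all levels near that of `p` are generic, so that the thickened section `S` is locally a box
  set S : Set Pt := P ∩ {q | |q k - p k| ≤ ε / 2} with hS
  have hSmem : ∀ q : Pt, q ∈ S ↔ q ∈ P ∧ |q k - p k| ≤ ε / 2 := fun q => Iff.rfl
  have hgen : ∀ q : Pt, |q k - p k| ≤ ε / 2 → q k ∉ gridCoords F k := fun q hq => by
    have : q k ∈ ((gridCoords F k : Set ℝ))ᶜ :=
      hball (by rw [Metric.mem_ball, Real.dist_eq]; linarith)
    simpa using this
  have hScomp : IsCompact S := hF.isCompact.inter_right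
    (isClosed_le (by fun_prop) continuous_const)
  have hloc : ∀ q ∈ S, ∃ D : Pt × Pt, (∀ i, D.1 i < D.2 i) ∧ q ∈ Icc D.1 D.2 ∧
      ∀ᶠ q' in 𝓝 q, q' ∈ S ↔ q' ∈ Icc D.1 D.2 := by
    rintro q ⟨hqP, hqk : |q k - p k| ≤ ε / 2⟩
    obtain ⟨D, hD, hD1, hD2, hDP⟩ := h.local_box hF hqP (hgen q hqk)
    have hqk' := abs_le.1 hqk
    refine ⟨(Function.update D.1 k (max (D.1 k) (p k - ε / 2)),
      Function.update D.2 k (min (D.2 k) (p k + ε / 2))), fun i => ?_, mem_box.2 fun i => ?_, ?_⟩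
    · by_cases hi : i = k
      · subst hi
        simp only [Function.update_self]
        refine max_lt (lt_min (hD1.trans hD2) ?_) (lt_min ?_ ?_) <;> linarith
      · simpa [hi] using (hD i).2.2
    · by_cases hi : i = k
      · subst hi
        simp only [Function.update_self]
        exact ⟨max_le hD1.le (by linarith), le_min hD2.le (by linarith)⟩
      · simpa [hi] using ⟨(hD i).1, (hD i).2.1⟩
    · filter_upwards [hDP] with q' hq'
      rw [hSmem, hq', mem_box, mem_box (A := (_, _))]
      constructor
      · rintro ⟨h1, h2⟩ i
        have h2 := abs_le.1 h2
        by_cases hi : i = k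
        · subst hi
          simp only [Function.update_self]
          exact ⟨max_le (h1 i).1 (by linarith), le_min (h1 i).2 (by linarith)⟩
        · simpa [hi] using h1 i
      · intro h1
        have h2 := h1 k
        simp only [Function.update_self, max_le_iff, le_min_iff] at h2
        refine ⟨fun i => ?_, abs_le.2 ⟨by linarith, by linarith⟩⟩
        by_cases hi : i = k
        · subst hi; exact ⟨h2.1.1, h2.2.1⟩
        · simpa [hi] using h1 i
  have hpS : p ∈ S := ⟨hp, by
    change |p k - p k| ≤ ε / 2
    rw [sub_self, abs_zero]; linarith⟩
  obtain ⟨K, hK, pK, hKS, hopen⟩ := exists_box_component hScomp hloc hpS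
  have hKle : K.1 ≤ K.2 := fun i => (hK i).le
  refine ⟨K, hF.isSlab_iff.2 ⟨hK, hKS.trans inter_subset_left, fun q hq h1 h2 => ?_⟩, pK, ?_⟩
  · have k1 : |K.1 k - p k| ≤ ε / 2 := (hKS ⟨le_rfl, hKle⟩).2
    have k2 : |K.2 k - p k| ≤ ε / 2 := (hKS ⟨hKle, le_rfl⟩).2
    rw [abs_le] at k1 k2
    filter_upwards [hopen q hq, eventually_lt_apply h1, eventually_apply_lt h2] with q' h3 h4 h5 h6
    have h7 : |q' k - p k| ≤ ε / 2 := abs_le.2 ⟨by linarith, by linarith⟩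
    exact h3 ⟨h6, h7⟩
  · -- `P` extends above and below `p`
    obtain ⟨D, hD, hD1, hD2, hDP⟩ := h.local_box hF hp hpk
    have hcont := (continuous_update_line p k).tendsto (p k)
    rw [Function.update_eq_self] at hcont
    obtain ⟨δ, hδ, hd⟩ := Metric.eventually_nhds_iff.1
      ((hcont.eventually ((hopen p pK).and hDP)).and ((lt_mem_nhds hD1).and (gt_mem_nhds hD2)))
    have key : ∀ a : ℝ, |a| < δ → |a| ≤ ε / 2 → K.1 k ≤ p k + a ∧ p k + a ≤ K.2 k := by
      intro a ha ha'
      obtain ⟨⟨h1, h2⟩, h3, h4⟩ := @hd (p k + a) (by rw [Real.dist_eq]; simpa using ha)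
      have h5 := h1 ⟨h2.2 (update_mem_box (mem_box.2 fun l => ⟨(hD l).1, (hD l).2.1⟩)
        ⟨h3.le, h4.le⟩), by simpa using ha'⟩
      simpa using mem_box.1 h5 k
    have hm : 0 < min (δ / 2) (ε / 2) := lt_min (by linarith) (by linarith)
    have hm1 := min_le_left (δ / 2) (ε / 2)
    have hm2 := min_le_right (δ / 2) (ε / 2)
    have h1 := key (min (δ / 2) (ε / 2)) (by rw [abs_of_pos hm]; linarith) (by rwa [abs_of_pos hm])
    have h2 := key (-min (δ / 2) (ε / 2)) (by rw [abs_neg, abs_of_pos hm]; linarith)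
      (by rwa [abs_neg, abs_of_pos hm])
    constructor <;> linarith

theorem brick_side_mem_gridCoords (h : IsTwoReflex P k) (hF : IsBoxUnion P F) {B : Pt × Pt}
    (hB : IsBrick P k B) (l : Fin 3) (s : Bool) : side B l s ∈ gridCoords F l := by
  have hBl := hF.isBrick_localSlab hB
  by_cases hl : l = k
  swap
  · exact hF.side_mem_gridCoords hBl hl s
  subst hl
  by_contra hcon
  have hlt := hB.1.1 l
  -- otherwise a slab around a point of the horizontal face extends the brick
  set q : Pt := Function.update B.1 l (side B l s) with hq
  have ql : q l = side B l s := by simp [hq]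
  have qB : q ∈ Icc B.1 B.2 :=
    update_mem_box ⟨le_rfl, fun i => (hB.1.1 i).le⟩ (side_bounds hlt s)
  obtain ⟨K, hK, qK, h1, h2⟩ := h.exists_slab hF (hBl.2.1 qB) (by rwa [ql])
  have hKl := hF.isSlab_iff.1 hK
  obtain ⟨t, ht1, ht2, ht3, ht4⟩ : ∃ t, B.1 l < t ∧ t < B.2 l ∧ K.1 l < t ∧ t < K.2 l := by
    have hm : max (B.1 l) (K.1 l) < min (B.2 l) (K.2 l) := by
      rw [ql] at h1 h2
      cases s
      · simp only [side_false] at h1 h2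
        rw [max_eq_left h1.le]; exact lt_min hlt h2
      · simp only [side_true] at h1 h2
        rw [min_eq_left h2.le]; exact max_lt hlt h1
    obtain ⟨t, ht, ht'⟩ := exists_between hm
    exact ⟨t, (le_max_left _ _).trans_lt ht, ht'.trans_le (min_le_left _ _),
      (le_max_right _ _).trans_lt ht, ht'.trans_le (min_le_right _ _)⟩
  have hsub := hF.slab_subset_brick hB hK
    (update_mem_box qB (t := t) (l := l) ⟨ht1.le, ht2.le⟩)
    (update_mem_box qK (t := t) (l := l) ⟨ht3.le, ht4.le⟩) (by simpa using ht1)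
    (by simpa using ht2) (by simpa using ht3) (by simpa using ht4)
  have hKle : K.1 ≤ K.2 := fun i => (hK.1 i).le
  have k1 := (hsub ⟨le_rfl, hKle⟩).1 l
  have k2 := (hsub ⟨hKle, le_rfl⟩).2 l
  rw [ql] at h1 h2
  cases s
  · simp only [side_false] at h1; linarith
  · simp only [side_true] at h2; linarith

theorem finite_bricks (h : IsTwoReflex P k) (hF : IsBoxUnion P F) :
    {B | IsBrick P k B}.Finite := by
  have hfin : {x : Pt | ∀ i, x i ∈ gridCoords F i}.Finite :=
    Set.Finite.pi' fun i => (gridCoords F i).finite_toSet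
  refine (hfin.prod hfin).subset fun B hB => ⟨fun i => ?_, fun i => ?_⟩
  · exact h.brick_side_mem_gridCoords hF hB i false
  · exact h.brick_side_mem_gridCoords hF hB i true

/-- The bricks cover the polyhedron: they cover the points at generic levels, and their union is
closed. -/
theorem isBoxUnion_bricks (h : IsTwoReflex P k) (hF : IsBoxUnion P F) {𝓑 : Finset (Pt × Pt)}
    (h𝓑 : ∀ B, B ∈ 𝓑 ↔ IsBrick P k B) : IsBoxUnion P 𝓑 := by
  refine ⟨fun B hB => ((h𝓑 B).1 hB).1.1, Subset.antisymm (fun p hp => ?_) (iUnion₂_subset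
    fun B hB => (hF.isBrick_localSlab ((h𝓑 B).1 hB)).2.1)⟩
  obtain ⟨c, hc, pc⟩ := hF.mem_iff.1 hp
  have hclosed : IsClosed {t : ℝ | Function.update p k t ∈ ⋃ B ∈ 𝓑, Icc B.1 B.2} :=
    (𝓑.finite_toSet.isClosed_biUnion fun B _ => isClosed_box B).preimage
      (continuous_update_line p k)
  have h1 : Ioo (c.1 k) (c.2 k) ∩ ((gridCoords F k : Set ℝ))ᶜ ⊆
      {t : ℝ | Function.update p k t ∈ ⋃ B ∈ 𝓑, Icc B.1 B.2} := by
    rintro t ⟨ht, htG⟩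
    obtain ⟨K, hK, pK, -⟩ := h.exists_slab hF
      (hF.box_subset hc (update_mem_box pc (l := k) ⟨ht.1.le, ht.2.le⟩)) (by simpa using htG)
    obtain ⟨B, hB, hKB⟩ := hF.exists_brick hK
    exact mem_biUnion ((h𝓑 B).2 hB) (hKB pK)
  have h2 := (Dense.open_subset_closure_inter
    ((gridCoords F k).finite_toSet.countable.dense_compl ℝ) (isOpen_Ioo (a := c.1 k) (b := c.2 k))).trans
    (hclosed.closure_subset_iff.2 h1)
  have h3 := hclosed.closure_subset_iff.2 h2
  rw [closure_Ioo (hF.lt c hc k).ne] at h3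
  have h4 := h3 (mem_box.1 pc k)
  rw [mem_ofPred_eq, Function.update_eq_self] at h4
  exact h4

end IsTwoReflex

namespace IsBoxUnion

variable {P : Set Pt} {k : Fin 3} {F : Finset (Pt × Pt)}

/-- Two bricks only meet at the top of one and the bottom of the other. -/
theorem brick_levels (hF : IsBoxUnion P F) {A B : Pt × Pt} (hA : IsBrick P k A) (hB : IsBrick P k B)
    (hne : A ≠ B) {p : Pt} (pA : p ∈ Icc A.1 A.2) (pB : p ∈ Icc B.1 B.2) :
    (p k = A.2 k ∧ p k = B.1 k) ∨ (p k = B.2 k ∧ p k = A.1 k) := by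
  have hlev : ∀ {A B : Pt × Pt}, IsBrick P k A → IsBrick P k B → A ≠ B → p ∈ Icc A.1 A.2 →
      p ∈ Icc B.1 B.2 → p k = A.1 k ∨ p k = A.2 k := by
    intro A B hA hB hne pA pB
    by_contra! hcon
    have h1 := lt_of_le_of_ne (mem_box.1 pA k).1 hcon.1.symm
    have h2 := lt_of_le_of_ne (mem_box.1 pA k).2 hcon.2
    have hev := (hF.isBrick_localSlab hA).2.2 p pA h1 h2
    obtain ⟨q, ⟨h3, h4, h5⟩, hq⟩ := mem_closure_iff_nhds.1 (mem_closure_interior_box hB.1.1 pB) _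
      (hev.and ((eventually_lt_apply h1).and (eventually_apply_lt h2)))
    have qB := interior_subset hq
    rw [IsBrickComplex.interior_box] at hq
    exact hne (hF.brick_eq hA hB (h3 ((hF.isBrick_localSlab hB).2.1 qB)) qB h4 h5 (hq k).1 (hq k).2)
  have lA := hA.1.1 k
  have lB := hB.1.1 k
  have hshift : ∀ t, A.1 k < t → t < A.2 k → B.1 k < t → t < B.2 k → False := by
    intro t h1 h2 h3 h4
    exact hne (hF.brick_eq hA hB (update_mem_box pA (l := k) ⟨h1.le, h2.le⟩)
      (update_mem_box pB (l := k) ⟨h3.le, h4.le⟩) (by simpa using h1) (by simpa using h2)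
      (by simpa using h3) (by simpa using h4))
  rcases hlev hA hB hne pA pB with h1 | h1 <;> rcases hlev hB hA hne.symm pB pA with h2 | h2
  · obtain ⟨t, h3, h4⟩ := exists_between (show p k < min (A.2 k) (B.2 k) from
      lt_min (h1 ▸ lA) (h2 ▸ lB))
    exact (hshift t (h1 ▸ h3) (h4.trans_le (min_le_left _ _)) (h2 ▸ h3)
      (h4.trans_le (min_le_right _ _))).elim
  · exact Or.inr ⟨h2, h1⟩
  · exact Or.inl ⟨h1, h2⟩
  · obtain ⟨t, h3, h4⟩ := exists_between (show max (A.1 k) (B.1 k) < p k from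
      max_lt (h1 ▸ lA) (h2 ▸ lB))
    exact (hshift t ((le_max_left _ _).trans_lt h3) (h1 ▸ h4) ((le_max_right _ _).trans_lt h3)
      (h2 ▸ h4)).elim

end IsBoxUnion

namespace IsTwoReflex

variable {P : Set Pt} {k : Fin 3}

/-- The bricks of a 2-reflex orthogonal polyhedron form a brick complex. -/
theorem exists_complex (h : IsTwoReflex P k) :
    ∃ 𝓑 : Finset (Pt × Pt), IsBrickComplex P k 𝓑 ∧ ∀ B, IsBrick P k B → B ∈ 𝓑 := by
  obtain ⟨F, hFlt, hFU⟩ := h.polyhedron.union_boxes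
  have hF : IsBoxUnion P F := ⟨hFlt, hFU⟩
  set 𝓑 := (h.finite_bricks hF).toFinset with h𝓑def
  have h𝓑 : ∀ B, B ∈ 𝓑 ↔ IsBrick P k B := fun B => by simp [h𝓑def]
  have hU := h.isBoxUnion_bricks hF h𝓑
  -- no third brick is present at a common point of two bricks
  have hnear : ∀ A ∈ 𝓑, ∀ B ∈ 𝓑, ∀ p ∈ Icc A.1 A.2, p ∈ Icc B.1 B.2 → p k = A.2 k → p k = B.1 k →
      ∀ᶠ q in 𝓝 p, q ∈ P ↔ q ∈ Icc A.1 A.2 ∨ q ∈ Icc B.1 B.2 := by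
    intro A hA B hB p pA pB hpA hpB
    have lA := hU.lt A hA k
    have lB := hU.lt B hB k
    filter_upwards [hU.eventually_mem p] with q hq
    rw [hq]
    constructor
    · rintro ⟨C, hC, pC, qC⟩
      by_cases hCA : C = A
      · exact Or.inl (hCA ▸ qC)
      by_cases hCB : C = B
      · exact Or.inr (hCB ▸ qC)
      have lC := hU.lt C hC k
      rcases hF.brick_levels ((h𝓑 C).1 hC) ((h𝓑 A).1 hA) hCA pC pA with ⟨h1, h2⟩ | ⟨h1, h2⟩
      · linarith
      · rcases hF.brick_levels ((h𝓑 C).1 hC) ((h𝓑 B).1 hB) hCB pC pB with ⟨h3, h4⟩ | ⟨h3, h4⟩ <;>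
          linarith
    · rintro (h1 | h1)
      exacts [⟨A, hA, pA, h1⟩, ⟨B, hB, pB, h1⟩]
  have hmeet : ∀ A ∈ 𝓑, ∀ B ∈ 𝓑, ∀ p ∈ Icc A.1 A.2, p ∈ Icc B.1 B.2 → p k = A.2 k → p k = B.1 k →
      Stacked k A B := by
    intro A hA B hB p pA pB hpA hpB
    have hev := hnear A hA B hB p pA pB hpA hpB
    refine ⟨hpA.symm.trans hpB, fun i hik => ?_⟩
    have a1 := mem_box.1 pA i
    have b1 := mem_box.1 pB i
    have hpP := hU.box_subset hA pA
    have intA : ∀ q, q ∈ interior (Icc A.1 A.2) → q ∈ interior P ∧ A.1 i < q i ∧ q i < A.2 i :=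
      fun q hq => ⟨interior_mono (hU.box_subset hA) hq, by rw [IsBrickComplex.interior_box] at hq; exact hq i⟩
    have intB : ∀ q, q ∈ interior (Icc B.1 B.2) → q ∈ interior P ∧ B.1 i < q i ∧ q i < B.2 i :=
      fun q hq => ⟨interior_mono (hU.box_subset hB) hq, by rw [IsBrickComplex.interior_box] at hq; exact hq i⟩
    have clA := mem_closure_interior_box (hU.lt A hA) pA
    have clB := mem_closure_interior_box (hU.lt B hB) pB
    -- if a vertical plane separated the bricks, it would contain no inner points near `p`
    have touch : ∀ a : ℝ, (a = 1 ∨ a = -1) → (∀ q ∈ Icc A.1 A.2, 0 ≤ a * (q i - p i)) →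
        (∀ q ∈ Icc B.1 B.2, a * (q i - p i) ≤ 0) →
        ∀ᶠ q in 𝓝 p, q i = p i → q ∉ interior P := by
      intro a ha hAa hBa
      have haa : a * a = 1 := by rcases ha with rfl | rfl <;> norm_num
      filter_upwards [hev.eventually_nhds] with q hq hqi hint
      obtain ⟨δ, hδ, hd⟩ := eventually_nhds_cube.1 (hq.and (mem_interior_iff_mem_nhds.1 hint))
      have ha2 : |a * (δ / 2)| < δ := by
        have h0 : |δ / 2| = δ / 2 := abs_of_pos (by linarith)
        rw [abs_mul, h0]
        rcases ha with rfl | rfl <;> simp [hδ]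
      -- a point beside `q` that is too low for `B` or too high for `A`
      rcases le_or_gt (q k) (p k) with h1 | h1
      · set q' : Pt := fun l => if l = i then q i - a * (δ / 2) else
          if l = k then q k - δ / 2 else q l with hq'
        have qi : q' i = q i - a * (δ / 2) := by simp [hq']
        have qk : q' k = q k - δ / 2 := by simp [hq', hik.symm]
        obtain ⟨h2, h3⟩ := hd q' fun l => by
          by_cases hli : l = i
          · subst hli; rw [qi, sub_sub_cancel_left, abs_neg]; exact ha2
          by_cases hlk : l = k
          · subst hlk; rw [qk, sub_sub_cancel_left, abs_neg, abs_of_pos (by linarith)]; linarith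
          · simp [hq', hli, hlk, hδ]
        rcases h2.1 h3 with h4 | h4
        · have := hAa q' h4
          rw [qi, hqi] at this
          have : a * (p i - a * (δ / 2) - p i) = -(a * a * (δ / 2)) := by ring
          rw [haa] at this
          linarith
        · have := (mem_box.1 h4 k).1
          linarith
      · set q' : Pt := fun l => if l = i then q i + a * (δ / 2) else q l with hq'
        have qi : q' i = q i + a * (δ / 2) := by simp [hq']
        have qk : q' k = q k := by simp [hq', hik.symm]
        obtain ⟨h2, h3⟩ := hd q' fun l => by
          by_cases hli : l = i
          · subst hli; rw [qi, add_sub_cancel_left]; exact ha2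
          · simp [hq', hli, hδ]
        rcases h2.1 h3 with h4 | h4
        · have := (mem_box.1 h4 k).2
          linarith
        · have := hBa q' h4
          rw [qi, hqi] at this
          have : a * (p i + a * (δ / 2) - p i) = a * a * (δ / 2) := by ring
          rw [haa] at this
          linarith
    refine ⟨lt_of_le_of_ne (a1.1.trans b1.2) fun e => ?_,
      lt_of_le_of_ne (b1.1.trans a1.2) fun e => ?_⟩
    · have e1 : p i = A.1 i := le_antisymm (b1.2.trans e.ge) a1.1
      refine h.polyhedron.manifold.not_touching hpP (touch 1 (Or.inl rfl) (fun q hq => ?_)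
        fun q hq => ?_) (closure_mono (fun q hq => ?_) clA) (closure_mono (fun q hq => ?_) clB)
      · linarith [(mem_box.1 hq i).1]
      · linarith [(mem_box.1 hq i).2]
      · exact ⟨(intA q hq).1, e1.trans_lt (intA q hq).2.1⟩
      · exact ⟨(intB q hq).1, (intB q hq).2.2.trans_eq (e.symm.trans e1.symm)⟩
    · have e1 : p i = B.1 i := le_antisymm (a1.2.trans e.ge) b1.1
      refine h.polyhedron.manifold.not_touching hpP (touch (-1) (Or.inr rfl) (fun q hq => ?_)
        fun q hq => ?_) (closure_mono (fun q hq => ?_) clB) (closure_mono (fun q hq => ?_) clA)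
      · linarith [(mem_box.1 hq i).2]
      · linarith [(mem_box.1 hq i).1]
      · exact ⟨(intB q hq).1, e1.trans_lt (intB q hq).2.1⟩
      · exact ⟨(intA q hq).1, (intA q hq).2.2.trans_eq (e.symm.trans e1.symm)⟩
  refine ⟨𝓑, ⟨hU.lt, hU.eq_iUnion, fun A hA B hB hne p pA pB => ?_, fun A hA B hB hAB => ?_⟩,
    fun B hB => (h𝓑 B).2 hB⟩
  · rcases hF.brick_levels ((h𝓑 A).1 hA) ((h𝓑 B).1 hB) hne pA pB with ⟨h1, h2⟩ | ⟨h1, h2⟩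
    · exact Or.inl (hmeet A hA B hB p pA pB h1 h2)
    · exact Or.inr (hmeet B hB A hA p pB pA h1 h2)
  · -- two stacked bricks of the same extent would form a larger slab
    by_contra! hcon
    have lA := hU.lt A hA
    have lB := hU.lt B hB
    have sA := hF.isBrick_localSlab ((h𝓑 A).1 hA)
    have sB := hF.isBrick_localSlab ((h𝓑 B).1 hB)
    have hlev := hAB.1
    have subA : Icc A.1 A.2 ⊆ Icc A.1 B.2 := Icc_subset_Icc le_rfl fun l => by
      by_cases hl : l = k
      · subst hl; linarith [lB l]
      · exact (hcon l hl).2.le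
    have subB : Icc B.1 B.2 ⊆ Icc A.1 B.2 := Icc_subset_Icc (fun l => by
      by_cases hl : l = k
      · subst hl; linarith [lA l]
      · exact (hcon l hl).1.le) le_rfl
    have memA : ∀ q, q ∈ Icc A.1 B.2 → q k ≤ A.2 k → q ∈ Icc A.1 A.2 := fun q hq hk =>
      mem_box.2 fun l => by
        by_cases hl : l = k
        · subst hl; exact ⟨hq.1 l, hk⟩
        · exact ⟨hq.1 l, (hq.2 l).trans_eq (hcon l hl).2.symm⟩
    have memB : ∀ q, q ∈ Icc A.1 B.2 → B.1 k ≤ q k → q ∈ Icc B.1 B.2 := fun q hq hk =>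
      mem_box.2 fun l => by
        by_cases hl : l = k
        · subst hl; exact ⟨hk, hq.2 l⟩
        · exact ⟨(hcon l hl).1.symm.trans_le (hq.1 l), hq.2 l⟩
    have hslab : LocalSlab P k (A.1, B.2) := by
      refine ⟨fun l => ?_, fun q hq => ?_, fun q hq h1 h2 => ?_⟩
      · by_cases hl : l = k
        · subst hl; have := lA l; have := lB l; simp only; linarith
        · exact (hAB.2 l hl).1
      · rcases le_total (q k) (A.2 k) with h1 | h1
        · exact hU.box_subset hA (memA q hq h1)
        · exact hU.box_subset hB (memB q hq (hlev ▸ h1))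
      · rcases lt_trichotomy (q k) (A.2 k) with h3 | h3 | h3
        · exact (sA.2.2 q (memA q hq h3.le) h1 h3).mono fun q' h4 h5 => subA (h4 h5)
        · filter_upwards [hnear A hA B hB q (memA q hq h3.le) (memB q hq (hlev ▸ h3.ge)) h3
            (hlev ▸ h3)] with q' h4 h5
          rcases h4.1 h5 with h6 | h6
          exacts [subA h6, subB h6]
        · exact (sB.2.2 q (memB q hq (hlev ▸ h3.le)) (hlev ▸ h3) h2).mono
            fun q' h4 h5 => subB (h4 h5)
    have := ((h𝓑 A).1 hA).2 _ (hF.isSlab_iff.2 hslab) subA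
    have h2 := congrFun (congrArg Prod.snd this) k
    simp only at h2
    linarith [lB k]

end IsTwoReflex

/-! ### Charts of brick complexes -/

/-- A function that increases with unit speed along a vector with entries `±1` is a coordinate of
a homeomorphism. -/
theorem exists_homeomorph {v : Pt} (hv : v 0 = 1 ∨ v 0 = -1) {f : Pt → ℝ} (hf : Continuous f)
    (hfv : ∀ q t, f (q + t • v) = f q + t) : ∃ Φ : Pt ≃ₜ Pt, ∀ q, Φ q 0 = f q := by
  have hvv : v 0 * v 0 = 1 := by rcases hv with h | h <;> rw [h] <;> norm_num
  -- the projection along `v` to the plane where the coordinate `0` vanishes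
  set pr : Pt → Pt := fun q => q - (v 0 * q 0) • v with hpr
  have hpr0 : ∀ q, pr q 0 = 0 := fun q => by
    simp only [hpr, Pi.sub_apply, Pi.smul_apply, smul_eq_mul]
    linear_combination (-(q 0)) * hvv
  have hfun : ∀ q, q = pr q + (v 0 * q 0) • v := fun q => by simp [hpr]
  have hfpr : ∀ q, f q = f (pr q) + v 0 * q 0 := fun q => by
    conv_lhs => rw [hfun q]
    exact hfv _ _
  have hprc : Continuous pr := by
    refine continuous_id.sub ?_
    exact ((continuous_const.mul (continuous_apply 0)).smul continuous_const)
  have hprv : ∀ (q : Pt) (t : ℝ), q 0 = 0 → pr (q + t • v) = q := fun q t hq => by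
    funext l
    simp only [hpr, Pi.sub_apply, Pi.add_apply, Pi.smul_apply, smul_eq_mul, hq]
    linear_combination (-(t * v l)) * hvv
  refine ⟨⟨⟨fun q => Function.update (pr q) 0 (f q), fun y => Function.update y 0 0 +
    (y 0 - f (Function.update y 0 0)) • v, fun q => ?_, fun y => ?_⟩, ?_, ?_⟩, fun q => ?_⟩
  · have h0 : Function.update (Function.update (pr q) 0 (f q)) 0 0 = pr q := by
      rw [Function.update_idem]
      conv_rhs => rw [← Function.update_eq_self 0 (pr q), hpr0]
    simp only [h0, Function.update_self]
    rw [hfpr q, add_sub_cancel_left]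
    exact (hfun q).symm
  · simp only
    rw [hprv _ _ (by simp), hfv]
    simp
  · exact hprc.update 0 hf
  · have hc : Continuous fun y : Pt => Function.update y 0 (0 : ℝ) :=
      continuous_id.update 0 continuous_const
    exact hc.add (((continuous_apply 0).sub (hf.comp hc)).smul continuous_const)
  · change Function.update (pr q) 0 (f q) 0 = f q
    simp

/-- A set that is locally the superlevel set of a function as in `exists_homeomorph` has a chart. -/
theorem exists_chart {P : Set Pt} {p v : Pt} (hv : v 0 = 1 ∨ v 0 = -1) {f : Pt → ℝ}
    (hf : Continuous f) (hfv : ∀ q t, f (q + t • v) = f q + t)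
    (hP : ∀ᶠ q in 𝓝 p, q ∈ P ↔ 0 ≤ f q) :
    ∃ φ : OpenPartialHomeomorph Pt Pt, p ∈ φ.source ∧ ∀ q ∈ φ.source, (q ∈ P ↔ 0 ≤ φ q 0) := by
  obtain ⟨Φ, hΦ⟩ := exists_homeomorph hv hf hfv
  obtain ⟨U, hU, hUo, hpU⟩ := eventually_nhds_iff.1 hP
  refine ⟨Φ.toOpenPartialHomeomorph.restrOpen U hUo, ?_, ?_⟩
  · simpa using hpU
  · intro q hq
    have hqU : q ∈ U := by simpa using hq
    change q ∈ P ↔ 0 ≤ Φ q 0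
    rw [hΦ]
    exact hU q hqU

/-- Nested intervals near a common point, described by inequalities in the same direction. -/
theorem exists_direction {a b a' b' x : ℝ} (hab : a < b) (ha : a' ≤ a) (hb : b ≤ b')
    (hx : a ≤ x ∧ x ≤ b) : ∃ σ c c' : ℝ, (σ = 1 ∨ σ = -1) ∧
      ∀ᶠ t in 𝓝 x, ((a ≤ t ∧ t ≤ b) ↔ 0 ≤ σ * (t - x) + c) ∧
        ((a' ≤ t ∧ t ≤ b') ↔ 0 ≤ σ * (t - x) + c') := by
  have hone : ∀ᶠ t in 𝓝 x, |t - x| < 1 := by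
    filter_upwards [Metric.ball_mem_nhds x one_pos] with t ht
    rwa [Metric.mem_ball, Real.dist_eq] at ht
  rcases hx.2.eq_or_lt with rfl | hxb
  · rcases hb.eq_or_lt with rfl | hxb'
    · refine ⟨-1, 0, 0, Or.inr rfl, ?_⟩
      filter_upwards [lt_mem_nhds hab] with t ht
      constructor <;> constructor <;> intro h <;> (try constructor) <;> linarith [h]
    · refine ⟨-1, 0, 1, Or.inr rfl, ?_⟩
      filter_upwards [lt_mem_nhds hab, hone, gt_mem_nhds hxb'] with t ht h1 h2
      have h1 := abs_lt.1 h1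
      constructor <;> constructor <;> intro h <;> (try constructor) <;> linarith
  rcases hx.1.eq_or_lt with rfl | hax
  · rcases ha.eq_or_lt with rfl | hxa'
    · refine ⟨1, 0, 0, Or.inl rfl, ?_⟩
      filter_upwards [gt_mem_nhds hab] with t ht
      constructor <;> constructor <;> intro h <;> (try constructor) <;> linarith [h]
    · refine ⟨1, 0, 1, Or.inl rfl, ?_⟩
      filter_upwards [gt_mem_nhds hab, hone, lt_mem_nhds hxa'] with t ht h1 h2
      have h1 := abs_lt.1 h1
      constructor <;> constructor <;> intro h <;> (try constructor) <;> linarith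
  · refine ⟨1, 1, 1, Or.inl rfl, ?_⟩
    filter_upwards [gt_mem_nhds hxb, hone, lt_mem_nhds hax] with t ht h1 h2
    have h1 := abs_lt.1 h1
    constructor <;> constructor <;> intro h <;> (try constructor) <;> linarith

theorem eventually_apply {p : Pt} (l : Fin 3) {Q : ℝ → Prop} (h : ∀ᶠ t in 𝓝 (p l), Q t) :
    ∀ᶠ q in 𝓝 p, Q (q l) :=
  ((continuous_apply l).tendsto p).eventually h

theorem mem_box_iff {A : Pt × Pt} {q : Pt} : q ∈ Icc A.1 A.2 ↔ (A.1 0 ≤ q 0 ∧ q 0 ≤ A.2 0) ∧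
    (A.1 1 ≤ q 1 ∧ q 1 ≤ A.2 1) ∧ (A.1 2 ≤ q 2 ∧ q 2 ≤ A.2 2) := by
  rw [mem_box, Fin.forall_fin_succ, Fin.forall_fin_succ, Fin.forall_fin_succ]
  simp

/-- The chart at a point of a single box. -/
theorem exists_chart_box {P : Set Pt} {A : Pt × Pt} (hA : ∀ l, A.1 l < A.2 l) {p : Pt}
    (pA : p ∈ Icc A.1 A.2) (hP : ∀ᶠ q in 𝓝 p, q ∈ P ↔ q ∈ Icc A.1 A.2) :
    ∃ φ : OpenPartialHomeomorph Pt Pt, p ∈ φ.source ∧ ∀ q ∈ φ.source, (q ∈ P ↔ 0 ≤ φ q 0) := by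
  choose σ c _ hσ h _ using fun l =>
    (exists_direction (hA l) le_rfl le_rfl (mem_box.1 pA l)).imp fun σ => fun ⟨c, c', h1, h2⟩ =>
      (⟨c, c', h1, h2.mono fun t ht => ht.1, trivial⟩ :
        ∃ c c' : ℝ, (σ = 1 ∨ σ = -1) ∧ (∀ᶠ t in 𝓝 (p l), (A.1 l ≤ t ∧ t ≤ A.2 l) ↔
          0 ≤ σ * (t - p l) + c) ∧ True)
  have hσ2 : ∀ l, σ l * σ l = 1 := fun l => by rcases hσ l with h | h <;> rw [h] <;> norm_num
  refine exists_chart (v := σ) (hσ 0) (f := fun q => min (σ 0 * (q 0 - p 0) + c 0)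
    (min (σ 1 * (q 1 - p 1) + c 1) (σ 2 * (q 2 - p 2) + c 2))) (by fun_prop) (fun q t => ?_) ?_
  · simp only [Pi.add_apply, Pi.smul_apply, smul_eq_mul]
    have e : ∀ l, σ l * (q l + t * σ l - p l) + c l = σ l * (q l - p l) + c l + t := fun l => by
      linear_combination t * hσ2 l
    rw [e, e, e, min_add_add_right, min_add_add_right]
  · filter_upwards [hP, eventually_apply 0 (h 0), eventually_apply 1 (h 1), eventually_apply 2 (h 2)]
      with q h1 h2 h3 h4
    rw [h1, mem_box_iff, le_min_iff, le_min_iff, ← h2, ← h3, ← h4]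

/-- The chart at a contact of two boxes `S` and `C` that only differ in the extent along the axis
`0`, in which `S` is smaller. The box `C` is on the side `τ` of the contact. -/
theorem exists_chart_contact {P : Set Pt} {S C : Pt × Pt} (hS : ∀ l, S.1 l < S.2 l)
    (h0 : C.1 0 ≤ S.1 0 ∧ S.2 0 ≤ C.2 0) (h1 : C.1 1 = S.1 1 ∧ C.2 1 = S.2 1) {p : Pt}
    (pS : p ∈ Icc S.1 S.2) {τ : ℝ} (hτ : τ = 1 ∨ τ = -1)
    (hC2 : ∀ᶠ t in 𝓝 (p 2), (C.1 2 ≤ t ∧ t ≤ C.2 2) ↔ 0 ≤ τ * (t - p 2))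
    (hS2 : ∀ᶠ t in 𝓝 (p 2), (S.1 2 ≤ t ∧ t ≤ S.2 2) ↔ τ * (t - p 2) ≤ 0)
    (hP : ∀ᶠ q in 𝓝 p, q ∈ P ↔ q ∈ Icc S.1 S.2 ∨ q ∈ Icc C.1 C.2) :
    ∃ φ : OpenPartialHomeomorph Pt Pt, p ∈ φ.source ∧ ∀ q ∈ φ.source, (q ∈ P ↔ 0 ≤ φ q 0) := by
  obtain ⟨σ, c, c', hσ, hx⟩ := exists_direction (hS 0) h0.1 h0.2 (mem_box.1 pS 0)
  obtain ⟨ρ, d, d', hρ, hy⟩ := exists_direction (hS 1) le_rfl le_rfl (mem_box.1 pS 1)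
  have hσ2 : σ * σ = 1 := by rcases hσ with h | h <;> rw [h] <;> norm_num
  have hρ2 : ρ * ρ = 1 := by rcases hρ with h | h <;> rw [h] <;> norm_num
  have hτ2 : τ * τ = 1 := by rcases hτ with h | h <;> rw [h] <;> norm_num
  refine exists_chart (v := ![σ, ρ, τ]) hσ (f := fun q => min (ρ * (q 1 - p 1) + d)
    (min (σ * (q 0 - p 0) + c') (max (σ * (q 0 - p 0) + c) (τ * (q 2 - p 2))))) (by fun_prop)
    (fun q t => ?_) ?_
  · have v0 : (q + t • ![σ, ρ, τ]) 0 = q 0 + t * σ := rfl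
    have v1 : (q + t • ![σ, ρ, τ]) 1 = q 1 + t * ρ := rfl
    have v2 : (q + t • ![σ, ρ, τ]) 2 = q 2 + t * τ := rfl
    rw [v0, v1, v2]
    have e0 : ∀ c, σ * (q 0 + t * σ - p 0) + c = σ * (q 0 - p 0) + c + t := fun c => by
      linear_combination t * hσ2
    have e1 : ρ * (q 1 + t * ρ - p 1) + d = ρ * (q 1 - p 1) + d + t := by
      linear_combination t * hρ2
    have e2 : τ * (q 2 + t * τ - p 2) = τ * (q 2 - p 2) + t := by
      linear_combination t * hτ2
    rw [e0, e0, e1, e2, max_add_add_right, min_add_add_right, min_add_add_right]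
  · filter_upwards [hP, eventually_apply 0 hx, eventually_apply 1 hy, eventually_apply 2 hC2,
      eventually_apply 2 hS2] with q g g0 g1 g2 g3
    have hz : (S.1 2 ≤ q 2 ∧ q 2 ≤ S.2 2) ∨ (C.1 2 ≤ q 2 ∧ q 2 ≤ C.2 2) := by
      rw [g2, g3]; exact le_total _ _
    have hsub : (S.1 0 ≤ q 0 ∧ q 0 ≤ S.2 0) → C.1 0 ≤ q 0 ∧ q 0 ≤ C.2 0 := fun h =>
      ⟨h0.1.trans h.1, h.2.trans h0.2⟩
    rw [g, mem_box_iff, mem_box_iff, le_min_iff, le_min_iff, le_max_iff, ← g1.1, ← g0.1, ← g0.2,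
      ← g2, h1.1, h1.2]
    constructor
    · rintro (⟨a, b, c⟩ | ⟨a, b, c⟩)
      exacts [⟨b, hsub a, Or.inl a⟩, ⟨b, a, Or.inr c⟩]
    · rintro ⟨b, a, a' | c⟩
      · exact hz.imp (fun c => ⟨a', b, c⟩) fun c => ⟨a, b, c⟩
      · exact Or.inr ⟨a, b, c⟩

/-! ### The staircase -/

/-- The left end of the brick `n` of the staircase. -/
noncomputable def stairLeft (n : ℕ) : ℝ := 3 * (n / 2 : ℕ)

/-- The right end of the brick `n` of the staircase: the bricks with an even number have length
`1`, those with an odd number have length `4`. -/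
noncomputable def stairRight (n : ℕ) : ℝ := 3 * (n / 2 : ℕ) + 1 + 3 * (n % 2 : ℕ)

/-- The bottom level of the brick `n` of the staircase: the bricks with an even number have height
`2`, those with an odd number have height `1`. -/
noncomputable def stairBase (n : ℕ) : ℝ := 3 * (n / 2 : ℕ) + 2 * (n % 2 : ℕ)

/-- The abscissa of the only reflex edge between the bricks `n` and `n + 1` of the staircase. -/
noncomputable def stairStep (n : ℕ) : ℝ := 3 * (n / 2 : ℕ) + 1 + 2 * (n % 2 : ℕ)

/-- The brick `n` of the staircase. Bricks `n` and `n + 1` are flush at their left ends if `n` is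
even and at their right ends if `n` is odd. -/
noncomputable def stairBrick (n : ℕ) : Pt × Pt :=
  (![stairLeft n, 0, stairBase n], ![stairRight n, 1, stairBase (n + 1)])

/-- The staircase with the bricks `0`, …, `r`. -/
def staircase (r : ℕ) : Set Pt := {p | ∃ n ≤ r, p ∈ Icc (stairBrick n).1 (stairBrick n).2}

theorem stair_even (j : ℕ) : stairLeft (2 * j) = 3 * j ∧ stairRight (2 * j) = 3 * j + 1 ∧
    stairBase (2 * j) = 3 * j ∧ stairStep (2 * j) = 3 * j + 1 := by
  have h1 : 2 * j / 2 = j := by omega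
  have h2 : 2 * j % 2 = 0 := by omega
  simp [stairLeft, stairRight, stairBase, stairStep, h1, h2]

theorem stair_odd (j : ℕ) : stairLeft (2 * j + 1) = 3 * j ∧ stairRight (2 * j + 1) = 3 * j + 4 ∧
    stairBase (2 * j + 1) = 3 * j + 2 ∧ stairStep (2 * j + 1) = 3 * j + 3 := by
  have h1 : (2 * j + 1) / 2 = j := by omega
  have h2 : (2 * j + 1) % 2 = 1 := by omega
  simp only [stairLeft, stairRight, stairBase, stairStep, h1, h2]
  norm_num
  constructor <;> ring

theorem stair_even' (j : ℕ) : stairLeft (2 * j + 1 + 1) = 3 * j + 3 ∧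
    stairRight (2 * j + 1 + 1) = 3 * j + 4 ∧ stairBase (2 * j + 1 + 1) = 3 * j + 3 := by
  obtain ⟨h1, h2, h3, -⟩ := stair_even (j + 1)
  rw [show 2 * j + 1 + 1 = 2 * (j + 1) by ring, h1, h2, h3]
  push_cast
  refine ⟨by ring, by ring, by ring⟩

theorem stairBase_lt (n : ℕ) : stairBase n < stairBase (n + 1) := by
  obtain ⟨j, rfl | rfl⟩ := n.even_or_odd'
  · rw [(stair_even j).2.2.1, (stair_odd j).2.2.1]; linarith
  · rw [(stair_odd j).2.2.1, (stair_even' j).2.2]; linarith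

theorem stairBase_strictMono : StrictMono stairBase := strictMono_nat_of_lt_succ stairBase_lt

theorem mem_stairBrick {n : ℕ} {p : Pt} : p ∈ Icc (stairBrick n).1 (stairBrick n).2 ↔
    (stairLeft n ≤ p 0 ∧ p 0 ≤ stairRight n) ∧ (0 ≤ p 1 ∧ p 1 ≤ 1) ∧
      (stairBase n ≤ p 2 ∧ p 2 ≤ stairBase (n + 1)) :=
  mem_box_iff

theorem stairBrick_lt (n : ℕ) (l : Fin 3) : (stairBrick n).1 l < (stairBrick n).2 l := by
  have h2 := stairBase_lt n
  have h0 : stairLeft n < stairRight n := by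
    have : (0 : ℝ) ≤ (n % 2 : ℕ) := Nat.cast_nonneg _
    simp only [stairLeft, stairRight]
    linarith
  fin_cases l
  · exact h0
  · exact one_pos
  · exact h2

theorem stairBrick_injective : Function.Injective stairBrick := fun _ _ h =>
  stairBase_strictMono.injective (congrFun (congrArg Prod.fst h) 2)

/-- Consecutive bricks of the staircase are nested in the axis `0`. -/
theorem stair_nested (n : ℕ) :
    (Even n ∧ stairLeft (n + 1) = stairLeft n ∧ stairRight n < stairRight (n + 1) ∧
      stairStep n = stairRight n) ∨
    (¬ Even n ∧ stairRight (n + 1) = stairRight n ∧ stairLeft n < stairLeft (n + 1) ∧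
      stairStep n = stairLeft (n + 1)) := by
  obtain ⟨j, rfl | rfl⟩ := n.even_or_odd'
  · obtain ⟨h1, h2, h3, h4⟩ := stair_even j
    obtain ⟨g1, g2, g3, g4⟩ := stair_odd j
    rw [h1, h2, h4, g1, g2]
    exact Or.inl ⟨even_two_mul j, rfl, by linarith, rfl⟩
  · obtain ⟨h1, h2, h3⟩ := stair_even' j
    obtain ⟨g1, g2, g3, g4⟩ := stair_odd j
    rw [h1, h2, g1, g2, g4]
    exact Or.inr ⟨by simp, rfl, by linarith, rfl⟩

theorem stairLeft_lt (n : ℕ) : stairLeft n < stairRight n := stairBrick_lt n 0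

theorem stacked_stairBrick {m n : ℕ} : Stacked 2 (stairBrick m) (stairBrick n) ↔ n = m + 1 := by
  constructor
  · intro h
    exact (stairBase_strictMono.injective h.1).symm
  · rintro rfl
    refine ⟨rfl, fun i hi => ?_⟩
    have h1 := stairLeft_lt m
    have h2 := stairLeft_lt (m + 1)
    have h3 : stairLeft m < stairRight (m + 1) ∧ stairLeft (m + 1) < stairRight m := by
      rcases stair_nested m with h | h <;> constructor <;> linarith [h.2.1, h.2.2.1]
    fin_cases i
    · exact h3
    · exact ⟨one_pos, one_pos⟩
    · exact absurd rfl hi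

theorem stairBrick_meet {m n : ℕ} (h : m < n) {p : Pt}
    (hm : p ∈ Icc (stairBrick m).1 (stairBrick m).2)
    (hn : p ∈ Icc (stairBrick n).1 (stairBrick n).2) : n = m + 1 := by
  have : stairBase n ≤ stairBase (m + 1) :=
    (mem_stairBrick.1 hn).2.2.1.trans (mem_stairBrick.1 hm).2.2.2
  have := stairBase_strictMono.le_iff_le.1 this
  omega

open Classical in
/-- The bricks of the staircase. -/
noncomputable def stairBricks (r : ℕ) : Finset (Pt × Pt) := (Finset.range (r + 1)).image stairBrick

theorem mem_stairBricks {r : ℕ} {A : Pt × Pt} :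
    A ∈ stairBricks r ↔ ∃ n ≤ r, stairBrick n = A := by
  simp [stairBricks]

theorem isBrickComplex_staircase (r : ℕ) : IsBrickComplex (staircase r) 2 (stairBricks r) where
  lt A hA := by
    obtain ⟨n, -, rfl⟩ := mem_stairBricks.1 hA
    exact stairBrick_lt n
  eq_iUnion := by
    ext p
    simp only [staircase, mem_ofPred_eq, mem_iUnion, mem_stairBricks, exists_prop]
    constructor
    · rintro ⟨n, hn, hp⟩
      exact ⟨_, ⟨n, hn, rfl⟩, hp⟩
    · rintro ⟨_, ⟨n, hn, rfl⟩, hp⟩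
      exact ⟨n, hn, hp⟩
  meet A hA B hB hAB p pA pB := by
    obtain ⟨m, -, rfl⟩ := mem_stairBricks.1 hA
    obtain ⟨n, -, rfl⟩ := mem_stairBricks.1 hB
    rw [stacked_stairBrick, stacked_stairBrick]
    rcases lt_trichotomy m n with h | rfl | h
    · exact Or.inl (stairBrick_meet h pA pB)
    · exact absurd rfl hAB
    · exact Or.inr (stairBrick_meet h pB pA)
  differ A hA B hB hAB := by
    obtain ⟨m, -, rfl⟩ := mem_stairBricks.1 hA
    obtain ⟨n, -, rfl⟩ := mem_stairBricks.1 hB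
    obtain rfl := stacked_stairBrick.1 hAB
    refine ⟨0, by decide, ?_⟩
    rcases stair_nested m with h | h
    · exact Or.inr h.2.2.1.ne
    · exact Or.inl h.2.2.1.ne

theorem isConnected_staircase (r : ℕ) : IsConnected (staircase r) := by
  have hbox : ∀ n, IsConnected (Icc (stairBrick n).1 (stairBrick n).2) := fun n =>
    ⟨nonempty_Icc.2 fun l => (stairBrick_lt n l).le, (convex_box _).isPreconnected⟩
  induction r with
  | zero =>
    have : staircase 0 = Icc (stairBrick 0).1 (stairBrick 0).2 := by
      ext p; simp [staircase]
    rw [this]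
    exact hbox 0
  | succ r ih =>
    have : staircase (r + 1) = staircase r ∪ Icc (stairBrick (r + 1)).1 (stairBrick (r + 1)).2 := by
      ext p
      simp only [staircase, mem_ofPred_eq, mem_union, Nat.le_succ_iff]
      constructor
      · rintro ⟨n, hn | rfl, hp⟩
        exacts [Or.inl ⟨n, hn, hp⟩, Or.inr hp]
      · rintro (⟨n, hn, hp⟩ | hp)
        exacts [⟨n, Or.inl hn, hp⟩, ⟨_, Or.inr rfl, hp⟩]
    rw [this]
    refine IsConnected.union ⟨(stairBrick (r + 1)).1, ⟨r, le_rfl, mem_stairBrick.2 ?_⟩,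
      left_mem_Icc.2 fun l => (stairBrick_lt (r + 1) l).le⟩ ih (hbox _)
    have h1 := stairLeft_lt r
    have h2 : stairLeft r ≤ stairLeft (r + 1) ∧ stairLeft (r + 1) ≤ stairRight r := by
      have := stairLeft_lt (r + 1)
      rcases stair_nested r with h | h <;> constructor <;> linarith [h.2.1, h.2.2.1]
    exact ⟨h2, ⟨le_rfl, zero_le_one⟩, (stairBase_lt r).le, le_rfl⟩

theorem isThreeManifold_staircase (r : ℕ) : IsThreeManifold (staircase r) := by
  intro p hp
  have h := isBrickComplex_staircase r
  rcases h.single_or_stacked hp with ⟨A, hA, pA, hs⟩ | ⟨A, hA, B, hB, hAB, pA, pB⟩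
  · exact exists_chart_box (h.lt A hA) pA (h.eventually_mem_single hA pA hs)
  · have ev := h.eventually_mem_stacked hA hB hAB pA pB
    obtain ⟨m, -, rfl⟩ := mem_stairBricks.1 hA
    obtain ⟨n, -, rfl⟩ := mem_stairBricks.1 hB
    obtain rfl := stacked_stairBrick.1 hAB
    have hp2 : p 2 = stairBase (m + 1) :=
      le_antisymm (mem_stairBrick.1 pA).2.2.2 (mem_stairBrick.1 pB).2.2.1
    have hlo : ∀ᶠ t in 𝓝 (p 2), stairBase m < t := lt_mem_nhds (hp2 ▸ stairBase_lt m)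
    have hup : ∀ᶠ t in 𝓝 (p 2), t < stairBase (m + 1 + 1) :=
      gt_mem_nhds (hp2 ▸ stairBase_lt (m + 1))
    rcases stair_nested m with ⟨-, h1, h2, -⟩ | ⟨-, h1, h2, -⟩
    · refine exists_chart_contact (S := stairBrick m) (C := stairBrick (m + 1)) (stairBrick_lt m)
        ⟨h1.le, h2.le⟩ ⟨rfl, rfl⟩ pA (τ := 1) (Or.inl rfl) ?_ ?_ ev
      · filter_upwards [hup] with t ht
        change stairBase (m + 1) ≤ t ∧ t ≤ stairBase (m + 1 + 1) ↔ _
        rw [hp2]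
        exact ⟨fun h => by linarith [h.1], fun h => ⟨by linarith, ht.le⟩⟩
      · filter_upwards [hlo] with t ht
        change stairBase m ≤ t ∧ t ≤ stairBase (m + 1) ↔ _
        rw [hp2]
        exact ⟨fun h => by linarith [h.2], fun h => ⟨ht.le, by linarith⟩⟩
    · refine exists_chart_contact (S := stairBrick (m + 1)) (C := stairBrick m)
        (stairBrick_lt (m + 1)) ⟨h2.le, h1.le⟩ ⟨rfl, rfl⟩ pB (τ := -1) (Or.inr rfl) ?_ ?_
        (ev.mono fun q hq => hq.trans or_comm)
      · filter_upwards [hlo] with t ht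
        change stairBase m ≤ t ∧ t ≤ stairBase (m + 1) ↔ _
        rw [hp2]
        exact ⟨fun h => by linarith [h.2], fun h => ⟨ht.le, by linarith⟩⟩
      · filter_upwards [hup] with t ht
        change stairBase (m + 1) ≤ t ∧ t ≤ stairBase (m + 1 + 1) ↔ _
        rw [hp2]
        exact ⟨fun h => by linarith [h.1], fun h => ⟨by linarith, ht.le⟩⟩

theorem isTwoReflex_staircase (r : ℕ) : IsTwoReflex (staircase r) 2 where
  polyhedron := ⟨⟨stairBricks r, (isBrickComplex_staircase r).lt,
    (isBrickComplex_staircase r).eq_iUnion⟩, isConnected_staircase r, isThreeManifold_staircase r⟩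
  no_vertical := (isBrickComplex_staircase r).no_vertical

theorem contacts_stairBricks (r : ℕ) : IsBrickComplex.contacts (stairBricks r) 2 =
    (Finset.range r).map ⟨fun n => (stairBrick n, stairBrick (n + 1)),
      fun _ _ h => stairBrick_injective (congrArg Prod.fst h)⟩ := by
  ext ⟨A, B⟩
  simp only [IsBrickComplex.mem_contacts, mem_stairBricks, Finset.mem_map, Finset.mem_range]
  constructor
  · rintro ⟨⟨⟨m, -, rfl⟩, n, hn, rfl⟩, hAB⟩
    obtain rfl := stacked_stairBrick.1 hAB
    exact ⟨m, hn, rfl⟩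
  · rintro ⟨n, hn, hAB⟩
    obtain ⟨rfl, rfl⟩ := Prod.mk.inj hAB
    exact ⟨⟨⟨n, hn.le, rfl⟩, n + 1, hn, rfl⟩, stacked_stairBrick.2 rfl⟩

theorem side_stairBrick_ne_iff {n : ℕ} {i : Fin 3} {s : Bool} (hi : i ≠ 2) :
    side (stairBrick n) i s ≠ side (stairBrick (n + 1)) i s ↔ i = 0 ∧ (s = true ↔ Even n) := by
  rcases stair_nested n with ⟨h, h1, h2, -⟩ | ⟨h, h1, h2, -⟩ <;> fin_cases i <;> cases s <;>
    simp [stairBrick, h1, h2.ne, h] at hi ⊢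

theorem card_differingSides_stairBrick (n : ℕ) :
    (IsBrickComplex.differingSides 2 (stairBrick n, stairBrick (n + 1))).card = 1 := by
  refine Finset.card_eq_one.2 ⟨(0, decide (Even n)), ?_⟩
  ext ⟨i, s⟩
  simp only [IsBrickComplex.differingSides, Finset.mem_filter, Finset.mem_univ, true_and,
    Finset.mem_singleton, Prod.mk.injEq]
  constructor
  · rintro ⟨hi, h⟩
    obtain ⟨h1, h2⟩ := (side_stairBrick_ne_iff hi).1 h
    exact ⟨h1, by simp [← h2]⟩
  · rintro ⟨rfl, rfl⟩
    exact ⟨by decide, (side_stairBrick_ne_iff (by decide)).2 (by simp)⟩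

theorem encard_reflexEdges_staircase (r : ℕ) : (reflexEdges (staircase r)).encard = r := by
  rw [(isBrickComplex_staircase r).encard_reflexEdges, IsBrickComplex.card_reflexSides,
    contacts_stairBricks, Finset.sum_map]
  refine congrArg _ ((Finset.sum_congr rfl fun n _ => card_differingSides_stairBrick n).trans ?_)
  simp

theorem hasGenus_staircase (r : ℕ) : HasGenus (staircase r) 0 := by
  refine (isBrickComplex_staircase r).hasGenus ?_
  rw [contacts_stairBricks, Finset.card_map, stairBricks,
    Finset.card_image_of_injective _ stairBrick_injective]
  simp

/-- The position of the reflex edges of the staircase. -/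
theorem reflexEdge_staircase {r : ℕ} {e : Pt × Pt} (he : e ∈ reflexEdges (staircase r)) :
    ∃ n, ∀ g ∈ segment ℝ e.1 e.2, g 0 = stairStep n ∧ g 2 = stairBase (n + 1) := by
  have h := isBrickComplex_staircase r
  rw [h.reflexEdges_eq] at he
  obtain ⟨⟨⟨A, B⟩, i, s⟩, hx, rfl⟩ := he
  obtain ⟨⟨hA, hB⟩, hAB, hik, hs⟩ := IsBrickComplex.mem_reflexSides.1 (Finset.mem_coe.1 hx)
  dsimp only at hA hB hAB hik hs ⊢
  obtain ⟨n, -, rfl⟩ := mem_stairBricks.1 hA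
  obtain ⟨m, -, rfl⟩ := mem_stairBricks.1 hB
  obtain rfl := stacked_stairBrick.1 hAB
  obtain ⟨rfl, hse⟩ := (side_stairBrick_ne_iff hik).1 hs
  refine ⟨n, fun g hg => ?_⟩
  have hg := segment_of_axis (j := 1) (contactEdge_axis hAB (stairBrick_lt n 2)
    (stairBrick_lt (n + 1) 2) hik (by decide)) hg
  rw [hg 0 (by decide), hg 2 (by decide), contactEdge_fst_same,
    contactEdge_fst_vert hAB (stairBrick_lt n 2) hik]
  refine ⟨?_, rfl⟩
  rcases stair_nested n with ⟨h, h1, h2, h3⟩ | ⟨h, h1, h2, h3⟩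
  · rw [hse.2 h, h3, side_true, meetBox_apply_snd]
    exact min_eq_left h2.le
  · rw [Bool.eq_false_iff.2 fun hst => h (hse.1 hst), h3, side_false, meetBox_apply_fst]
    exact max_eq_right h2.le

/-- The witness in the brick `n`. Its height in the brick and its distance to the sides make the
slopes of all lines of sight from reflex edges that do not bound the brick contradictory. -/
noncomputable def stairWitness (n : ℕ) : Pt :=
  if Even n then ![3 * (n / 2 : ℕ) + 1 / 2, 1 / 2, 3 * (n / 2 : ℕ) + 1]
  else ![3 * (n / 2 : ℕ) + 2, 1 / 2, 3 * (n / 2 : ℕ) + 5 / 2]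

theorem stairWitness_even (j : ℕ) : stairWitness (2 * j) = ![3 * (j : ℝ) + 1 / 2, 1 / 2, 3 * j + 1] := by
  have h1 : 2 * j / 2 = j := by omega
  simp [stairWitness, h1]

theorem stairWitness_odd (j : ℕ) :
    stairWitness (2 * j + 1) = ![3 * (j : ℝ) + 2, 1 / 2, 3 * j + 5 / 2] := by
  have h1 : (2 * j + 1) / 2 = j := by omega
  simp [stairWitness, h1]

theorem stairWitness_mem (n : ℕ) :
    stairWitness n ∈ Icc (stairBrick n).1 (stairBrick n).2 := by
  rw [mem_stairBrick]
  obtain ⟨j, rfl | rfl⟩ := n.even_or_odd'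
  · obtain ⟨h1, h2, h3, h4⟩ := stair_even j
    rw [h1, h2, h3, (stair_odd j).2.2.1, stairWitness_even]
    simp; norm_num
  · obtain ⟨h1, h2, h3, h4⟩ := stair_odd j
    rw [h1, h2, h3, (stair_even' j).2.2, stairWitness_odd]
    simp; norm_num

/-- A line of sight that crosses a level strictly between the bottom and the top of the brick `n`
crosses it in that brick. -/
theorem exists_crossing {r n : ℕ} {g w : Pt} (h : Sees (staircase r) g w) {c : ℝ}
    (hc : (g 2 ≤ c ∧ c ≤ w 2) ∨ (w 2 ≤ c ∧ c ≤ g 2)) (h1 : stairBase n < c)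
    (h2 : c < stairBase (n + 1)) :
    ∃ x, stairLeft n ≤ x ∧ x ≤ stairRight n ∧
      (x - w 0) * (g 2 - w 2) = (g 0 - w 0) * (c - w 2) := by
  obtain ⟨q, hq, rfl⟩ := exists_mem_segment_level hc
  obtain ⟨m, -, hm⟩ := h hq
  rw [mem_stairBrick] at hm
  have h3 : m < n + 1 := stairBase_strictMono.lt_iff_lt.1 (hm.2.2.1.trans_lt h2)
  have h4 : n < m + 1 := stairBase_strictMono.lt_iff_lt.1 (h1.trans_le hm.2.2.2)
  obtain rfl : m = n := by omega
  refine ⟨q 0, hm.1.1, hm.1.2, ?_⟩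
  obtain ⟨a, b, -, -, hab, rfl⟩ := hq
  obtain rfl : b = 1 - a := by linarith
  simp only [Pi.add_apply, Pi.smul_apply, smul_eq_mul]
  ring

/-- The reflex edge between the bricks `n` and `n + 1` of the staircase only sees the witnesses in
these bricks: at two levels in a brick between them, or in the brick of the witness, the bricks
bound the slope of a longer line of sight in contradictory ways. -/
theorem eq_of_sees_stairWitness {r n m : ℕ} {g : Pt} (hg0 : g 0 = stairStep n)
    (hg2 : g 2 = stairBase (n + 1)) (h : Sees (staircase r) g (stairWitness m)) :
    m = n ∨ m = n + 1 := by
  by_contra! hne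
  rcases lt_or_ge n m with hnm | hnm
  · have hnm : n + 2 ≤ m := by omega
    obtain ⟨j, rfl | rfl⟩ := m.even_or_odd'
    · obtain ⟨i, rfl⟩ : ∃ i, j = i + 1 := ⟨j - 1, by omega⟩
      have w0 : stairWitness (2 * (i + 1)) 0 = 3 * (i : ℝ) + 7 / 2 := by
        rw [stairWitness_even]; simp; ring
      have w2 : stairWitness (2 * (i + 1)) 2 = 3 * (i : ℝ) + 4 := by
        rw [stairWitness_even]; simp; ring
      obtain ⟨a1, a2, a3, -⟩ := stair_even i
      obtain ⟨b1, b2, b3, b4⟩ := stair_odd i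
      obtain ⟨c1, c2, c3⟩ := stair_even' i
      have d3 := (stair_odd (i + 1)).2.2.1
      push_cast at d3
      have hg : g 2 ≤ 3 * (i : ℝ) + 2 := by
        rw [hg2, ← b3]
        exact stairBase_strictMono.monotone (by omega)
      obtain ⟨x, hx1, hx2, hx⟩ := exists_crossing (n := 2 * i + 1 + 1) (c := 3 * i + 13 / 4) h
        (Or.inl ⟨by linarith, by rw [w2]; linarith⟩) (by rw [c3]; linarith)
        (by rw [show 2 * i + 1 + 1 + 1 = 2 * (i + 1) + 1 by ring, d3]; linarith)
      rw [w0, w2] at hx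
      rw [c1] at hx1
      rcases (show n = 2 * i ∨ n + 1 ≤ 2 * i by omega) with rfl | hn
      · rw [hg0, hg2, b3, (stair_even i).2.2.2] at hx
        nlinarith
      · have hg' : g 2 ≤ 3 * (i : ℝ) := by
          rw [hg2, ← a3]
          exact stairBase_strictMono.monotone hn
        obtain ⟨y, hy1, hy2, hy⟩ := exists_crossing (n := 2 * i) (c := 3 * i + 3 / 2) h
          (Or.inl ⟨by linarith, by rw [w2]; linarith⟩) (by rw [a3]; linarith)
          (by rw [b3]; linarith)
        rw [w0, w2] at hy
        rw [a2] at hy2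
        nlinarith
    · have w0 : stairWitness (2 * j + 1) 0 = 3 * (j : ℝ) + 2 := by rw [stairWitness_odd]; simp
      have w2 : stairWitness (2 * j + 1) 2 = 3 * (j : ℝ) + 5 / 2 := by rw [stairWitness_odd]; simp
      obtain ⟨a1, a2, a3, -⟩ := stair_even j
      obtain ⟨b1, b2, b3, b4⟩ := stair_odd j
      have hg : g 2 ≤ 3 * (j : ℝ) := by
        rw [hg2, ← a3]
        exact stairBase_strictMono.monotone (by omega)
      obtain ⟨x, hx1, hx2, hx⟩ := exists_crossing (n := 2 * j) (c := 3 * j + 7 / 4) h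
        (Or.inl ⟨by linarith, by rw [w2]; linarith⟩) (by rw [a3]; linarith) (by rw [b3]; linarith)
      obtain ⟨y, hy1, hy2, hy⟩ := exists_crossing (n := 2 * j) (c := 3 * j + 1 / 2) h
        (Or.inl ⟨by linarith, by rw [w2]; linarith⟩) (by rw [a3]; linarith) (by rw [b3]; linarith)
      rw [w0, w2] at hx hy
      rw [a2] at hx2
      rw [a1] at hy1
      nlinarith
  · have hnm : m + 1 ≤ n := by omega
    obtain ⟨j, rfl | rfl⟩ := m.even_or_odd'
    · have w0 : stairWitness (2 * j) 0 = 3 * (j : ℝ) + 1 / 2 := by rw [stairWitness_even]; simp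
      have w2 : stairWitness (2 * j) 2 = 3 * (j : ℝ) + 1 := by rw [stairWitness_even]; simp
      obtain ⟨a1, a2, a3, -⟩ := stair_even j
      obtain ⟨b1, b2, b3, b4⟩ := stair_odd j
      obtain ⟨c1, c2, c3⟩ := stair_even' j
      have d3 := (stair_odd (j + 1)).2.2.1
      push_cast at d3
      have hg : 3 * (j : ℝ) + 3 ≤ g 2 := by
        rw [hg2, ← c3]
        exact stairBase_strictMono.monotone (by omega)
      obtain ⟨x, hx1, hx2, hx⟩ := exists_crossing (n := 2 * j) (c := 3 * j + 7 / 4) h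
        (Or.inr ⟨by rw [w2]; linarith, by linarith⟩) (by rw [a3]; linarith) (by rw [b3]; linarith)
      rw [w0, w2] at hx
      rw [a2] at hx2
      rcases (show n = 2 * j + 1 ∨ 2 * (j + 1) + 1 ≤ n + 1 by omega) with rfl | hn
      · rw [hg0, hg2, c3, b4] at hx
        nlinarith
      · have hg' : 3 * ((j : ℝ) + 1) + 2 ≤ g 2 := by
          rw [hg2, ← d3]
          exact stairBase_strictMono.monotone hn
        obtain ⟨y, hy1, hy2, hy⟩ := exists_crossing (n := 2 * j + 1 + 1) (c := 3 * j + 7 / 2) h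
          (Or.inr ⟨by rw [w2]; linarith, by linarith⟩) (by rw [c3]; linarith)
          (by rw [show 2 * j + 1 + 1 + 1 = 2 * (j + 1) + 1 by ring, d3]; linarith)
        rw [w0, w2] at hy
        rw [c1] at hy1
        nlinarith
    · have w0 : stairWitness (2 * j + 1) 0 = 3 * (j : ℝ) + 2 := by rw [stairWitness_odd]; simp
      have w2 : stairWitness (2 * j + 1) 2 = 3 * (j : ℝ) + 5 / 2 := by rw [stairWitness_odd]; simp
      obtain ⟨c1, c2, c3⟩ := stair_even' j
      have d3 := (stair_odd (j + 1)).2.2.1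
      push_cast at d3
      have hg : 3 * ((j : ℝ) + 1) + 2 ≤ g 2 := by
        rw [hg2, ← d3]
        exact stairBase_strictMono.monotone (by omega)
      obtain ⟨x, hx1, hx2, hx⟩ := exists_crossing (n := 2 * j + 1 + 1) (c := 3 * j + 13 / 4) h
        (Or.inr ⟨by rw [w2]; linarith, by linarith⟩) (by rw [c3]; linarith)
        (by rw [show 2 * j + 1 + 1 + 1 = 2 * (j + 1) + 1 by ring, d3]; linarith)
      obtain ⟨y, hy1, hy2, hy⟩ := exists_crossing (n := 2 * j + 1 + 1) (c := 3 * j + 9 / 2) h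
        (Or.inr ⟨by rw [w2]; linarith, by linarith⟩) (by rw [c3]; linarith)
        (by rw [show 2 * j + 1 + 1 + 1 = 2 * (j + 1) + 1 by ring, d3]; linarith)
      rw [w0, w2] at hx hy
      rw [c1] at hx1
      rw [c2] at hy2
      nlinarith

/-- Each guard of the staircase sees at most two of the `r + 1` witnesses. -/
theorem le_card_of_closedGuards_staircase {r : ℕ} {S : Finset (Pt × Pt)}
    (hS : (S : Set (Pt × Pt)) ⊆ reflexEdges (staircase r)) (h : ClosedGuards (staircase r) S) :
    r + 1 ≤ S.card * 2 := by
  classical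
  choose! n hn using fun e (he : e ∈ reflexEdges (staircase r)) => reflexEdge_staircase he
  have hsub : Finset.range (r + 1) ⊆ S.biUnion fun e => {n e, n e + 1} := by
    intro m hm
    obtain ⟨e, he, g, hg, hs⟩ := h (stairWitness m)
      ⟨m, Nat.lt_succ_iff.1 (Finset.mem_range.1 hm), stairWitness_mem m⟩
    obtain ⟨h0, h2⟩ := hn e (hS he) g hg
    refine Finset.mem_biUnion.2 ⟨e, he, ?_⟩
    simpa using eq_of_sees_stairWitness h0 h2 hs
  calc r + 1 = (Finset.range (r + 1)).card := (Finset.card_range _).symm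
    _ ≤ _ := Finset.card_le_card hsub
    _ ≤ S.card * 2 := Finset.card_biUnion_le_card_mul _ _ _ fun e _ => Finset.card_le_two

theorem exists_staircase (r : ℕ) : ∃ (P : Set Pt) (k : Fin 3), IsTwoReflex P k ∧
    (reflexEdges P).encard = r ∧ HasGenus P 0 ∧
      ∀ S : Finset (Pt × Pt), (S : Set (Pt × Pt)) ⊆ reflexEdges P →
        ClosedGuards P S ∨ OpenGuards P S → ⌊(r : ℝ) / 2⌋ + 1 ≤ (S.card : ℤ) := by
  refine ⟨staircase r, 2, isTwoReflex_staircase r, encard_reflexEdges_staircase r,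
    hasGenus_staircase r, fun S hS h => ?_⟩
  have h1 := le_card_of_closedGuards_staircase hS (h.elim id fun h => h.closed)
  have h2 : ((r : ℝ) + 1) ≤ S.card * 2 := by exact_mod_cast h1
  refine Int.add_one_le_of_lt (Int.floor_lt.2 ?_)
  push_cast
  linarith

theorem theorem4 :
    (∀ (P : Set Pt) (k : Fin 3) (r b g : ℕ), IsTwoReflex P k →
      (reflexEdges P).encard = r → 0 < r → (collars P k).encard = b → HasGenus P g →
        (∃ S : Finset (Pt × Pt), (S : Set (Pt × Pt)) ⊆ reflexEdges P ∧ ClosedGuards P S ∧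
          (S.card : ℤ) ≤ ⌊((r : ℝ) - g) / 2⌋ - b + 1) ∧
        (∃ S : Finset (Pt × Pt), (S : Set (Pt × Pt)) ⊆ reflexEdges P ∧ OpenGuards P S ∧
          (S.card : ℤ) ≤ ⌊((r : ℝ) - g) / 2⌋ - b + 1)) ∧
    (∀ r : ℕ, 0 < r → ∃ (P : Set Pt) (k : Fin 3), IsTwoReflex P k ∧
      (reflexEdges P).encard = r ∧ HasGenus P 0 ∧
        ∀ S : Finset (Pt × Pt), (S : Set (Pt × Pt)) ⊆ reflexEdges P →
          ClosedGuards P S ∨ OpenGuards P S → ⌊(r : ℝ) / 2⌋ + 1 ≤ (S.card : ℤ)) := by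
  refine ⟨fun P k r b g h hr hr0 hb hg => ?_, fun r _ => ?_⟩
  · obtain ⟨𝓑, h𝓑, hbr⟩ := h.exists_complex
    obtain ⟨S, h1, h2, h3⟩ :=
      h𝓑.exists_guards h.polyhedron.connected hr hr0 hg (h𝓑.collars_le hbr hb)
    exact ⟨⟨S, h1, h2.closed, h3⟩, S, h1, h2, h3⟩
  · exact exists_staircase r
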